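/- **Model (data-oblivious outsourced external memory, DO-OEM).** A server stores an unbounded array of words of $w$ bits, divided into blocks of $B\ge 1$ consecutive words. A client has a private memory of $M\ge B$ words, the first $B$ of which serve as I/O buffer. A *program* is a finite list of steps; in each step the client replaces the content of its private memory by the result of an arbitrary, possibly randomized, computation on it, and issues one request: read block $j$ into the buffer, or write the buffer to block $j$. Its number of I/Os is the number of its steps. A program *data-obliviously* solves a problem on a set of inputs (those with the given public parameters) if, started with zeroed private memory and the input in an otherwise zero server memory, it always ends with a correct output on the server, and the distribution of the sequence of requests is the same for any two inputs in the set. For $n\ge 1$ let $s(n)$ be the least number of I/Os with which arrays of $n$ full blocks of words can be sorted data-obliviously in this model (for the given $B,M,w$). Let $\operatorname{DO-Sort}(N)=\max_{1\le m\le n}\frac nm\,s(m)$ with $n=\lceil N/B\rceil$ (and $0$ if $N=0$). This is the least upper bound of $s$ whose cost per block is nondecreasing, and it equals $s(n)$ whenever $s(m)/m$ is nondecreasing, as is usual for sorting bounds. A *graph* is a connected simple graph with $V$ vertices and $E$ edges whose weights are natural numbers below $U$. It is stored as an array of its edges in arbitrary order, each edge as three words (endpoint, endpoint, weight) and listed once.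 The output is the list, at the start of the server's memory and in the same format, of the $V-1$ edges of a minimum spanning tree. All logarithms have base 2. **Theorem 4.1.** There is an absolute constant $c$ such that the following holds for all $B,M,w,V,E,U$ with $M\ge cB$ and $2^w\ge (V+E+U)^c$. A minimum spanning tree of a graph $G$ can be constructed data-obliviously in the DO-OEM model, with $V,E,U$ (and, in 4, the family) as public parameters, and with the following numbers of I/Os: 1. for all constants $\gamma\ge 0$ and $a>0$: $O\big(\operatorname{DO-Sort}(E)\cdot\frac{\log V}{\log\log V}\big)$ if $V\ge 3$ and $E\le a\,V\log^\gamma V$; 2. for all constants $0<\delta<1$ and $a,b>0$: $O\big(\operatorname{DO-Sort}(E)\cdot\log^{1-\delta}V\big)$ if $a\,V2^{\log^\delta V}\le E\le b\,V2^{\log^\delta V}$; 3. for all constants $0<\varepsilon\le 1$ and $a>0$: $O(\operatorname{DO-Sort}(E))$ if $E\ge a\,V^{1+\varepsilon}$; 4. for every minor-closed family $\mathcal F$ of finite graphs that does not contain all graphs: $O(\operatorname{DO-Sort}(E))$ if $G\in\mathcal F$. The constant in the $O$ depends only on $\gamma,a$ in 1, on $\delta,a,b$ in 2, on $\varepsilon,a$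 in 3, and on $\mathcal F$ in 4; it does not depend on $B,M,w,V,E,U$. -/

import Mathlib

open scoped ENNReal

/-! ### The data-oblivious outsourced external-memory model -/

/-- The parameters of the model: the server stores words of `wordBits` bits, one request transfers a
block of `blockSize` consecutive words, and the client has a private memory of `memSize` words,
which includes the buffer for the block being transferred. -/
structure OEMParams where
  blockSize : ℕ
  memSize : ℕ
  wordBits : ℕ
  blockSize_pos : 0 < blockSize
  blockSize_le_memSize : blockSize ≤ memSize

namespace OEMParams

variable (P : OEMParams)

/-- The content of one memory cell. -/
abbrev Word : Type := BitVec P.wordBits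

/-- The content of the server's memory, cell by cell. -/
abbrev Server : Type := ℕ → P.Word

/-- The content of the client's private memory. Its first `blockSize` cells are the I/O buffer. -/
abbrev Client : Type := Fin P.memSize → P.Word

/-- The standing assumption on the parameters for a graph with `V` vertices, `E` edges and weights
below `U`: the private memory holds at least `c` blocks, and a word has at least
`c * log₂ (V + E + U)` bits. -/
def Fits (c V E U : ℕ) : Prop :=
  c * P.blockSize ≤ P.memSize ∧ (V + E + U) ^ c ≤ 2 ^ P.wordBits

end OEMParams

/-- What the server observes of one I/O: a read or a write request, with the number of the block.
(Contents are encrypted, hence not part of what is observed.) -/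
inductive IORequest where
  | read (j : ℕ) : IORequest
  | write (j : ℕ) : IORequest

namespace IORequest

variable {P : OEMParams}

/-- The client's memory after a request: a read overwrites the buffer by block `j`, that is by the
cells `j * blockSize, …, (j + 1) * blockSize - 1` of the server. -/
def newClient (q : IORequest) (s : P.Client) (m : P.Server) : P.Client :=
  match q with
  | read j => fun i => if (i : ℕ) < P.blockSize then m (j * P.blockSize + i) else s i
  | write _ => s

/-- The server's memory after a request: a write overwrites block `j` by the buffer. -/
def newServer (q : IORequest) (s : P.Client) (m : P.Server) : P.Server :=
  match q with
  | read _ => m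
  | write j => fun a =>
      if a / P.blockSize = j then
        s ⟨a % P.blockSize, (Nat.mod_lt a P.blockSize_pos).trans_le P.blockSize_le_memSize⟩
      else m a

end IORequest

/-- A (randomized) client program: a list of I/O steps. In each step the client performs an
arbitrary computation, with fresh private coins, on its private memory, which yields its new private
memory and the next request; then this request is executed. Nothing but the private memory (and the
number of steps done so far) is carried from one step to the next.
The number of I/Os of a program is its length. -/
abbrev OEMProgram (P : OEMParams) : Type := List (P.Client → PMF (P.Client × IORequest))

namespace OEMProgram

variable {P : OEMParams}

/-- The joint distribution of the sequence of requests and of the final content of the server's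
memory, when a program is run from given contents of the two memories. -/
noncomputable def run : OEMProgram P → P.Client → P.Server → PMF (List IORequest × P.Server)
  | [], _, m => PMF.pure ([], m)
  | f :: p, s, m =>
      (f s).bind fun r =>
        (run p (r.2.newClient r.1 m) (r.2.newServer r.1 m)).map fun o => (r.2 :: o.1, o.2)

/-- `p.ObliviouslyComputes inputs load ok`: started with cleared private memory on the server memory
`load x`, where `x` is one of the `inputs`, the program always ends with a server memory that is an
acceptable output for `x`, and the distribution of the access sequence is the same for any two of
the inputs. -/
def ObliviouslyComputes (p : OEMProgram P) {X : Type} (inputs : Set X) (load : X → P.Server)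
    (ok : X → P.Server → Prop) : Prop :=
  (∀ x ∈ inputs, ∀ o ∈ (p.run (fun _ => 0) (load x)).support, ok x o.2) ∧
  ∀ x ∈ inputs, ∀ y ∈ inputs,
    (p.run (fun _ => 0) (load x)).map Prod.fst = (p.run (fun _ => 0) (load y)).map Prod.fst

end OEMProgram

/-! ### Data-oblivious sorting -/

/-- The server's memory holding an array of `N` words in its first `N` cells. -/
def loadArray {P : OEMParams} {N : ℕ} (x : Fin N → P.Word) : P.Server :=
  fun a => if h : a < N then x ⟨a, h⟩ else 0

/-- The first `N` cells hold the sorted rearrangement of the array `x`. -/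
def HoldsSorted {P : OEMParams} {N : ℕ} (x : Fin N → P.Word) (m : P.Server) : Prop :=
  (Monotone fun i : Fin N => (m i).toNat) ∧ ∃ σ : Equiv.Perm (Fin N), ∀ i : Fin N, m i = x (σ i)

/-- The least number of I/Os of a data-oblivious program that sorts every array of `n` full blocks
of words (`⊤` if there is no such program). -/
noncomputable def sortCost (P : OEMParams) (n : ℕ) : ℝ≥0∞ :=
  ⨅ (p : OEMProgram P)
    (_ : p.ObliviouslyComputes (Set.univ : Set (Fin (n * P.blockSize) → P.Word))
      loadArray HoldsSorted),
    (p.length : ℝ≥0∞)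

/-- `DO-Sort(N)`, the sorting cost of `N` words, that is of `n = ⌈N / B⌉` blocks. As usual for a
sorting bound, it is taken to grow at least linearly: `DOSort` is the least upper bound of the
minimal cost `sortCost` whose cost per block is nondecreasing in the number of blocks. So it is
`sortCost P n` itself when `sortCost P m / m` is nondecreasing, see `doSort_eq_sortCost`, and it is
below every sorting bound with a nondecreasing cost per block, see `doSort_le`. -/
noncomputable def DOSort (P : OEMParams) (N : ℕ) : ℝ≥0∞ :=
  ⨆ m ∈ Finset.Icc 1 (N ⌈/⌉ P.blockSize),
    (((N ⌈/⌉ P.blockSize : ℕ) : ℝ≥0∞) / (m : ℝ≥0∞)) * sortCost P m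

theorem doSort_le (P : OEMParams) (S : ℕ → ℝ≥0∞) (hS : ∀ n, 1 ≤ n → sortCost P n ≤ S n)
    (hmono : ∀ m n : ℕ, 1 ≤ m → m ≤ n → S m / m ≤ S n / n) (N : ℕ) :
    DOSort P N ≤ S (N ⌈/⌉ P.blockSize) := by
  refine iSup₂_le fun m hm => ?_
  obtain ⟨h1, h2⟩ := Finset.mem_Icc.1 hm
  set n := N ⌈/⌉ P.blockSize
  have hn0 : (n : ℝ≥0∞) ≠ 0 := by exact_mod_cast (by omega : n ≠ 0)
  calc ((n : ℝ≥0∞) / m) * sortCost P m ≤ ((n : ℝ≥0∞) / m) * S m := by gcongr; exact hS m h1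
    _ = n * (S m / m) := by rw [div_eq_mul_inv, div_eq_mul_inv]; ring
    _ ≤ n * (S n / n) := mul_le_mul' le_rfl (hmono m n h1 h2)
    _ = S n := ENNReal.mul_div_cancel hn0 (ENNReal.natCast_ne_top n)

theorem doSort_eq_sortCost (P : OEMParams)
    (hmono : ∀ m n : ℕ, 1 ≤ m → m ≤ n → sortCost P m / m ≤ sortCost P n / n)
    (N : ℕ) (hN : 1 ≤ N ⌈/⌉ P.blockSize) :
    DOSort P N = sortCost P (N ⌈/⌉ P.blockSize) := by
  refine le_antisymm (doSort_le P _ (fun _ _ => le_rfl) hmono N) ?_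
  have h0 : ((N ⌈/⌉ P.blockSize : ℕ) : ℝ≥0∞) ≠ 0 := by
    exact_mod_cast (by omega : N ⌈/⌉ P.blockSize ≠ 0)
  have h := le_iSup₂ (f := fun m (_ : m ∈ Finset.Icc 1 (N ⌈/⌉ P.blockSize)) =>
    (((N ⌈/⌉ P.blockSize : ℕ) : ℝ≥0∞) / (m : ℝ≥0∞)) * sortCost P m)
    (N ⌈/⌉ P.blockSize) (Finset.mem_Icc.2 ⟨hN, le_rfl⟩)
  rwa [ENNReal.div_self h0 (ENNReal.natCast_ne_top _), one_mul] at h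

/-! ### Weighted graphs as edge arrays -/

/-- A simple graph on `V` vertices, given as an array of its `E` edges in arbitrary order, with
edge weights below `U`. -/
structure EdgeArray (V E U : ℕ) where
  src : Fin E → Fin V
  dst : Fin E → Fin V
  wt : Fin E → ℕ
  wt_lt : ∀ i, wt i < U
  src_ne_dst : ∀ i, src i ≠ dst i
  edge_injective : Function.Injective fun i => s(src i, dst i)

namespace EdgeArray

variable {V E U : ℕ} (X : EdgeArray V E U)

/-- The spanning subgraph with the edges in `A`. -/
def subgraph (A : Set (Fin E)) : SimpleGraph (Fin V) :=
  SimpleGraph.fromEdgeSet ((fun i => s(X.src i, X.dst i)) '' A)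

/-- The graph that is given by the array. -/
def graph : SimpleGraph (Fin V) := X.subgraph Set.univ

/-- `A` is the edge set of a minimum spanning tree. -/
def IsMinSpanningTree (A : Finset (Fin E)) : Prop :=
  (X.subgraph A).IsTree ∧
    ∀ A' : Finset (Fin E), (X.subgraph A').IsTree → ∑ i ∈ A, X.wt i ≤ ∑ i ∈ A', X.wt i

/-- The server's memory holding the array: edge `i` occupies the cells `3 i` (one endpoint),
`3 i + 1` (the other endpoint) and `3 i + 2` (the weight). -/
def load {P : OEMParams} : P.Server := fun a =>
  if h : a / 3 < E then
    BitVec.ofNat P.wordBits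
      (if a % 3 = 0 then (X.src ⟨a / 3, h⟩ : ℕ)
       else if a % 3 = 1 then (X.dst ⟨a / 3, h⟩ : ℕ)
       else X.wt ⟨a / 3, h⟩)
  else 0

/-- The first `3 (V - 1)` cells list, each edge once and in the format of the input, the edges of
a minimum spanning tree. -/
def HoldsMinSpanningTree {P : OEMParams} (m : P.Server) : Prop :=
  ∃ e : Fin (V - 1) ↪ Fin E, X.IsMinSpanningTree (Finset.univ.map e) ∧
    ∀ k : Fin (V - 1),
      (m (3 * k)).toNat = X.src (e k) ∧
      (m (3 * k + 1)).toNat = X.dst (e k) ∧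
      (m (3 * k + 2)).toNat = X.wt (e k)

end EdgeArray

/-- For the connected graphs with `V` vertices, `E` edges and weights below `U` that belong to the
class `F`, a minimum spanning tree can be constructed data-obliviously with at most `T` I/Os; `V`,
`E`, `U` and the class are public. -/
def MSTConstructible (P : OEMParams) (V E U : ℕ) (F : Set (SimpleGraph (Fin V))) (T : ℝ≥0∞) :
    Prop :=
  ∃ p : OEMProgram P,
    p.ObliviouslyComputes {X : EdgeArray V E U | X.graph.Connected ∧ X.graph ∈ F}
      (fun X => X.load) (fun X => X.HoldsMinSpanningTree) ∧
    (p.length : ℝ≥0∞) ≤ T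

/-! ### Minor-closed families -/

/-- `H` is a minor of `G`: there are disjoint connected branch sets in `G`, one for each vertex of
`H`, such that adjacent vertices of `H` have branch sets joined by an edge of `G`. -/
def SimpleGraph.IsMinorOf {W V : Type} (H : SimpleGraph W) (G : SimpleGraph V) : Prop :=
  ∃ β : W → Set V,
    (∀ x, (G.induce (β x)).Connected) ∧
    (∀ x y, x ≠ y → Disjoint (β x) (β y)) ∧
    ∀ x y, H.Adj x y → ∃ a ∈ β x, ∃ b ∈ β y, G.Adj a b

/-- A family of finite graphs that is closed under taking minors, in particular under isomorphism,
and does not contain all graphs. -/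
structure IsProperMinorClosed (F : (n : ℕ) → Set (SimpleGraph (Fin n))) : Prop where
  minor_mem : ∀ {n k : ℕ} (G : SimpleGraph (Fin n)) (H : SimpleGraph (Fin k)),
    G ∈ F n → H.IsMinorOf G → H ∈ F k
  proper : ∃ (n : ℕ) (G : SimpleGraph (Fin n)), G ∉ F n

/-! ### Running programs and tracking the client -/

/-! The algorithm is Borůvka's, carried out by operations on relations that are oblivious because
they consist of nothing but sorting and scanning. A relation that depends on the input is stored as
an encoded table (`RawTable`, `Tbl`). `RawReach` and `Reach` say that one program, whose request
distribution does not depend on the input, brings given tables on the server. Filtering and union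
only change the decoding. Least elements of groups, sums over groups and joins cost one or two sorts
and scans (`Reach.groupMin`, `Reach.groupSum`, `Reach.join`), and a relation with few elements can
be squeezed into few blocks (`Reach.shrink`). All costs are multiples of a rate `u` per block with
`u ⌈E/B⌉ = O(DO-Sort(E))`, provided by `exists_sort_unit`.

In a round every component picks its lightest outgoing edge, which belongs to the minimum spanning
tree by the cut property (`Contraction.pick`). Contracting all picks at once would require following
long paths, so only picks that form stars are used. Each component gets one of `O(log V)` colours
such that successive picks have different colours (`colour_ne`). A pairwise independent family of
sets of colours (`exists_seeds`) contains a set such that a quarter of the picks lead from the set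
to its outside (`card_le_hooks`). The best set is found from the numbers of picks for each pair of
colours. Hence a round reduces `n` components to at most `3n/4` as long as there are two of them.

When there are many more edges than components, rounds are grouped into phases. A phase keeps for
every component only its `j` lightest neighbours, followed by a mark, and runs about `3 log j`
rounds on this small graph. A component stuck at a mark has swallowed `j` of the components at the
start (`Contraction.le_fiber`), so that `n` components become at most `2n/j`, or one
(`Contraction.phase`), at the cost of a constant number of sorts of the whole graph
(`Contracted.phase`). If `E` is at least `2 ^ (3 y)` times the number of components, then `j = 2 ^
y` is affordable, and `O(log V / y)` phases suffice (`exists_mst_cost`). In case 1, `O(log log V)`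
preliminary rounds make `y = (log log V) / 3` possible. In cases 2 and 3, `y` is `(log V) ^ δ / 6`
and `ε (log V) / 6`, without preliminary rounds.

For a minor-closed family, some complete graph is excluded as a minor, and Mader's argument bounds
the average degree of every minor (`complete_isMinorOf`). The graph of the components is a minor, so
after each round, once parallel edges are removed, its size is proportional to the number of
components (`Contraction.ncard_lightest_le`). The costs of the rounds form a geometric series. As
soon as the graph fits into one block, the client completes the tree in its private memory. -/

theorem PMF.bind_congr_support {α β : Type*} (p : PMF α) {f g : α → PMF β}
    (h : ∀ a ∈ p.support, f a = g a) : p.bind f = p.bind g := by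
  ext b
  simp only [PMF.bind_apply]
  refine tsum_congr fun a => ?_
  by_cases ha : a ∈ p.support
  · rw [h a ha]
  · rw [PMF.mem_support_iff, not_not] at ha
    simp [ha]

namespace OEMProgram

variable {P : OEMParams}

/-- Like `run`, but with the final content of the client's memory. -/
noncomputable def runFull : OEMProgram P → P.Client → P.Server →
    PMF (List IORequest × P.Client × P.Server)
  | [], s, m => PMF.pure ([], s, m)
  | f :: p, s, m => (f s).bind fun r =>
      (runFull p (r.2.newClient r.1 m) (r.2.newServer r.1 m)).map fun o => (r.2 :: o.1, o.2)

theorem run_eq_map_runFull (p : OEMProgram P) (s : P.Client) (m : P.Server) :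
    p.run s m = (p.runFull s m).map fun o => (o.1, o.2.2) := by
  induction p generalizing s m with
  | nil => simp [run, runFull, PMF.pure_map]
  | cons f p ih =>
    simp only [run, runFull, PMF.map_bind, PMF.map_comp, ih]
    rfl

/-- Composition is what `runFull` is for: `run` forgets the client's memory, from which the second
program continues. -/
theorem runFull_append (p q : OEMProgram P) (s : P.Client) (m : P.Server) :
    runFull (p ++ q) s m = (runFull p s m).bind fun o =>
      (runFull q o.2.1 o.2.2).map fun o' => (o.1 ++ o'.1, o'.2) := by
  induction p generalizing s m with
  | nil =>
    simp only [List.nil_append, runFull, PMF.pure_bind]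
    exact (PMF.map_id _).symm
  | cons f p ih =>
    simp only [List.cons_append, runFull, PMF.bind_bind, PMF.map_bind, ih, PMF.bind_map,
      PMF.map_comp]
    rfl

/-- As `ν` is the same for every outcome of `p`, the requests of `q` are independent of those of
`p`, and the joint distribution depends on `μ` and `ν` only. Obliviousness thus passes to
compositions. -/
theorem runFull_append_spec {p q : OEMProgram P} {s : P.Client} {m : P.Server}
    {μ ν : PMF (List IORequest)} {post : P.Server → Prop}
    (hp : (runFull p s m).map Prod.fst = μ)
    (hq : ∀ o ∈ (runFull p s m).support, (runFull q o.2.1 o.2.2).map Prod.fst = ν ∧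
      ∀ o' ∈ (runFull q o.2.1 o.2.2).support, post o'.2.2) :
    (runFull (p ++ q) s m).map Prod.fst = (μ.bind fun a => ν.map fun b => a ++ b) ∧
      ∀ o ∈ (runFull (p ++ q) s m).support, post o.2.2 := by
  constructor
  · rw [runFull_append, PMF.map_bind, ← hp, PMF.bind_map]
    refine PMF.bind_congr_support _ fun o ho => ?_
    rw [PMF.map_comp, Function.comp_apply, ← (hq o ho).1, PMF.map_comp]
    rfl
  · intro o ho
    rw [runFull_append, PMF.mem_support_bind_iff] at ho
    obtain ⟨o₁, h₁, h₂⟩ := ho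
    rw [PMF.mem_support_map_iff] at h₂
    obtain ⟨o₂, h₂, rfl⟩ := h₂
    exact (hq o₁ h₁).2 o₂ h₂

/-! ### Deterministic passes over blocks -/

/-- The client's memory after its buffer has been overwritten by `b`. -/
def fill (s : P.Client) (b : ℕ → P.Word) : P.Client :=
  fun i => if (i : ℕ) < P.blockSize then b i else s i

theorem fill_congr (s : P.Client) {b b' : ℕ → P.Word} (h : ∀ i < P.blockSize, b i = b' i) :
    fill s b = fill s b' := by
  funext i
  unfold fill
  split_ifs with hi
  · exact h i hi
  · rfl

/-- Iteration `j` of a pass reads block `rd j`, applies `g j` to the client's memory and writes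
block `wr j`. -/
noncomputable def pass (g : ℕ → P.Client → P.Client) (rd wr : ℕ → ℕ) (N : ℕ) : OEMProgram P :=
  (List.range N).flatMap fun j =>
    [fun s => PMF.pure (s, IORequest.read (rd j)),
      fun s => PMF.pure (g j s, IORequest.write (wr j))]

/-- The client's memory after `j` iterations of a pass that reads the blocks `b 0, b 1, …`. -/
def clientSeq (g : ℕ → P.Client → P.Client) (s : P.Client) (b : ℕ → ℕ → P.Word) : ℕ → P.Client
  | 0 => s
  | j + 1 => g j (fill (clientSeq g s b j) (b j))

theorem clientSeq_congr (g : ℕ → P.Client → P.Client) (s : P.Client) {b b' : ℕ → ℕ → P.Word}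
    {N : ℕ} (h : ∀ j < N, ∀ i < P.blockSize, b j i = b' j i) :
    ∀ j ≤ N, clientSeq g s b j = clientSeq g s b' j := by
  intro j hj
  induction j with
  | zero => rfl
  | succ j ih =>
    simp only [clientSeq]
    rw [ih (by omega), fill_congr _ (h j (by omega))]

/-- Cell `i` of the buffer. -/
def bufIdx (P : OEMParams) (i : ℕ) : Fin P.memSize :=
  ⟨i % P.blockSize, (Nat.mod_lt i P.blockSize_pos).trans_le P.blockSize_le_memSize⟩

theorem block_div {P : OEMParams} {j i : ℕ} (hi : i < P.blockSize) :
    (j * P.blockSize + i) / P.blockSize = j := by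
  rw [Nat.add_comm, Nat.add_mul_div_right _ _ P.blockSize_pos, Nat.div_eq_of_lt hi, Nat.zero_add]

theorem block_mod {P : OEMParams} {j i : ℕ} (hi : i < P.blockSize) :
    (j * P.blockSize + i) % P.blockSize = i := by
  rw [Nat.add_comm, Nat.add_mul_mod_self_right, Nat.mod_eq_of_lt hi]

/-- A pass uses no coins, so its run is a point mass. Since no block that is read is ever written,
each iteration sees the initial server; since the written blocks are distinct, no result is
overwritten. -/
theorem runFull_pass (g : ℕ → P.Client → P.Client) (rd wr : ℕ → ℕ) (N : ℕ) (s : P.Client)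
    (m : P.Server) (hrw : ∀ j < N, ∀ k < N, rd j ≠ wr k)
    (hwr : ∀ j < N, ∀ k < N, wr j = wr k → j = k) :
    ∃ m' : P.Server, runFull (pass g rd wr N) s m = PMF.pure
        ((List.range N).flatMap fun j => [IORequest.read (rd j), IORequest.write (wr j)],
          clientSeq g s (fun j i => m (rd j * P.blockSize + i)) N, m') ∧
      (∀ a, (∀ j < N, a / P.blockSize ≠ wr j) → m' a = m a) ∧
      ∀ j < N, ∀ i < P.blockSize, m' (wr j * P.blockSize + i) =
        clientSeq g s (fun j i => m (rd j * P.blockSize + i)) (j + 1) (bufIdx P i) := by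
  induction N with
  | zero => exact ⟨m, by simp [pass, runFull, clientSeq], by simp, by simp⟩
  | succ N ih =>
    obtain ⟨m', hrun, hoff, hon⟩ := ih (fun j hj k hk => hrw j (by omega) k (by omega))
      (fun j hj k hk => hwr j (by omega) k (by omega))
    set c := clientSeq g s (fun j i => m (rd j * P.blockSize + i)) with hc
    have hrd : fill (c N) (fun i => m' (rd N * P.blockSize + i)) =
        fill (c N) (fun i => m (rd N * P.blockSize + i)) := by
      refine fill_congr _ fun i hi => hoff _ fun j hj => ?_
      rw [block_div hi]
      exact hrw N (by omega) j (by omega)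
    have hstep : g N ((IORequest.read (rd N)).newClient (c N) m') = c (N + 1) := by
      change g N (fill (c N) (fun i => m' (rd N * P.blockSize + i))) = _
      rw [hrd, hc]
      rfl
    refine ⟨(IORequest.write (wr N)).newServer (c (N + 1)) m', ?_, ?_, ?_⟩
    · have hsplit : pass g rd wr (N + 1) = pass g rd wr N ++
          [fun s => PMF.pure (s, IORequest.read (rd N)),
            fun s => PMF.pure (g N s, IORequest.write (wr N))] := by
        simp [pass, List.range_succ]
      rw [hsplit, runFull_append, hrun, PMF.pure_bind]
      simp only [runFull, PMF.pure_bind, PMF.pure_map]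
      have hserv : IORequest.newServer (IORequest.read (rd N)) (c N) m' = m' := rfl
      simp only [hserv, hstep]
      simp [List.range_succ, IORequest.newClient]
    · intro a ha
      simp only [IORequest.newServer]
      rw [if_neg (ha N (by omega))]
      exact hoff a fun j hj => ha j (by omega)
    · intro j hj i hi
      simp only [IORequest.newServer]
      by_cases hjN : j = N
      · subst hjN
        rw [if_pos (block_div hi)]
        congr 1
        simp only [bufIdx, Fin.mk.injEq]
        rw [block_mod hi, Nat.mod_eq_of_lt hi]
      · rw [block_div hi, if_neg fun h => hjN (hwr _ (by omega) _ (by omega) h)]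
        exact hon j (by omega) i hi

theorem length_pass (g : ℕ → P.Client → P.Client) (rd wr : ℕ → ℕ) (N : ℕ) :
    (pass g rd wr N).length = 2 * N := by
  simp [pass, List.length_flatMap]
  ring

end OEMProgram

/-! ### Stored tables -/

/-- A table of `n` blocks whose content depends on the input. -/
structure RawTable (P : OEMParams) (X : Type) where
  n : ℕ
  val : X → List P.Word
  length_val : ∀ x, (val x).length = n * P.blockSize

section Reach

variable {P : OEMParams} {X : Type}

open OEMProgram

/-- In the server memory `m` block `j` of the table `r` is found in block `α r j`, and the blocks
`φ 0, φ 1, …` are zero. -/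
def Stored (α : RawTable P X → ℕ → ℕ) (φ : ℕ → ℕ) (Γ : Set (RawTable P X)) (x : X)
    (m : P.Server) : Prop :=
  (∀ r ∈ Γ, ∀ j < r.n, ∀ i < P.blockSize,
    m (α r j * P.blockSize + i) = (r.val x).getD (j * P.blockSize + i) 0) ∧
  ∀ j, ∀ i < P.blockSize, m (φ j * P.blockSize + i) = 0

/-- The layout `α`, `φ` keeps the tables `Γ` off the free blocks, and the latter start at `R`. -/
structure Layout (R : ℕ) (Γ : Set (RawTable P X)) (α : RawTable P X → ℕ → ℕ) (φ : ℕ → ℕ) :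
    Prop where
  inj : φ.Injective
  le : ∀ i, R ≤ φ i
  off : ∀ r ∈ Γ, ∀ j < r.n, ∀ i, α r j ≠ φ i

/-- Some program with at most `T` I/Os obliviously brings all tables in `Γ` on the server, and
leaves infinitely many zero blocks, with numbers at least `R`. -/
def RawReach (ld : X → P.Server) (R : ℕ) (Γ : Set (RawTable P X)) (T : ℝ) : Prop :=
  ∃ (p : OEMProgram P) (μ : PMF (List IORequest)) (α : RawTable P X → ℕ → ℕ) (φ : ℕ → ℕ),
    (p.length : ℝ) ≤ T ∧ Layout R Γ α φ ∧ ∀ x, (runFull p (fun _ => 0) (ld x)).map Prod.fst = μ ∧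
      ∀ o ∈ (runFull p (fun _ => 0) (ld x)).support, Stored α φ Γ x o.2.2

variable {ld : X → P.Server} {R : ℕ} {Γ : Set (RawTable P X)} {T : ℝ}

theorem RawReach.mono {Γ' : Set (RawTable P X)} {T' : ℝ} (h : RawReach ld R Γ T) (hΓ : Γ' ⊆ Γ)
    (hT : T ≤ T') : RawReach ld R Γ' T' := by
  obtain ⟨p, μ, α, φ, hp, hl, hx⟩ := h
  exact ⟨p, μ, α, φ, hp.trans hT, ⟨hl.inj, hl.le, fun r hr => hl.off r (hΓ hr)⟩, fun x =>
    ⟨(hx x).1, fun o ho => ⟨fun r hr => ((hx x).2 o ho).1 r (hΓ hr), ((hx x).2 o ho).2⟩⟩⟩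

/-- To add a table it suffices to have a program for it that works in the free blocks. -/
theorem RawReach.extend (h : RawReach ld R Γ T) (r' : RawTable P X) (t : ℝ)
    (hq : ∀ α φ, Layout R Γ α φ → ∃ (q : OEMProgram P) (ν : PMF (List IORequest)) (β φ' : ℕ → ℕ),
      (q.length : ℝ) ≤ t ∧ φ'.Injective ∧ (∀ i, ∃ k, φ' i = φ k) ∧
      (∀ j < r'.n, ∀ i, β j ≠ φ' i) ∧
      ∀ x s m, Stored α φ Γ x m → (runFull q s m).map Prod.fst = ν ∧
        ∀ o ∈ (runFull q s m).support,
          (∀ a, (∀ i, a / P.blockSize ≠ φ i) → o.2.2 a = m a) ∧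
          (∀ j < r'.n, ∀ i < P.blockSize,
            o.2.2 (β j * P.blockSize + i) = (r'.val x).getD (j * P.blockSize + i) 0) ∧
          ∀ j, ∀ i < P.blockSize, o.2.2 (φ' j * P.blockSize + i) = 0) :
    RawReach ld R (insert r' Γ) (T + t) := by
  classical
  obtain ⟨p, μ, α, φ, hp, hl, hx⟩ := h
  -- The program for the new table depends on the layout alone, and the layout is the same for all
  -- inputs.
  obtain ⟨q, ν, β, φ', hlen, hinj, hφ, hβ, hrun⟩ := hq α φ hl
  refine ⟨p ++ q, μ.bind fun a => ν.map fun b => a ++ b, Function.update α r' β, φ', ?_,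
    ⟨hinj, ?_, ?_⟩, fun x => ?_⟩
  · rw [List.length_append, Nat.cast_add]
    linarith
  · intro i
    obtain ⟨k, hk⟩ := hφ i
    exact hk ▸ hl.le k
  · intro r hr j hj i
    by_cases hrr : r = r'
    · subst hrr
      rw [Function.update_self]
      exact hβ j hj i
    · rw [Function.update_of_ne hrr]
      obtain ⟨k, hk⟩ := hφ i
      exact hk ▸ hl.off r (hr.resolve_left hrr) j hj k
  · refine runFull_append_spec (hx x).1 fun o ho => ?_
    have hst := (hx x).2 o ho
    refine ⟨(hrun x o.2.1 o.2.2 hst).1, fun o' ho' => ?_⟩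
    obtain ⟨h1, h2, h3⟩ := (hrun x o.2.1 o.2.2 hst).2 o' ho'
    refine ⟨fun r hr j hj i hi => ?_, h3⟩
    by_cases hrr : r = r'
    · subst hrr
      rw [Function.update_self]
      exact h2 j hj i hi
    · have hr := hr.resolve_left hrr
      rw [Function.update_of_ne hrr, h1 _ fun k => ?_]
      · exact hst.1 r hr j hj i hi
      · rw [block_div hi]
        exact hl.off r hr j hj k

/-- Tables whose blocks are blocks of known tables come for free. -/
theorem RawReach.view (h : RawReach ld R Γ T) (r' : RawTable P X)
    (hr : ∀ j < r'.n, ∃ r ∈ Γ, ∃ k < r.n, ∀ x, ∀ i < P.blockSize,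
      (r'.val x).getD (j * P.blockSize + i) 0 = (r.val x).getD (k * P.blockSize + i) 0) :
    RawReach ld R (insert r' Γ) T := by
  classical
  obtain ⟨p, μ, α, φ, hp, hl, hx⟩ := h
  have hr' : ∀ j, ∃ r k, j < r'.n → r ∈ Γ ∧ k < r.n ∧ ∀ x, ∀ i < P.blockSize,
      (r'.val x).getD (j * P.blockSize + i) 0 = (r.val x).getD (k * P.blockSize + i) 0 := by
    intro j
    by_cases hj : j < r'.n
    · obtain ⟨r, h1, k, h2, h3⟩ := hr j hj
      exact ⟨r, k, fun _ => ⟨h1, h2, h3⟩⟩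
    · exact ⟨r', 0, fun h => absurd h hj⟩
  choose r k hrk using hr'
  refine ⟨p, μ, Function.update α r' fun j => α (r j) (k j), φ, hp, ⟨hl.inj, hl.le, ?_⟩,
    fun x => ⟨(hx x).1, fun o ho => ⟨?_, ((hx x).2 o ho).2⟩⟩⟩
  · intro q hq j hj i
    by_cases hqr : q = r'
    · subst hqr
      rw [Function.update_self]
      exact hl.off _ (hrk j hj).1 _ (hrk j hj).2.1 i
    · rw [Function.update_of_ne hqr]
      exact hl.off q (hq.resolve_left hqr) j hj i
  · intro q hq j hj i hi
    by_cases hqr : q = r'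
    · subst hqr
      rw [Function.update_self, (hrk j hj).2.2 x i hi]
      exact ((hx x).2 o ho).1 _ (hrk j hj).1 _ (hrk j hj).2.1 i hi
    · rw [Function.update_of_ne hqr]
      exact ((hx x).2 o ho).1 q (hq.resolve_left hqr) j hj i hi

/-- The table written by a pass. -/
noncomputable def passTable (g : ℕ → P.Client → P.Client) (N : ℕ) (r : RawTable P X) :
    RawTable P X where
  n := N
  val x := List.ofFn fun k : Fin (N * P.blockSize) =>
    clientSeq g (fun _ => 0) (fun j i => (r.val x).getD (j * P.blockSize + i) 0)
      (k / P.blockSize + 1) (bufIdx P k)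
  length_val x := by simp

theorem block_lt {P : OEMParams} {j i N : ℕ} (hj : j < N) (hi : i < P.blockSize) :
    j * P.blockSize + i < N * P.blockSize := by
  calc j * P.blockSize + i < j * P.blockSize + P.blockSize := by omega
    _ = (j + 1) * P.blockSize := by ring
    _ ≤ N * P.blockSize := Nat.mul_le_mul_right _ hj

theorem passTable_getD (g : ℕ → P.Client → P.Client) (N : ℕ) (r : RawTable P X) (x : X) {j i : ℕ}
    (hj : j < N) (hi : i < P.blockSize) :
    ((passTable g N r).val x).getD (j * P.blockSize + i) 0 =
      clientSeq g (fun _ => 0) (fun j i => (r.val x).getD (j * P.blockSize + i) 0)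
      (j + 1) (bufIdx P i) := by
  have hlt := block_lt hj hi
  simp only [passTable]
  rw [List.getD_eq_getElem _ _ (by simpa using hlt), List.getElem_ofFn]
  simp only [block_div hi]
  congr 1
  simp only [bufIdx, block_mod hi, Nat.mod_eq_of_lt hi]

/-- A pass into the blocks `wr 0, wr 1, …`, after the client's memory has been cleared. -/
noncomputable def clearPass (g : ℕ → P.Client → P.Client) (rd wr : ℕ → ℕ) (junk N : ℕ) :
    OEMProgram P :=
  (fun _ => PMF.pure (fun _ => 0, IORequest.write junk)) :: pass g rd wr N

/-- Earlier steps may leave anything in the client's memory. A step has to issue a request, so the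
clearing step writes zeros to the block `junk`, which is zero already: the server does not change.
-/
theorem runFull_clearPass (g : ℕ → P.Client → P.Client) (r : RawTable P X) (x : X) (N junk : ℕ)
    (rd wr : ℕ → ℕ) (hwr : ∀ j < N, ∀ k < N, wr j = wr k → j = k)
    (hrw : ∀ j < N, ∀ k < N, rd j ≠ wr k)
    (s : P.Client) (m : P.Server)
    (hm0 : ∀ i < P.blockSize, m (junk * P.blockSize + i) = 0)
    (hm : ∀ j < N, ∀ i < P.blockSize,
      m (rd j * P.blockSize + i) = (r.val x).getD (j * P.blockSize + i) 0) :
    ∃ (c : P.Client) (m' : P.Server), runFull (clearPass g rd wr junk N) s m = PMF.pure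
        (IORequest.write junk ::
          (List.range N).flatMap fun j => [IORequest.read (rd j), IORequest.write (wr j)],
          c, m') ∧
      (∀ a, (∀ j < N, a / P.blockSize ≠ wr j) → m' a = m a) ∧
      ∀ j < N, ∀ i < P.blockSize, m' (wr j * P.blockSize + i) =
        ((passTable g N r).val x).getD (j * P.blockSize + i) 0 := by
  have hclear : (IORequest.write junk).newServer (fun _ => 0) m = m := by
    funext a
    simp only [IORequest.newServer]
    split_ifs with h
    · have := hm0 (a % P.blockSize) (Nat.mod_lt _ P.blockSize_pos)
      rw [← h, Nat.div_add_mod'] at this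
      exact this.symm
    · rfl
  obtain ⟨m', hrun, hoff, hon⟩ := runFull_pass g rd wr N (fun _ => 0) m hrw hwr
  refine ⟨clientSeq g (fun _ => 0) (fun j i => m (rd j * P.blockSize + i)) N, m', ?_, hoff,
    fun j hj i hi => ?_⟩
  · simp only [clearPass, runFull, PMF.pure_bind, hclear, IORequest.newClient]
    rw [hrun, PMF.pure_map]
  · rw [hon j hj i hi, passTable_getD g N r x hj hi]
    exact congrFun (clientSeq_congr g _ hm (j + 1) (by omega)) _

theorem length_clearPass (g : ℕ → P.Client → P.Client) (rd wr : ℕ → ℕ) (junk N : ℕ) :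
    (clearPass g rd wr junk N).length = 2 * N + 1 := by
  simp [clearPass, length_pass]

/-- The free blocks are divided by parity: the table goes to the blocks `φ (2 * j)`, and the blocks
`φ (2 * i + 1)` remain free. When the pass is longer than the table `r`, it reads the zero block `φ
1`, in accordance with the default value of `getD`. -/
theorem RawReach.pass (h : RawReach ld R Γ T) {r : RawTable P X} (hr : r ∈ Γ)
    (g : ℕ → P.Client → P.Client) (N : ℕ) :
    RawReach ld R (insert (passTable g N r) Γ) (T + (2 * N + 1)) := by
  refine h.extend _ _ fun α φ hl => ?_
  have hne : ∀ a b, φ (2 * a + 1) ≠ φ (2 * b) := fun a b hab => by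
    have := hl.inj hab; omega
  refine ⟨clearPass g (fun j => if j < r.n then α r j else φ 1) (fun j => φ (2 * j)) (φ 1) N,
    PMF.pure (IORequest.write (φ 1) :: (List.range N).flatMap fun j =>
      [IORequest.read (if j < r.n then α r j else φ 1), IORequest.write (φ (2 * j))]),
    fun j => φ (2 * j), fun i => φ (2 * i + 1), ?_, ?_, fun i => ⟨_, rfl⟩,
    fun j _ i => (hne i j).symm, fun x s m hst => ?_⟩
  · rw [length_clearPass]; push_cast; exact le_rfl
  · intro a b hab
    have := hl.inj hab; omega
  · obtain ⟨c, m', hrun, hoff, hon⟩ := runFull_clearPass g r x N (φ 1)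
      (fun j => if j < r.n then α r j else φ 1) (fun j => φ (2 * j))
      (fun j _ k _ hjk => by have := hl.inj hjk; omega)
      (fun j _ k _ => by
        split_ifs with hj
        · exact hl.off r hr j hj _
        · exact hne 0 k)
      s m (hst.2 1)
      (fun j _ i hi => by
        split_ifs with hj
        · exact hst.1 r hr j hj i hi
        · rw [hst.2 1 i hi, List.getD_eq_default]
          rw [r.length_val]
          exact (Nat.mul_le_mul_right _ (not_lt.1 hj)).trans (Nat.le_add_right _ _))
    rw [hrun, PMF.pure_map]
    refine ⟨rfl, fun o ho => ?_⟩
    rw [PMF.support_pure, Set.mem_singleton_iff] at ho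
    subst ho
    refine ⟨fun a ha => hoff a fun j _ => ha _, hon, fun j i hi => ?_⟩
    dsimp only
    rw [hoff _ fun k _ => by rw [block_div hi]; exact hne j k]
    exact hst.2 _ i hi

end Reach

/-! ### Scans -/

section Scan

variable {P : OEMParams} {X : Type}

open OEMProgram

/-- The states of a transducer that runs through the words `v 0, v 1, …`. -/
def scanState {σ ω ω' : Type} (f : ℕ → σ → ω → σ × ω') (init : σ) (v : ℕ → ω) : ℕ → σ
  | 0 => init
  | k + 1 => (f k (scanState f init v k) (v k)).1

/-- The output of a transducer that runs through the words `v 0, v 1, …`. -/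
def scanOut {σ ω ω' : Type} (f : ℕ → σ → ω → σ × ω') (init : σ) (v : ℕ → ω) (k : ℕ) : ω' :=
  (f k (scanState f init v k) (v k)).2

theorem scanState_add {σ ω ω' : Type} (f : ℕ → σ → ω → σ × ω') (init : σ) (v : ℕ → ω) (k i : ℕ) :
    scanState (fun i => f (k + i)) (scanState f init v k) (fun i => v (k + i)) i =
      scanState f init v (k + i) := by
  induction i with
  | zero => rfl
  | succ i ih =>
    rw [← Nat.add_assoc]
    simp only [scanState, ih]

theorem scanState_congr {σ ω ω' : Type} (f : ℕ → σ → ω → σ × ω') (init : σ) {v v' : ℕ → ω} {N : ℕ}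
    (h : ∀ i < N, v i = v' i) : ∀ k ≤ N, scanState f init v k = scanState f init v' k := by
  intro k hk
  induction k with
  | zero => rfl
  | succ k ih =>
    simp only [scanState]
    rw [ih (by omega), h k (by omega)]

/-- One block of a scan; the state is kept behind the buffer. -/
def scanBlock (hM : P.blockSize < P.memSize) (f : ℕ → P.Word → P.Word → P.Word × P.Word)
    (init : P.Word) (j : ℕ) (s : P.Client) : P.Client :=
  fun c =>
    if (c : ℕ) < P.blockSize then
      scanOut (fun i => f (j * P.blockSize + i)) (if j = 0 then init else s ⟨P.blockSize, hM⟩)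
        (fun i => s (bufIdx P i)) c
    else
      scanState (fun i => f (j * P.blockSize + i)) (if j = 0 then init else s ⟨P.blockSize, hM⟩)
        (fun i => s (bufIdx P i)) P.blockSize

theorem fill_bufIdx (s : P.Client) (b : ℕ → P.Word) {i : ℕ} (hi : i < P.blockSize) :
    fill s b (bufIdx P i) = b i := by
  simp [fill, bufIdx, Nat.mod_eq_of_lt hi, hi]

theorem clientSeq_scanBlock (hM : P.blockSize < P.memSize)
    (f : ℕ → P.Word → P.Word → P.Word × P.Word) (init : P.Word) (s : P.Client) (v : ℕ → P.Word)
    (j : ℕ) :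
    (∀ i < P.blockSize,
      clientSeq (scanBlock hM f init) s (fun j i => v (j * P.blockSize + i)) (j + 1) (bufIdx P i) =
        scanOut f init v (j * P.blockSize + i)) ∧
    clientSeq (scanBlock hM f init) s (fun j i => v (j * P.blockSize + i)) (j + 1)
        ⟨P.blockSize, hM⟩ = scanState f init v ((j + 1) * P.blockSize) := by
  have hst : ∀ j, (if j = 0 then init else
      fill (clientSeq (scanBlock hM f init) s (fun j i => v (j * P.blockSize + i)) j)
        (fun i => v (j * P.blockSize + i)) ⟨P.blockSize, hM⟩) =
        scanState f init v (j * P.blockSize) → ∀ i ≤ P.blockSize,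
      scanState (fun i => f (j * P.blockSize + i)) (if j = 0 then init else
      fill (clientSeq (scanBlock hM f init) s (fun j i => v (j * P.blockSize + i)) j)
        (fun i => v (j * P.blockSize + i)) ⟨P.blockSize, hM⟩) (fun i => fill
          (clientSeq (scanBlock hM f init) s (fun j i => v (j * P.blockSize + i)) j)
        (fun i => v (j * P.blockSize + i)) (bufIdx P i)) i =
        scanState f init v (j * P.blockSize + i) := by
    intro j hj i hi
    rw [hj, ← scanState_add]
    exact scanState_congr _ _ (fun i hi => fill_bufIdx _ _ hi) i hi
  have main : ∀ j, (if j = 0 then init else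
      fill (clientSeq (scanBlock hM f init) s (fun j i => v (j * P.blockSize + i)) j)
        (fun i => v (j * P.blockSize + i)) ⟨P.blockSize, hM⟩) =
        scanState f init v (j * P.blockSize) := by
    intro j
    induction j with
    | zero => simp [scanState]
    | succ j ih =>
      rw [if_neg (by omega)]
      simp only [fill, lt_irrefl, if_false]
      simp only [clientSeq, scanBlock, lt_irrefl, if_false]
      rw [hst j ih _ le_rfl]
      congr 1
      ring
  constructor
  · intro i hi
    simp only [clientSeq, scanBlock]
    rw [if_pos (by simpa [bufIdx, Nat.mod_eq_of_lt hi] using hi)]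
    simp only [scanOut]
    have : ((bufIdx P i : Fin P.memSize) : ℕ) = i := by simp [bufIdx, Nat.mod_eq_of_lt hi]
    rw [this, hst j (main j) i hi.le, fill_bufIdx _ _ hi]
  · simp only [clientSeq, scanBlock, lt_irrefl, if_false]
    rw [hst j (main j) _ le_rfl]
    congr 1
    ring

/-- The table of the outputs of a scan. -/
def scanTable (f : ℕ → P.Word → P.Word → P.Word × P.Word) (init : P.Word) (N : ℕ)
    (r : RawTable P X) : RawTable P X where
  n := N
  val x := List.ofFn fun k : Fin (N * P.blockSize) =>
    scanOut f init (fun i => (r.val x).getD i 0) k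
  length_val x := by simp

theorem scanTable_getD (f : ℕ → P.Word → P.Word → P.Word × P.Word) (init : P.Word) (N : ℕ)
    (r : RawTable P X) (x : X) {k : ℕ} (hk : k < N * P.blockSize) :
    ((scanTable f init N r).val x).getD k 0 = scanOut f init (fun i => (r.val x).getD i 0) k := by
  simp only [scanTable]
  rw [List.getD_eq_getElem _ _ (by simpa using hk), List.getElem_ofFn]

variable {ld : X → P.Server} {R : ℕ} {Γ : Set (RawTable P X)} {T : ℝ}

/-- Known tables with the same words may be exchanged. -/
theorem RawReach.congr (h : RawReach ld R Γ T) {r r' : RawTable P X} (hr : r ∈ Γ)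
    (hn : r'.n ≤ r.n) (hv : ∀ x, ∀ k < r'.n * P.blockSize,
      (r'.val x).getD k 0 = (r.val x).getD k 0) : RawReach ld R (insert r' Γ) T :=
  h.view r' fun j hj => ⟨r, hr, j, hj.trans_le hn, fun x _ hi => hv x _ (block_lt hj hi)⟩

theorem RawReach.scan (h : RawReach ld R Γ T) {r : RawTable P X} (hr : r ∈ Γ)
    (hM : P.blockSize < P.memSize) (f : ℕ → P.Word → P.Word → P.Word × P.Word) (init : P.Word)
    (N : ℕ) : RawReach ld R (insert (scanTable f init N r) Γ) (T + (2 * N + 1)) := by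
  refine ((h.pass hr (scanBlock hM f init) N).view (scanTable f init N r) fun j hj =>
    ⟨_, Set.mem_insert _ _, j, hj, fun x i hi => ?_⟩).mono
      (Set.insert_subset_insert (Set.subset_insert _ _)) le_rfl
  replace hj : j < N := hj
  rw [scanTable_getD _ _ _ _ _ (block_lt hj hi), passTable_getD _ _ _ _ hj hi]
  exact ((clientSeq_scanBlock hM f init _ (fun i => (r.val x).getD i 0) j).1 i hi).symm

end Scan

/-! ### Sorting -/

section Sorting

variable {P : OEMParams} {X : Type}

open OEMProgram

/-- A request with a renamed block. -/
def IORequest.rename (ψ : ℕ → ℕ) : IORequest → IORequest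
  | read j => read (ψ j)
  | write j => write (ψ j)

/-- A program with renamed blocks. -/
noncomputable def OEMProgram.rename (ψ : ℕ → ℕ) (q : OEMProgram P) : OEMProgram P :=
  q.map fun f s => (f s).map fun r => (r.1, r.2.rename ψ)

open Classical in
/-- The memory `m` with its blocks `ψ 0, ψ 1, …` replaced by the blocks of `m₀`. -/
noncomputable def overlay (ψ : ℕ → ℕ) (m m₀ : P.Server) : P.Server := fun a =>
  if h : ∃ j, ψ j = a / P.blockSize then m₀ (h.choose * P.blockSize + a % P.blockSize) else m a

theorem overlay_apply {ψ : ℕ → ℕ} (hψ : ψ.Injective) (m m₀ : P.Server) {j a : ℕ}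
    (ha : ψ j = a / P.blockSize) :
    overlay ψ m m₀ a = m₀ (j * P.blockSize + a % P.blockSize) := by
  have h : ∃ j, ψ j = a / P.blockSize := ⟨j, ha⟩
  rw [overlay, dif_pos h, hψ (h.choose_spec.trans ha.symm)]

theorem overlay_block {ψ : ℕ → ℕ} (hψ : ψ.Injective) (m m₀ : P.Server) (j : ℕ) {i : ℕ}
    (hi : i < P.blockSize) :
    overlay ψ m m₀ (ψ j * P.blockSize + i) = m₀ (j * P.blockSize + i) := by
  rw [overlay_apply hψ m m₀ (block_div hi).symm, block_mod hi]

theorem overlay_off {ψ : ℕ → ℕ} (m m₀ : P.Server) {a : ℕ} (ha : ∀ j, a / P.blockSize ≠ ψ j) :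
    overlay ψ m m₀ a = m a :=
  dif_neg fun ⟨j, hj⟩ => ha j hj.symm

theorem newClient_rename {ψ : ℕ → ℕ} (hψ : ψ.Injective) (m m₀ : P.Server) (s : P.Client)
    (q : IORequest) : (q.rename ψ).newClient s (overlay ψ m m₀) = q.newClient s m₀ := by
  cases q with
  | read j => exact fill_congr s fun i hi => overlay_block hψ m m₀ j hi
  | write j => rfl

theorem newServer_rename {ψ : ℕ → ℕ} (hψ : ψ.Injective) (m m₀ : P.Server) (s : P.Client)
    (q : IORequest) :
    (q.rename ψ).newServer s (overlay ψ m m₀) = overlay ψ m (q.newServer s m₀) := by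
  cases q with
  | read j => rfl
  | write j =>
    funext a
    by_cases h : ∃ k, ψ k = a / P.blockSize
    · obtain ⟨k, hk⟩ := h
      have hlt := Nat.mod_lt a P.blockSize_pos
      rw [overlay_apply hψ _ _ hk]
      simp only [IORequest.rename, IORequest.newServer, overlay_apply hψ _ _ hk, block_div hlt,
        block_mod hlt, ← hk, hψ.eq_iff]
    · have ha : ∀ k, a / P.blockSize ≠ ψ k := fun k hk => h ⟨k, hk.symm⟩
      rw [overlay_off _ _ ha]
      simp only [IORequest.rename, IORequest.newServer]
      rw [if_neg (ha j), overlay_off _ _ ha]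

/-- With its blocks renamed injectively, a program lives in a region of its own. It cannot notice
what else is stored, and leaves it alone. -/
theorem runFull_rename {ψ : ℕ → ℕ} (hψ : ψ.Injective) (q : OEMProgram P) (s : P.Client)
    (m m₀ : P.Server) : runFull (q.rename ψ) s (overlay ψ m m₀) =
      (runFull q s m₀).map fun o => (o.1.map (IORequest.rename ψ), o.2.1, overlay ψ m o.2.2) := by
  induction q generalizing s m₀ with
  | nil => simp [OEMProgram.rename, runFull, PMF.pure_map]
  | cons f q ih =>
    simp only [OEMProgram.rename, List.map_cons, runFull, PMF.map_bind, PMF.bind_map]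
    congr 1
    funext r
    simp only [Function.comp_apply, newClient_rename hψ, newServer_rename hψ]
    have := ih (r.2.newClient r.1 m₀) (r.2.newServer r.1 m₀)
    simp only [OEMProgram.rename] at this
    rw [this, PMF.map_comp, PMF.map_comp]
    rfl

/-- The comparison by which words are sorted. -/
def wordLE (a b : P.Word) : Bool := decide (a.toNat ≤ b.toNat)

/-- The table with its words sorted. -/
def sortTable (r : RawTable P X) : RawTable P X where
  n := r.n
  val x := (r.val x).mergeSort wordLE
  length_val x := by rw [List.length_mergeSort, r.length_val]

theorem pairwise_sort (l : List P.Word) :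
    (l.mergeSort wordLE).Pairwise fun a b => a.toNat ≤ b.toNat := by
  have := List.pairwise_mergeSort (le := wordLE (P := P))
    (fun a b c hab hbc => by simp only [wordLE, decide_eq_true_eq] at *; omega)
    (fun a b => by simp only [wordLE, Bool.or_eq_true, decide_eq_true_eq]; omega) l
  simpa only [wordLE, decide_eq_true_eq] using this

/-- A word is determined by its number, so the sorted arrangement of a list is unique. Whatever an
optimal sorting program does, its result is the one of `mergeSort`. -/
theorem eq_sort {l l' : List P.Word} (hp : l'.Perm l)
    (hs : l'.Pairwise fun a b => a.toNat ≤ b.toNat) : l' = l.mergeSort wordLE :=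
  (hp.trans (List.mergeSort_perm l _).symm).eq_of_pairwise
    (fun _ _ _ _ h h' => BitVec.eq_of_toNat_eq (le_antisymm h h')) hs (pairwise_sort l)

theorem HoldsSorted.ofFn_eq {N : ℕ} {x : Fin N → P.Word} {m : P.Server} (h : HoldsSorted x m) :
    (List.ofFn fun i : Fin N => m i) = (List.ofFn x).mergeSort wordLE := by
  obtain ⟨hm, τ, hτ⟩ := h
  refine eq_sort ?_ ?_
  · have : (fun i : Fin N => m i) = x ∘ τ := funext hτ
    rw [this]
    exact Equiv.Perm.ofFn_comp_perm τ x
  · rw [List.pairwise_ofFn]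
    exact fun i j hij => hm hij.le

/-- Tables of `n` blocks can be sorted with `c` I/Os. -/
def CanSort (P : OEMParams) (n : ℕ) (c : ℝ) : Prop :=
  ∀ (X : Type) (ld : X → P.Server) (R : ℕ) (Γ : Set (RawTable P X)) (T : ℝ) (r : RawTable P X),
    r ∈ Γ → r.n = n → RawReach ld R Γ T → RawReach ld R (insert (sortTable r) Γ) (T + c)

theorem passTable_id_getD (r : RawTable P X) (N : ℕ) (x : X) {j i : ℕ} (hj : j < N)
    (hi : i < P.blockSize) :
    ((passTable (fun _ s => s) N r).val x).getD (j * P.blockSize + i) 0 =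
      (r.val x).getD (j * P.blockSize + i) 0 := by
  rw [passTable_getD _ _ _ _ hj hi]
  simp only [clientSeq]
  exact fill_bufIdx _ _ hi

/-- A sorting program expects cleared private memory and an otherwise zero server with the array in
front. The table is therefore copied to free blocks, the client is cleared, and the program runs
with block `j` renamed to `φ (2 * j)`; the blocks with `j ≥ n` are zero as required. Copying takes
`2 n + 1` I/Os and clearing takes one. -/
theorem canSort_of_program {n : ℕ} (q : OEMProgram P)
    (hq : q.ObliviouslyComputes (Set.univ : Set (Fin (n * P.blockSize) → P.Word)) loadArray
      HoldsSorted) : CanSort P n (q.length + (2 * n + 2)) := by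
  classical
  intro X ld R Γ T r hr hn h
  refine h.extend _ _ fun α φ hl => ?_
  have hψ : Function.Injective fun j => φ (2 * j) := fun a b hab => by
    have := hl.inj hab; omega
  have hne : ∀ a b, φ (2 * a + 1) ≠ φ (2 * b) := fun a b hab => by
    have := hl.inj hab; omega
  -- By obliviousness, the requests for the zero array represent those for all arrays.
  set ν := (q.run (fun _ => 0) (loadArray fun _ : Fin (n * P.blockSize) => (0 : P.Word))).map
    Prod.fst
  set reqs : List IORequest := IORequest.write (φ 1) :: (List.range n).flatMap fun j =>
      [IORequest.read (if j < r.n then α r j else φ 1), IORequest.write (φ (2 * j))]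
  set clear : P.Client → PMF (P.Client × IORequest) :=
    fun _ => PMF.pure (fun _ => 0, IORequest.write (φ 1))
  refine ⟨clearPass (fun _ s => s) (fun j => if j < r.n then α r j else φ 1)
    (fun j => φ (2 * j)) (φ 1) n ++ clear :: q.rename fun j => φ (2 * j),
    (PMF.pure reqs).bind fun a => (ν.map fun b => IORequest.write (φ 1) ::
      b.map (IORequest.rename fun j => φ (2 * j))).map fun b => a ++ b, fun j => φ (2 * j),
    fun i => φ (2 * i + 1), ?_, ?_, fun i => ⟨_, rfl⟩, fun j _ i => (hne i j).symm,
    fun x s m hst => ?_⟩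
  · rw [List.length_append, length_clearPass, List.length_cons, OEMProgram.rename, List.length_map]
    push_cast
    linarith
  · intro a b hab
    have := hl.inj hab; omega
  · obtain ⟨c, m', hrun, hoff, hon⟩ := runFull_clearPass (fun _ s => s) r x n (φ 1)
      (fun j => if j < r.n then α r j else φ 1) (fun j => φ (2 * j))
      (fun j _ k _ hjk => hψ hjk)
      (fun j _ k _ => by
        split_ifs with hj
        · exact hl.off r hr j hj _
        · exact hne 0 k)
      s m (hst.2 1)
      (fun j hj i hi => by
        rw [if_pos (hn ▸ hj)]
        exact hst.1 r hr j (hn ▸ hj) i hi)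
    set arr : Fin (n * P.blockSize) → P.Word := fun k => (r.val x).getD k 0 with harr
    have hm1 : ∀ i < P.blockSize, m' (φ 1 * P.blockSize + i) = 0 := fun i hi => by
      rw [hoff _ fun k _ => by rw [block_div hi]; exact hne 0 k]
      exact hst.2 1 i hi
    have hclear : (IORequest.write (φ 1)).newServer (fun _ => 0) m' = m' := by
      funext a
      simp only [IORequest.newServer]
      split_ifs with h
      · have := hm1 (a % P.blockSize) (Nat.mod_lt _ P.blockSize_pos)
        rw [← h, Nat.div_add_mod'] at this
        exact this.symm
      · rfl
    -- Within the renamed blocks, the server is exactly the initial memory of the sorting program.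
    have hover : m' = overlay (fun j => φ (2 * j)) m' (loadArray arr) := by
      funext a
      by_cases h : ∃ j, φ (2 * j) = a / P.blockSize
      · obtain ⟨j, hj⟩ := h
        have hlt := Nat.mod_lt a P.blockSize_pos
        rw [overlay_apply hψ _ _ hj]
        have ha : a = φ (2 * j) * P.blockSize + a % P.blockSize := by rw [hj, Nat.div_add_mod']
        simp only [loadArray]
        by_cases hjn : j < n
        · rw [dif_pos (block_lt hjn hlt)]
          conv_lhs => rw [ha, hon j hjn _ hlt, passTable_id_getD r n x hjn hlt]
        · rw [dif_neg]
          · conv_lhs => rw [ha]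
            rw [hoff _ fun k hk => by rw [block_div hlt]; intro h; have := hψ h; omega]
            exact hst.2 _ _ hlt
          · have := Nat.mul_le_mul_right P.blockSize (not_lt.1 hjn)
            omega
      · rw [overlay_off _ _ fun k hk => h ⟨k, hk.symm⟩]
    have hrun2 : ∀ c, runFull (clear :: q.rename fun j => φ (2 * j)) c m' =
        (runFull q (fun _ => 0) (loadArray arr)).map fun o => (IORequest.write (φ 1) ::
          o.1.map (IORequest.rename fun j => φ (2 * j)), o.2.1,
            overlay (fun j => φ (2 * j)) m' o.2.2) := by
      intro c
      simp only [runFull, clear, PMF.pure_bind, hclear, IORequest.newClient]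
      conv_lhs => rw [hover, runFull_rename hψ, PMF.map_comp]
      rfl
    obtain ⟨hok, hobl⟩ := hq
    have hsup : ∀ o ∈ (runFull q (fun _ => 0) (loadArray arr)).support,
        HoldsSorted arr o.2.2 := fun o ho => by
      refine hok arr trivial (o.1, o.2.2) ?_
      rw [run_eq_map_runFull, PMF.mem_support_map_iff]
      exact ⟨o, ho, rfl⟩
    have hdist : (runFull q (fun _ => 0) (loadArray arr)).map Prod.fst = ν := by
      have := hobl arr trivial (fun _ => 0) trivial
      rw [run_eq_map_runFull, PMF.map_comp] at this
      exact this
    refine runFull_append_spec (μ := PMF.pure reqs) (post := fun m₂ =>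
      (∀ a, (∀ i, a / P.blockSize ≠ φ i) → m₂ a = m a) ∧
      (∀ j < (sortTable r).n, ∀ i < P.blockSize, m₂ (φ (2 * j) * P.blockSize + i) =
        ((sortTable r).val x).getD (j * P.blockSize + i) 0) ∧
      ∀ j, ∀ i < P.blockSize, m₂ (φ (2 * j + 1) * P.blockSize + i) = 0)
      (by rw [hrun, PMF.pure_map]) fun o ho => ?_
    rw [hrun, PMF.support_pure, Set.mem_singleton_iff] at ho
    subst ho
    dsimp only
    rw [hrun2]
    constructor
    · rw [PMF.map_comp, ← hdist, PMF.map_comp]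
      rfl
    · intro o' ho'
      rw [PMF.mem_support_map_iff] at ho'
      obtain ⟨o, ho, rfl⟩ := ho'
      dsimp only
      refine ⟨fun a ha => ?_, fun j hj i hi => ?_, fun j i hi => ?_⟩
      · rw [overlay_off _ _ fun k => ha _]
        exact hoff a fun j _ => ha _
      · have hj' : j < n := hn ▸ hj
        rw [overlay_block hψ _ _ _ hi]
        have hsort := (hsup o ho).ofFn_eq
        have hlist : List.ofFn arr = r.val x := by
          refine List.ext_getElem (by simp [r.length_val, hn]) fun k h1 h2 => ?_
          rw [List.getElem_ofFn]
          simp only [harr]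
          rw [List.getD_eq_getElem]
        rw [hlist] at hsort
        change _ = ((r.val x).mergeSort wordLE).getD _ _
        have hlt := block_lt hj' hi
        rw [← hsort, List.getD_eq_getElem _ _ (by simpa using hlt), List.getElem_ofFn]
      · rw [overlay_off _ _ fun k => by rw [block_div hi]; exact hne j k,
          hoff _ fun k _ => by rw [block_div hi]; exact hne j k]
        exact hst.2 _ i hi

/-- A program that writes a known table to the start of the server's memory. -/
theorem RawReach.output {ld : X → P.Server} {R : ℕ}
    {Γ : Set (RawTable P X)} {T : ℝ} (h : RawReach ld R Γ T) {r : RawTable P X} (hr : r ∈ Γ)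
    (hR : r.n ≤ R) : ∃ (p : OEMProgram P) (μ : PMF (List IORequest)),
      (p.length : ℝ) ≤ T + (4 * r.n + 2) ∧ ∀ x, (p.run (fun _ => 0) (ld x)).map Prod.fst = μ ∧
        ∀ o ∈ (p.run (fun _ => 0) (ld x)).support, ∀ k < r.n * P.blockSize,
          o.2 k = (r.val x).getD k 0 := by
  obtain ⟨p, μ, α, φ, hp, hl, hx⟩ := h
  have hne : ∀ a b, φ (2 * a + 1) ≠ φ (2 * b) := fun a b hab => by
    have := hl.inj hab; omega
  have hbig : ∀ i, ∀ j < r.n, φ i ≠ j := fun i j hj => by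
    have := hl.le i; omega
  set g : ℕ → P.Client → P.Client := fun _ s => s
  -- The table may itself occupy the first blocks, in another order. It is first copied to free
  -- blocks, which lie beyond the output, and only then to the front.
  set q₁ := clearPass g (α r) (fun j => φ (2 * j)) (φ 1) r.n
  set q₂ := clearPass g (fun j => φ (2 * j)) (fun j => j) (φ 1) r.n
  obtain ⟨ν, key⟩ : ∃ ν : PMF (List IORequest), ∀ x s m, Stored α φ Γ x m →
      (runFull (q₁ ++ q₂) s m).map Prod.fst = ν ∧
      ∀ o ∈ (runFull (q₁ ++ q₂) s m).support, ∀ k < r.n * P.blockSize,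
          o.2.2 k = (r.val x).getD k 0 := by
    refine ⟨(PMF.pure (IORequest.write (φ 1) :: (List.range r.n).flatMap fun j =>
        [IORequest.read (α r j), IORequest.write (φ (2 * j))])).bind (fun a =>
      (PMF.pure (IORequest.write (φ 1) :: (List.range r.n).flatMap fun j =>
        [IORequest.read (φ (2 * j)), IORequest.write j])).map fun b => a ++ b), ?_⟩
    intro x s m hst
    obtain ⟨c, m', hrun, hoff, hon⟩ := runFull_clearPass g r x r.n (φ 1)
      (α r) (fun j => φ (2 * j)) (fun j _ k _ hjk => by have := hl.inj hjk; omega)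
      (fun j hj k _ => hl.off r hr j hj _) s m (hst.2 1) (fun j hj i hi => hst.1 r hr j hj i hi)
    obtain ⟨c₂, m₂, hrun₂, hoff₂, hon₂⟩ := runFull_clearPass g r x r.n (φ 1)
      (fun j => φ (2 * j)) (fun j => j) (fun j _ k _ hjk => hjk) (fun j _ k hk => hbig _ k hk) c m'
      (fun i hi => by
        rw [hoff _ fun k _ => by rw [block_div hi]; exact hne 0 k]
        exact hst.2 1 i hi)
      (fun j hj i hi => by rw [hon j hj i hi, passTable_id_getD r _ x hj hi])
    refine runFull_append_spec (post := fun m₂ => ∀ k < r.n * P.blockSize,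
      m₂ k = (r.val x).getD k 0) (by rw [hrun, PMF.pure_map]) fun o ho => ?_
    rw [hrun, PMF.support_pure, Set.mem_singleton_iff] at ho
    subst ho
    dsimp only
    rw [hrun₂, PMF.pure_map]
    refine ⟨rfl, fun o ho k hk => ?_⟩
    rw [PMF.support_pure, Set.mem_singleton_iff] at ho
    subst ho
    dsimp only
    have hlt := Nat.mod_lt k P.blockSize_pos
    have hj : k / P.blockSize < r.n := Nat.div_lt_of_lt_mul (by rwa [Nat.mul_comm])
    have := hon₂ _ hj _ hlt
    rw [passTable_id_getD r _ x hj hlt, Nat.div_add_mod'] at this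
    exact this
  refine ⟨p ++ (q₁ ++ q₂), μ.bind fun a => ν.map fun b => a ++ b, ?_, fun x => ?_⟩
  rotate_left
  · have := runFull_append_spec (q := q₁ ++ q₂)
      (post := fun m₂ => ∀ k < r.n * P.blockSize, m₂ k = (r.val x).getD k 0) (hx x).1 fun o ho =>
      key x o.2.1 o.2.2 ((hx x).2 o ho)
    rw [run_eq_map_runFull, PMF.map_comp]
    refine ⟨this.1, fun o ho => ?_⟩
    rw [PMF.mem_support_map_iff] at ho
    obtain ⟨o, ho, rfl⟩ := ho
    exact this.2 o ho
  · rw [List.length_append, List.length_append, length_clearPass, length_clearPass]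
    push_cast
    linarith

/-- The initial state, where the input is a table at the start of the server's memory. -/
theorem rawReach_input (ld : X → P.Server) (R : ℕ) (r : RawTable P X) (hR : r.n ≤ R)
    (hr : ∀ x, ∀ k, ld x k = (r.val x).getD k 0) : RawReach ld R {r} 0 := by
  refine ⟨[], PMF.pure [], fun _ j => j, fun i => R + i, by simp,
    ⟨add_right_injective R, fun i => Nat.le_add_right _ _, ?_⟩, fun x => ?_⟩
  · rintro q rfl j hj i
    omega
  · simp only [runFull, PMF.pure_map, PMF.support_pure, Set.mem_singleton_iff, forall_eq, true_and]
    refine ⟨?_, fun j i _ => ?_⟩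
    · rintro q rfl j _ i _
      exact hr x _
    · rw [hr, List.getD_eq_default]
      rw [r.length_val, Nat.add_mul]
      have := Nat.mul_le_mul_right P.blockSize hR
      omega

end Sorting

/-! ### Sorting long tables by sorting pairs of chunks -/

section Network

variable {P : OEMParams} {X : Type}

open OEMProgram

/-- Two tables, one after the other. -/
def RawTable.append (r r' : RawTable P X) : RawTable P X where
  n := r.n + r'.n
  val x := r.val x ++ r'.val x
  length_val x := by rw [List.length_append, r.length_val, r'.length_val, Nat.add_mul]

/-- The first `h` blocks of a table. -/
def RawTable.take (h : ℕ) (r : RawTable P X) : RawTable P X where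
  n := min h r.n
  val x := (r.val x).take (h * P.blockSize)
  length_val x := by rw [List.length_take, r.length_val, Nat.mul_min_mul_right]

/-- A table without its first `h` blocks. -/
def RawTable.drop (h : ℕ) (r : RawTable P X) : RawTable P X where
  n := r.n - h
  val x := (r.val x).drop (h * P.blockSize)
  length_val x := by rw [List.length_drop, r.length_val, Nat.sub_mul]

/-- The table with no blocks. -/
def RawTable.empty : RawTable P X where
  n := 0
  val _ := []
  length_val _ := by simp

variable {ld : X → P.Server} {R : ℕ} {Γ : Set (RawTable P X)} {T : ℝ}

theorem RawReach.empty (h : RawReach ld R Γ T) : RawReach ld R (insert RawTable.empty Γ) T :=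
  h.view _ fun _ hj => absurd hj (Nat.not_lt_zero _)

theorem RawReach.append (h : RawReach ld R Γ T) {r r' : RawTable P X} (hr : r ∈ Γ) (hr' : r' ∈ Γ) :
    RawReach ld R (insert (r.append r') Γ) T := by
  refine h.view _ fun j hj => ?_
  by_cases hjr : j < r.n
  · refine ⟨r, hr, j, hjr, fun x i hi => ?_⟩
    have := block_lt hjr hi
    rw [← r.length_val x] at this
    simp only [RawTable.append]
    rw [List.getD_append _ _ _ _ this]
  · have hj' : j - r.n < r'.n := by simp only [RawTable.append] at hj; omega
    refine ⟨r', hr', j - r.n, hj', fun x i hi => ?_⟩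
    have h1 : r.n * P.blockSize ≤ j * P.blockSize := Nat.mul_le_mul_right _ (by omega)
    simp only [RawTable.append]
    rw [List.getD_append_right _ _ _ _ (by rw [r.length_val]; omega), r.length_val, Nat.sub_mul]
    congr 1
    omega

theorem RawReach.take (h : RawReach ld R Γ T) {r : RawTable P X} (hr : r ∈ Γ) (k : ℕ) :
    RawReach ld R (insert (r.take k) Γ) T := by
  refine h.view _ fun j hj => ?_
  simp only [RawTable.take, lt_min_iff] at hj
  refine ⟨r, hr, j, hj.2, fun x i hi => ?_⟩
  have := block_lt hj.1 hi
  simp only [RawTable.take]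
  simp [List.getD, this]

theorem RawReach.drop (h : RawReach ld R Γ T) {r : RawTable P X} (hr : r ∈ Γ) (k : ℕ) :
    RawReach ld R (insert (r.drop k) Γ) T := by
  refine h.view _ fun j hj => ?_
  simp only [RawTable.drop] at hj
  refine ⟨r, hr, k + j, by omega, fun x i hi => ?_⟩
  simp only [RawTable.drop]
  simp only [List.getD, List.getElem?_drop]
  congr 2
  ring

/-- At least `c.length` words of the sorted list are at most `y`, and such words form an initial
segment of it. -/
theorem le_of_mem_take_sort {c d : List P.Word} {y : ℕ} (hc : ∀ a ∈ c, a.toNat ≤ y) :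
    ∀ a ∈ ((c ++ d).mergeSort wordLE).take c.length, a.toNat ≤ y := by
  intro a ha
  by_contra hay
  set l := (c ++ d).mergeSort wordLE with hl
  obtain ⟨i, hi, rfl⟩ := List.getElem_of_mem ha
  rw [List.length_take, lt_min_iff] at hi
  rw [List.getElem_take] at hay
  have hcount : c.length ≤ l.countP fun a => decide (a.toNat ≤ y) := by
    rw [hl, (List.mergeSort_perm _ _).countP_eq, List.countP_append]
    have : c.countP (fun a => decide (a.toNat ≤ y)) = c.length :=
      List.countP_eq_length.2 fun a ha => by simpa using hc a ha
    omega
  have hdrop : (l.drop i).countP (fun a => decide (a.toNat ≤ y)) = 0 := by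
    rw [List.countP_eq_zero]
    intro b hb
    obtain ⟨k, hk, rfl⟩ := List.getElem_of_mem hb
    rw [List.getElem_drop]
    have hs := pairwise_sort (c ++ d)
    rw [← hl, List.pairwise_iff_getElem] at hs
    rw [List.length_drop] at hk
    rcases Nat.eq_zero_or_pos k with rfl | hk0
    · simpa using hay
    · have := hs i (i + k) hi.2 (by omega) (by omega)
      simp only [decide_eq_true_eq]
      omega
  rw [← List.take_append_drop i l, List.countP_append, hdrop] at hcount
  have := List.countP_le_length (p := fun a : P.Word => decide (a.toNat ≤ y)) (l := l.take i)
  rw [List.length_take] at this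
  omega

/-- The words of a table in nondecreasing order. -/
def WordsSorted (l : List P.Word) : Prop := l.Pairwise fun a b => a.toNat ≤ b.toNat

/-- The words of several tables of the same shape. -/
def chunks (ds : List (RawTable P X)) (x : X) : List P.Word := ds.flatMap fun d => d.val x

/-- Moving the smallest words into the first of several chunks. -/
theorem RawReach.selectMin {h : ℕ} {t : ℝ} (ht : CanSort P (2 * h) t)
    (ds : List (RawTable P X)) : ∀ (Γ : Set (RawTable P X)) (T : ℝ) (c : RawTable P X), c ∈ Γ →
    c.n = h → (∀ d ∈ ds, d ∈ Γ ∧ d.n = h) → RawReach ld R Γ T →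
    ∃ (Γ' : Set (RawTable P X)) (c' : RawTable P X) (ds' : List (RawTable P X)), Γ ⊆ Γ' ∧
      RawReach ld R Γ' (T + ds.length * t) ∧ c' ∈ Γ' ∧ c'.n = h ∧ ds'.length = ds.length ∧
      (∀ d ∈ ds', d ∈ Γ' ∧ d.n = h) ∧ ∀ x,
        (c'.val x ++ chunks ds' x).Perm (c.val x ++ chunks ds x) ∧
        (∀ y, (∀ a ∈ c.val x, a.toNat ≤ y) → ∀ a ∈ c'.val x, a.toNat ≤ y) ∧
        (∀ a ∈ c'.val x, ∀ b ∈ chunks ds' x, a.toNat ≤ b.toNat) ∧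
        (WordsSorted (c.val x) ∨ ds ≠ [] → WordsSorted (c'.val x)) ∧
        ∀ d ∈ ds', WordsSorted (d.val x) := by
  induction ds with
  | nil =>
    intro Γ T c hc hn _ hR
    exact ⟨Γ, c, [], subset_rfl, by simpa using hR, hc, hn, rfl, by simp, fun x =>
      ⟨by simp, fun y h => h, by simp [chunks], by simp, by simp⟩⟩
  | cons d ds ih =>
    intro Γ T c hc hn hds hR
    obtain ⟨hd, hdn⟩ := hds d (by simp)
    -- The smaller half of `c` and `d` continues as the candidate for the minimum; the larger half
    -- takes the place of `d`.
    set m := sortTable (c.append d) with hm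
    have hmn : m.n = 2 * h := by
      simp only [hm, sortTable, RawTable.append, hn, hdn]; ring
    have h1 := ht X ld R _ T (c.append d) (Set.mem_insert _ _)
      (by simp only [RawTable.append, hn, hdn]; ring) (hR.append hc hd)
    have h2 := h1.take (Set.mem_insert _ _) h
    have h3 := h2.drop (Set.mem_insert_of_mem _ (Set.mem_insert _ _)) h
    rw [← hm] at h3
    set Γ₁ := insert (m.drop h) (insert (m.take h) (insert m (insert (c.append d) Γ))) with hΓ₁
    have hsub : Γ ⊆ Γ₁ := fun r hr => by simp [hΓ₁, hr]
    have hcl : ∀ x, (c.val x).length = h * P.blockSize := fun x => by rw [c.length_val, hn]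
    obtain ⟨Γ', c', ds', hΓ, hreach, hc', hcn, hlen, hmem, hspec⟩ :=
      ih Γ₁ (T + t) (m.take h) (by simp [hΓ₁]) (by simp only [RawTable.take, hmn]; omega)
        (fun e he => ⟨hsub (hds e (by simp [he])).1, (hds e (by simp [he])).2⟩) h3
    refine ⟨Γ', c', m.drop h :: ds', hsub.trans hΓ, ?_, hc', hcn, by simp [hlen], ?_, fun x => ?_⟩
    · rw [List.length_cons]
      push_cast
      convert hreach using 1
      ring
    · intro e he
      rcases List.mem_cons.1 he with rfl | he
      · exact ⟨hΓ (by simp [hΓ₁]), by simp only [RawTable.drop, hmn]; omega⟩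
      · exact hmem e he
    · obtain ⟨s1, s2, s3, s4, s5⟩ := hspec x
      have hmv : m.val x = (c.val x ++ d.val x).mergeSort wordLE := rfl
      have hms : WordsSorted (m.val x) := pairwise_sort _
      have htd : (m.take h).val x ++ (m.drop h).val x = m.val x := List.take_append_drop _ _
      refine ⟨?_, fun y hy => s2 y ?_, ?_, fun _ => s4 (Or.inl ?_), ?_⟩
      · have e1 : (c'.val x ++ chunks (m.drop h :: ds') x).Perm
            ((m.drop h).val x ++ (c'.val x ++ chunks ds' x)) := by
          simp only [chunks, List.flatMap_cons]
          rw [← List.append_assoc, ← List.append_assoc]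
          exact List.perm_append_comm.append_right _
        refine e1.trans ((s1.append_left _).trans ?_)
        have e2 : ((m.drop h).val x ++ (m.take h).val x).Perm (c.val x ++ d.val x) := by
          refine List.perm_append_comm.trans ?_
          rw [htd, hmv]
          exact List.mergeSort_perm _ _
        simp only [chunks, List.flatMap_cons]
        rw [← List.append_assoc, ← List.append_assoc]
        exact e2.append_right _
      · have := le_of_mem_take_sort (d := d.val x) hy
        rw [hcl] at this
        exact this
      · intro a ha b hb
        simp only [chunks, List.flatMap_cons, List.mem_append] at hb
        rcases hb with hb | hb
        · refine s2 b.toNat (fun a' ha' => ?_) a ha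
          unfold WordsSorted at hms
          rw [← htd, List.pairwise_append] at hms
          exact hms.2.2 a' ha' b hb
        · exact s3 a ha b hb
      · exact hms.sublist (List.take_sublist _ _)
      · intro e he
        rcases List.mem_cons.1 he with rfl | he
        · exact hms.sublist (List.drop_sublist _ _)
        · exact s5 e he

/-- Sorting several chunks by selection. -/
theorem RawReach.sortChunks {h : ℕ} {t : ℝ} (ht : CanSort P (2 * h) t) (ht0 : 0 ≤ t) (k : ℕ) :
    ∀ (ds : List (RawTable P X)) (Γ : Set (RawTable P X)) (T : ℝ), ds.length = k →
    (∀ d ∈ ds, d ∈ Γ ∧ d.n = h) → RawReach ld R Γ T →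
    ∃ (Γ' : Set (RawTable P X)) (ds' : List (RawTable P X)), Γ ⊆ Γ' ∧
      RawReach ld R Γ' (T + k * k * t) ∧ ds'.length = k ∧
      (∀ d ∈ ds', d ∈ Γ' ∧ d.n = h) ∧ ∀ x,
        (chunks ds' x).Perm (chunks ds x) ∧
        ((∀ d ∈ ds, WordsSorted (d.val x)) ∨ 2 ≤ k → WordsSorted (chunks ds' x)) := by
  induction k with
  | zero =>
    intro ds Γ T hk _ hR
    rw [List.length_eq_zero_iff] at hk
    subst hk
    exact ⟨Γ, [], subset_rfl, by simpa using hR, rfl, by simp, fun x => by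
      simp [chunks, WordsSorted]⟩
  | succ k ih =>
    intro ds Γ T hk hds hR
    obtain _ | ⟨c, ds⟩ := ds
    · simp at hk
    have hk' : ds.length = k := by simpa using hk
    obtain ⟨Γ₁, c₁, ds₁, hΓ₁, hR₁, hc₁, hcn₁, hlen₁, hmem₁, hs₁⟩ :=
      RawReach.selectMin ht ds Γ T c (hds c (by simp)).1 (hds c (by simp)).2
        (fun d hd => hds d (by simp [hd])) hR
    obtain ⟨Γ₂, ds₂, hΓ₂, hR₂, hlen₂, hmem₂, hs₂⟩ := ih ds₁ Γ₁ _ (hlen₁.trans hk') hmem₁ hR₁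
    refine ⟨Γ₂, c₁ :: ds₂, hΓ₁.trans hΓ₂, hR₂.mono subset_rfl ?_, by simp [hlen₂], ?_,
      fun x => ⟨?_, fun hx => ?_⟩⟩
    · rw [hk']
      push_cast
      nlinarith [mul_nonneg (Nat.cast_nonneg (α := ℝ) k) ht0]
    · intro d hd
      rcases List.mem_cons.1 hd with rfl | hd
      · exact ⟨hΓ₂ hc₁, hcn₁⟩
      · exact hmem₂ d hd
    · obtain ⟨s1, -, -, -, -⟩ := hs₁ x
      exact ((hs₂ x).1.append_left _).trans s1
    · obtain ⟨s1, s2, s3, s4, s5⟩ := hs₁ x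
      -- A single chunk takes part in no sort. It has to be sorted from the outset, unless there is
      -- another chunk.
      have : WordsSorted (c₁.val x) := s4 <| by
        rcases hx with hx | hx
        · exact Or.inl (hx c (by simp))
        · right
          rintro rfl
          simp at hk'
          omega
      unfold WordsSorted at *
      change (c₁.val x ++ chunks ds₂ x).Pairwise _
      rw [List.pairwise_append]
      refine ⟨this, (hs₂ x).2 (Or.inl s5), fun a ha b hb => s3 a ha b ?_⟩
      exact (hs₂ x).1.mem_iff.1 hb

theorem RawReach.split {h : ℕ} (k : ℕ) : ∀ (Γ : Set (RawTable P X)) (T : ℝ) (r : RawTable P X),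
    r ∈ Γ → r.n = k * h → RawReach ld R Γ T →
    ∃ (Γ' : Set (RawTable P X)) (ds : List (RawTable P X)), Γ ⊆ Γ' ∧ RawReach ld R Γ' T ∧
      ds.length = k ∧ (∀ d ∈ ds, d ∈ Γ' ∧ d.n = h) ∧ ∀ x, chunks ds x = r.val x := by
  induction k with
  | zero =>
    intro Γ T r _ hn hR
    refine ⟨Γ, [], subset_rfl, hR, rfl, by simp, fun x => ?_⟩
    have := r.length_val x
    rw [hn, Nat.zero_mul, Nat.zero_mul, List.length_eq_zero_iff] at this
    simp [chunks, this]
  | succ k ih =>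
    intro Γ T r hr hn hR
    have h2 := (hR.take hr h).drop (Set.mem_insert_of_mem _ hr) h
    obtain ⟨Γ', ds, hΓ, hR', hlen, hmem, hv⟩ := ih _ T (r.drop h) (Set.mem_insert _ _)
      (by simp only [RawTable.drop, hn]; rw [Nat.succ_mul]; omega) h2
    refine ⟨Γ', r.take h :: ds, fun q hq => hΓ (by simp [hq]), hR', by simp [hlen], ?_,
      fun x => ?_⟩
    · intro d hd
      rcases List.mem_cons.1 hd with rfl | hd
      · exact ⟨hΓ (by simp), by simp only [RawTable.take, hn]; rw [Nat.succ_mul]; omega⟩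
      · exact hmem d hd
    · change (r.take h).val x ++ chunks ds x = _
      rw [hv]
      exact List.take_append_drop _ _

theorem RawReach.join {h : ℕ} (ds : List (RawTable P X)) : ∀ (Γ : Set (RawTable P X)) (T : ℝ),
    (∀ d ∈ ds, d ∈ Γ ∧ d.n = h) → RawReach ld R Γ T →
    ∃ (Γ' : Set (RawTable P X)) (r : RawTable P X), Γ ⊆ Γ' ∧ RawReach ld R Γ' T ∧ r ∈ Γ' ∧
      r.n = ds.length * h ∧ ∀ x, r.val x = chunks ds x := by
  induction ds with
  | nil =>
    intro Γ T _ hR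
    exact ⟨_, RawTable.empty, Set.subset_insert _ _, hR.empty, Set.mem_insert _ _,
      by simp [RawTable.empty], fun x => by simp [RawTable.empty, chunks]⟩
  | cons d ds ih =>
    intro Γ T hds hR
    obtain ⟨Γ', r, hΓ, hR', hr, hn, hv⟩ := ih Γ T (fun e he => hds e (by simp [he])) hR
    obtain ⟨hd, hdn⟩ := hds d (by simp)
    refine ⟨_, d.append r, hΓ.trans (Set.subset_insert _ _), hR'.append (hΓ hd) hr,
      Set.mem_insert _ _, ?_, fun x => ?_⟩
    · simp only [RawTable.append, hdn, hn, List.length_cons]; ring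
    · simp only [RawTable.append, hv, chunks, List.flatMap_cons]

/-- This is selection sort with chunks in the place of elements: each of the `k` selections takes
fewer than `k` sorts of two chunks. -/
theorem CanSort.chunked {h : ℕ} {t : ℝ} (ht : CanSort P (2 * h) t) (ht0 : 0 ≤ t) {k : ℕ}
    (hk : 2 ≤ k) : CanSort P (k * h) (k * k * t) := by
  intro X ld R Γ T r hr hn hR
  obtain ⟨Γ₁, ds₁, hΓ₁, hR₁, hlen₁, hmem₁, hv₁⟩ := RawReach.split k Γ T r hr hn hR
  obtain ⟨Γ₂, ds₂, hΓ₂, hR₂, hlen₂, hmem₂, hs₂⟩ :=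
    RawReach.sortChunks ht ht0 k ds₁ Γ₁ T hlen₁ hmem₁ hR₁
  obtain ⟨Γ₃, r₃, hΓ₃, hR₃, hr₃, hn₃, hv₃⟩ := RawReach.join ds₂ Γ₂ _ hmem₂ hR₂
  refine (hR₃.congr (r' := sortTable r) hr₃ ?_ fun x i hi => ?_).mono
    (Set.insert_subset_insert (hΓ₁.trans (hΓ₂.trans hΓ₃))) le_rfl
  · simp only [sortTable, hn, hn₃, hlen₂, le_rfl]
  · rw [hv₃, eq_sort (l := r.val x) (l' := chunks ds₂ x) (by rw [← hv₁]; exact (hs₂ x).1)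
      ((hs₂ x).2 (Or.inr hk))]
    rfl

theorem CanSort.mono {n : ℕ} {c c' : ℝ} (h : CanSort P n c) (hc : c ≤ c') : CanSort P n c' :=
  fun X ld R Γ T r hr hn hR => (h X ld R Γ T r hr hn hR).mono subset_rfl (by linarith)

theorem canSort_zero : CanSort P 0 0 := by
  intro X ld R Γ T r _ hn hR
  rw [add_zero]
  exact hR.view _ fun j hj => absurd hj (by simp [sortTable, hn])

/-- Filling up with the largest word is harmless: these words end up behind the words of the table,
and the first blocks of the result are the sorted table. -/
theorem CanSort.pad {n n' : ℕ} {c : ℝ} (h : CanSort P n c) (hn : n' ≤ n) :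
    CanSort P n' (c + (2 * (n - n') + 1)) := by
  intro X ld R Γ T r hr hrn hR
  have h1 := hR.pass hr (fun _ _ _ => BitVec.allOnes P.wordBits) (n - n')
  set p := passTable (fun (_ : ℕ) (_ : P.Client) _ => BitVec.allOnes P.wordBits) (n - n') r with hp
  have h2 := h1.append (Set.mem_insert_of_mem _ hr) (Set.mem_insert _ _)
  have h3 := h X ld R _ _ (r.append p) (Set.mem_insert _ _)
    (by simp only [RawTable.append, hrn, hp, passTable]; omega) h2
  have hpv : ∀ x, ∀ a ∈ p.val x, a = BitVec.allOnes P.wordBits := by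
    intro x a ha
    simp only [hp, passTable, List.mem_ofFn] at ha
    obtain ⟨k, rfl⟩ := ha
    rfl
  refine ((h3.congr (r' := sortTable r) (Set.mem_insert _ _) ?_ fun x i hi => ?_).mono
    (Set.insert_subset_insert fun q hq => by simp [hq]) ?_)
  · simp only [sortTable, RawTable.append]; omega
  · have : (r.val x).mergeSort wordLE ++ p.val x = (r.val x ++ p.val x).mergeSort wordLE := by
      refine eq_sort ((List.mergeSort_perm _ _).append_right _) ?_
      rw [List.pairwise_append]
      refine ⟨pairwise_sort _, ?_, fun a _ b hb => ?_⟩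
      · refine List.Pairwise.imp_of_mem (R := fun _ _ => True) (fun {a b} ha hb _ => ?_)
          (List.pairwise_of_forall fun _ _ => trivial)
        rw [hpv x a ha, hpv x b hb]
      · rw [hpv x b hb, BitVec.toNat_allOnes]
        have := a.isLt
        omega
    simp only [sortTable, RawTable.append] at hi ⊢
    rw [← this, List.getD_append]
    rwa [List.length_mergeSort, r.length_val]
  · have : ((n - n' : ℕ) : ℝ) = n - n' := by push_cast [hn]; ring
    rw [this]
    linarith

end Network

/-! ### The cost of sorting per block -/

section SortUnit

variable {P : OEMParams}

open OEMProgram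

/-- The words in the cells `k, …, k + B - 1` of the client's memory, where `k + B ≤ M`. -/
def clientWords (s : P.Client) (k : ℕ) : List P.Word :=
  List.ofFn fun i : Fin P.blockSize => if h : k + i < P.memSize then s ⟨k + i, h⟩ else 0

/-- Reading two blocks, the client sorts them in its private memory and then writes them back. -/
def sortTwo (j : ℕ) (s : P.Client) : P.Client :=
  if j = 0 then fun c => s (bufIdx P c)
  else if j = 1 then fun c =>
    ((clientWords s P.blockSize ++ clientWords s 0).mergeSort wordLE).getD c 0
  else fun c => if h : P.blockSize + c < P.memSize then s ⟨P.blockSize + c, h⟩ else 0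

/-- A pass of three iterations suffices. The first copies block 0 behind the buffer, the second
sorts both blocks in private memory and writes the smaller half, and the third shifts the larger
half into the buffer. The result is in the last two of the three blocks written, which explains the
index `j + 1`. -/
theorem canSort_two (hM : 2 * P.blockSize ≤ P.memSize) : CanSort P 2 7 := by
  intro X ld R Γ T r hr hn hR
  refine ((hR.pass hr sortTwo 3).view (sortTable r) fun j hj =>
    ⟨_, Set.mem_insert _ _, j + 1, ?_, fun x i hi => ?_⟩).mono
    (Set.insert_subset_insert (Set.subset_insert _ _)) (by norm_num)
  · simp only [sortTable, hn] at hj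
    simp only [passTable]
    omega
  · simp only [sortTable, hn] at hj
    have hB := P.blockSize_pos
    rw [passTable_getD _ _ _ _ (by omega) hi]
    set v : ℕ → ℕ → P.Word := fun j i => (r.val x).getD (j * P.blockSize + i) 0 with hv
    set s₁ := clientSeq sortTwo (fun _ => 0) v 1 with hs₁
    have h1 : ∀ (c : Fin P.memSize), s₁ c = v 0 (c % P.blockSize) := by
      intro c
      simp only [hs₁, clientSeq, sortTwo, if_true]
      have : bufIdx P (c : ℕ) = bufIdx P ((c : ℕ) % P.blockSize) := by simp [bufIdx]
      rw [this, fill_bufIdx _ _ (Nat.mod_lt _ hB)]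
    have hl1 : clientWords (fill s₁ (v 1)) P.blockSize = (r.val x).take P.blockSize := by
      refine List.ext_getElem (by simp [clientWords, r.length_val, hn]; omega) fun k hk hk' => ?_
      simp only [clientWords, List.length_ofFn] at hk
      simp only [clientWords, List.getElem_ofFn, List.getElem_take]
      rw [dif_pos (by omega)]
      simp only [fill]
      rw [if_neg (by omega), h1]
      simp only [Nat.add_mod_left, Nat.mod_eq_of_lt hk, hv, Nat.zero_mul, Nat.zero_add]
      rw [List.getD_eq_getElem]
    have hl2 : clientWords (fill s₁ (v 1)) 0 = (r.val x).drop P.blockSize := by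
      refine List.ext_getElem (by simp [clientWords, r.length_val, hn]; omega) fun k hk hk' => ?_
      simp only [clientWords, List.length_ofFn] at hk
      simp only [clientWords, List.getElem_ofFn, List.getElem_drop]
      rw [dif_pos (by omega)]
      simp only [fill]
      rw [if_pos (by omega)]
      simp only [hv, Nat.zero_add, Nat.one_mul]
      rw [List.getD_eq_getElem]
    set s₂ := clientSeq sortTwo (fun _ => 0) v 2 with hs₂
    have h2 : ∀ (c : Fin P.memSize), s₂ c = ((r.val x).mergeSort wordLE).getD c 0 := by
      intro c
      have : s₂ = sortTwo 1 (fill s₁ (v 1)) := rfl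
      rw [this]
      simp only [sortTwo, one_ne_zero, if_false, if_true]
      rw [hl1, hl2, List.take_append_drop]
    have hbuf : ∀ i < P.blockSize, ((bufIdx P i : Fin P.memSize) : ℕ) = i := fun i hi => by
      simp [bufIdx, Nat.mod_eq_of_lt hi]
    simp only [sortTable]
    obtain rfl | rfl : j = 0 ∨ j = 1 := by omega
    · change _ = s₂ _
      rw [h2, hbuf i hi, Nat.zero_mul, Nat.zero_add]
    · have : clientSeq sortTwo (fun _ => 0) v (1 + 1 + 1) = sortTwo 2 (fill s₂ (v 2)) := rfl
      rw [this]
      simp only [sortTwo, OfNat.ofNat_ne_zero, OfNat.ofNat_ne_one, if_false]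
      rw [dif_pos (by rw [hbuf i hi]; omega)]
      simp only [fill]
      rw [if_neg (by omega), h2]
      simp only [hbuf i hi, Nat.one_mul]

/-- The empty program leaves the array `1, 0, 0, …` unsorted. -/
theorem one_le_sortCost (hw : 0 < P.wordBits) {n : ℕ} (hn : 2 ≤ n * P.blockSize) :
    1 ≤ sortCost P n := by
  refine le_iInf₂ fun p hp => ?_
  rcases Nat.eq_zero_or_pos p.length with h0 | h0
  · rw [List.length_eq_zero_iff] at h0
    subst h0
    exfalso
    set x : Fin (n * P.blockSize) → P.Word := fun i => if (i : ℕ) = 0 then 1 else 0 with hx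
    have h := hp.1 x trivial ([], loadArray x) (by
      rw [OEMProgram.run, PMF.support_pure]; exact Set.mem_singleton _)
    have h01 := h.1 (show (⟨0, by omega⟩ : Fin (n * P.blockSize)) ≤ ⟨1, by omega⟩ by
      simp)
    simp only [loadArray] at h01
    rw [dif_pos (by omega), dif_pos (by omega)] at h01
    simp only [hx, if_true, one_ne_zero, if_false] at h01
    have h1 : (1 : P.Word).toNat = 1 := BitVec.toNat_one hw
    have h0 : (0 : P.Word).toNat = 0 := BitVec.toNat_zero
    omega
  · exact_mod_cast h0

theorem sortCost_le_doSort (P : OEMParams) {E m : ℕ} (h1 : 1 ≤ m) (h2 : m ≤ E ⌈/⌉ P.blockSize) :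
    sortCost P m ≤ (m : ℝ≥0∞) / (E ⌈/⌉ P.blockSize : ℕ) * DOSort P E := by
  have h := le_iSup₂ (f := fun m (_ : m ∈ Finset.Icc 1 (E ⌈/⌉ P.blockSize)) =>
    (((E ⌈/⌉ P.blockSize : ℕ) : ℝ≥0∞) / (m : ℝ≥0∞)) * sortCost P m) m (Finset.mem_Icc.2 ⟨h1, h2⟩)
  have hm : (m : ℝ≥0∞) ≠ 0 := by exact_mod_cast (by omega : m ≠ 0)
  have hn : ((E ⌈/⌉ P.blockSize : ℕ) : ℝ≥0∞) ≠ 0 := by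
    exact_mod_cast (by omega : E ⌈/⌉ P.blockSize ≠ 0)
  calc sortCost P m = (m : ℝ≥0∞) / (E ⌈/⌉ P.blockSize : ℕ) *
        (((E ⌈/⌉ P.blockSize : ℕ) : ℝ≥0∞) / (m : ℝ≥0∞) * sortCost P m) := by
        rw [← mul_assoc, ← mul_div_assoc, ENNReal.div_mul_cancel hn (ENNReal.natCast_ne_top _),
          ENNReal.div_self hm (ENNReal.natCast_ne_top _), one_mul]
    _ ≤ _ := by gcongr; exact h

/-- Sorting one block, or two blocks if a block is a single word, takes at least one I/O, and the
definition of `DOSort` scales this linearly to all blocks. Thereby the linear cost of scans is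
covered by the cost of sorting. -/
theorem half_le_doSort (hw : 0 < P.wordBits) {E : ℕ} (hE : 2 ≤ E) :
    ((E ⌈/⌉ P.blockSize : ℕ) : ℝ≥0∞) ≤ 2 * DOSort P E := by
  have hB := P.blockSize_pos
  obtain ⟨m, hm1, hm2, hmn, hmB⟩ : ∃ m, 1 ≤ m ∧ m ≤ 2 ∧ m ≤ E ⌈/⌉ P.blockSize ∧
      2 ≤ m * P.blockSize := by
    have h1 : 1 ≤ E ⌈/⌉ P.blockSize := by
      by_contra h
      have : E ⌈/⌉ P.blockSize ≤ 0 := by omega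
      rw [ceilDiv_le_iff_le_mul hB] at this
      omega
    by_cases h2 : 2 ≤ P.blockSize
    · exact ⟨1, le_rfl, by norm_num, h1, by omega⟩
    · refine ⟨2, by norm_num, le_rfl, ?_, by omega⟩
      by_contra h
      have : E ⌈/⌉ P.blockSize ≤ 1 := by omega
      rw [ceilDiv_le_iff_le_mul hB] at this
      nlinarith
  have h := le_iSup₂ (f := fun m (_ : m ∈ Finset.Icc 1 (E ⌈/⌉ P.blockSize)) =>
    (((E ⌈/⌉ P.blockSize : ℕ) : ℝ≥0∞) / (m : ℝ≥0∞)) * sortCost P m) m (Finset.mem_Icc.2 ⟨hm1, hmn⟩)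
  have hm0 : (m : ℝ≥0∞) ≠ 0 := by exact_mod_cast (by omega : m ≠ 0)
  calc ((E ⌈/⌉ P.blockSize : ℕ) : ℝ≥0∞)
      = m * ((((E ⌈/⌉ P.blockSize : ℕ) : ℝ≥0∞) / (m : ℝ≥0∞)) * 1) := by
        rw [mul_one, ENNReal.mul_div_cancel hm0 (ENNReal.natCast_ne_top _)]
    _ ≤ 2 * ((((E ⌈/⌉ P.blockSize : ℕ) : ℝ≥0∞) / (m : ℝ≥0∞)) * sortCost P m) := by
        gcongr
        · exact_mod_cast hm2
        · exact one_le_sortCost hw hmB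
    _ ≤ 2 * DOSort P E := by gcongr; exact h

/-- Some program comes within one I/O of the infimum; the other `2 n + 2` I/Os are those of
`canSort_of_program`. -/
theorem exists_canSort_of_lt_top {n : ℕ} (h : sortCost P n ≠ ⊤) :
    CanSort P n ((sortCost P n).toReal + (2 * n + 3)) := by
  have hlt : sortCost P n < sortCost P n + 1 := ENNReal.lt_add_right h one_ne_zero
  unfold sortCost at hlt
  rw [iInf_lt_iff] at hlt
  obtain ⟨q, hlt⟩ := hlt
  rw [iInf_lt_iff] at hlt
  obtain ⟨hq, hlt⟩ := hlt
  refine (canSort_of_program q hq).mono ?_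
  have : (q.length : ℝ≥0∞) ≤ sortCost P n + 1 := hlt.le
  have := ENNReal.toReal_mono (ENNReal.add_ne_top.2 ⟨h, ENNReal.one_ne_top⟩) this
  rw [ENNReal.toReal_add h ENNReal.one_ne_top, ENNReal.toReal_natCast, ENNReal.toReal_one] at this
  linarith

/-- Selection sort with single blocks as chunks is quadratic. It is used for a bounded number of
blocks, and where no finite sorting cost is prescribed. -/
theorem canSort_small (hM : 2 * P.blockSize ≤ P.memSize) (n : ℕ) :
    CanSort P n (10 * n * n) := by
  rcases Nat.lt_or_ge n 2 with h | h
  · obtain rfl | rfl : n = 0 ∨ n = 1 := by omega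
    · exact canSort_zero.mono (by simp)
    · exact ((canSort_two hM).pad (n' := 1) (by norm_num)).mono (by norm_num)
  · have := (CanSort.chunked (h := 1) (canSort_two hM) (by norm_num) h)
    rw [mul_one] at this
    exact this.mono (by nlinarith [Nat.cast_nonneg (α := ℝ) n])

/-- The unit `u` of cost per block: arrays of up to `K ⌈E/B⌉` blocks are sorted at this rate, and
`u ⌈E/B⌉` is of the order of `DO-Sort(E)`. -/
theorem exists_sort_unit (K : ℕ) : ∃ C : ℝ, 0 < C ∧ ∀ (P : OEMParams) (E : ℕ),
    2 * P.blockSize ≤ P.memSize → 0 < P.wordBits → 2 ≤ E → ∃ u : ℝ, 1 ≤ u ∧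
      (∀ n ≤ K * (E ⌈/⌉ P.blockSize), CanSort P n (u * n)) ∧
      ENNReal.ofReal (u * (E ⌈/⌉ P.blockSize : ℕ)) ≤ ENNReal.ofReal C * DOSort P E := by
  set A : ℝ := 12 * (3 * K + 2) ^ 2 + 20 * K + 20 with hA
  have hA0 : 20 ≤ A := by nlinarith [sq_nonneg (3 * (K : ℝ) + 2), Nat.cast_nonneg (α := ℝ) K]
  have hKsq : (0 : ℝ) ≤ (3 * K + 2) ^ 2 := sq_nonneg _
  have hK0 : (0 : ℝ) ≤ K := Nat.cast_nonneg _
  refine ⟨A, by linarith, fun P E hM hw hE => ?_⟩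
  set n₀ := E ⌈/⌉ P.blockSize with hn₀
  have hD := half_le_doSort hw hE (P := P)
  rw [← hn₀] at hD
  by_cases htop : DOSort P E = ⊤
  -- If `DOSort` is infinite, then every rate is allowed, in particular that of the quadratic sort.
  · refine ⟨10 * K * n₀ + 1, ?_, fun n hn => (canSort_small hM n).mono ?_, ?_⟩
    · have : (0 : ℝ) ≤ 10 * K * n₀ := by positivity
      linarith
    · have : (n : ℝ) ≤ K * n₀ := by exact_mod_cast hn
      nlinarith [Nat.cast_nonneg (α := ℝ) n]
    · rw [htop, ENNReal.mul_top]
      · exact le_top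
      · simp only [ne_eq, ENNReal.ofReal_eq_zero, not_le]
        linarith
  · set d := (DOSort P E).toReal with hd
    have hn1 : 1 ≤ n₀ := by
      by_contra h
      have : n₀ ≤ 0 := by omega
      rw [hn₀, ceilDiv_le_iff_le_mul P.blockSize_pos] at this
      omega
    have hn1' : (1 : ℝ) ≤ n₀ := by exact_mod_cast hn1
    have hd2 : (n₀ : ℝ) ≤ 2 * d := by
      have := ENNReal.toReal_mono (ENNReal.mul_ne_top (by norm_num) htop) hD
      rwa [ENNReal.toReal_natCast, ENNReal.toReal_mul, ENNReal.toReal_ofNat] at this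
    -- This is the cost per block in `DOSort`. By its definition, up to `n₀` blocks are sorted at
    -- this rate, up to a constant.
    set ρ := d / n₀ with hρ
    have hρ2 : 1 / 2 ≤ ρ := by rw [hρ, le_div_iff₀ (by linarith)]; linarith
    have hsmall : ∀ m, 1 ≤ m → m ≤ n₀ → CanSort P m (11 * m * ρ) := by
      intro m hm1 hm2
      have hle := sortCost_le_doSort P (E := E) hm1 hm2
      rw [← hn₀] at hle
      have hne : (m : ℝ≥0∞) / (n₀ : ℕ) * DOSort P E ≠ ⊤ := by
        refine ENNReal.mul_ne_top (ENNReal.div_ne_top (ENNReal.natCast_ne_top _) ?_) htop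
        exact_mod_cast (by omega : n₀ ≠ 0)
      refine (exists_canSort_of_lt_top (ne_top_of_le_ne_top hne hle)).mono ?_
      have := ENNReal.toReal_mono hne hle
      rw [ENNReal.toReal_mul, ENNReal.toReal_div, ENNReal.toReal_natCast,
        ENNReal.toReal_natCast, ← hd] at this
      have e : (m : ℝ) / n₀ * d = m * ρ := by rw [hρ]; ring
      have hm1' : (1 : ℝ) ≤ m := by exact_mod_cast hm1
      nlinarith
    refine ⟨A * ρ, by nlinarith, fun n hn => ?_, ?_⟩
    · have hnK : (n : ℝ) ≤ K * n₀ := by exact_mod_cast hn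
      have hnn : (0 : ℝ) ≤ n := Nat.cast_nonneg _
      rcases Nat.eq_zero_or_pos n with rfl | hn0
      · exact canSort_zero.mono (by simp)
      rcases Nat.lt_or_ge n₀ n with hlt | hge
      · rcases Nat.lt_or_ge 1 n₀ with h2 | h2
        -- Two chunks of half the length fit into `n₀` blocks, where the rate is known. Because of
        -- `n₀ ≤ 3 * h`, the number of chunks is bounded in terms of `K`.
        · set h := n₀ / 2 with hh
          set k := n / h + 1 with hk
          have hh1 : 1 ≤ h := by omega
          have hdm := Nat.div_add_mod n h
          have hml := Nat.mod_lt n hh1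
          have hk2 : 2 ≤ k := by
            have : 1 ≤ n / h := (Nat.one_le_div_iff hh1).2 (by omega)
            omega
          have hkh : k * h = h * (n / h) + h := by rw [hk]; ring
          have hk3 : k ≤ 3 * K + 1 := by
            have : n / h ≤ 3 * K := Nat.div_le_of_le_mul <|
              calc n ≤ K * n₀ := hn
                _ ≤ K * (3 * h) := Nat.mul_le_mul_left _ (by omega)
                _ = h * (3 * K) := by ring
            omega
          have ht := hsmall (2 * h) (by omega) (by omega)
          have := (CanSort.chunked ht (by positivity) hk2).pad (n' := n) (by omega)
          refine this.mono ?_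
          have r1 : ((k * h : ℕ) : ℝ) ≤ n + h := by exact_mod_cast (by omega)
          have r2 : (k : ℝ) ≤ 3 * K + 2 := by exact_mod_cast (by omega)
          have r3 : (2 : ℝ) * h ≤ n₀ := by exact_mod_cast (by omega)
          have r4 : (n₀ : ℝ) ≤ n := by exact_mod_cast hlt.le
          have r5 : (k : ℝ) * k ≤ (3 * K + 2) ^ 2 := by
            rw [sq]; exact mul_le_mul r2 r2 (Nat.cast_nonneg _) (by positivity)
          have r6 : (11 * ((2 * h : ℕ) : ℝ) * ρ) ≤ 11 * n * ρ := by
            push_cast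
            have : (2 * h : ℝ) ≤ n := r3.trans r4
            gcongr
          have r7 : (k : ℝ) * k * (11 * ((2 * h : ℕ) : ℝ) * ρ) ≤ (3 * K + 2) ^ 2 * (11 * n * ρ) :=
            mul_le_mul r5 r6 (by positivity) hKsq
          have r8 : (n : ℝ) ≤ 2 * (n * ρ) := by nlinarith
          have r9 : 0 ≤ K * (n * ρ) := by positivity
          have r10 : 0 ≤ (3 * (K : ℝ) + 2) ^ 2 * (n * ρ) := by positivity
          calc _ ≤ (3 * (K : ℝ) + 2) ^ 2 * (11 * n * ρ) + (n₀ + 1) := by linarith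
            _ ≤ 12 * ((3 * (K : ℝ) + 2) ^ 2 * (n * ρ)) + 20 * (K * (n * ρ)) + 20 * (n * ρ) := by
              nlinarith
            _ = A * ρ * n := by rw [hA]; ring
        -- A single block cannot be halved, but then `n ≤ K`, and a quadratic cost is linear.
        · refine (canSort_small hM n).mono ?_
          have : (n₀ : ℝ) = 1 := by exact_mod_cast (by omega : n₀ = 1)
          rw [this, mul_one] at hnK
          have r8 : (n : ℝ) ≤ 2 * (n * ρ) := by nlinarith
          have r9 : 0 ≤ n * ρ := by positivity
          calc 10 * (n : ℝ) * n ≤ 10 * (2 * (n * ρ)) * K := by gcongr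
            _ ≤ (12 * (3 * (K : ℝ) + 2) ^ 2 + 20 * K + 20) * (n * ρ) := by nlinarith
            _ = A * ρ * n := by rw [hA]; ring
      · refine (hsmall n hn0 hge).mono ?_
        have r9 : 0 ≤ n * ρ := by positivity
        nlinarith
    · have e : A * ρ * n₀ = A * d := by rw [hρ]; field_simp
      rw [e, ENNReal.ofReal_mul (by linarith), hd, ENNReal.ofReal_toReal htop]

end SortUnit

/-! ### Sorting followed by a scan, on abstract records -/

section RankCode

variable {ρ ℓ σ : Type} [Finite ρ] [LinearOrder ℓ] (key : ρ → ℓ)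

/-- The position of a record in the order by `key`; missing records come last. -/
noncomputable def rankCode : Option ρ → ℕ
  | some y => {z | key z < key y}.ncard
  | none => Nat.card ρ

theorem rankCode_some_lt (y : ρ) : rankCode key (some y) < Nat.card ρ := by
  rw [← Set.ncard_univ]
  refine Set.ncard_lt_ncard ?_ (Set.toFinite _)
  rw [Set.ssubset_univ_iff, Set.ne_univ_iff_exists_notMem]
  exact ⟨y, by simp⟩

theorem rankCode_le (o : Option ρ) : rankCode key o ≤ Nat.card ρ := by
  cases o with
  | none => exact le_rfl
  | some y => exact (rankCode_some_lt key y).le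

theorem rankCode_lt_iff (y y' : ρ) :
    rankCode key (some y) < rankCode key (some y') ↔ key y < key y' := by
  have mono : ∀ y y', key y < key y' → rankCode key (some y) < rankCode key (some y') := by
    intro y y' h
    refine Set.ncard_lt_ncard ?_ (Set.toFinite _)
    have hsub : {z | key z < key y} ⊆ {z | key z < key y'} := fun z hz => lt_trans hz h
    rw [Set.ssubset_iff_of_subset hsub]
    exact ⟨y, h, by simp⟩
  refine ⟨fun h => ?_, mono y y'⟩
  by_contra hn
  rcases (not_lt.1 hn).lt_or_eq with h' | h'
  · exact absurd (mono _ _ h') (by omega)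
  · simp [rankCode, h'] at h

theorem rankCode_injective (hkey : key.Injective) : (rankCode key).Injective := by
  intro o o' h
  cases o with
  | none =>
    cases o' with
    | none => rfl
    | some y' => exact absurd h (rankCode_some_lt key y').ne'
  | some y =>
    cases o' with
    | none => exact absurd h (rankCode_some_lt key y).ne
    | some y' =>
      congr 1
      refine hkey (le_antisymm ?_ ?_)
      · rw [← not_lt, ← rankCode_lt_iff key, h]; exact lt_irrefl _
      · rw [← not_lt, ← rankCode_lt_iff key, h]; exact lt_irrefl _

open Classical in
/-- The transducer that runs through sorted records, skips repetitions, maintains a summary of the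
records that it has seen, and emits each record with the summary of the smaller ones. -/
noncomputable def summaryStep (g : σ → ρ → σ) (s : Option ρ × σ) :
    Option ρ → (Option ρ × σ) × (Option ρ × σ)
  | none => (s, (none, s.2))
  | some y => if s.1 = some y then (s, (none, s.2)) else ((some y, g s.2 y), (some y, s.2))

variable {key}

/-- In a sorted sequence repetitions can only concern the largest record seen so far. It is
therefore enough to remember that record, and every new record is larger than all the previous ones,
as the update rule `hg` demands. -/
theorem summary_invariant {Φ : Set ρ → σ} {g : σ → ρ → σ}
    (hg : ∀ A y, (∀ z ∈ A, key z < key y) → Φ (insert y A) = g (Φ A) y) (hkey : key.Injective)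
    {a : ℕ → Option ρ} {L : ℕ}
    (ha : ∀ i j, i < j → j < L → rankCode key (a i) ≤ rankCode key (a j)) (k : ℕ) (hk : k ≤ L) :
    (scanState (fun _ => summaryStep g) (none, Φ ∅) a k).2 = Φ {y | ∃ i < k, a i = some y} ∧
    (∀ y, (scanState (fun _ => summaryStep g) (none, Φ ∅) a k).1 = some y →
      (∃ i < k, a i = some y) ∧ ∀ i < k, ∀ z, a i = some z → key z ≤ key y) ∧
    ((scanState (fun _ => summaryStep g) (none, Φ ∅) a k).1 = none → ∀ i < k, a i = none) := by
  classical
  induction k with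
  | zero => simp [scanState]
  | succ k ih =>
    obtain ⟨h1, h2, h3⟩ := ih (by omega)
    simp only [scanState]
    set s := scanState (fun _ => summaryStep g) (none, Φ ∅) a k with hs
    cases hak : a k with
    | none =>
      have hset : {y | ∃ i < k + 1, a i = some y} = {y | ∃ i < k, a i = some y} := by
        ext y
        constructor
        · rintro ⟨i, hi, hy⟩
          refine ⟨i, lt_of_le_of_ne (by omega) ?_, hy⟩
          rintro rfl
          simp [hak] at hy
        · rintro ⟨i, hi, hy⟩
          exact ⟨i, by omega, hy⟩
      simp only [summaryStep]
      refine ⟨by rw [hset, h1], fun y hy => ?_, fun hn i hi => ?_⟩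
      · obtain ⟨⟨i, hi, hiy⟩, hmax⟩ := h2 y hy
        refine ⟨⟨i, by omega, hiy⟩, fun j hj z hz => hmax j (lt_of_le_of_ne (by omega) ?_) z hz⟩
        rintro rfl
        simp [hak] at hz
      · rcases Nat.lt_succ_iff_lt_or_eq.1 hi with hi | rfl
        · exact h3 hn i hi
        · exact hak
    | some y =>
      simp only [summaryStep]
      split_ifs with hsy
      · obtain ⟨⟨i₀, hi₀, hiy⟩, hmax⟩ := h2 y hsy
        have hset : {y | ∃ i < k + 1, a i = some y} = {y | ∃ i < k, a i = some y} := by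
          ext z
          constructor
          · rintro ⟨i, hi, hz⟩
            rcases Nat.lt_succ_iff_lt_or_eq.1 hi with hi | rfl
            · exact ⟨i, hi, hz⟩
            · rw [hak, Option.some_inj] at hz
              exact ⟨i₀, hi₀, hz ▸ hiy⟩
          · rintro ⟨i, hi, hz⟩
            exact ⟨i, by omega, hz⟩
        refine ⟨by rw [hset, h1], fun z hz => ?_, fun hn => by rw [hsy] at hn; cases hn⟩
        rw [hsy, Option.some_inj] at hz
        subst hz
        refine ⟨⟨i₀, by omega, hiy⟩, fun j hj z hz => ?_⟩
        rcases Nat.lt_succ_iff_lt_or_eq.1 hj with hj | rfl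
        · exact hmax j hj z hz
        · rw [hak, Option.some_inj] at hz
          rw [hz]
      · have hle : ∀ i < k, ∀ z, a i = some z → key z < key y := by
          intro i hi z hz
          have := ha i k hi (by omega)
          rw [hz, hak, ← not_lt, rankCode_lt_iff, not_lt] at this
          refine lt_of_le_of_ne this fun he => ?_
          have hzy := hkey he
          subst hzy
          cases hs1 : s.1 with
          | none => simp [h3 hs1 i hi] at hz
          | some z' =>
            obtain ⟨⟨j, hj, hjz⟩, hmax⟩ := h2 z' hs1
            have h4 := ha j k hj (by omega)
            rw [hjz, hak, ← not_lt, rankCode_lt_iff, not_lt] at h4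
            exact hsy (by rw [hs1, hkey (le_antisymm h4 (hmax i hi z hz))])
        have hset : {y | ∃ i < k + 1, a i = some y} = insert y {y | ∃ i < k, a i = some y} := by
          ext z
          simp only [Set.mem_ofPred_eq, Set.mem_insert_iff]
          constructor
          · rintro ⟨i, hi, hz⟩
            rcases Nat.lt_succ_iff_lt_or_eq.1 hi with hi | rfl
            · exact Or.inr ⟨i, hi, hz⟩
            · rw [hak, Option.some_inj] at hz
              exact Or.inl hz.symm
          · rintro (rfl | ⟨i, hi, hz⟩)
            · exact ⟨k, by omega, hak⟩
            · exact ⟨i, by omega, hz⟩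
        refine ⟨?_, fun z hz => ?_, fun hn => by cases hn⟩
        · rw [hset, hg _ _ (by rintro z ⟨i, hi, hz⟩; exact hle i hi z hz), h1]
        · rw [Option.some_inj] at hz
          subst hz
          refine ⟨⟨k, by omega, hak⟩, fun j hj z hz => ?_⟩
          rcases Nat.lt_succ_iff_lt_or_eq.1 hj with hj | rfl
          · exact (hle j hj z hz).le
          · rw [hak, Option.some_inj] at hz
            rw [hz]

/-- The records emitted by the transducer are the records at their first occurrence, each with the
summary of the smaller ones. -/
theorem summary_out {Φ : Set ρ → σ} {g : σ → ρ → σ}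
    (hg : ∀ A y, (∀ z ∈ A, key z < key y) → Φ (insert y A) = g (Φ A) y) (hkey : key.Injective)
    {a : ℕ → Option ρ} {L : ℕ}
    (ha : ∀ i j, i < j → j < L → rankCode key (a i) ≤ rankCode key (a j)) (k : ℕ) (hk : k < L) :
    ((scanOut (fun _ => summaryStep g) (none, Φ ∅) a k).1 = none ∧
      (a k = none ∨ ∃ i < k, a i = a k)) ∨
    ∃ y, a k = some y ∧ (∀ i < k, a i ≠ a k) ∧
      scanOut (fun _ => summaryStep g) (none, Φ ∅) a k =
        (some y, Φ {z | (∃ i < L, a i = some z) ∧ key z < key y}) := by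
  classical
  obtain ⟨h1, h2, h3⟩ := summary_invariant hg hkey ha k hk.le
  simp only [scanOut]
  set s := scanState (fun _ => summaryStep g) (none, Φ ∅) a k with hs
  cases hak : a k with
  | none => exact Or.inl ⟨rfl, Or.inl rfl⟩
  | some y =>
    simp only [summaryStep]
    split_ifs with hsy
    · obtain ⟨⟨i, hi, hiy⟩, -⟩ := h2 y hsy
      exact Or.inl ⟨rfl, Or.inr ⟨i, hi, hiy⟩⟩
    · have hne : ∀ i < k, a i ≠ some y := by
        intro i hi hiy
        cases hs1 : s.1 with
        | none => simp [h3 hs1 i hi] at hiy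
        | some z' =>
          obtain ⟨⟨j, hj, hjz⟩, hmax⟩ := h2 z' hs1
          have h4 := ha j k hj (by omega)
          rw [hjz, hak, ← not_lt, rankCode_lt_iff, not_lt] at h4
          exact hsy (by rw [hs1, hkey (le_antisymm h4 (hmax i hi y hiy))])
      refine Or.inr ⟨y, rfl, hne, ?_⟩
      suffices hset : {z | ∃ i < k, a i = some z} =
          {z | (∃ i < L, a i = some z) ∧ key z < key y} by rw [h1, hset]
      ext z
      simp only [Set.mem_ofPred_eq]
      constructor
      · rintro ⟨i, hi, hz⟩
        refine ⟨⟨i, by omega, hz⟩, ?_⟩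
        have h4 := ha i k hi hk
        rw [hz, hak, ← not_lt, rankCode_lt_iff, not_lt] at h4
        refine lt_of_le_of_ne h4 fun he => hne i hi ?_
        rw [hz, hkey he]
      · rintro ⟨⟨i, hi, hz⟩, hlt⟩
        refine ⟨i, ?_, hz⟩
        by_contra hik
        rcases (not_lt.1 hik).lt_or_eq with h | rfl
        · have h4 := ha k i h hi
          rw [hz, hak, ← not_lt, rankCode_lt_iff] at h4
          exact h4 hlt
        · rw [hak, Option.some_inj] at hz
          rw [hz] at hlt
          exact lt_irrefl _ hlt

end RankCode

/-- Transducers with encoded states, inputs and outputs. -/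
theorem scanState_encode {σ ω τ W : Type} {f : ℕ → σ → ω → σ × τ} {f' : ℕ → W → W → W × W}
    {enc : σ → W} {dec : ℕ → W → ω} (init : σ)
    (hf : ∀ i s w, (f' i (enc s) w).1 = enc (f i s (dec i w)).1) (v : ℕ → W) (k : ℕ) :
    scanState f' (enc init) v k = enc (scanState f init (fun i => dec i (v i)) k) := by
  induction k with
  | zero => rfl
  | succ k ih => simp only [scanState, ih, hf]

/-! ### Relations as encoded tables -/

section Relational

variable {P : OEMParams} {X : Type}

/-- Tables of up to `N` blocks are sorted at the rate of `u` I/Os per block. -/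
structure SortEnv (P : OEMParams) (u : ℝ) (N : ℕ) : Prop where
  one_le : 1 ≤ u
  sort : ∀ n ≤ N, CanSort P n (u * n)
  mem : 2 * P.blockSize ≤ P.memSize

theorem SortEnv.lt_mem {u : ℝ} {N : ℕ} (h : SortEnv P u N) : P.blockSize < P.memSize := by
  have := h.mem
  have := P.blockSize_pos
  omega

theorem card_word (P : OEMParams) : Nat.card P.Word = 2 ^ P.wordBits := by
  rw [Nat.card_congr (BitVec.equivFin (m := P.wordBits)).toEquiv, Nat.card_fin]

/-- Records are encoded by words as long as there are not too many of them. -/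
theorem exists_wordCode {τ : Type} [Finite τ] [Nonempty τ] (h : Nat.card τ ≤ 2 ^ P.wordBits) :
    ∃ (enc : τ → P.Word) (dec : P.Word → τ), ∀ t, dec (enc t) = t := by
  have : Finite P.Word := Finite.of_equiv _ (BitVec.equivFin (m := P.wordBits)).symm.toEquiv
  have hfin := Fintype.ofFinite τ
  have hfin' := Fintype.ofFinite P.Word
  rw [← card_word P, Nat.card_eq_fintype_card, Nat.card_eq_fintype_card] at h
  obtain ⟨e⟩ := Function.Embedding.nonempty_of_card_le h
  exact ⟨e, Function.invFun e, Function.leftInverse_invFun e.injective⟩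

theorem list_eq_map_getD {α : Type} (l : List α) (d : α) {L : ℕ} (h : l.length = L) :
    l = (List.range L).map fun i => l.getD i d := by
  subst h
  refine List.ext_getElem (by simp) fun i h1 h2 => ?_
  simp [List.getElem?_eq_getElem h1]

variable {ld : X → P.Server} {R : ℕ} {Γ : Set (RawTable P X)} {T u : ℝ} {N : ℕ}

/-- Sorting the records of a table. -/
theorem RawReach.rankSort {ρ ℓ : Type} [Finite ρ] [LinearOrder ℓ] (hE : SortEnv P u N)
    (hR : RawReach ld R Γ T) {r : RawTable P X} (hr : r ∈ Γ) (hN : r.n ≤ N)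
    (dec : ℕ → P.Word → Option ρ) {key : ρ → ℓ} (hkey : key.Injective)
    (hcard : Nat.card ρ + 1 ≤ 2 ^ P.wordBits) :
    ∃ (r' : RawTable P X) (dec' : P.Word → Option ρ), r'.n = r.n ∧
      RawReach ld R (insert r' Γ) (T + (2 * r.n + 1 + u * r.n)) ∧
      ∀ x, (∀ i j, i < j → j < r.n * P.blockSize →
          rankCode key (dec' ((r'.val x).getD i 0)) ≤ rankCode key (dec' ((r'.val x).getD j 0))) ∧
        ((List.range (r.n * P.blockSize)).map fun k => dec' ((r'.val x).getD k 0)).Perm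
          ((List.range (r.n * P.blockSize)).map fun k => dec k ((r.val x).getD k 0)) := by
  -- The code of a record is its rank, so that sorting words by their numbers sorts records by their
  -- keys.
  set enc : Option ρ → P.Word := fun o => BitVec.ofNat _ (rankCode key o) with henc
  have hnat : ∀ o, (enc o).toNat = rankCode key o := fun o => by
    rw [henc, BitVec.toNat_ofNat, Nat.mod_eq_of_lt]
    have := rankCode_le key o
    omega
  have hinj : enc.Injective := fun o o' h => rankCode_injective key hkey (by
    rw [← hnat, ← hnat, h])
  set dec' : P.Word → Option ρ := Function.invFun enc with hdec'
  have hde : ∀ o, dec' (enc o) = o := Function.leftInverse_invFun hinj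
  have h1 := hR.scan hr hE.lt_mem (fun k s w => (s, enc (dec k w))) 0 r.n
  set r₁ := scanTable (fun k (s : P.Word) w => (s, enc (dec k w))) 0 r.n r with hr₁
  have h2 := hE.sort r.n hN X ld R _ _ r₁ (Set.mem_insert _ _) rfl h1
  have hl₁ : ∀ x, r₁.val x = (List.range (r.n * P.blockSize)).map fun k =>
      enc (dec k ((r.val x).getD k 0)) := by
    intro x
    rw [list_eq_map_getD (r₁.val x) 0 (r₁.length_val x)]
    refine List.map_congr_left fun k hk => ?_
    have hk : k < r.n * P.blockSize := List.mem_range.1 hk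
    rw [hr₁, scanTable_getD _ _ _ _ _ hk]
    rfl
  refine ⟨sortTable r₁, dec', rfl, h2.mono (Set.insert_subset_insert (Set.subset_insert _ _))
    (by linarith), fun x => ?_⟩
  have hlen : ((sortTable r₁).val x).length = r.n * P.blockSize := (sortTable r₁).length_val x
  have hperm : ((sortTable r₁).val x).Perm (r₁.val x) := List.mergeSort_perm _ _
  constructor
  · intro i j hij hj
    have hs := pairwise_sort (r₁.val x)
    rw [List.pairwise_iff_getElem] at hs
    have := hs i j (by rw [← hlen] at hj; exact hij.trans hj) (by rw [← hlen] at hj; exact hj) hij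
    have hw : ∀ k, k < r.n * P.blockSize →
        ∃ o, ((sortTable r₁).val x).getD k 0 = enc o := by
      intro k hk
      rw [← hlen] at hk
      rw [List.getD_eq_getElem _ _ hk]
      have hm := hperm.mem_iff.1 (List.getElem_mem hk)
      rw [hl₁, List.mem_map] at hm
      obtain ⟨a, -, ha⟩ := hm
      exact ⟨_, ha.symm⟩
    have e : ∀ k (hk : k < ((sortTable r₁).val x).length),
        ((sortTable r₁).val x).getD k 0 = ((sortTable r₁).val x)[k] := fun k hk =>
      List.getD_eq_getElem _ _ hk
    obtain ⟨o, ho⟩ := hw i (hij.trans hj)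
    obtain ⟨o', ho'⟩ := hw j hj
    rw [ho, ho', hde, hde, ← hnat, ← hnat, ← ho, ← ho', e i (by omega), e j (by omega)]
    exact this
  · have h3 := hperm.map dec'
    rw [hl₁, List.map_map, list_eq_map_getD ((sortTable r₁).val x) 0 hlen, List.map_map] at h3
    refine h3.trans (List.Perm.of_eq (List.map_congr_left fun k _ => ?_))
    exact hde _

/-- The raw table `r` holds the relation `S`. -/
def RawTable.Represents {ρ : Type} (r : RawTable P X) (S : X → Set ρ) : Prop :=
  ∃ dec : ℕ → P.Word → Option ρ, ∀ x y, y ∈ S x ↔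
    ∃ k < r.n * P.blockSize, dec k ((r.val x).getD k 0) = some y

/-- Sorting and scanning a table while maintaining a summary. -/
theorem RawReach.summary {ρ ℓ σ : Type} [Finite ρ] [Finite σ] [LinearOrder ℓ]
    (hE : SortEnv P u N) (hR : RawReach ld R Γ T) {r : RawTable P X} (hr : r ∈ Γ) (hN : r.n ≤ N)
    {S : X → Set ρ} (hS : r.Represents S) {key : ρ → ℓ} (hkey : key.Injective)
    {Φ : Set ρ → σ} {g : σ → ρ → σ}
    (hg : ∀ A y, (∀ z ∈ A, key z < key y) → Φ (insert y A) = g (Φ A) y)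
    (hcard : (Nat.card ρ + 1) * Nat.card σ ≤ 2 ^ P.wordBits) :
    ∃ (r' : RawTable P X) (dec' : P.Word → Option ρ × σ), r'.n = r.n ∧
      RawReach ld R (insert r' Γ) (T + (4 * r.n + 2 + u * r.n)) ∧
      ∀ x, (∀ i < r.n * P.blockSize, ∀ y s, dec' ((r'.val x).getD i 0) = (some y, s) →
          y ∈ S x ∧ s = Φ {z | z ∈ S x ∧ key z < key y}) ∧
        (∀ y ∈ S x, ∃ i < r.n * P.blockSize, (dec' ((r'.val x).getD i 0)).1 = some y) ∧
        ∀ i < r.n * P.blockSize, ∀ j < r.n * P.blockSize, ∀ y,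
          (dec' ((r'.val x).getD i 0)).1 = some y → (dec' ((r'.val x).getD j 0)).1 = some y →
          i = j := by
  obtain ⟨dec, hdec⟩ := hS
  have hne : Nonempty (Option ρ × σ) := ⟨(none, Φ ∅)⟩
  have hσ : 1 ≤ Nat.card σ := Nat.card_pos_iff.2 ⟨⟨Φ ∅⟩, inferInstance⟩
  have hcard' : Nat.card (Option ρ × σ) ≤ 2 ^ P.wordBits := by
    rw [Nat.card_prod, Finite.card_option]
    exact hcard
  obtain ⟨enc, δ, hδ⟩ := exists_wordCode hcard'
  obtain ⟨r₁, dec₁, hn₁, hR₁, h₁⟩ := hR.rankSort hE hr hN dec hkey (by nlinarith)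
  have h2 := hR₁.scan (Set.mem_insert _ _) hE.lt_mem
    (fun _ s w => (enc (summaryStep g (δ s) (dec₁ w)).1, enc (summaryStep g (δ s) (dec₁ w)).2))
    (enc (none, Φ ∅)) r.n
  set r₂ := scanTable (fun (_ : ℕ) s w =>
    (enc (summaryStep g (δ s) (dec₁ w)).1, enc (summaryStep g (δ s) (dec₁ w)).2))
    (enc (none, Φ ∅)) r.n r₁ with hr₂
  refine ⟨r₂, δ, rfl, h2.mono (Set.insert_subset_insert (Set.subset_insert _ _)) (by linarith),
    fun x => ?_⟩
  obtain ⟨hmono, hperm⟩ := h₁ x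
  set a : ℕ → Option ρ := fun k => dec₁ ((r₁.val x).getD k 0) with ha
  set L := r.n * P.blockSize with hL
  have hSa : ∀ y, y ∈ S x ↔ ∃ k < L, a k = some y := by
    intro y
    rw [hdec]
    have := hperm.mem_iff (a := some y)
    simp only [List.mem_map, List.mem_range] at this
    exact this.symm
  -- On the level of decoded words, the scan is the abstract transducer `summaryStep`.
  have hout : ∀ i < L, δ ((r₂.val x).getD i 0) =
      scanOut (fun _ => summaryStep g) (none, Φ ∅) a i := by
    intro i hi
    rw [hr₂, scanTable_getD _ _ _ _ _ hi]
    simp only [scanOut]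
    rw [scanState_encode (f := fun _ => summaryStep g) (dec := fun _ => dec₁) (enc := enc)
      (none, Φ ∅) (fun i s w => by simp only [hδ])]
    simp only [hδ]
    rfl
  have hset : ∀ y, {z | (∃ i < L, a i = some z) ∧ key z < key y} =
      {z | z ∈ S x ∧ key z < key y} := fun y => by
    ext z
    simp only [Set.mem_ofPred_eq, hSa]
  have hsum := fun i hi => summary_out hg hkey hmono i hi
  refine ⟨fun i hi y s h => ?_, fun y hy => ?_, fun i hi j hj y hyi hyj => ?_⟩
  · rw [hout i hi] at h
    rcases hsum i hi with ⟨h0, -⟩ | ⟨y', hy', -, h0⟩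
    · rw [h] at h0
      cases h0
    · rw [h0, hset] at h
      simp only [Prod.mk.injEq, Option.some_inj] at h
      obtain ⟨rfl, rfl⟩ := h
      exact ⟨(hSa _).2 ⟨i, hi, hy'⟩, rfl⟩
  · classical
    have hex : ∃ k, k < L ∧ a k = some y := (hSa y).1 hy
    obtain ⟨hk, hky⟩ := Nat.find_spec hex
    refine ⟨Nat.find hex, hk, ?_⟩
    rw [hout _ hk]
    rcases hsum _ hk with ⟨-, h0 | ⟨i, hi, h0⟩⟩ | ⟨y', hy', -, h0⟩
    · exact absurd (hky.symm.trans h0) (by simp)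
    · exact absurd ⟨hi.trans hk, h0.trans hky⟩ (Nat.find_min hex hi)
    · rw [h0, ← Option.some_inj.1 (hky.symm.trans hy')]
  · rw [hout _ hi] at hyi
    rw [hout _ hj] at hyj
    have key : ∀ i < L, (scanOut (fun _ => summaryStep g) (none, Φ ∅) a i).1 = some y →
        a i = some y ∧ ∀ k < i, a k ≠ a i := by
      intro i hi hyi
      rcases hsum i hi with ⟨h0, -⟩ | ⟨y', hy', hn, h0⟩
      · rw [h0] at hyi
        cases hyi
      · rw [h0] at hyi
        simp only [Option.some_inj] at hyi
        exact ⟨hyi ▸ hy', hn⟩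
    obtain ⟨hai, hni⟩ := key i hi hyi
    obtain ⟨haj, hnj⟩ := key j hj hyj
    rcases lt_trichotomy i j with h | h | h
    · exact absurd (hai.trans haj.symm) (hnj i h)
    · exact h
    · exact absurd (haj.trans hai.symm) (hni j h)

/-- Bringing the distinct records of a table into sorted order, without gaps. -/
theorem RawReach.canonical {ρ ℓ : Type} [Finite ρ] [LinearOrder ℓ]
    (hE : SortEnv P u N) (hR : RawReach ld R Γ T) {r : RawTable P X} (hr : r ∈ Γ) (hN : r.n ≤ N)
    {S : X → Set ρ} (hS : r.Represents S) {key : ρ → ℓ} (hkey : key.Injective)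
    (hcard : Nat.card ρ + 1 ≤ 2 ^ P.wordBits) :
    ∃ (r' : RawTable P X) (dec' : P.Word → Option ρ), r'.n = r.n ∧
      RawReach ld R (insert r' Γ) (T + (6 * r.n + 3 + 2 * u * r.n)) ∧
      ∀ x, (∀ i < r.n * P.blockSize, ∀ j < i, ∀ y, dec' ((r'.val x).getD i 0) = some y →
          ∃ z, dec' ((r'.val x).getD j 0) = some z ∧ key z < key y) ∧
        ∀ y, y ∈ S x ↔ ∃ i < r.n * P.blockSize, dec' ((r'.val x).getD i 0) = some y := by
  obtain ⟨r₁, dec₁, hn₁, hR₁, h₁⟩ := hR.summary hE hr hN hS hkey (Φ := fun _ => ())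
    (g := fun _ _ => ()) (fun _ _ _ => rfl) (by simpa using hcard)
  -- The first sort, with a trivial summary, has turned repetitions into missing records. The second
  -- one moves these to the end.
  obtain ⟨r₂, dec₂, hn₂, hR₂, h₂⟩ := hR₁.rankSort hE (Set.mem_insert _ _) (by omega)
    (fun _ w => (dec₁ w).1) hkey hcard
  rw [hn₁] at hn₂ hR₂ h₂
  refine ⟨r₂, dec₂, hn₂, hR₂.mono (Set.insert_subset_insert (Set.subset_insert _ _))
    (by linarith), fun x => ?_⟩
  obtain ⟨hmono, hperm⟩ := h₂ x
  obtain ⟨s1, s2, s3⟩ := h₁ x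
  have hdis : ((List.range (r.n * P.blockSize)).map fun k => dec₂ ((r₂.val x).getD k 0)).Pairwise
      fun o o' => ∀ y, o = some y → o' ≠ some y := by
    rw [hperm.pairwise_iff fun h y ho' ho => h y ho ho']
    rw [List.pairwise_map, List.pairwise_iff_getElem]
    intro i j hi hj hij y hyi hyj
    simp only [List.length_range] at hi hj
    simp only [List.getElem_range] at hyi hyj
    exact hij.ne (s3 i hi j hj y hyi hyj)
  rw [List.pairwise_map, List.pairwise_iff_getElem] at hdis
  constructor
  · intro i hi j hj y hy
    have hm := hmono j i hj hi
    have hd := hdis j i (by simpa using hj.trans hi) (by simpa using hi) hj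
    simp only [List.getElem_range] at hd
    rw [hy] at hm hd
    cases hz : dec₂ ((r₂.val x).getD j 0) with
    | none =>
      rw [hz] at hm
      exact absurd (rankCode_some_lt key y) (not_lt.2 hm)
    | some z =>
      rw [hz] at hm
      refine ⟨z, rfl, ?_⟩
      rw [← not_lt, rankCode_lt_iff, not_lt] at hm
      refine lt_of_le_of_ne hm fun he => ?_
      exact hd y (by rw [hz, hkey he]) rfl
  · intro y
    have := hperm.mem_iff (a := some y)
    simp only [List.mem_map, List.mem_range] at this
    rw [this]
    constructor
    · exact s2 y
    · rintro ⟨i, hi, hy⟩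
      exact (s1 i hi y _ (Prod.ext hy rfl)).1

end Relational

/-! ### Relations on the server -/

section Tables

/-- A relation that depends on the input, stored in at most `n` blocks. -/
structure Tbl (X : Type) where
  ρ : Type
  n : ℕ
  S : X → Set ρ

/-- `ρ` has at most `Q ^ d` elements. -/
class SmallType (Q : ℕ) (ρ : Type) (d : outParam ℕ) : Prop where
  finite : Finite ρ
  card_le : Nat.card ρ ≤ Q ^ d

/-- The exponents are computed by instance search, so that `decide` can check that the records
occurring in an operation fit into a word. -/
instance {Q : ℕ} {α β : Type} {a b : ℕ} [ha : SmallType Q α a] [hb : SmallType Q β b] :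
    SmallType Q (α × β) (a + b) where
  finite := by
    have := ha.finite
    have := hb.finite
    infer_instance
  card_le := by
    rw [Nat.card_prod, pow_add]
    exact Nat.mul_le_mul ha.card_le hb.card_le

instance {Q : ℕ} {α : Type} {a : ℕ} [ha : SmallType Q α a] : SmallType Q (Lex α) a := ha

instance {Q : ℕ} {α : Type} {a : ℕ} [hQ : Fact (2 ≤ Q)] [ha : SmallType Q α a] :
    SmallType Q (Option α) (a + 1) where
  finite := by
    have := ha.finite
    infer_instance
  card_le := by
    have := ha.finite
    rw [Finite.card_option, pow_succ]
    have h1 := ha.card_le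
    have h2 : 1 ≤ Q ^ a := Nat.one_le_pow _ _ (by have := hQ.out; omega)
    have := Nat.mul_le_mul_left (Q ^ a) hQ.out
    omega

instance {Q : ℕ} {α β : Type} {a b : ℕ} [hQ : Fact (2 ≤ Q)] [ha : SmallType Q α a]
    [hb : SmallType Q β b] : SmallType Q (α ⊕ β) (a + b + 1) where
  finite := by
    have := ha.finite
    have := hb.finite
    infer_instance
  card_le := by
    have := ha.finite
    have := hb.finite
    rw [Nat.card_sum, pow_succ, pow_add]
    have h1 := ha.card_le
    have h2 := hb.card_le
    have h3 : 1 ≤ Q ^ a := Nat.one_le_pow _ _ (by have := hQ.out; omega)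
    have h4 : 1 ≤ Q ^ b := Nat.one_le_pow _ _ (by have := hQ.out; omega)
    have h5 := Nat.mul_le_mul_left (Q ^ a * Q ^ b) hQ.out
    have h6 := Nat.mul_le_mul_left (Q ^ a) h4
    have h7 := Nat.mul_le_mul_right (Q ^ b) h3
    omega

instance {Q : ℕ} [hQ : Fact (2 ≤ Q)] : SmallType Q Bool 1 where
  finite := inferInstance
  card_le := by simpa using hQ.out

instance {Q : ℕ} : SmallType Q Unit 0 where
  finite := inferInstance
  card_le := by simp

theorem SmallType.of_card {Q : ℕ} {α : Type} [hf : Finite α] {d : ℕ} (h : Nat.card α ≤ Q ^ d) :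
    SmallType Q α d := ⟨hf, h⟩

variable {P : OEMParams} {X : Type}

/-- The parameters of the algorithms: sorting at the rate of `u` I/Os per block up to `N` blocks,
and words that hold 80 numbers below `Q`. -/
structure AlgEnv (P : OEMParams) (u : ℝ) (N Q : ℕ) : Prop extends SortEnv P u N where
  two_le : 2 ≤ Q
  pow_le : Q ^ 80 ≤ 2 ^ P.wordBits

/-- Some program with at most `T` I/Os obliviously brings all relations in `𝓢` on the server. -/
def Reach (ld : X → P.Server) (R : ℕ) (𝓢 : Set (Tbl X)) (T : ℝ) : Prop :=
  ∃ Γ, RawReach ld R Γ T ∧ ∀ t ∈ 𝓢, ∃ r ∈ Γ, r.n ≤ t.n ∧ r.Represents t.S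

variable {ld : X → P.Server} {R : ℕ} {𝓢 𝓢' : Set (Tbl X)} {T T' u : ℝ} {N Q : ℕ}

theorem AlgEnv.card_le (hE : AlgEnv P u N Q) {m d : ℕ} (hm : m ≤ Q ^ d) (hd : d ≤ 80) :
    m ≤ 2 ^ P.wordBits :=
  hm.trans ((Nat.pow_le_pow_right (by have := hE.two_le; omega) hd).trans hE.pow_le)

theorem AlgEnv.add_one_le (hE : AlgEnv P u N Q) {m d : ℕ} (hm : m ≤ Q ^ d) :
    m + 1 ≤ Q ^ (d + 1) := by
  have h2 : 1 ≤ Q ^ d := Nat.one_le_pow _ _ (by have := hE.two_le; omega)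
  have := Nat.mul_le_mul_left (Q ^ d) hE.two_le
  rw [pow_succ]
  omega

theorem Reach.mono (h : Reach ld R 𝓢 T) (hS : 𝓢' ⊆ 𝓢) (hT : T ≤ T') : Reach ld R 𝓢' T' := by
  obtain ⟨Γ, hΓ, h⟩ := h
  exact ⟨Γ, hΓ.mono subset_rfl hT, fun t ht => h t (hS ht)⟩

theorem Reach.insert_of (h : Reach ld R 𝓢 T) {t : Tbl X}
    (ht : ∀ Γ, RawReach ld R Γ T → (∀ t ∈ 𝓢, ∃ r ∈ Γ, r.n ≤ t.n ∧ r.Represents t.S) →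
      ∃ r, r.n ≤ t.n ∧ r.Represents t.S ∧ RawReach ld R (insert r Γ) T') :
    Reach ld R (insert t 𝓢) T' := by
  obtain ⟨Γ, hΓ, h⟩ := h
  obtain ⟨r, hn, hr, hR⟩ := ht Γ hΓ h
  refine ⟨_, hR, fun s hs => ?_⟩
  rcases hs with rfl | hs
  · exact ⟨r, Set.mem_insert _ _, hn, hr⟩
  · obtain ⟨r', h1, h2⟩ := h s hs
    exact ⟨r', Set.mem_insert_of_mem _ h1, h2⟩

/-- This takes no I/Os, since only the decoding of the words changes. -/
theorem Reach.filterMap (h : Reach ld R 𝓢 T) {ρ ρ' : Type} {n : ℕ} {S : X → Set ρ}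
    (hS : ⟨ρ, n, S⟩ ∈ 𝓢) (f : ρ → Option ρ') :
    Reach ld R (insert ⟨ρ', n, fun x => {z | ∃ y ∈ S x, f y = some z}⟩ 𝓢) T := by
  refine h.insert_of fun Γ hΓ hs => ?_
  obtain ⟨r, hr, hn, dec, hdec⟩ := hs _ hS
  refine ⟨r, hn, ⟨fun k w => (dec k w).bind f, fun x z => ?_⟩, by rwa [Set.insert_eq_of_mem hr]⟩
  simp only [Set.mem_ofPred_eq, Option.bind_eq_some_iff]
  constructor
  · rintro ⟨y, hy, hz⟩
    obtain ⟨k, hk, hky⟩ := (hdec x y).1 hy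
    exact ⟨k, hk, y, hky, hz⟩
  · rintro ⟨k, hk, y, hky, hz⟩
    exact ⟨y, (hdec x y).2 ⟨k, hk, hky⟩, hz⟩

/-- This takes no I/Os either: the two tables are regarded as one, whose decoding depends on the
position. -/
theorem Reach.union (h : Reach ld R 𝓢 T) {ρ : Type} {n n' : ℕ} {S S' : X → Set ρ}
    (hS : ⟨ρ, n, S⟩ ∈ 𝓢) (hS' : ⟨ρ, n', S'⟩ ∈ 𝓢) :
    Reach ld R (insert ⟨ρ, n + n', fun x => S x ∪ S' x⟩ 𝓢) T := by
  refine h.insert_of fun Γ hΓ hs => ?_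
  obtain ⟨r, hr, hn, dec, hdec⟩ := hs _ hS
  obtain ⟨r', hr', hn', dec', hdec'⟩ := hs _ hS'
  refine ⟨r.append r', Nat.add_le_add hn hn', ⟨fun k w => if k < r.n * P.blockSize then dec k w
    else dec' (k - r.n * P.blockSize) w, fun x z => ?_⟩, hΓ.append hr hr'⟩
  have hl := r.length_val x
  simp only [Set.mem_union, hdec, hdec', RawTable.append]
  dsimp only at hdec hdec'
  constructor
  · rintro (⟨k, hk, hz⟩ | ⟨k, hk, hz⟩)
    · refine ⟨k, by rw [Nat.add_mul]; omega, ?_⟩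
      rw [if_pos hk, List.getD_append _ _ _ _ (by omega), hz]
    · refine ⟨r.n * P.blockSize + k, by rw [Nat.add_mul]; omega, ?_⟩
      rw [if_neg (by omega), List.getD_append_right _ _ _ _ (by omega), hl,
        Nat.add_sub_cancel_left, hz]
  · rintro ⟨k, hk, hz⟩
    split_ifs at hz with hkr
    · rw [List.getD_append _ _ _ _ (by omega)] at hz
      exact Or.inl ⟨k, hkr, hz⟩
    · rw [List.getD_append_right _ _ _ _ (by omega), hl] at hz
      exact Or.inr ⟨_, by rw [Nat.add_mul] at hk; omega, hz⟩

/-- Two relations of different types, made into one. -/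
theorem Reach.unionMap (h : Reach ld R 𝓢 T) {ρ ρ' τ : Type} {n n' : ℕ} {S : X → Set ρ}
    {S' : X → Set ρ'} (hS : ⟨ρ, n, S⟩ ∈ 𝓢) (hS' : ⟨ρ', n', S'⟩ ∈ 𝓢) (f : ρ → Option τ)
    (f' : ρ' → Option τ) :
    Reach ld R (insert ⟨τ, n + n', fun x => {z | ∃ y ∈ S x, f y = some z} ∪
      {z | ∃ y ∈ S' x, f' y = some z}⟩ 𝓢) T := by
  have h1 := h.filterMap hS f
  have h2 := h1.filterMap (Set.mem_insert_of_mem _ hS') f'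
  have h3 := h2.union (Set.mem_insert_of_mem _ (Set.mem_insert _ _)) (Set.mem_insert _ _)
  exact h3.mono (Set.insert_subset_insert fun t ht => by simp [ht]) le_rfl

theorem RawTable.represents_empty {ρ : Type} (S : X → Set ρ) (hS : ∀ x y, y ∉ S x) :
    (RawTable.empty : RawTable P X).Represents S :=
  ⟨fun _ _ => none, fun x y => by simp [hS x y, RawTable.empty]⟩

theorem Reach.sortScan (h : Reach ld R 𝓢 T) (hE : SortEnv P u N) {ρ ρ' ℓ σ : Type} [Finite ρ]
    [Finite σ] [LinearOrder ℓ] {n : ℕ} {S : X → Set ρ} (hS : ⟨ρ, n, S⟩ ∈ 𝓢) (hn : n ≤ N)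
    {key : ρ → ℓ} (hkey : key.Injective) {Φ : Set ρ → σ} (g : σ → ρ → σ)
    (hg : ∀ A y, (∀ z ∈ A, key z < key y) → Φ (insert y A) = g (Φ A) y)
    (hcard : (Nat.card ρ + 1) * Nat.card σ ≤ 2 ^ P.wordBits) (out : ρ → σ → Option ρ') :
    Reach ld R (insert ⟨ρ', n, fun x => {z | ∃ y ∈ S x,
      out y (Φ {y' | y' ∈ S x ∧ key y' < key y}) = some z}⟩ 𝓢) (T + 7 * u * n) := by
  have hu := hE.one_le
  refine h.insert_of fun Γ hΓ hs => ?_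
  obtain ⟨r, hr, hrn, hrep⟩ := hs _ hS
  dsimp only at hrn hrep
  -- The cost bound has no additive term. A table without blocks must not be processed at all.
  rcases Nat.eq_zero_or_pos r.n with h0 | h0
  · refine ⟨RawTable.empty, Nat.zero_le _, RawTable.represents_empty _ ?_,
      hΓ.empty.mono subset_rfl ?_⟩
    · rintro x y ⟨z, hz, -⟩
      obtain ⟨dec, hdec⟩ := hrep
      obtain ⟨k, hk, -⟩ := (hdec x z).1 hz
      rw [h0] at hk
      omega
    · have : (0 : ℝ) ≤ n := Nat.cast_nonneg _
      nlinarith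
  · obtain ⟨r', dec', hn', hR', hx⟩ := hΓ.summary hE hr (hrn.trans hn) hrep hkey hg hcard
    refine ⟨r', hn'.le.trans hrn, ⟨fun _ w => (dec' w).1.bind fun y => out y (dec' w).2, fun x z => ?_⟩,
      hR'.mono subset_rfl ?_⟩
    · obtain ⟨h1, h2, -⟩ := hx x
      rw [hn']
      simp only [Set.mem_ofPred_eq, Option.bind_eq_some_iff]
      constructor
      · rintro ⟨y, hy, hz⟩
        obtain ⟨i, hi, hiy⟩ := h2 y hy
        refine ⟨i, hi, y, hiy, ?_⟩
        obtain ⟨-, hs⟩ := h1 i hi y _ (Prod.ext hiy rfl)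
        exact (congrArg (fun t => out y t) hs).trans hz
      · rintro ⟨i, hi, y, hiy, hz⟩
        obtain ⟨hy, hs⟩ := h1 i hi y _ (Prod.ext hiy rfl)
        exact ⟨y, hy, (congrArg (fun t => out y t) hs).symm.trans hz⟩
    · have h1 : (1 : ℝ) ≤ r.n := by exact_mod_cast h0
      have h2 : (r.n : ℝ) ≤ n := by exact_mod_cast hrn
      nlinarith

/-- A relation with few elements needs few blocks. -/
theorem Reach.shrink (h : Reach ld R 𝓢 T) (hE : AlgEnv P u N Q) {ρ : Type} {d : ℕ}
    [hρ : SmallType Q ρ d] {n : ℕ} {S : X → Set ρ} (hS : ⟨ρ, n, S⟩ ∈ 𝓢) (hn : n ≤ N) (m : ℕ)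
    (hm : ∀ x, (S x).ncard ≤ m) (hd : d + 1 ≤ 80 := by decide) :
    Reach ld R (insert ⟨ρ, m ⌈/⌉ P.blockSize, S⟩ 𝓢) (T + 11 * u * n) := by
  have hu := hE.one_le
  have hfin := hρ.finite
  refine h.insert_of fun Γ hΓ hs => ?_
  obtain ⟨r, hr, hrn, hrep⟩ := hs _ hS
  dsimp only at hrn hrep
  rcases Nat.eq_zero_or_pos r.n with h0 | h0
  · refine ⟨r, by omega, hrep, ?_⟩
    rw [Set.insert_eq_of_mem hr]
    refine hΓ.mono subset_rfl ?_
    have : (0 : ℝ) ≤ n := Nat.cast_nonneg _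
    nlinarith
  · obtain ⟨_, ⟨e⟩⟩ := Finite.exists_equiv_fin ρ
    obtain ⟨r₁, dec, hn₁, hR₁, hx⟩ := hΓ.canonical hE.toSortEnv hr (hrn.trans hn) hrep e.injective
      (hE.card_le (hE.add_one_le hρ.card_le) hd)
    have h2 := hR₁.take (Set.mem_insert _ _) (m ⌈/⌉ P.blockSize)
    refine ⟨r₁.take (m ⌈/⌉ P.blockSize), min_le_left _ _, ⟨fun _ => dec, fun x y => ?_⟩,
      h2.mono (Set.insert_subset_insert (Set.subset_insert _ _)) ?_⟩
    · obtain ⟨h3, h4⟩ := hx x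
      rw [h4]
      have hget : ∀ i < (m ⌈/⌉ P.blockSize) * P.blockSize,
          ((r₁.take (m ⌈/⌉ P.blockSize)).val x).getD i 0 = (r₁.val x).getD i 0 := by
        intro i hi
        simp [RawTable.take, List.getD, hi]
      simp only [RawTable.take] at hget ⊢
      rw [hn₁]
      constructor
      · rintro ⟨i, hi, hiy⟩
        -- A record in cell `i` is preceded, without gaps, by `i` different records of the relation,
        -- so that `i + 1 ≤ m`.
        have hlt : i < (m ⌈/⌉ P.blockSize) * P.blockSize := by
          have hmm : m ≤ m ⌈/⌉ P.blockSize * P.blockSize := by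
            rw [Nat.mul_comm]; exact (ceilDiv_le_iff_le_mul P.blockSize_pos).1 le_rfl
          refine lt_of_lt_of_le ?_ ((hm x).trans hmm)
          have hall : ∀ j : Fin (i + 1), ∃ z, dec ((r₁.val x).getD j 0) = some z := by
            intro j
            rcases Nat.lt_succ_iff_lt_or_eq.1 j.2 with hj | hj
            · obtain ⟨z, hz, -⟩ := h3 i hi j hj y hiy
              exact ⟨z, hz⟩
            · exact ⟨y, by rw [hj]; exact hiy⟩
          choose f hf using hall
          have hinj : Function.Injective f := by
            intro a b hab
            by_contra hne
            rcases lt_or_gt_of_ne hne with hlt | hlt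
            · obtain ⟨z, hz, hzlt⟩ := h3 b (by omega) a hlt _ (hf b)
              rw [hf a, Option.some_inj] at hz
              rw [← hz, hab] at hzlt
              exact lt_irrefl _ hzlt
            · obtain ⟨z, hz, hzlt⟩ := h3 a (by omega) b hlt _ (hf a)
              rw [hf b, Option.some_inj] at hz
              rw [← hz, hab] at hzlt
              exact lt_irrefl _ hzlt
          have hsub : Set.range f ⊆ S x := by
            rintro _ ⟨j, rfl⟩
            exact (h4 _).2 ⟨j, by omega, hf j⟩
          have := Set.ncard_le_ncard hsub (Set.toFinite _)
          rw [← Set.image_univ, Set.ncard_image_of_injective _ hinj, Set.ncard_univ,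
            Nat.card_fin] at this
          omega
        refine ⟨i, ?_, by rw [hget i hlt]; exact hiy⟩
        rw [← Nat.mul_min_mul_right]
        exact lt_min hlt hi
      · rintro ⟨i, hi, hiy⟩
        rw [← Nat.mul_min_mul_right] at hi
        obtain ⟨hi1, hi2⟩ := lt_min_iff.1 hi
        rw [hget i hi1] at hiy
        exact ⟨i, hi2, hiy⟩
    · have h1 : (1 : ℝ) ≤ r.n := by exact_mod_cast h0
      have h2 : (r.n : ℝ) ≤ n := by exact_mod_cast hrn
      nlinarith

theorem exists_enumeration {ρ : Type} [Finite ρ] (F : Set ρ) {m : ℕ} (h : F.ncard ≤ m) :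
    ∃ e : ℕ → Option ρ, ∀ y, y ∈ F ↔ ∃ i < m, e i = some y := by
  classical
  have hfin : Finite F := inferInstance
  obtain ⟨k, ⟨e⟩⟩ := Finite.exists_equiv_fin F
  have hk : k ≤ m := by
    rwa [← Nat.card_coe_set_eq, Nat.card_congr e, Nat.card_fin] at h
  refine ⟨fun i => if hi : i < k then some (e.symm ⟨i, hi⟩ : ρ) else none, fun y => ?_⟩
  constructor
  · intro hy
    exact ⟨e ⟨y, hy⟩, (e ⟨y, hy⟩).2.trans_le hk, by simp⟩
  · rintro ⟨i, -, hi⟩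
    dsimp only at hi
    split_ifs at hi with hik
    rw [Option.some_inj] at hi
    exact hi ▸ (e.symm _).2

/-- Arbitrary computations on a relation that fits into one block. -/
theorem Reach.onBlock (h : Reach ld R 𝓢 T) (hE : AlgEnv P u N Q) {ρ ρ' : Type} {d : ℕ}
    [hρ : SmallType Q ρ' d] {S : X → Set ρ} (hS : ⟨ρ, 1, S⟩ ∈ 𝓢) (f : Set ρ → Set ρ')
    (hf : ∀ x, (f (S x)).ncard ≤ P.blockSize) (hd : d + 1 ≤ 80 := by decide) :
    Reach ld R (insert ⟨ρ', 1, fun x => f (S x)⟩ 𝓢) (T + 3 * u) := by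
  classical
  have hu := hE.one_le
  have hfin := hρ.finite
  refine h.insert_of fun Γ hΓ hs => ?_
  obtain ⟨r, hr, hrn, dec, hdec⟩ := hs _ hS
  dsimp only at hrn hdec
  obtain ⟨enc, δ, hδ⟩ := exists_wordCode (P := P) (τ := Option ρ') (by
    rw [Finite.card_option]
    exact hE.card_le (hE.add_one_le hρ.card_le) hd)
  have hen : ∀ F : Set ρ', ∃ e : ℕ → Option ρ', F.ncard ≤ P.blockSize →
      ∀ y, y ∈ F ↔ ∃ i < P.blockSize, e i = some y := by
    intro F
    by_cases hF : F.ncard ≤ P.blockSize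
    · obtain ⟨e, he⟩ := exists_enumeration F hF
      exact ⟨e, fun _ => he⟩
    · exact ⟨fun _ => none, fun h => absurd h hF⟩
  choose e he using hen
  -- The buffer contains the whole relation. Cell `c` of the new memory receives the code of element
  -- number `c` of the result.
  set g : ℕ → P.Client → P.Client := fun _ s c =>
    enc (e (f {y | ∃ i < r.n * P.blockSize, dec i (s (OEMProgram.bufIdx P i)) = some y}) c) with hg
  refine ⟨passTable g 1 r, le_rfl, ⟨fun _ => δ, fun x y => ?_⟩,
    (hΓ.pass hr g 1).mono subset_rfl (by push_cast; linarith)⟩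
  have hval : ∀ i < P.blockSize, δ (((passTable g 1 r).val x).getD i 0) = e (f (S x)) i := by
    intro i hi
    have := passTable_getD g 1 r x (j := 0) (by omega) hi
    rw [Nat.zero_mul, Nat.zero_add] at this
    rw [this]
    simp only [OEMProgram.clientSeq, hg]
    rw [hδ]
    congr 3
    · ext y
      refine Iff.trans ?_ (hdec x y).symm
      have hlt : ∀ i, i < r.n * P.blockSize → i < P.blockSize := fun i hi => by
        have := Nat.mul_le_mul_right P.blockSize hrn
        omega
      constructor
      · rintro ⟨k, hk, hky⟩
        rw [fill_bufIdx _ _ (hlt k hk), Nat.zero_mul, Nat.zero_add] at hky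
        exact ⟨k, hk, hky⟩
      · rintro ⟨k, hk, hky⟩
        refine ⟨k, hk, ?_⟩
        rw [fill_bufIdx _ _ (hlt k hk), Nat.zero_mul, Nat.zero_add]
        exact hky
    · simp [OEMProgram.bufIdx, Nat.mod_eq_of_lt hi]
  rw [he _ (hf x)]
  change _ ↔ ∃ k < 1 * P.blockSize, _
  rw [Nat.one_mul]
  constructor
  · rintro ⟨i, hi, hiy⟩
    exact ⟨i, hi, (hval i hi).trans hiy⟩
  · rintro ⟨i, hi, hiy⟩
    exact ⟨i, hi, (hval i hi).symm.trans hiy⟩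

/-- A relation that does not depend on the input. -/
theorem Reach.const (h : Reach ld R 𝓢 T) (hE : SortEnv P u N) {ρ : Type} [Finite ρ] (F : Set ρ)
    (n : ℕ) (hn : F.ncard ≤ n * P.blockSize) :
    Reach ld R (insert ⟨ρ, n, fun _ => F⟩ 𝓢) (T + 3 * u * n) := by
  have hu := hE.one_le
  refine h.insert_of fun Γ hΓ hs => ?_
  obtain ⟨e, he⟩ := exists_enumeration F hn
  rcases Nat.eq_zero_or_pos n with rfl | h0
  · refine ⟨RawTable.empty, le_rfl, RawTable.represents_empty _ fun x y hy => ?_,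
      hΓ.empty.mono subset_rfl (by simp)⟩
    obtain ⟨i, hi, -⟩ := (he y).1 hy
    omega
  -- The words are irrelevant: the relation is contained in the decoding, which looks at the
  -- position only.
  · refine ⟨passTable (fun _ s => s) n RawTable.empty, le_rfl, ⟨fun k _ => e k, fun x y => he y⟩,
      ((hΓ.empty.pass (Set.mem_insert _ _) _ n).mono
        (Set.insert_subset_insert (Set.subset_insert _ _)) ?_)⟩
    have : (1 : ℝ) ≤ n := by exact_mod_cast h0
    nlinarith

end Tables

/-! ### Grouping, joining and counting -/

section Grouping

open Classical in
/-- The element of `A` with the largest key. -/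
noncomputable def maxOf {α ℓ : Type} [LinearOrder ℓ] (key : α → ℓ) (A : Set α) : Option α :=
  if h : ∃ y ∈ A, ∀ z ∈ A, key z ≤ key y then some h.choose else none

theorem maxOf_insert {α ℓ : Type} [LinearOrder ℓ] (key : α → ℓ) {A : Set α} {y : α}
    (h : ∀ z ∈ A, key z < key y) : maxOf key (insert y A) = some y := by
  have h1 : ∃ y' ∈ insert y A, ∀ z ∈ insert y A, key z ≤ key y' :=
    ⟨y, Set.mem_insert _ _, fun z hz => by
      rcases hz with rfl | hz
      exacts [le_rfl, (h z hz).le]⟩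
  rw [maxOf, dif_pos h1, Option.some_inj]
  obtain ⟨h2, h3⟩ := h1.choose_spec
  rcases h2 with h2 | h2
  · exact h2
  · exact absurd (h _ h2) (not_lt.2 (h3 y (Set.mem_insert _ _)))

theorem maxOf_spec {α ℓ : Type} [LinearOrder ℓ] (key : α → ℓ) {A : Set α} {y : α}
    (h : maxOf key A = some y) : y ∈ A ∧ ∀ z ∈ A, key z ≤ key y := by
  rw [maxOf] at h
  split_ifs at h with h1
  rw [Option.some_inj] at h
  exact h ▸ h1.choose_spec

theorem maxOf_eq_none {α ℓ : Type} [LinearOrder ℓ] (key : α → ℓ) {A : Set α} (hA : A.Finite)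
    (h : maxOf key A = none) : A = ∅ := by
  rw [maxOf] at h
  split_ifs at h with h1
  by_contra hne
  exact h1 (hA.exists_maximalFor key A (Set.nonempty_iff_ne_empty.2 hne) |>.imp fun y hy =>
    ⟨hy.1, fun z hz => (le_total (key z) (key y)).elim id fun h => hy.2 hz h⟩)

variable {P : OEMParams} {X : Type} {ld : X → P.Server} {R : ℕ} {𝓢 𝓢' : Set (Tbl X)}
  {T T' u : ℝ} {N Q : ℕ}

theorem Reach.congr (h : Reach ld R 𝓢 T) {ρ : Type} {n n' : ℕ} {S S' : X → Set ρ}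
    (hS : ⟨ρ, n, S⟩ ∈ 𝓢) (hn : n ≤ n') (hSS : ∀ x, S x = S' x) :
    Reach ld R (insert ⟨ρ, n', S'⟩ 𝓢) T := by
  obtain rfl : S = S' := funext hSS
  refine h.insert_of fun Γ hΓ hs => ?_
  obtain ⟨r, hr, hrn, hrep⟩ := hs _ hS
  exact ⟨r, hrn.trans hn, hrep, by rwa [Set.insert_eq_of_mem hr]⟩

open Classical in
/-- Sorting by groups, followed by a scan of each group. -/
theorem Reach.groupScan (h : Reach ld R 𝓢 T) (hE : AlgEnv P u N Q) {ρ ρ' κ σ ℓ : Type}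
    {d e f : ℕ} [hρ : SmallType Q ρ d] [hκ : SmallType Q κ e] [hσ : SmallType Q σ f]
    [LinearOrder ℓ] {n : ℕ} {S : X → Set ρ} (hS : ⟨ρ, n, S⟩ ∈ 𝓢) (hn : n ≤ N) (grp : ρ → κ)
    (kk : ρ → ℓ) (hinj : ∀ y y', grp y = grp y' → kk y = kk y' → y = y') (ψ : Set ρ → σ)
    (g : σ → ρ → σ) (hg : ∀ A y, (∀ z ∈ A, kk z < kk y) → ψ (insert y A) = g (ψ A) y)
    (out : ρ → σ → Option ρ') (hd : d + e + f + 2 ≤ 80 := by decide) :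
    Reach ld R (insert ⟨ρ', n, fun x => {z | ∃ y ∈ S x,
      out y (ψ {y' | y' ∈ S x ∧ grp y' = grp y ∧ kk y' < kk y}) = some z}⟩ 𝓢)
      (T + 7 * u * n) := by
  have hf1 := hρ.finite
  have hf2 := hκ.finite
  have hf3 := hσ.finite
  have : Fact (2 ≤ Q) := ⟨hE.two_le⟩
  obtain ⟨_, ⟨cd⟩⟩ := Finite.exists_equiv_fin κ
  -- Sorting by the group first makes every group contiguous.
  set key : ρ → _ ×ₗ ℓ := fun y => toLex (cd (grp y), kk y) with hkeydef
  have hkey : Function.Injective key := fun y y' hyy => by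
    have h1 := Prod.ext_iff.1 (toLex.injective hyy)
    exact hinj _ _ (cd.injective h1.1) h1.2
  -- The summary consists of the group of the last record and the value of `ψ` on the part of that
  -- group seen so far.
  set Φ : Set ρ → Option κ × σ := fun A =>
    ((maxOf key A).map grp, ψ {z | z ∈ A ∧ (maxOf key A).map grp = some (grp z)}) with hΦ
  have key_lt : ∀ {z y}, grp z = grp y → (key z < key y ↔ kk z < kk y) := fun {z y} hzy => by
    rw [hkeydef]
    simp only [Prod.Lex.lt_iff, ofLex_toLex, hzy, lt_self_iff_false, false_or, true_and]
  -- When the group changes, the value starts afresh with `ψ ∅`: no record of the new group has been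
  -- seen, since groups are contiguous.
  have hval : ∀ A y, (∀ z ∈ A, key z < key y) →
      (if (Φ A).1 = some (grp y) then (Φ A).2 else ψ ∅) = ψ {z | z ∈ A ∧ grp z = grp y} := by
    intro A y hA
    by_cases hc : (maxOf key A).map grp = some (grp y)
    · rw [hΦ]
      simp only [hc, if_true, Option.some_inj]
      congr 1
      ext z
      simp [eq_comm]
    · have hcc : (Φ A).1 ≠ some (grp y) := hc
      rw [if_neg hcc]
      congr 1
      symm
      rw [Set.eq_empty_iff_forall_notMem]
      rintro z ⟨hz, hzy⟩
      cases hm : maxOf key A with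
      | none =>
        rw [maxOf_eq_none key (Set.toFinite _) hm] at hz
        exact hz
      | some m =>
        obtain ⟨hmA, hmax⟩ := maxOf_spec key hm
        have h1 := hmax z hz
        have h2 := hA m hmA
        rw [hkeydef] at h1 h2
        simp only [Prod.Lex.le_iff, Prod.Lex.lt_iff, ofLex_toLex, hzy] at h1 h2
        have h3 : cd (grp m) = cd (grp y) := by
          rcases h1 with h1 | h1
          · rcases h2 with h2 | h2
            · exact absurd h1 (not_lt.2 h2.le)
            · exact h2.1
          · exact h1.1.symm
        exact hc (by rw [hm, Option.map_some, cd.injective h3])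
  have hkk : ∀ (A : Set ρ) (y : ρ), (∀ z ∈ A, key z < key y) → ∀ z ∈ ({z | z ∈ A ∧ grp z = grp y} : Set ρ), kk z < kk y :=
    fun A y hA z hz => (key_lt hz.2).1 (hA z hz.1)
  have hstep : ∀ A y, (∀ z ∈ A, key z < key y) → Φ (insert y A) =
      (fun (s : Option κ × σ) y => (some (grp y), g (if s.1 = some (grp y) then s.2 else ψ ∅) y))
        (Φ A) y := by
    intro A y hA
    simp only [hval A y hA]
    rw [← hg _ y (hkk A y hA)]
    simp only [hΦ, maxOf_insert key hA, Option.map_some, Option.some_inj, Prod.mk.injEq, true_and]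
    congr 1
    ext z
    simp only [Set.mem_insert_iff, Set.mem_ofPred_eq]
    constructor
    · rintro ⟨rfl | hz, h⟩
      · exact Or.inl rfl
      · exact Or.inr ⟨hz, h.symm⟩
    · rintro (rfl | ⟨hz, h⟩)
      · exact ⟨Or.inl rfl, rfl⟩
      · exact ⟨Or.inr hz, h.symm⟩
  have hcard : (Nat.card ρ + 1) * Nat.card (Option κ × σ) ≤ 2 ^ P.wordBits := by
    have h1 : SmallType Q (Option κ × σ) (e + 1 + f) := inferInstance
    have h2 := Nat.mul_le_mul (hE.add_one_le hρ.card_le) h1.card_le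
    rw [← pow_add] at h2
    exact hE.card_le h2 (by omega)
  have h1 := h.sortScan hE.toSortEnv hS hn hkey (Φ := Φ)
    (fun (s : Option κ × σ) y => (some (grp y), g (if s.1 = some (grp y) then s.2 else ψ ∅) y))
    hstep hcard
    (fun y s => out y (if s.1 = some (grp y) then s.2 else ψ ∅))
  refine (h1.congr (Set.mem_insert _ _) le_rfl (S' := fun x => {z | ∃ y ∈ S x,
      out y (ψ {y' | y' ∈ S x ∧ grp y' = grp y ∧ kk y' < kk y}) = some z}) fun x => ?_).mono
    (Set.insert_subset_insert (Set.subset_insert _ _)) le_rfl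
  ext z
  simp only [Set.mem_ofPred_eq]
  refine exists_congr fun y => and_congr_right fun _ => ?_
  rw [hval _ y (fun z hz => hz.2)]
  have : {z | z ∈ {y' | y' ∈ S x ∧ key y' < key y} ∧ grp z = grp y} =
      {y' | y' ∈ S x ∧ grp y' = grp y ∧ kk y' < kk y} := by
    ext z
    simp only [Set.mem_ofPred_eq]
    constructor
    · rintro ⟨⟨h1, h2⟩, h3⟩
      exact ⟨h1, h3, (key_lt h3).1 h2⟩
    · rintro ⟨h1, h3, h2⟩
      exact ⟨⟨h1, (key_lt h3).2 h2⟩, h3⟩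
  rw [this]

open Classical in
/-- The least element of each group. -/
theorem Reach.groupMin (h : Reach ld R 𝓢 T) (hE : AlgEnv P u N Q) {ρ ρ' κ ℓ : Type}
    {d e : ℕ} [hρ : SmallType Q ρ d] [hκ : SmallType Q κ e]
    [LinearOrder ℓ] {n : ℕ} {S : X → Set ρ} (hS : ⟨ρ, n, S⟩ ∈ 𝓢) (hn : n ≤ N) (grp : ρ → κ)
    (kk : ρ → ℓ) (hinj : ∀ y y', grp y = grp y' → kk y = kk y' → y = y')
    (out : ρ → Option ρ') (hd : d + e + 3 ≤ 80 := by decide) :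
    Reach ld R (insert ⟨ρ', n, fun x => {z | ∃ y ∈ S x,
      (∀ y' ∈ S x, grp y' = grp y → kk y ≤ kk y') ∧ out y = some z}⟩ 𝓢) (T + 7 * u * n) := by
  have : Fact (2 ≤ Q) := ⟨hE.two_le⟩
  -- One bit is enough: whether a smaller record of the group has occurred.
  have h1 := h.groupScan hE hS hn grp kk hinj (σ := Bool) (fun A => decide A.Nonempty)
    (fun _ _ => true) (fun A y _ => by simp) (fun y b => if b = true then none else out y)
    (by omega)
  refine (h1.congr (Set.mem_insert _ _) le_rfl (S' := fun x => {z | ∃ y ∈ S x,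
      (∀ y' ∈ S x, grp y' = grp y → kk y ≤ kk y') ∧ out y = some z}) fun x => ?_).mono
    (Set.insert_subset_insert (Set.subset_insert _ _)) le_rfl
  ext z
  simp only [Set.mem_ofPred_eq]
  refine exists_congr fun y => and_congr_right fun _ => ?_
  by_cases hc : ∀ y' ∈ S x, grp y' = grp y → kk y ≤ kk y'
  · have h2 : ¬ {y' | y' ∈ S x ∧ grp y' = grp y ∧ kk y' < kk y}.Nonempty := by
      rintro ⟨y', h3, h4, h5⟩
      exact absurd (hc y' h3 h4) (not_le.2 h5)
    simp only [h2, decide_false, Bool.false_eq_true, if_false]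
    exact ⟨fun h => ⟨hc, h⟩, fun h => h.2⟩
  · have h2 : {y' | y' ∈ S x ∧ grp y' = grp y ∧ kk y' < kk y}.Nonempty := by
      push Not at hc
      obtain ⟨y', h3, h4, h5⟩ := hc
      exact ⟨y', h3, h4, h5⟩
    simp only [h2, decide_true, if_true]
    exact ⟨fun h => by simp at h, fun h => absurd h.1 hc⟩

open Classical in
/-- The value that the relation `F` assigns to `k`. -/
noncomputable def lookup {κ δ : Type} (F : Set (κ × δ)) (k : κ) : Option δ :=
  if h : ∃ d, (k, d) ∈ F then some h.choose else none

theorem lookup_eq_some {κ δ : Type} {F : Set (κ × δ)}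
    (hF : ∀ k d d', (k, d) ∈ F → (k, d') ∈ F → d = d') {k : κ} {d : δ} :
    lookup F k = some d ↔ (k, d) ∈ F := by
  rw [lookup]
  split_ifs with h
  · rw [Option.some_inj]
    exact ⟨fun h' => h' ▸ h.choose_spec, fun h' => hF _ _ _ h.choose_spec h'⟩
  · simp only [false_iff]
    exact fun h' => h ⟨d, h'⟩

theorem lookup_eq_none {κ δ : Type} {F : Set (κ × δ)} {k : κ} :
    lookup F k = none ↔ ∀ d, (k, d) ∉ F := by
  rw [lookup]
  split_ifs with h
  · simpa using h
  · simpa using h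

/-- For each element of `G`, the value that `F` assigns to its key. -/
theorem Reach.join (h : Reach ld R 𝓢 T) (hE : AlgEnv P u N Q) {κ δ γ ρ' : Type}
    {a b c : ℕ} [hκ : SmallType Q κ a] [hδ : SmallType Q δ b] [hγ : SmallType Q γ c]
    {n n' : ℕ} {F : X → Set (κ × δ)} {G : X → Set γ} (hF : ⟨κ × δ, n, F⟩ ∈ 𝓢)
    (hG : ⟨γ, n', G⟩ ∈ 𝓢) (hn : n + n' ≤ N)
    (hfun : ∀ x k d d', (k, d) ∈ F x → (k, d') ∈ F x → d = d') (kf : γ → κ)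
    (out : γ → Option δ → Option ρ') (hd : (a + (b + c + 1)) + a + (b + 1) + 2 ≤ 80 := by decide) :
    Reach ld R (insert ⟨ρ', n + n', fun x => {z | ∃ q ∈ G x, out q (lookup (F x) (kf q)) = some z}⟩
      𝓢) (T + 7 * u * (n + n' : ℕ)) := by
  classical
  have : Fact (2 ≤ Q) := ⟨hE.two_le⟩
  have hf1 := hδ.finite
  have hf2 := hγ.finite
  have hf3 := hκ.finite
  obtain ⟨m, ⟨e⟩⟩ := Finite.exists_equiv_fin δ
  obtain ⟨_, ⟨e'⟩⟩ := Finite.exists_equiv_fin γ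
  have h1 := h.unionMap hF hG (τ := κ × (δ ⊕ γ)) (fun p => some (p.1, Sum.inl p.2))
    (fun q => some (kf q, Sum.inr q))
  -- Among the records with the same key, the value from `F` comes before all elements of `G`. The
  -- scan hands it on to them.
  set kk : κ × (δ ⊕ γ) → ℕ := fun p => p.2.elim (fun d => (e d : ℕ)) (fun q => m + e' q) with hkk
  set A' : Set (κ × (δ ⊕ γ)) → Set (κ × (δ ⊕ γ)) := fun A => {z | z ∈ A ∧ z.2.isLeft} with hA'
  have h2 := h1.groupScan hE (Set.mem_insert _ _) hn Prod.fst kk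
    (by
      rintro ⟨k, d | q⟩ ⟨k', d' | q'⟩ h1 h2
      · have h3 : (e d : ℕ) = e d' := h2
        rw [Fin.val_inj, e.injective.eq_iff] at h3
        dsimp only at h1
        rw [h1, h3]
      · have h3 : (e d : ℕ) = m + e' q' := h2
        omega
      · have h3 : m + (e' q : ℕ) = e d' := h2
        omega
      · have h3 : m + (e' q : ℕ) = m + e' q' := h2
        rw [Nat.add_left_cancel_iff, Fin.val_inj, e'.injective.eq_iff] at h3
        dsimp only at h1
        rw [h1, h3])
    (σ := Option δ) (fun A => (maxOf kk (A' A)).bind fun z => z.2.getLeft?)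
    (fun s z => z.2.elim some fun _ => s)
    (by
      rintro A ⟨k, d | q⟩ hA
      · have : A' (insert (k, Sum.inl d) A) = insert (k, Sum.inl d) (A' A) := by
          ext z
          simp only [hA', Set.mem_insert_iff, Set.mem_ofPred_eq]
          constructor
          · rintro ⟨rfl | h, h'⟩
            exacts [Or.inl rfl, Or.inr ⟨h, h'⟩]
          · rintro (rfl | ⟨h, h'⟩)
            exacts [⟨Or.inl rfl, rfl⟩, ⟨Or.inr h, h'⟩]
        dsimp only
        rw [this, maxOf_insert kk fun z hz => hA z hz.1]
        rfl
      · have : A' (insert (k, Sum.inr q) A) = A' A := by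
          ext z
          simp only [hA', Set.mem_insert_iff, Set.mem_ofPred_eq]
          constructor
          · rintro ⟨rfl | h, h'⟩
            · simp at h'
            · exact ⟨h, h'⟩
          · rintro ⟨h, h'⟩
            exact ⟨Or.inr h, h'⟩
        dsimp only
        rw [this]
        rfl)
    (fun z s => z.2.elim (fun _ => none) fun q => out q s) (by omega)
  refine (h2.congr (Set.mem_insert _ _) le_rfl
    (S' := fun x => {z | ∃ q ∈ G x, out q (lookup (F x) (kf q)) = some z}) fun x => ?_).mono
    (Set.insert_subset_insert ((Set.subset_insert _ _).trans (Set.subset_insert _ _))) le_rfl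
  ext z
  simp only [Set.mem_ofPred_eq, Set.mem_union]
  have hlook : ∀ q ∈ G x, ((maxOf kk (A' {y' |
      ((∃ y ∈ F x, some (y.1, Sum.inl y.2) = some y') ∨
        ∃ y ∈ G x, some (kf y, Sum.inr y) = some y') ∧
      y'.1 = kf q ∧ kk y' < kk (kf q, Sum.inr q)})).bind fun z => z.2.getLeft?) =
      lookup (F x) (kf q) := by
    intro q hq
    cases hl : lookup (F x) (kf q) with
    | none =>
      rw [lookup_eq_none] at hl
      rw [Option.bind_eq_none_iff]
      rintro ⟨k, d | q'⟩ hz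
      · obtain ⟨⟨h3, -⟩, -⟩ := maxOf_spec kk hz
        obtain ⟨⟨⟨k', d'⟩, h5, h6⟩ | ⟨y, h5, h6⟩, h4, -⟩ := h3
        · simp only [Option.some_inj, Prod.mk.injEq, Sum.inl.injEq] at h6
          obtain ⟨rfl, rfl⟩ := h6
          dsimp only at h4
          subst h4
          exact absurd h5 (hl _)
        · simp at h6
      · rfl
    | some d =>
      have hd := (lookup_eq_some (hfun x)).1 hl
      cases hz : maxOf kk _ with
      | none =>
        have h3 := maxOf_eq_none kk (Set.toFinite _) hz
        exfalso
        have h4 : ((kf q, Sum.inl d) : κ × (δ ⊕ γ)) ∈ (∅ : Set (κ × (δ ⊕ γ))) := by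
          rw [← h3]
          refine ⟨⟨Or.inl ⟨_, hd, rfl⟩, rfl, ?_⟩, rfl⟩
          have := (e d).2
          simp only [hkk, Sum.elim_inl, Sum.elim_inr]
          omega
        exact h4
      | some z =>
        obtain ⟨⟨h3, h3'⟩, -⟩ := maxOf_spec kk hz
        obtain ⟨⟨⟨k', d'⟩, h5, h6⟩ | ⟨y, h5, h6⟩, h4, -⟩ := h3
        · rw [Option.some_inj] at h6
          subst h6
          dsimp only at h4
          subst h4
          simp only [Option.bind_some, Sum.getLeft?_inl, Option.some_inj]
          exact hfun x _ _ _ h5 hd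
        · rw [Option.some_inj] at h6
          subst h6
          simp at h3'
  constructor
  · rintro ⟨y, hy | hy, hz⟩
    · obtain ⟨p, -, hp⟩ := hy
      rw [Option.some_inj] at hp
      subst hp
      simp at hz
    · obtain ⟨q, hq, hp⟩ := hy
      rw [Option.some_inj] at hp
      subst hp
      refine ⟨q, hq, ?_⟩
      rw [← hlook q hq]
      exact hz
  · rintro ⟨q, hq, hz⟩
    refine ⟨(kf q, Sum.inr q), Or.inr ⟨q, hq, rfl⟩, ?_⟩
    rw [← hlook q hq] at hz
    exact hz

end Grouping

/-! ### Sums, input and output -/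

section InputOutput

variable {P : OEMParams} {X : Type} {ld : X → P.Server} {R : ℕ} {𝓢 𝓢' : Set (Tbl X)}
  {T T' u : ℝ} {N Q : ℕ}

instance {Q m : ℕ} [h : Fact (m ≤ Q)] : SmallType Q (Fin m) 1 where
  finite := inferInstance
  card_le := by simpa using h.out

theorem finsum_mem_mono_set {α : Type} (w : α → ℕ) {s t : Set α} (h : s ⊆ t) (ht : t.Finite) :
    ∑ᶠ y ∈ s, w y ≤ ∑ᶠ y ∈ t, w y := by
  rw [finsum_mem_eq_finite_toFinset_sum _ ht, finsum_mem_eq_finite_toFinset_sum _ (ht.subset h)]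
  exact Finset.sum_le_sum_of_subset (by simpa using h)

/-- The sum of the weights in each group. -/
theorem Reach.groupSum (h : Reach ld R 𝓢 T) (hE : AlgEnv P u N Q) {ρ ρ' κ : Type}
    {d e f : ℕ} [hρ : SmallType Q ρ d] [hκ : SmallType Q κ e] {n : ℕ}
    {S : X → Set ρ} (hS : ⟨ρ, n, S⟩ ∈ 𝓢) (hn : n ≤ N) (grp : ρ → κ) (w : ρ → ℕ) (m : ℕ)
    (hm : ∀ x, ∀ y ∈ S x, ∑ᶠ y' ∈ {y' | y' ∈ S x ∧ grp y' = grp y}, w y' ≤ m)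
    (hmQ : m + 1 ≤ Q ^ f) (out : κ → ℕ → Option ρ') (hd : d + 2 * e + f + 3 ≤ 80 := by decide) :
    Reach ld R (insert ⟨ρ', n, fun x => {z | ∃ y ∈ S x,
      out (grp y) (∑ᶠ y' ∈ {y' | y' ∈ S x ∧ grp y' = grp y}, w y') = some z}⟩ 𝓢)
      (T + 14 * u * n) := by
  have hf1 := hρ.finite
  have : SmallType Q (Fin (m + 1)) f := SmallType.of_card (by simpa using hmQ)
  obtain ⟨_, ⟨cd⟩⟩ := Finite.exists_equiv_fin ρ
  -- Sums are cut off at `m` to have a small type of states; by `hm` the cut-off never takes effect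
  -- on the sets that occur.
  set ψ : Set ρ → Fin (m + 1) := fun A =>
    ⟨min m (∑ᶠ y ∈ A, w y), Nat.lt_succ_of_le (min_le_left _ _)⟩ with hψ
  have h1 := h.groupScan hE hS hn grp cd (fun _ _ _ h => cd.injective h) ψ
    (fun s y => ⟨min m (w y + s), Nat.lt_succ_of_le (min_le_left _ _)⟩) (by
      intro A y hA
      have hy : y ∉ A := fun hy => lt_irrefl _ (hA y hy)
      simp only [hψ]
      rw [finsum_mem_insert _ hy (Set.toFinite _)]
      simp only [Fin.mk.injEq]
      omega)
    (fun y s => some ((grp y, ⟨min m (w y + s), Nat.lt_succ_of_le (min_le_left _ _)⟩) :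
      κ × Fin (m + 1))) (by omega)
  -- The first scan has attached partial sums to the group. The largest of them, hence the dual
  -- order, is the total.
  have h2 := h1.groupMin hE (Set.mem_insert _ _) hn Prod.fst (fun p => OrderDual.toDual p.2)
    (fun y y' h h' => Prod.ext h h') (fun p => out p.1 p.2) (by omega)
  refine (h2.congr (Set.mem_insert _ _) le_rfl (S' := fun x => {z | ∃ y ∈ S x,
      out (grp y) (∑ᶠ y' ∈ {y' | y' ∈ S x ∧ grp y' = grp y}, w y') = some z}) fun x => ?_).mono
    (Set.insert_subset_insert ((Set.subset_insert _ _).trans (Set.subset_insert _ _)))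
    (by linarith)
  set A : ρ → Set ρ := fun y => {y' | y' ∈ S x ∧ grp y' = grp y} with hA
  set A' : ρ → Set ρ := fun y => {y' | y' ∈ S x ∧ grp y' = grp y ∧ cd y' < cd y} with hA'
  have hval : ∀ y ∈ S x, min m (w y + (ψ (A' y) : ℕ)) ≤ ∑ᶠ y' ∈ A y, w y' := by
    intro y hy
    have hyA : y ∉ A' y := fun h => lt_irrefl _ h.2.2
    refine (min_le_right _ _).trans ?_
    calc w y + (ψ (A' y) : ℕ) ≤ w y + ∑ᶠ y' ∈ A' y, w y' :=
          Nat.add_le_add_left (min_le_right _ _) _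
      _ = ∑ᶠ y' ∈ insert y (A' y), w y' := (finsum_mem_insert _ hyA (Set.toFinite _)).symm
      _ ≤ _ := by
        refine finsum_mem_mono_set _ ?_ (Set.toFinite _)
        rintro z (rfl | hz)
        exacts [⟨hy, rfl⟩, ⟨hz.1, hz.2.1⟩]
  have htop : ∀ y ∈ S x, ∃ y' ∈ S x, grp y' = grp y ∧
      min m (w y' + (ψ (A' y') : ℕ)) = ∑ᶠ z ∈ A y, w z := by
    intro y hy
    obtain ⟨y', ⟨hy', hmax⟩⟩ := (Set.toFinite (A y)).exists_maximalFor cd (A y) ⟨y, hy, rfl⟩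
    refine ⟨y', hy'.1, hy'.2, ?_⟩
    have hyA : y' ∉ A' y' := fun h => lt_irrefl _ h.2.2
    have hins : insert y' (A' y') = A y := by
      ext z
      constructor
      · rintro (rfl | hz)
        exacts [hy', ⟨hz.1, hz.2.1.trans hy'.2⟩]
      · intro hz
        rcases eq_or_ne z y' with rfl | hne
        · exact Set.mem_insert _ _
        · refine Set.mem_insert_of_mem _ ⟨hz.1, hz.2.trans hy'.2.symm, ?_⟩
          rcases le_total (cd z) (cd y') with hle | hle
          · exact lt_of_le_of_ne hle fun h => hne (cd.injective h)
          · exact lt_of_le_of_ne (hmax hz hle) fun h => hne (cd.injective h)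
    have hsum := finsum_mem_insert w hyA (Set.toFinite _)
    rw [hins] at hsum
    have := hm x y hy
    simp only [hψ]
    simp only [hA] at hsum ⊢
    omega
  ext z
  simp only [Set.mem_ofPred_eq, Option.some_inj]
  constructor
  · rintro ⟨_, ⟨y, hy, rfl⟩, hmin, hz⟩
    refine ⟨y, hy, ?_⟩
    rw [← hz]
    congr 1
    refine le_antisymm ?_ (hval y hy)
    obtain ⟨y', hy', hg, hs⟩ := htop y hy
    have h3 := hmin _ ⟨y', hy', rfl⟩ hg
    rw [OrderDual.toDual_le_toDual, Fin.le_def] at h3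
    exact hs.symm.le.trans h3
  · rintro ⟨y, hy, hz⟩
    obtain ⟨y', hy', hg, hs⟩ := htop y hy
    refine ⟨_, ⟨y', hy', rfl⟩, ?_, ?_⟩
    · rintro _ ⟨y'', hy'', rfl⟩ hg'
      rw [OrderDual.toDual_le_toDual, Fin.le_def]
      refine (hval y'' hy'').trans ?_
      dsimp only at hg' ⊢
      change _ ≤ min m (w y' + (ψ (A' y') : ℕ))
      rw [hs]
      simp only [hA]
      rw [hg', hg]
    · rw [← hz]
      exact congrArg₂ out hg hs

/-- A scan that remembers the last two words assembles a triple at each third word of an edge. The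
decoding retains the positions `k` with `k % 3 = 2`. -/
theorem reach_input (hE : AlgEnv P u N Q) (ld : X → P.Server) (R E n : ℕ) (hn : 3 * n ≤ R)
    (hEn : E ≤ n * P.blockSize) (w : X → Fin E → Fin Q × Fin Q × Fin Q)
    (hld : ∀ x a, ld x a = if h : a / 3 < E then BitVec.ofNat P.wordBits
      (if a % 3 = 0 then ((w x ⟨a / 3, h⟩).1 : ℕ)
       else if a % 3 = 1 then ((w x ⟨a / 3, h⟩).2.1 : ℕ)
       else ((w x ⟨a / 3, h⟩).2.2 : ℕ)) else 0) :
    Reach ld R {⟨Fin Q × Fin Q × Fin Q, 3 * n, fun x => Set.range (w x)⟩} (7 * u * n + 1) := by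
  have hu := hE.one_le
  have hQ : NeZero Q := ⟨by have := hE.two_le; omega⟩
  obtain ⟨r, hrn, hr⟩ : ∃ r : RawTable P X, r.n = 3 * n ∧ ∀ x k, ld x k = (r.val x).getD k 0 := by
    refine ⟨⟨3 * n, fun x => List.ofFn fun k : Fin (3 * n * P.blockSize) => ld x k, by simp⟩, rfl,
      fun x k => ?_⟩
    rcases lt_or_ge k (3 * n * P.blockSize) with hk | hk
    · rw [List.getD_eq_getElem _ _ (by simpa using hk), List.getElem_ofFn]
    · rw [List.getD_eq_default _ _ (by simpa using hk), hld, dif_neg]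
      have : 3 * E ≤ 3 * n * P.blockSize := by rw [Nat.mul_assoc]; omega
      omega
  have h2Q : 2 ≤ Q := hE.two_le
  obtain ⟨enc, dec, hdec⟩ := exists_wordCode (P := P) (τ := Fin Q × Fin Q) (by
    have := hE.card_le (m := Q * Q) (d := 2) (by rw [pow_two]) (by omega)
    simpa using this)
  obtain ⟨enc', dec', hdec'⟩ := exists_wordCode (P := P) (τ := Fin Q × Fin Q × Fin Q) (by
    have := hE.card_le (m := Q * (Q * Q)) (d := 3) (by ring_nf; exact le_rfl) (by omega)
    simpa using this)
  set toF : P.Word → Fin Q := fun v => Fin.ofNat Q v.toNat with htoF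
  set f : ℕ → P.Word → P.Word → P.Word × P.Word := fun _ s v =>
    (enc (toF v, (dec s).1), enc' ((dec s).2, (dec s).1, toF v)) with hf
  have h1 := (rawReach_input ld R r (by omega) hr).scan (Set.mem_singleton r) hE.lt_mem f 0 (3 * n)
  have hstate : ∀ v : ℕ → P.Word, ∀ k,
      dec (scanState f 0 v (k + 2)) = (toF (v (k + 1)), toF (v k)) := by
    intro v k
    simp only [scanState, hf, hdec]
  have htoF' : ∀ a : Fin Q, toF (BitVec.ofNat P.wordBits a) = a := by
    intro a
    have h3 := hE.card_le (m := Q) (d := 1) (by simp) (by omega)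
    simp only [htoF, BitVec.toNat_ofNat]
    rw [Nat.mod_eq_of_lt (a.2.trans_le h3)]
    simp
  refine ⟨_, h1.mono subset_rfl (by push_cast; nlinarith [(Nat.cast_nonneg n : (0 : ℝ) ≤ n)]), ?_⟩
  rintro t rfl
  refine ⟨_, Set.mem_insert _ _, le_rfl,
    fun k w => if k % 3 = 2 ∧ k / 3 < E then some (dec' w) else none, fun x y => ?_⟩
  have hget : ∀ i : Fin E, dec' (((scanTable f 0 (3 * n) r).val x).getD (3 * i + 2) 0) = w x i := by
    intro i
    have hi : 3 * (i : ℕ) + 2 < 3 * n * P.blockSize := by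
      rw [Nat.mul_assoc]; have := i.2; omega
    rw [scanTable_getD _ _ _ _ _ hi]
    simp only [scanOut, hf, hdec']
    have hs := hstate (fun i => (r.val x).getD i 0) (3 * i)
    simp only [hf] at hs
    rw [hs]
    dsimp only
    rw [← hr, ← hr, ← hr, hld, hld, hld]
    have e1 : (3 * (i : ℕ)) / 3 = i := by omega
    have e2 : (3 * (i : ℕ) + 1) / 3 = i := by omega
    have e3 : (3 * (i : ℕ) + 2) / 3 = i := by omega
    have e4 : (3 * (i : ℕ)) % 3 = 0 := by omega
    have e5 : (3 * (i : ℕ) + 1) % 3 = 1 := by omega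
    have e6 : (3 * (i : ℕ) + 2) % 3 = 2 := by omega
    simp only [e1, e2, e3, e4, e5, e6, i.2, dif_pos, if_true, one_ne_zero, if_false,
      OfNat.ofNat_ne_zero, OfNat.ofNat_ne_one, htoF']
  change _ ↔ ∃ k < 3 * n * P.blockSize, _
  constructor
  · rintro ⟨i, rfl⟩
    refine ⟨3 * i + 2, by rw [Nat.mul_assoc]; have := i.2; omega, ?_⟩
    have e3 : (3 * (i : ℕ) + 2) / 3 = i := by omega
    exact (if_pos ⟨by omega, by rw [e3]; exact i.2⟩).trans (congrArg some (hget i))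
  · rintro ⟨k, -, hk⟩
    dsimp only at hk
    split_ifs at hk with hc
    rw [Option.some_inj] at hk
    refine ⟨⟨k / 3, hc.2⟩, ?_⟩
    rw [← hget]
    have : 3 * (k / 3) + 2 = k := by omega
    simp only [this]
    exact hk

/-- The relation `S` is written, in the order of the keys, at the start of the server's memory. -/
theorem Reach.output (h : Reach ld R 𝓢 T) (hE : AlgEnv P u N Q) {ρ ℓ : Type} {d : ℕ}
    [hρ : SmallType Q ρ d] [LinearOrder ℓ] {n : ℕ} {S : X → Set ρ} (hS : ⟨ρ, n, S⟩ ∈ 𝓢)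
    (hn : n ≤ N) (hR : n ≤ R) {key : ρ → ℓ} (hkey : key.Injective) (wd : ρ → ℕ)
    (hd : d + 1 ≤ 80 := by decide) :
    ∃ (p : OEMProgram P) (μ : PMF (List IORequest)), (p.length : ℝ) ≤ T + 20 * u * n ∧
      ∀ x, (p.run (fun _ => 0) (ld x)).map Prod.fst = μ ∧
        ∃ y : Fin (S x).ncard → ρ, StrictMono (fun i => key (y i)) ∧ Set.range y = S x ∧
        ∀ o ∈ (p.run (fun _ => 0) (ld x)).support, ∀ k : Fin (S x).ncard,
          o.2 k = BitVec.ofNat P.wordBits (wd (y k)) := by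
  have hu := hE.one_le
  have hf := hρ.finite
  obtain ⟨Γ, hΓ, hs⟩ := h
  obtain ⟨r, hr, hrn, hrep⟩ := hs _ hS
  dsimp only at hrn hrep
  obtain ⟨r₁, dec, hn₁, hR₁, hx⟩ := hΓ.canonical hE.toSortEnv hr (hrn.trans hn) hrep hkey
    (hE.card_le (hE.add_one_le hρ.card_le) hd)
  set f : ℕ → P.Word → P.Word → P.Word × P.Word := fun _ s v =>
    (s, (dec v).elim 0 fun y => BitVec.ofNat P.wordBits (wd y)) with hf
  have hR₂ := hR₁.scan (Set.mem_insert _ _) hE.lt_mem f 0 r.n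
  have hcell : ∀ x, ∀ k < r.n * P.blockSize, ((scanTable f 0 r.n r₁).val x).getD k 0 =
      (dec ((r₁.val x).getD k 0)).elim 0 fun y => BitVec.ofNat P.wordBits (wd y) := by
    intro x k hk
    rw [scanTable_getD _ _ _ _ _ hk]
    rfl
  have henum : ∀ x, ∃ y : Fin (S x).ncard → ρ, StrictMono (fun i => key (y i)) ∧
      Set.range y = S x ∧ ∀ k : Fin (S x).ncard, (k : ℕ) < r.n * P.blockSize ∧
        dec ((r₁.val x).getD k 0) = some (y k) := by
    intro x
    obtain ⟨h1, h2⟩ := hx x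
    have hex : ∃ i, ¬ (i < r.n * P.blockSize ∧ (dec ((r₁.val x).getD i 0)).isSome) :=
      ⟨r.n * P.blockSize, fun h => lt_irrefl _ h.1⟩
    classical
    -- The first cell without a record. There are no gaps, so the cells before it contain the whole
    -- relation.
    obtain ⟨c, hc, hlt⟩ : ∃ c, ¬ (c < r.n * P.blockSize ∧ (dec ((r₁.val x).getD c 0)).isSome) ∧
        ∀ i < c, i < r.n * P.blockSize ∧ (dec ((r₁.val x).getD i 0)).isSome :=
      ⟨Nat.find hex, Nat.find_spec hex, fun i hi => not_not.1 (Nat.find_min hex hi)⟩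
    choose y hy using fun i : Fin c => Option.isSome_iff_exists.1 (hlt i i.2).2
    have hmono : StrictMono fun i => key (y i) := by
      intro i j hij
      obtain ⟨z, hz, hzlt⟩ := h1 j (hlt j j.2).1 i hij _ (hy j)
      rw [hy i, Option.some_inj] at hz
      rw [← hz] at hzlt
      exact hzlt
    have hrange : Set.range y = S x := by
      ext z
      rw [h2]
      constructor
      · rintro ⟨i, rfl⟩
        exact ⟨i, (hlt i i.2).1, hy i⟩
      · rintro ⟨i, hi, hiz⟩
        have hic : i < c := by
          by_contra hci
          rcases (not_lt.1 hci).eq_or_lt with rfl | hci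
          · exact hc ⟨hi, by rw [hiz]; rfl⟩
          · obtain ⟨z', hz', -⟩ := h1 i hi c hci _ hiz
            exact hc ⟨hci.trans hi, by rw [hz']; rfl⟩
        refine ⟨⟨i, hic⟩, ?_⟩
        have := hy ⟨i, hic⟩
        rw [hiz, Option.some_inj] at this
        exact this.symm
    obtain rfl : c = (S x).ncard := by
      have hinj : Function.Injective y := fun i j hij => hmono.injective (congrArg key hij)
      rw [← hrange, ← Set.image_univ, Set.ncard_image_of_injective _ hinj, Set.ncard_univ,
        Nat.card_fin]
    exact ⟨y, hmono, hrange, fun k => ⟨(hlt k k.2).1, hy k⟩⟩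
  have fin : ∀ (r' : RawTable P X) (T' : ℝ), RawReach ld R {r'} T' → r'.n = r.n →
      T' + (4 * r.n + 2) ≤ T + 20 * u * n → (∀ x, ∀ k < r.n * P.blockSize, (r'.val x).getD k 0 =
      (dec ((r₁.val x).getD k 0)).elim 0 fun y => BitVec.ofNat P.wordBits (wd y)) →
      ∃ (p : OEMProgram P) (μ : PMF (List IORequest)), (p.length : ℝ) ≤ T + 20 * u * n ∧
      ∀ x, (p.run (fun _ => 0) (ld x)).map Prod.fst = μ ∧
        ∃ y : Fin (S x).ncard → ρ, StrictMono (fun i => key (y i)) ∧ Set.range y = S x ∧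
        ∀ o ∈ (p.run (fun _ => 0) (ld x)).support, ∀ k : Fin (S x).ncard,
          o.2 k = BitVec.ofNat P.wordBits (wd (y k)) := by
    intro r' T' hr' hn' hT' hcell
    obtain ⟨p, μ, hp, hx⟩ := hr'.output (Set.mem_singleton r') (by omega)
    rw [hn'] at hp
    refine ⟨p, μ, hp.trans hT', fun x => ⟨(hx x).1, ?_⟩⟩
    obtain ⟨y, hy1, hy2, hy3⟩ := henum x
    refine ⟨y, hy1, hy2, fun o ho k => ?_⟩
    rw [(hx x).2 o ho k (by rw [hn']; exact (hy3 k).1), hcell x k (hy3 k).1, (hy3 k).2]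
    rfl
  have hrn' : (r.n : ℝ) ≤ n := by exact_mod_cast hrn
  rcases Nat.eq_zero_or_pos r.n with h0 | h0
  -- A table without blocks represents the empty relation, and nothing has to be written.
  · obtain ⟨p, μ, α, φ, hp, -⟩ := hΓ
    refine ⟨[], PMF.pure [], ?_, fun x => ⟨by simp [OEMProgram.run, PMF.pure_map], ?_⟩⟩
    · have : (0 : ℝ) ≤ T := le_trans (Nat.cast_nonneg _) hp
      have : (0 : ℝ) ≤ n := Nat.cast_nonneg _
      simp only [List.length_nil, Nat.cast_zero]
      positivity
    · obtain ⟨y, hy1, hy2, hy3⟩ := henum x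
      refine ⟨y, hy1, hy2, fun o ho k => ?_⟩
      have := (hy3 k).1
      rw [h0, Nat.zero_mul] at this
      exact absurd this (Nat.not_lt_zero _)
  · refine fin (scanTable f 0 r.n r₁) _ (hR₂.mono (Set.singleton_subset_iff.2
      (Set.mem_insert _ _)) le_rfl) rfl ?_ hcell
    have h1 : (1 : ℝ) ≤ r.n := by exact_mod_cast h0
    nlinarith

end InputOutput

/-! ### Minimum spanning trees -/

section SpanningTree

/-- Weighted edges, ordered by weight. -/
abbrev Ed (V U : ℕ) : Type := Fin U ×ₗ Fin V ×ₗ Fin V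

namespace Ed

variable {V U : ℕ}

def src (e : Ed V U) : Fin V := (ofLex (ofLex e).2).1

def dst (e : Ed V U) : Fin V := (ofLex (ofLex e).2).2

def wt (e : Ed V U) : ℕ := (ofLex e).1

def ends (e : Ed V U) : Sym2 (Fin V) := s(e.src, e.dst)

/-- The graph with a given set of edges. -/
def gr (A : Set (Ed V U)) : SimpleGraph (Fin V) := SimpleGraph.fromEdgeSet (ends '' A)

/-- Connection by the edges in `A`. -/
def Conn (A : Set (Ed V U)) (a b : Fin V) : Prop := (gr A).Reachable a b

theorem wt_mono {e f : Ed V U} (h : e ≤ f) : e.wt ≤ f.wt := by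
  rcases (Prod.Lex.le_iff.1 h) with h | h
  · exact Nat.le_of_lt h
  · exact le_of_eq (congrArg Fin.val h.1)

theorem Conn.refl (A : Set (Ed V U)) (a : Fin V) : Conn A a a := SimpleGraph.Reachable.refl a

theorem Conn.symm {A : Set (Ed V U)} {a b : Fin V} (h : Conn A a b) : Conn A b a :=
  SimpleGraph.Reachable.symm h

theorem Conn.trans {A : Set (Ed V U)} {a b c : Fin V} (h : Conn A a b) (h' : Conn A b c) :
    Conn A a c := SimpleGraph.Reachable.trans h h'

theorem conn_equivalence (A : Set (Ed V U)) : Equivalence (Conn A) :=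
  ⟨Conn.refl A, Conn.symm, Conn.trans⟩

theorem conn_of_mem {A : Set (Ed V U)} {e : Ed V U} (h : e ∈ A) : Conn A e.src e.dst := by
  by_cases hne : e.src = e.dst
  · rw [hne]
    exact Conn.refl _ _
  · exact SimpleGraph.Adj.reachable ((SimpleGraph.fromEdgeSet_adj _).2 ⟨⟨e, h, rfl⟩, hne⟩)

/-- Connection is the least equivalence relation that contains the pairs of ends. -/
theorem Conn.lift {A : Set (Ed V U)} {a b : Fin V} (h : Conn A a b) {r : Fin V → Fin V → Prop}
    (hr : Equivalence r) (hA : ∀ e ∈ A, r e.src e.dst) : r a b := by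
  rw [Conn, SimpleGraph.reachable_iff_reflTransGen] at h
  induction h with
  | refl => exact hr.refl _
  | tail _ hadj ih =>
    refine hr.trans ih ?_
    obtain ⟨⟨e, he, hs⟩, -⟩ := (SimpleGraph.fromEdgeSet_adj _).1 hadj
    rw [ends, Sym2.eq_iff] at hs
    rcases hs with ⟨rfl, rfl⟩ | ⟨rfl, rfl⟩
    exacts [hA e he, hr.symm (hA e he)]

theorem Conn.of_forall {A B : Set (Ed V U)} {a b : Fin V} (h : Conn A a b)
    (hA : ∀ e ∈ A, Conn B e.src e.dst) : Conn B a b := h.lift (conn_equivalence B) hA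

theorem Conn.mono {A B : Set (Ed V U)} {a b : Fin V} (h : Conn A a b) (hAB : A ⊆ B) : Conn B a b :=
  h.of_forall fun _ he => conn_of_mem (hAB he)

/-- A property that the edges preserve holds on connected components. -/
theorem Conn.invariant {A : Set (Ed V U)} {a b : Fin V} (h : Conn A a b) {W : Fin V → Prop}
    (hA : ∀ e ∈ A, (W e.src ↔ W e.dst)) : W a ↔ W b :=
  h.lift (r := fun a b => (W a ↔ W b)) ⟨fun _ => Iff.rfl, Iff.symm, Iff.trans⟩ hA

/-- The edges of the minimum spanning forest. -/
def msf (𝓔 : Set (Ed V U)) : Set (Ed V U) := {e | e ∈ 𝓔 ∧ ¬ Conn {e' | e' ∈ 𝓔 ∧ e' < e} e.src e.dst}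

variable {𝓔 : Set (Ed V U)}

theorem msf_subset : msf 𝓔 ⊆ 𝓔 := fun _ h => h.1

/-- This is Kruskal's argument: an edge outside `msf` is bypassed by smaller edges, and these, by
induction, by edges of `msf` that are no larger. The ends take part in the order of the edges, so
there are no ties. -/
theorem conn_msf_le {e : Ed V U} (he : e ∈ 𝓔) :
    Conn {e' | e' ∈ msf 𝓔 ∧ e' ≤ e} e.src e.dst := by
  induction e using WellFoundedLT.induction with
  | _ e ih =>
    by_cases h : e ∈ msf 𝓔
    · exact conn_of_mem ⟨h, le_rfl⟩
    · have h1 : Conn {e' | e' ∈ 𝓔 ∧ e' < e} e.src e.dst := by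
        by_contra h2
        exact h ⟨he, h2⟩
      exact h1.of_forall fun e' he' => (ih e' he'.2 he'.1).mono
        fun f hf => ⟨hf.1, hf.2.trans he'.2.le⟩

theorem conn_msf_lt {e : Ed V U} (he : e ∈ 𝓔) (h : e ∉ msf 𝓔) :
    Conn {e' | e' ∈ msf 𝓔 ∧ e' < e} e.src e.dst := by
  have h1 : Conn {e' | e' ∈ 𝓔 ∧ e' < e} e.src e.dst := by
    by_contra h2
    exact h ⟨he, h2⟩
  exact h1.of_forall fun e' he' => (conn_msf_le he'.1).mono fun f hf => ⟨hf.1, hf.2.trans_lt he'.2⟩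

theorem Conn.msf {a b : Fin V} (h : Conn 𝓔 a b) : Conn (msf 𝓔) a b :=
  h.of_forall fun _ he => (conn_msf_le he).mono fun _ hf => hf.1

/-- The lightest edge across a cut belongs to the minimum spanning forest. -/
theorem mem_msf_of_cut (W : Fin V → Prop) {e : Ed V U} (he : e ∈ 𝓔) (hW : ¬ (W e.src ↔ W e.dst))
    (hmin : ∀ f ∈ 𝓔, ¬ (W f.src ↔ W f.dst) → e ≤ f) : e ∈ msf 𝓔 :=
  ⟨he, fun h => hW (h.invariant fun f hf => by
    by_contra hc
    exact not_lt.2 (hmin f hf.1 hc) hf.2)⟩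

/-- The edges have distinct ends, and different edges have different ends. -/
def Simple (𝓔 : Set (Ed V U)) : Prop :=
  (∀ e ∈ 𝓔, e.src ≠ e.dst) ∧ Set.InjOn ends 𝓔

theorem Simple.mono {A : Set (Ed V U)} (h : Simple 𝓔) (hA : A ⊆ 𝓔) : Simple A :=
  ⟨fun e he => h.1 e (hA he), h.2.mono hA⟩

theorem edgeSet_gr (h : Simple 𝓔) : (gr 𝓔).edgeSet = ends '' 𝓔 := by
  rw [gr, SimpleGraph.edgeSet_fromEdgeSet, sdiff_eq_left, Set.disjoint_left]
  rintro _ ⟨e, he, rfl⟩ hd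
  exact h.1 e he (by simpa [ends] using hd)

theorem card_edgeSet_gr (h : Simple 𝓔) : Nat.card (gr 𝓔).edgeSet = 𝓔.ncard := by
  rw [edgeSet_gr h, Nat.card_coe_set_eq, h.2.ncard_image]

theorem isTree_iff (h : Simple 𝓔) : (gr 𝓔).IsTree ↔ (gr 𝓔).Connected ∧ 𝓔.ncard + 1 = V := by
  rw [SimpleGraph.isTree_iff_connected_and_card, card_edgeSet_gr h, Nat.card_fin]

theorem card_le_of_connected (h : Simple 𝓔) (hc : (gr 𝓔).Connected) : V ≤ 𝓔.ncard + 1 := by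
  have := hc.card_vert_le_card_edgeSet_add_one
  rwa [card_edgeSet_gr h, Nat.card_fin] at this

/-- If the edges are added in increasing order, each one joins two components and closes no cycle.
-/
theorem isAcyclic_of_forall (A : Finset (Ed V U))
    (hA : ∀ e ∈ A, ¬ Conn {e' | e' ∈ A ∧ e' < e} e.src e.dst) :
    (gr (A : Set (Ed V U))).IsAcyclic := by
  classical
  induction A using Finset.induction_on_max with
  | empty => simp [gr]
  | insert e A hmax ih =>
    have h1 : {e' | e' ∈ insert e A ∧ e' < e} = (A : Set (Ed V U)) := by
      ext f
      simp only [Finset.mem_insert, Set.mem_ofPred_eq, Finset.mem_coe]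
      constructor
      · rintro ⟨rfl | h, h'⟩
        · exact absurd h' (lt_irrefl _)
        · exact h
      · exact fun h => ⟨Or.inr h, hmax f h⟩
    have h2 := hA e (Finset.mem_insert_self _ _)
    rw [h1] at h2
    have h3 := ih fun f hf h => hA f (Finset.mem_insert_of_mem hf)
      (h.mono fun g hg => ⟨Finset.mem_insert_of_mem hg.1, hg.2⟩)
    have h4 : gr ((insert e A : Finset (Ed V U)) : Set (Ed V U)) =
        gr (A : Set (Ed V U)) ⊔ SimpleGraph.edge e.src e.dst := by
      rw [Finset.coe_insert, gr, gr, Set.image_insert_eq, SimpleGraph.edge,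
        ← SimpleGraph.fromEdgeSet_union, Set.union_comm, ← Set.insert_eq]
      rfl
    rw [h4]
    exact h3.sup_edge_of_not_reachable h2

theorem isTree_msf (hc : (gr 𝓔).Connected) : (gr (msf 𝓔)).IsTree := by
  classical
  have := hc.nonempty
  refine ⟨⟨fun a b => (show Conn 𝓔 a b from hc.preconnected a b).msf⟩, ?_⟩
  have h := isAcyclic_of_forall (Set.toFinite (msf 𝓔)).toFinset fun e he h => by
    rw [Set.Finite.mem_toFinset] at he
    exact he.2 (h.mono fun f hf => ⟨msf_subset ((Set.Finite.mem_toFinset _).1 hf.1), hf.2⟩)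
  rwa [Set.Finite.coe_toFinset] at h

/-- A connected part of the minimum spanning tree is all of it. -/
theorem eq_msf {O : Set (Ed V U)} (hs : Simple 𝓔) (hc : (gr 𝓔).Connected) (hO : O ⊆ msf 𝓔)
    (hconn : ∀ a b, Conn O a b) : O = msf 𝓔 := by
  have h1 := ((isTree_iff (hs.mono msf_subset)).1 (isTree_msf hc)).2
  have hne := hc.nonempty
  have h2 := card_le_of_connected (hs.mono (hO.trans msf_subset)) ⟨hconn⟩
  exact Set.eq_of_subset_of_ncard_le hO (by omega) (Set.toFinite _)

theorem ncard_msf (hs : Simple 𝓔) (hc : (gr 𝓔).Connected) : (msf 𝓔).ncard + 1 = V :=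
  ((isTree_iff (hs.mono msf_subset)).1 (isTree_msf hc)).2

/-- Without `f` the tree falls into two sides. As `f` is not in `msf`, its ends are connected by
smaller edges of `msf`, and one of these crosses from one side to the other. -/
theorem exists_exchange (hs : Simple 𝓔) {A : Set (Ed V U)} (hA : A ⊆ 𝓔) (hT : (gr A).IsTree)
    {f : Ed V U} (hf : f ∈ A) (hfm : f ∉ msf 𝓔) :
    ∃ g ∈ msf 𝓔, g ∉ A ∧ g < f ∧ (gr (insert g (A \ {f}))).IsTree := by
  obtain ⟨hc, hcard⟩ := (isTree_iff (hs.mono hA)).1 hT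
  have hne := hc.nonempty
  have hcard' : (A \ {f}).ncard + 1 = A.ncard := Set.ncard_sdiff_singleton_add_one hf (Set.toFinite _)
  -- Otherwise the remaining edges would connect all vertices, but there are only `V - 2` of them.
  have hbridge : ¬ Conn (A \ {f}) f.src f.dst := by
    intro h
    have h1 : (gr (A \ {f})).Connected := ⟨fun a b =>
      (show Conn A a b from hc.preconnected a b).of_forall fun e he => by
        by_cases hef : e = f
        · rw [hef]; exact h
        · exact conn_of_mem ⟨he, hef⟩⟩
    have := card_le_of_connected (hs.mono (Set.sdiff_subset.trans hA)) h1
    omega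
  have hside : ∀ v, Conn (A \ {f}) f.src v ∨ Conn (A \ {f}) f.dst v := by
    intro v
    have h1 : Conn A f.src v := hc.preconnected _ _
    refine (h1.invariant (W := fun v => Conn (A \ {f}) f.src v ∨ Conn (A \ {f}) f.dst v) ?_).1
      (Or.inl (Conn.refl _ _))
    intro e he
    by_cases hef : e = f
    · rw [hef]
      exact ⟨fun _ => Or.inr (Conn.refl _ _), fun _ => Or.inl (Conn.refl _ _)⟩
    · have h2 : Conn (A \ {f}) e.src e.dst := conn_of_mem ⟨he, hef⟩
      exact ⟨Or.imp (fun h => h.trans h2) fun h => h.trans h2,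
        Or.imp (fun h => h.trans h2.symm) fun h => h.trans h2.symm⟩
  obtain ⟨g, ⟨hg, hgf⟩, hcross⟩ : ∃ g ∈ {e' | e' ∈ msf 𝓔 ∧ e' < f},
      ¬ (Conn (A \ {f}) f.src g.src ↔ Conn (A \ {f}) f.src g.dst) := by
    by_contra hno
    push Not at hno
    exact hbridge (((conn_msf_lt (hA hf) hfm).invariant
      (W := fun v => Conn (A \ {f}) f.src v) hno).1 (Conn.refl _ _))
  have hgA : g ∉ A \ {f} := fun h => hcross
    ⟨fun h' => h'.trans (conn_of_mem h), fun h' => h'.trans (conn_of_mem h).symm⟩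
  have hgA' : g ∉ A := fun h => hgA ⟨h, hgf.ne⟩
  refine ⟨g, hg, hgA', hgf, (isTree_iff (hs.mono ?_)).2 ⟨⟨fun a b => ?_⟩, ?_⟩⟩
  · exact Set.insert_subset (msf_subset hg) (Set.sdiff_subset.trans hA)
  · have hg' : Conn (insert g (A \ {f})) g.src g.dst := conn_of_mem (Set.mem_insert _ _)
    have hmono : ∀ {a b}, Conn (A \ {f}) a b → Conn (insert g (A \ {f})) a b :=
      fun h => h.mono (Set.subset_insert _ _)
    have hfc : Conn (insert g (A \ {f})) f.src f.dst := by
      by_cases h1 : Conn (A \ {f}) f.src g.src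
      · have h2 : ¬ Conn (A \ {f}) f.src g.dst := fun h2 => hcross ⟨fun _ => h2, fun _ => h1⟩
        exact ((hmono h1).trans hg').trans (hmono ((hside _).resolve_left h2)).symm
      · have h2 : Conn (A \ {f}) f.src g.dst := by
          by_contra h2
          exact hcross ⟨fun h => absurd h h1, fun h => absurd h h2⟩
        exact ((hmono h2).trans hg'.symm).trans (hmono ((hside _).resolve_left h1)).symm
    refine (show Conn A a b from hc.preconnected a b).of_forall fun e he => ?_
    by_cases hef : e = f
    · rw [hef]; exact hfc
    · exact hmono (conn_of_mem ⟨he, hef⟩)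
  · rw [Set.ncard_insert_of_notMem hgA (Set.toFinite _)]
    omega

/-- Exchanging an edge outside `msf` does not increase the weight and brings the tree closer to
`msf`. A spanning tree inside `msf` is equal to it. -/
theorem msf_minimal (hs : Simple 𝓔) (hc : (gr 𝓔).Connected) (A₀ : Finset (Ed V U))
    (hA₀ : (A₀ : Set (Ed V U)) = msf 𝓔) (A : Finset (Ed V U)) (hA : (A : Set (Ed V U)) ⊆ 𝓔)
    (hT : (gr (A : Set (Ed V U))).IsTree) : ∑ e ∈ A₀, e.wt ≤ ∑ e ∈ A, e.wt := by
  classical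
  induction hk : (A \ A₀).card using Nat.strong_induction_on generalizing A with
  | _ k ih =>
    by_cases hsub : (A : Set (Ed V U)) ⊆ msf 𝓔
    · have h1 := eq_msf hs hc hsub fun a b => hT.1.preconnected a b
      rw [← hA₀, Finset.coe_inj] at h1
      rw [h1]
    · obtain ⟨f, hf, hfm⟩ := Set.not_subset.1 hsub
      obtain ⟨g, hg, hgA, hgf, hT'⟩ := exists_exchange hs hA hT hf hfm
      have hgA₀ : g ∈ A₀ := by rw [← Finset.mem_coe, hA₀]; exact hg
      have hfA₀ : f ∉ A₀ := by rw [← Finset.mem_coe, hA₀]; exact hfm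
      have hcoe : ((insert g (A.erase f) : Finset (Ed V U)) : Set (Ed V U)) =
          insert g ((A : Set (Ed V U)) \ {f}) := by simp
      rw [← hcoe] at hT'
      have h1 := ih _ ?_ (insert g (A.erase f)) ?_ hT' rfl
      · refine h1.trans ?_
        rw [Finset.sum_insert fun h => hgA (Finset.mem_of_mem_erase h), ← Finset.add_sum_erase A _ hf]
        exact Nat.add_le_add_right (wt_mono hgf.le) _
      · rw [← hk]
        refine Finset.card_lt_card ?_
        rw [Finset.ssubset_iff_of_subset]
        · exact ⟨f, by simp [hfA₀, Finset.mem_coe.1 hf], by simp [hgf.ne']⟩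
        · intro e he
          simp only [Finset.mem_sdiff, Finset.mem_insert, Finset.mem_erase] at he ⊢
          rcases he with ⟨rfl | he, he'⟩
          · exact absurd hgA₀ he'
          · exact ⟨he.2, he'⟩
      · rw [hcoe]
        exact Set.insert_subset (msf_subset hg) (Set.sdiff_subset.trans hA)

end Ed

end SpanningTree

/-! ### The frame of the algorithms -/

section Frame

namespace EdgeArray

variable {V E U : ℕ} (X : EdgeArray V E U)

/-- An edge of the array. -/
def ed (i : Fin E) : Ed V U := toLex (⟨X.wt i, X.wt_lt i⟩, toLex (X.src i, X.dst i))

/-- The set of edges. -/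
def edges : Set (Ed V U) := Set.range X.ed

theorem ed_injective : Function.Injective X.ed := fun _ _ h =>
  X.edge_injective (congrArg Ed.ends h)

theorem simple_edges : Ed.Simple X.edges := by
  constructor
  · rintro _ ⟨i, rfl⟩
    exact X.src_ne_dst i
  · rintro _ ⟨i, rfl⟩ _ ⟨j, rfl⟩ h
    exact congrArg X.ed (X.edge_injective h)

theorem subgraph_eq (A : Set (Fin E)) : X.subgraph A = Ed.gr (X.ed '' A) := by
  rw [subgraph, Ed.gr, Set.image_image]
  rfl

theorem graph_eq : X.graph = Ed.gr X.edges := by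
  rw [graph, subgraph_eq, Set.image_univ, edges]

theorem ncard_edges : X.edges.ncard = E := by
  rw [edges, ← Set.image_univ, X.ed_injective.injOn.ncard_image, Set.ncard_univ, Nat.card_fin]

theorem holdsMinSpanningTree_of {P : OEMParams} (hc : X.graph.Connected) (m : P.Server)
    (hw : V + E + U ≤ 2 ^ P.wordBits) (f : Fin (V - 1) → Ed V U) (hf : Function.Injective f)
    (hr : Set.range f = Ed.msf X.edges)
    (hm : ∀ k : Fin (V - 1), m (3 * k) = BitVec.ofNat _ ((f k).src : ℕ) ∧
      m (3 * k + 1) = BitVec.ofNat _ ((f k).dst : ℕ) ∧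
      m (3 * k + 2) = BitVec.ofNat _ (f k).wt) : X.HoldsMinSpanningTree m := by
  classical
  have hc' : (Ed.gr X.edges).Connected := by rwa [← graph_eq]
  have hmem : ∀ k, ∃ i, X.ed i = f k := fun k =>
    Ed.msf_subset (hr ▸ Set.mem_range_self k : f k ∈ Ed.msf X.edges)
  choose g hg using hmem
  have hginj : Function.Injective g := fun a b h => hf (by rw [← hg, ← hg, h])
  have himg : ∀ A : Finset (Fin E), ∑ i ∈ A, X.wt i =
      ∑ e ∈ A.map ⟨X.ed, X.ed_injective⟩, e.wt := fun A => by
    rw [Finset.sum_map]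
    rfl
  have hcoe : ∀ A : Finset (Fin E), ((A.map ⟨X.ed, X.ed_injective⟩ : Finset (Ed V U)) :
      Set (Ed V U)) = X.ed '' A := fun A => by simp
  have hA₀ : X.ed '' ((Finset.univ.map ⟨g, hginj⟩ : Finset (Fin E)) : Set (Fin E)) =
      Ed.msf X.edges := by
    rw [← hr, Finset.coe_map, Finset.coe_univ, Set.image_univ, ← Set.range_comp]
    exact congrArg Set.range (funext hg)
  refine ⟨⟨g, hginj⟩, ⟨?_, fun A' hA' => ?_⟩, fun k => ?_⟩
  · rw [subgraph_eq, hA₀]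
    exact Ed.isTree_msf hc'
  · rw [himg, himg]
    rw [subgraph_eq, ← hcoe] at hA'
    refine Ed.msf_minimal X.simple_edges hc' _ ?_ _ ?_ hA'
    · rw [hcoe, hA₀]
    · rw [hcoe]
      exact Set.image_subset_range _ _
  · obtain ⟨h1, h2, h3⟩ := hm k
    have hlt : ∀ a, a < V + E + U → (BitVec.ofNat P.wordBits a).toNat = a := fun a ha => by
      rw [BitVec.toNat_ofNat, Nat.mod_eq_of_lt (ha.trans_le hw)]
    have hU := X.wt_lt (g k)
    rw [h1, h2, h3, hlt _ (by have := (f k).src.2; omega), hlt _ (by have := (f k).dst.2; omega)]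
    rw [← hg k, hlt _ (by change X.wt _ < _; omega)]
    exact ⟨rfl, rfl, rfl⟩

end EdgeArray

/-- The inputs of the algorithms. -/
abbrev GraphInput (V E U : ℕ) (𝓕 : Set (SimpleGraph (Fin V))) : Type :=
  {X : EdgeArray V E U // X.graph.Connected ∧ X.graph ∈ 𝓕}

variable {P : OEMParams} {V E U : ℕ} {𝓕 : Set (SimpleGraph (Fin V))} {R : ℕ}
  {𝓢 : Set (Tbl (GraphInput V E U 𝓕))} {T u : ℝ} {N Q : ℕ}

theorem reach_edges (hE : AlgEnv P u N Q) (hV : V ≤ Q) (hU : U ≤ Q) (hR : 3 * (E ⌈/⌉ P.blockSize) ≤ R) :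
    Reach (P := P) (X := GraphInput V E U 𝓕) (fun x => x.1.load) R
      {⟨Ed V U, 3 * (E ⌈/⌉ P.blockSize), fun x => x.1.edges⟩} (7 * u * (E ⌈/⌉ P.blockSize : ℕ) + 1) := by
  have h1 := reach_input (X := GraphInput V E U 𝓕) hE (fun x => x.1.load) R E (E ⌈/⌉ P.blockSize) hR
    (by rw [Nat.mul_comm]; exact (ceilDiv_le_iff_le_mul P.blockSize_pos).1 le_rfl)
    (fun x i => (Fin.castLE hV (x.1.src i), Fin.castLE hV (x.1.dst i),
      Fin.castLE hU ⟨x.1.wt i, x.1.wt_lt i⟩)) (fun x a => rfl)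
  have h2 := h1.filterMap (Set.mem_singleton _) (ρ' := Ed V U) fun t =>
    if h : (t.1 : ℕ) < V ∧ (t.2.1 : ℕ) < V ∧ (t.2.2 : ℕ) < U then
      some (toLex (⟨t.2.2, h.2.2⟩, toLex (⟨t.1, h.1⟩, ⟨t.2.1, h.2.1⟩))) else none
  refine (h2.congr (Set.mem_insert _ _) le_rfl (S' := fun x => x.1.edges) fun x => ?_).mono
    (by simp) le_rfl
  ext e
  constructor
  · rintro ⟨_, ⟨i, rfl⟩, he⟩
    split_ifs at he with h
    rw [Option.some_inj] at he
    exact ⟨i, he⟩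
  · rintro ⟨i, rfl⟩
    refine ⟨_, ⟨i, rfl⟩, ?_⟩
    rw [dif_pos ⟨(x.1.src i).2, (x.1.dst i).2, x.1.wt_lt i⟩]
    rfl

/-- Each edge of the tree is tripled by an index `0`, `1`, `2`, which selects an end or the weight.
The lexicographic order of the tripled edges is the order of the cells of the output. -/
theorem mstConstructible_of_reach (hE : AlgEnv P u N Q) (hV : V ≤ Q) (hU : U ≤ Q)
    (hw : V + E + U ≤ 2 ^ P.wordBits)
    (n : ℕ) (hN : 3 * n ≤ N) (hR : 3 * n ≤ R)
    (h : Reach (P := P) (X := GraphInput V E U 𝓕) (fun x => x.1.load) R 𝓢 T)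
    (hS : ⟨Ed V U, n, fun x => Ed.msf x.1.edges⟩ ∈ 𝓢) :
    MSTConstructible P V E U 𝓕 (ENNReal.ofReal (T + 60 * u * n)) := by
  have : Fact (V ≤ Q) := ⟨hV⟩
  have : Fact (U ≤ Q) := ⟨hU⟩
  have : SmallType Q (Fin 3) 2 := SmallType.of_card (by
    have := Nat.pow_le_pow_left hE.two_le 2
    simp only [Nat.card_fin]
    omega)
  have h1 := h.filterMap hS (fun e => some (e, (0 : Fin 3)))
  have h2 := h1.filterMap (Set.mem_insert_of_mem _ hS) (fun e => some (e, (1 : Fin 3)))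
  have h3 := h2.filterMap (Set.mem_insert_of_mem _ (Set.mem_insert_of_mem _ hS))
    (fun e => some (e, (2 : Fin 3)))
  have h4 := h3.union (Set.mem_insert_of_mem _ (Set.mem_insert_of_mem _ (Set.mem_insert _ _)))
    (Set.mem_insert_of_mem _ (Set.mem_insert _ _))
  have h5 := h4.union (Set.mem_insert _ _) (Set.mem_insert_of_mem _ (Set.mem_insert _ _))
  have h6 := h5.congr (n' := 3 * n) (S' := fun x => Ed.msf x.1.edges ×ˢ (Set.univ : Set (Fin 3)))
    (Set.mem_insert _ _) (by omega) fun x => by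
      ext ⟨e, i⟩
      simp only [Set.mem_union, Set.mem_ofPred_eq, Option.some_inj, Prod.mk.injEq, Set.mem_prod,
        Set.mem_univ, and_true]
      constructor
      · rintro ((⟨y, hy, rfl, -⟩ | ⟨y, hy, rfl, -⟩) | ⟨y, hy, rfl, -⟩) <;> exact hy
      · intro he
        fin_cases i
        exacts [Or.inl (Or.inl ⟨e, he, rfl, rfl⟩), Or.inl (Or.inr ⟨e, he, rfl, rfl⟩),
          Or.inr ⟨e, he, rfl, rfl⟩]
  obtain ⟨p, μ, hp, hx⟩ := h6.output hE (Set.mem_insert _ _) hN hR (key := fun q => toLex q)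
    toLex.injective (fun q => if q.2 = 0 then (q.1.src : ℕ) else if q.2 = 1 then (q.1.dst : ℕ)
      else q.1.wt)
  refine ⟨p, ⟨fun x hxs o ho => ?_, fun x hxs y hys => ?_⟩, ?_⟩
  · obtain ⟨-, y, hy, hyr, hyo⟩ := hx ⟨x, hxs⟩
    have hc' : (Ed.gr x.edges).Connected := by rw [← x.graph_eq]; exact hxs.1
    have hcard := Ed.ncard_msf x.simple_edges hc'
    obtain ⟨f, hf, hfr⟩ : ∃ f : Fin (V - 1) → Ed V U, StrictMono f ∧
        Set.range f = Ed.msf x.edges := by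
      classical
      have hfin : Set.Finite (Ed.msf x.edges) := Set.toFinite _
      have hcd : hfin.toFinset.card = V - 1 := by
        rw [← Set.ncard_eq_toFinset_card _ hfin]; omega
      refine ⟨hfin.toFinset.orderEmbOfFin hcd, OrderEmbedding.strictMono _, ?_⟩
      rw [Finset.range_orderEmbOfFin, Set.Finite.coe_toFinset]
    have hn3 : (Ed.msf x.edges ×ˢ (Set.univ : Set (Fin 3))).ncard = 3 * (V - 1) := by
      rw [Set.ncard_prod, Set.ncard_univ, Nat.card_fin]; omega
    set z : Fin (3 * (V - 1)) → Ed V U ×ₗ Fin 3 := fun k =>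
      toLex (f ⟨k / 3, by omega⟩, ⟨k % 3, by omega⟩) with hz
    have hzmono : StrictMono z := by
      intro a b hab
      rw [hz, Prod.Lex.lt_iff]
      have hab' : (a : ℕ) < b := hab
      rcases Nat.lt_or_ge ((a : ℕ) / 3) (b / 3) with hlt | hge
      · exact Or.inl (hf hlt)
      · refine Or.inr ⟨congrArg f (Fin.ext ?_), ?_⟩
        · change (a : ℕ) / 3 = b / 3
          omega
        · change (a : ℕ) % 3 < b % 3
          omega
    -- Two strictly increasing enumerations of the same set agree.
    have hkey : ∀ k : Fin (3 * (V - 1)), toLex (y (Fin.cast hn3.symm k)) = z k := by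
      refine congrFun ((StrictMono.range_inj (f := fun k => toLex (y (Fin.cast hn3.symm k)))
        (fun a b hab => hy hab) hzmono).1 ?_)
      ext q
      constructor
      · rintro ⟨k, rfl⟩
        have h7 : y (Fin.cast hn3.symm k) ∈ Ed.msf x.edges ×ˢ (Set.univ : Set (Fin 3)) :=
          hyr.subset (Set.mem_range_self _)
        obtain ⟨j, hj⟩ := hfr.symm.subset h7.1
        refine ⟨⟨3 * j + (y (Fin.cast hn3.symm k)).2, by omega⟩, ?_⟩
        rw [hz]
        refine congrArg toLex (Prod.ext ?_ (Fin.ext ?_))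
        · rw [← hj]
          refine congrArg f (Fin.ext ?_)
          change (3 * (j : ℕ) + (y (Fin.cast hn3.symm k)).2) / 3 = j
          omega
        · change (3 * (j : ℕ) + (y (Fin.cast hn3.symm k)).2) % 3 = _
          omega
      · rintro ⟨k, rfl⟩
        have h7 : (ofLex (z k)) ∈ Ed.msf x.edges ×ˢ (Set.univ : Set (Fin 3)) :=
          ⟨hfr ▸ Set.mem_range_self _, Set.mem_univ _⟩
        rw [← hyr] at h7
        obtain ⟨j, hj⟩ := h7
        refine ⟨Fin.cast hn3 j, ?_⟩
        change toLex (y j) = z k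
        rw [hj]
        rfl
    refine x.holdsMinSpanningTree_of hxs.1 _ hw f hf.injective hfr fun k => ?_
    have hcell : ∀ i : Fin 3, o.2 (3 * k + i) = BitVec.ofNat P.wordBits
        (if i = 0 then ((f k).src : ℕ) else if i = 1 then ((f k).dst : ℕ) else (f k).wt) := by
      intro i
      have h8 := hyo o ho (Fin.cast hn3.symm ⟨3 * k + i, by omega⟩)
      have h9 : y (Fin.cast hn3.symm ⟨3 * k + i, by omega⟩) = (f k, i) := by
        have := hkey ⟨3 * k + i, by omega⟩
        refine toLex.injective (this.trans ?_)
        rw [hz]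
        refine congrArg toLex (Prod.ext (congrArg f (Fin.ext ?_)) (Fin.ext ?_))
        · change (3 * (k : ℕ) + i) / 3 = k
          omega
        · change (3 * (k : ℕ) + i) % 3 = i
          omega
      rw [h9] at h8
      exact h8
    exact ⟨hcell 0, hcell 1, hcell 2⟩
  · rw [(hx ⟨x, hxs⟩).1, (hx ⟨y, hys⟩).1]
  · rw [← ENNReal.ofReal_natCast]
    refine ENNReal.ofReal_le_ofReal (hp.trans ?_)
    push_cast
    linarith

end Frame

/-! ### Breaking the symmetry of the picks -/

section Stars

/-- A small pairwise independent family of sets. -/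
theorem exists_seeds (κ : Type) [Finite κ] [Nontrivial κ] :
    ∃ (q : ℕ) (F : Fin q → κ → Prop), 0 < q ∧ q ≤ 4 * Nat.card κ ∧
      (∀ c c', c ≠ c' → q ≤ 4 * {s | F s c ∧ ¬ F s c'}.ncard) := by
  classical
  have := Fintype.ofFinite κ
  set k := Nat.clog 2 (Nat.card κ) with hk
  have hκ : 1 < Nat.card κ := Finite.one_lt_card
  have hk1 : Nat.card κ ≤ 2 ^ k := Nat.le_pow_clog (by norm_num) _
  have hk2 : 2 ^ k ≤ 2 * Nat.card κ := by
    have hpos : k ≠ 0 := (Nat.clog_pos (by norm_num) hκ).ne'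
    have h1 := Nat.pow_pred_clog_lt_self (b := 2) (by norm_num) hκ
    rw [← hk] at h1
    obtain ⟨j, hj⟩ := Nat.exists_eq_succ_of_ne_zero hpos
    rw [hj, Nat.pred_succ] at h1
    rw [hj, Nat.pow_succ]
    omega
  obtain ⟨v⟩ : Nonempty (κ ↪ (Fin k → ZMod 2)) := by
    refine Function.Embedding.nonempty_of_card_le ?_
    rw [Fintype.card_fun, ZMod.card, Fintype.card_fin, ← Nat.card_eq_fintype_card]
    exact hk1
  -- The values of a random affine function on two different vectors over the field with two
  -- elements are independent. Here `s.2` is the constant term, and `v c` is the vector of the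
  -- colour `c`.
  set f : (Fin k → ZMod 2) × ZMod 2 → κ → ZMod 2 := fun s c => s.2 + ∑ i, s.1 i * v c i with hf
  have hcard : Fintype.card ((Fin k → ZMod 2) × ZMod 2) = 2 * 2 ^ k := by
    rw [Fintype.card_prod, Fintype.card_fun, ZMod.card, Fintype.card_fin, Nat.mul_comm]
  have e := (Fintype.equivFin ((Fin k → ZMod 2) × ZMod 2)).symm
  have main : ∀ c c', c ≠ c' → Fintype.card ((Fin k → ZMod 2) × ZMod 2) ≤
      4 * (Finset.univ.filter fun s => f s c = 1 ∧ f s c' = 0).card := by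
    intro c c' hcc
    obtain ⟨i, hi⟩ := Function.ne_iff.1 fun h => hcc (v.injective h)
    set M : ZMod 2 × ZMod 2 → ℕ := fun z => (Finset.univ.filter fun s => (f s c, f s c') = z).card
      with hM
    -- Translating the seeds by `d` is injective and shifts the pair of values by `w`.
    have hflip : ∀ (d : (Fin k → ZMod 2) × ZMod 2) (z w : ZMod 2 × ZMod 2),
        (∀ s, (f (s + d) c, f (s + d) c') = (f s c, f s c') + w) → M z ≤ M (z + w) := by
      intro d z w hd
      refine Finset.card_le_card_of_injOn (fun s => s + d) (fun s hs => ?_)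
        (add_left_injective d).injOn
      simp only [Finset.coe_filter, Finset.mem_univ, true_and, Set.mem_ofPred_eq] at hs ⊢
      rw [hd, hs]
    -- The constant term flips both values. In `h2`, coordinate `i`, where the two vectors differ,
    -- flips exactly one of them. Together these two shifts generate all shifts, so each of the four
    -- pairs of values has the same frequency.
    have h1 : ∀ z, M z ≤ M (z + (1, 1)) := fun z => hflip (0, 1) z (1, 1) fun s => by
      simp only [hf, Prod.fst_add, Prod.snd_add, add_zero, Prod.mk_add_mk, Prod.mk.injEq]
      constructor <;> ring
    have h2 : ∀ z, M z ≤ M (z + (v c i, v c' i)) := fun z =>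
      hflip (Pi.single i 1, 0) z (v c i, v c' i) fun s => by
        simp only [hf, Prod.fst_add, Prod.snd_add, add_zero, Prod.mk_add_mk,
          Pi.add_apply, add_mul, Finset.sum_add_distrib, Pi.single_apply, ite_mul, one_mul,
          zero_mul, Finset.sum_ite_eq', Finset.mem_univ, if_true, add_assoc]
    have htot : Fintype.card ((Fin k → ZMod 2) × ZMod 2) =
        M (0, 0) + M (0, 1) + M (1, 0) + M (1, 1) := by
      rw [← Finset.card_univ, Finset.card_eq_sum_card_fiberwise
        (f := fun s => (f s c, f s c')) (t := Finset.univ) (fun _ _ => Finset.mem_univ _)]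
      have huniv : (Finset.univ : Finset (ZMod 2 × ZMod 2)) = {(0, 0), (0, 1), (1, 0), (1, 1)} := by
        decide
      rw [huniv]
      rw [Finset.sum_insert (by decide), Finset.sum_insert (by decide),
        Finset.sum_insert (by decide), Finset.sum_singleton]
      simp only [hM]
      ring
    have hgoal : (Finset.univ.filter fun s => f s c = 1 ∧ f s c' = 0).card = M (1, 0) := by
      simp only [hM, Prod.mk.injEq]
    have hz : ∀ x : ZMod 2, x = 0 ∨ x = 1 := by decide
    have e11 : (1 : ZMod 2) + 1 = 0 := by decide
    have a1 := h1 (0, 0)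
    have a2 := h1 (0, 1)
    have a3 := h1 (1, 0)
    have a4 := h1 (1, 1)
    have b1 := h2 (0, 0)
    have b2 := h2 (0, 1)
    have b3 := h2 (1, 0)
    have b4 := h2 (1, 1)
    rw [hgoal, htot]
    rcases hz (v c i) with h3 | h3 <;> rcases hz (v c' i) with h4 | h4 <;> rw [h3, h4] at hi b1 b2 b3 b4
    · exact absurd rfl hi
    · simp only [Prod.mk_add_mk, zero_add, add_zero, e11] at a1 a2 a3 a4 b1 b2 b3 b4
      omega
    · simp only [Prod.mk_add_mk, zero_add, add_zero, e11] at a1 a2 a3 a4 b1 b2 b3 b4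
      omega
    · exact absurd rfl hi
  refine ⟨_, fun s c => f (e s) c = 1, Fintype.card_pos, ?_, fun c c' hcc => ?_⟩
  · rw [hcard]
    omega
  · refine (main c c' hcc).trans (Nat.mul_le_mul_left 4 ?_)
    rw [← Set.ncard_coe_finset, Finset.coe_filter]
    refine Set.ncard_le_ncard_of_injOn e.symm (fun s hs => ?_) e.symm.injective.injOn
      (Set.toFinite _)
    simp only [Finset.mem_univ, true_and, Set.mem_ofPred_eq, Equiv.apply_symm_apply] at hs ⊢
    exact ⟨hs.1, by rw [hs.2]; decide⟩

variable {V U L : ℕ}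

/-- A lightest edge at a component: the component, the component at the other end, the edge. -/
abbrev Pick (V U : ℕ) : Type := Fin V × Fin V × Ed V U

/-- The colours of the components. -/
abbrev Colour (L : ℕ) : Type := Fin L × Bool

open Classical in
/-- A position in which the binary expansions of `a` and `b` differ, and the digit of `a`. -/
noncomputable def colour [NeZero L] (a b : Fin V) : Colour L :=
  let i : Fin L := if h : ∃ i : Fin L, (a : ℕ).testBit i ≠ (b : ℕ).testBit i then h.choose else 0
  (i, (a : ℕ).testBit i)

/-- This is the device of Cole and Vishkin. If both colours name the same position, then `a` and `b`
differ in this position by the choice of the first colour, and so do the recorded digits. -/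
theorem colour_ne [NeZero L] (hL : V ≤ 2 ^ L) {a b : Fin V} (hab : a ≠ b) (c : Fin V) :
    colour (L := L) a b ≠ colour b c := by
  have h : ∃ i : Fin L, (a : ℕ).testBit i ≠ (b : ℕ).testBit i := by
    by_contra hno
    push Not at hno
    refine hab (Fin.ext (Nat.eq_of_testBit_eq fun i => ?_))
    rcases lt_or_ge i L with hi | hi
    · exact hno ⟨i, hi⟩
    · have h2 : 2 ^ L ≤ 2 ^ i := Nat.pow_le_pow_right (by norm_num) hi
      rw [Nat.testBit_lt_two_pow (by omega), Nat.testBit_lt_two_pow (by omega)]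
  intro heq
  have h1 := congrArg Prod.fst heq
  have h2 := congrArg Prod.snd heq
  simp only [colour, dif_pos h] at h1 h2
  rw [← h1] at h2
  exact h.choose_spec h2

/-- Whether a pick with the given colours at its two ends survives with the set `F s`. -/
def Good {q : ℕ} (F : Fin q → Colour L → Prop) (s : Fin q) (π : Colour L × Option (Colour L)) :
    Prop := F s π.1 ∧ ∀ c ∈ π.2, ¬ F s c

/-- The colours of the components that have a pick. -/
def colours (L : ℕ) [NeZero L] (K : Set (Pick V U)) : Set (Fin V × Colour L) :=
  {z | ∃ p ∈ K, some (p.1, colour p.1 p.2.1) = some z}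

/-- The colours at both ends of a pick. -/
noncomputable def ends (L : ℕ) [NeZero L] (K : Set (Pick V U)) (p : Pick V U) :
    Colour L × Option (Colour L) :=
  (colour p.1 p.2.1, lookup (colours L K) p.2.1)

variable {q : ℕ} [NeZero L] (F : Fin q → Colour L → Prop) (K : Set (Pick V U))

/-- The picks that survive with the set `F s`. -/
def survivors (s : Fin q) : Set (Pick V U) := {p | p ∈ K ∧ Good F s (ends L K p)}

/-- The index of a set for which most picks survive. -/
def IsBest (s : Fin q) : Prop :=
  (survivors F K s).Nonempty ∧ ∀ s', (survivors F K s').Nonempty →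
    toLex (OrderDual.toDual (survivors F K s).ncard, s) ≤
      toLex (OrderDual.toDual (survivors F K s').ncard, s')

/-- The picks that are used for contraction. -/
def hooks : Set (Pick V U) := {p | ∃ s, IsBest F K s ∧ p ∈ survivors F K s}

theorem hooks_subset : hooks F K ⊆ K := fun _ ⟨_, _, hp⟩ => hp.1

theorem IsBest.unique {s s' : Fin q} (h : IsBest F K s) (h' : IsBest F K s') : s = s' := by
  have := le_antisymm (h.2 s' h'.1) (h'.2 s h.1)
  exact congrArg (fun z => (ofLex z).2) this

variable {K}

theorem colours_functional (hK : ∀ p ∈ K, ∀ p' ∈ K, p.1 = p'.1 → p = p') (a : Fin V)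
    (c c' : Colour L) (hc : (a, c) ∈ colours L K) (hc' : (a, c') ∈ colours L K) : c = c' := by
  obtain ⟨p, hp, h⟩ := hc
  obtain ⟨p', hp', h'⟩ := hc'
  rw [Option.some_inj, Prod.mk.injEq] at h h'
  have := hK p hp p' hp' (h.1.trans h'.1.symm)
  rw [← h.2, ← h'.2, this]

/-- The component at which a hook starts has its colour in the chosen set, while the target, if it
has a colour, has it outside. So no target is the start of a hook: the hooks form stars, and a
single renaming contracts them. -/
theorem hooks_star (hK : ∀ p ∈ K, ∀ p' ∈ K, p.1 = p'.1 → p = p') {p p' : Pick V U}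
    (hp : p ∈ hooks F K) (hp' : p' ∈ hooks F K) : p.2.1 ≠ p'.1 := by
  intro heq
  obtain ⟨s, hs, hps⟩ := hp
  obtain ⟨s', hs', hps'⟩ := hp'
  obtain rfl := hs.unique _ _ hs'
  refine hps.2.2 (colour p'.1 p'.2.1) ?_ hps'.2.1
  exact (lookup_eq_some (colours_functional hK)).2 ⟨p', hps'.1, by rw [heq]⟩

/-- Each pick survives for at least a quarter of the sets, so on average, and hence for the best
set, a quarter of the picks survive. -/
theorem card_le_hooks (hL : V ≤ 2 ^ L) (hq : 0 < q)
    (hF : ∀ c c', c ≠ c' → q ≤ 4 * {s | F s c ∧ ¬ F s c'}.ncard)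
    (hK : ∀ p ∈ K, ∀ p' ∈ K, p.1 = p'.1 → p = p') (hne : ∀ p ∈ K, p.1 ≠ p.2.1) :
    K.ncard ≤ 4 * (hooks F K).ncard := by
  classical
  have hone : ∀ p ∈ K, q ≤ 4 * {s | Good F s (ends L K p)}.ncard := by
    intro p hp
    cases hl : lookup (colours L K) p.2.1 with
    | none =>
      -- The target has no pick, hence no colour, and only membership of the first colour matters.
      -- The colour with the opposite digit serves as a different colour for `hF`.
      refine (hF (colour (L := L) p.1 p.2.1)
        ((colour (L := L) p.1 p.2.1).1, !(colour (L := L) p.1 p.2.1).2) fun h => ?_).trans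
        (Nat.mul_le_mul_left 4 (Set.ncard_le_ncard (fun s hs => ⟨hs.1, ?_⟩) (Set.toFinite _)))
      · have := congrArg Prod.snd h
        simp at this
      · intro c hc
        simp only [ends, hl] at hc
        exact absurd hc (by simp)
    | some c' =>
      obtain ⟨p', hp', hpc⟩ := (lookup_eq_some (colours_functional hK)).1 hl
      rw [Option.some_inj, Prod.mk.injEq] at hpc
      obtain ⟨h1, h2⟩ := hpc
      have hcc : colour (L := L) p.1 p.2.1 ≠ c' := by
        rw [← h2, h1]
        exact colour_ne hL (hne p hp) _
      refine (hF _ _ hcc).trans (Nat.mul_le_mul_left 4 (Set.ncard_le_ncard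
        (fun s hs => ⟨hs.1, ?_⟩) (Set.toFinite _)))
      intro c hc
      simp only [ends, hl, Option.mem_def, Option.some_inj] at hc
      exact hc ▸ hs.2
  rcases K.eq_empty_or_nonempty with rfl | hKne
  · simp
  have hKfin := Set.toFinite K
  -- The pairs of a set and a pick that survives with it are counted in two ways.
  have hex : ∃ s, K.ncard ≤ 4 * (survivors F K s).ncard := by
    by_contra hno
    push Not at hno
    have h1 := Finset.sum_card_bipartiteAbove_eq_sum_card_bipartiteBelow
      (fun (s : Fin q) (p : Pick V U) => Good F s (ends L K p)) (s := Finset.univ)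
      (t := hKfin.toFinset)
    have h2 : ∀ s, (Finset.bipartiteAbove (fun (s : Fin q) (p : Pick V U) => Good F s (ends L K p))
        hKfin.toFinset s).card = (survivors F K s).ncard := by
      intro s
      rw [Finset.bipartiteAbove, ← Set.ncard_coe_finset]
      congr 1
      ext p
      simp [survivors]
    have h3 : ∀ p, (Finset.bipartiteBelow (fun (s : Fin q) (p : Pick V U) => Good F s (ends L K p))
        Finset.univ p).card = {s | Good F s (ends L K p)}.ncard := by
      intro p
      rw [Finset.bipartiteBelow, ← Set.ncard_coe_finset]
      congr 1
      ext s
      simp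
    simp only [h2, h3] at h1
    have h4 : ∑ s : Fin q, 4 * (survivors F K s).ncard < ∑ s : Fin q, K.ncard :=
      Finset.sum_lt_sum_of_nonempty ⟨⟨0, hq⟩, Finset.mem_univ _⟩ fun s _ => hno s
    have h5 : ∑ p ∈ hKfin.toFinset, q ≤
        ∑ p ∈ hKfin.toFinset, 4 * {s | Good F s (ends L K p)}.ncard :=
      Finset.sum_le_sum fun p hp => hone p (hKfin.mem_toFinset.1 hp)
    rw [← Finset.mul_sum] at h4 h5
    rw [h1, Finset.sum_const, Finset.card_univ, Fintype.card_fin, smul_eq_mul] at h4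
    rw [Finset.sum_const, smul_eq_mul, ← Set.ncard_eq_toFinset_card] at h5
    rw [Nat.mul_comm] at h5
    omega
  obtain ⟨s, hs⟩ := hex
  have hKpos := hKne.ncard_pos (Set.toFinite _)
  have hsne : (survivors F K s).Nonempty := (Set.ncard_pos (Set.toFinite _)).1 (by omega)
  obtain ⟨s', hs', hmin⟩ := Set.exists_min_image {s | (survivors F K s).Nonempty}
    (fun s => toLex (OrderDual.toDual (survivors F K s).ncard, s)) (Set.toFinite _) ⟨s, hsne⟩
  have hbest : IsBest F K s' := ⟨hs', hmin⟩
  have h6 : (survivors F K s).ncard ≤ (survivors F K s').ncard := by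
    have := hmin s hsne
    rw [Prod.Lex.le_iff] at this
    rcases this with h | h
    · exact (OrderDual.toDual_lt_toDual.1 h).le
    · exact (congrArg OrderDual.ofDual h.1).ge
  have h7 : (survivors F K s').ncard ≤ (hooks F K).ncard :=
    Set.ncard_le_ncard (fun p hp => ⟨s', hbest, hp⟩) (Set.toFinite _)
  omega

end Stars

/-! ### Contraction rounds on the server -/

section Rounds

variable {P : OEMParams} {X : Type} {ld : X → P.Server} {R : ℕ} {𝓢 𝓢' : Set (Tbl X)}
  {T T' u : ℝ} {N Q : ℕ} {V U L q : ℕ}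

theorem finsum_card_fiber {α β : Type} [Finite α] (A : Set α) (f : α → β) (B : Set β)
    (hB : ∀ b ∈ B, ∃ a ∈ A, f a = b) :
    ∑ᶠ b ∈ B, {a | a ∈ A ∧ f a = b}.ncard = {a | a ∈ A ∧ f a ∈ B}.ncard := by
  classical
  have hBf : B.Finite := (Set.toFinite (f '' A)).subset fun b hb => hB b hb
  have hAf : {a | a ∈ A ∧ f a ∈ B}.Finite := Set.toFinite _
  rw [finsum_mem_eq_finite_toFinset_sum _ hBf, Set.ncard_eq_toFinset_card _ hAf,
    Finset.card_eq_sum_card_fiberwise (f := f) (t := hBf.toFinset)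
      (fun a ha => by simpa using (hAf.mem_toFinset.1 ha).2)]
  refine Finset.sum_congr rfl fun b hb => ?_
  rw [← Set.ncard_coe_finset]
  congr 1
  ext a
  simp only [Finset.coe_filter, Set.Finite.mem_toFinset, Set.mem_ofPred_eq]
  exact ⟨fun h => ⟨⟨h.1, by rw [h.2]; exact hBf.mem_toFinset.1 hb⟩, h.2⟩, fun h => ⟨h.1.1, h.2⟩⟩

theorem finsum_one_eq_ncard {α : Type} [Finite α] (A : Set α) : ∑ᶠ _y ∈ A, 1 = A.ncard := by
  rw [finsum_mem_eq_finite_toFinset_sum _ (Set.toFinite A), Finset.sum_const, smul_eq_mul, mul_one,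
    Set.ncard_eq_toFinset_card]

/-- A record of a directed edge: the component it leaves, the edge, and the component it enters.
If the latter is missing, then the record marks the end of the known part of a list of edges. -/
abbrev Rec (V U : ℕ) : Type := Fin V × Ed V U × Option (Fin V)

/-- Testing each set against each pick would be too expensive. Whether a pick survives depends on
its pair of colours only, so the picks are counted for each pair, and all further work on the choice
of the set takes place in a table of all sets and pairs of colours, which has `O(L ^ 3)` records and
fits into `n₁` blocks. -/
theorem Reach.hookTable (h : Reach ld R 𝓢 T) (hE : AlgEnv P u N Q) [hV : Fact (V ≤ Q)]
    [hU : Fact (U ≤ Q)] [hL : Fact (L ≤ Q)] [NeZero L] (F : Fin q → Colour L → Prop)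
    (hq : q ≤ 4 * Nat.card (Colour L)) {n n₁ : ℕ} {K : X → Set (Pick V U)}
    (hK : ⟨Pick V U, n, K⟩ ∈ 𝓢) (hfun : ∀ x, ∀ p ∈ K x, ∀ p' ∈ K x, p.1 = p'.1 → p = p')
    (hn : 3 * n + 2 * n₁ ≤ N)
    (hn₁ : 8 * L * (2 * L * (2 * L + 1)) ≤ n₁ * P.blockSize) :
    Reach ld R (insert ⟨Pick V U, n₁ + n₁ + (n + n), fun x => hooks F (K x)⟩ 𝓢)
      (T + u * (100 * n + 100 * n₁ : ℕ)) := by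
  classical
  have hQ : Fact (2 ≤ Q) := ⟨hE.two_le⟩
  have hq4 : SmallType Q (Fin q) 5 := SmallType.of_card (by
    simp only [Nat.card_eq_fintype_card, Fintype.card_prod, Fintype.card_fin, Fintype.card_bool]
      at hq ⊢
    have h1 := hL.out
    have h2 := hQ.out
    calc q ≤ 2 * 2 * 2 * L := by omega
      _ ≤ Q * Q * Q * Q := by gcongr
      _ ≤ Q * Q * Q * Q * Q := Nat.le_mul_of_pos_right _ (by omega)
      _ = Q ^ 5 := by ring)
  have hm : SmallType Q (Fin (V + 1)) 2 := SmallType.of_card (by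
    simpa using hE.add_one_le (d := 1) (by simpa using hV.out))
  have h1 := h.filterMap hK (fun p => some (p.1, colour (L := L) p.1 p.2.1))
  have h2 := h1.join hE (Set.mem_insert _ _) (Set.mem_insert_of_mem _ hK) (by omega)
    (fun x => colours_functional (hfun x)) (fun p => p.2.1)
    (fun p c => some (p, (colour (L := L) p.1 p.2.1, c)))
  -- all picks with their colours
  have h3 := h2.congr (S' := fun x => {z | ∃ p ∈ K x, z = (p, ends L (K x) p)}) (Set.mem_insert _ _)
    le_rfl fun x => by
      ext z
      exact exists_congr fun p => and_congr_right fun _ =>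
        ⟨fun h => (Option.some.inj h).symm, fun h => congrArg some h.symm⟩
  have hKV : ∀ x, (K x).ncard ≤ V := by
    intro x
    have := Set.ncard_le_ncard_of_injOn (t := (Set.univ : Set (Fin V))) Prod.fst
      (fun _ _ => Set.mem_univ _) (fun p hp p' hp' h => hfun x p hp p' hp' h) (Set.toFinite _)
    simpa using this
  have hfib : ∀ x π, {y' : Pick V U × (Colour L × Option (Colour L)) |
      y' ∈ {z | ∃ p ∈ K x, z = (p, ends L (K x) p)} ∧ y'.2 = π}.ncard =
      {p | p ∈ K x ∧ ends L (K x) p = π}.ncard := by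
    intro x π
    refine (Set.ncard_congr (fun p _ => (p, ends L (K x) p)) ?_ ?_ ?_).symm
    · rintro p ⟨hp, hπ⟩
      exact ⟨⟨p, hp, rfl⟩, hπ⟩
    · rintro p p' - - h
      exact congrArg Prod.fst h
    · rintro _ ⟨⟨p, hp, rfl⟩, hπ⟩
      exact ⟨p, ⟨hp, hπ⟩, rfl⟩
  have hle : ∀ x π, {p | p ∈ K x ∧ ends L (K x) p = π}.ncard ≤ V := fun x π =>
    (Set.ncard_le_ncard (fun p hp => hp.1) (Set.toFinite _)).trans (hKV x)
  have h4 := h3.groupSum hE (Set.mem_insert _ _) (by omega) Prod.snd (fun _ => 1) V (f := 2)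
    (fun x y _ => by rw [finsum_one_eq_ncard, hfib]; exact hle x _)
    (hE.add_one_le (d := 1) (by simpa using hV.out))
    (fun π c => if hc : c < V + 1 then some (π, (⟨c, hc⟩ : Fin (V + 1))) else none)
  -- the number of picks for each pair of colours
  have h5 := h4.congr (S' := fun x => {z | ∃ p ∈ K x, ends L (K x) p = z.1 ∧
      (z.2 : ℕ) = {p | p ∈ K x ∧ ends L (K x) p = z.1}.ncard}) (Set.mem_insert _ _)
    le_rfl fun x => by
      ext z
      constructor
      · rintro ⟨_, ⟨p, hp, rfl⟩, hz⟩
        rw [finsum_one_eq_ncard, hfib, dif_pos (Nat.lt_succ_of_le (hle x _)), Option.some_inj] at hz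
        subst hz
        exact ⟨p, hp, rfl, rfl⟩
      · rintro ⟨p, hp, h1, h2⟩
        refine ⟨_, ⟨p, hp, rfl⟩, ?_⟩
        rw [finsum_one_eq_ncard, hfib, dif_pos (Nat.lt_succ_of_le (hle x _)), Option.some_inj]
        refine Prod.ext h1 (Fin.ext ?_)
        dsimp only
        rw [h1, h2]
  have hκ : Nat.card (Colour L × Option (Colour L)) = 2 * L * (2 * L + 1) := by
    rw [Nat.card_prod, Finite.card_option, Nat.card_prod, Nat.card_fin, Nat.card_eq_fintype_card,
      Fintype.card_bool, Nat.mul_comm L 2]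
  have hqL : q ≤ 8 * L := by
    rw [Nat.card_prod, Nat.card_fin, Nat.card_eq_fintype_card, Fintype.card_bool] at hq
    omega
  have hL1 : 1 ≤ L := NeZero.one_le
  -- There are no more counts than pairs of colours, which is `2 * L * (2 * L + 1)` as the second
  -- colour may be missing.
  have h6 := h5.shrink hE (Set.mem_insert _ _) (by omega) (2 * L * (2 * L + 1)) fun x => by
    rw [← hκ, ← Set.ncard_univ]
    refine Set.ncard_le_ncard_of_injOn Prod.fst (fun _ _ => Set.mem_univ _) ?_ (Set.toFinite _)
    rintro z ⟨p, hp, h1, h2⟩ z' ⟨p', hp', h1', h2'⟩ hzz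
    exact Prod.ext hzz (Fin.ext (by rw [h2, h2', hzz]))
  have h7 := h6.congr (n' := n₁) (Set.mem_insert _ _) ((ceilDiv_le_iff_le_mul P.blockSize_pos).2
    (by rw [Nat.mul_comm P.blockSize]; exact le_trans (Nat.le_mul_of_pos_left _ (show 0 < 8 * L by omega)) hn₁)) fun x => rfl
  have h8 := h7.const hE.toSortEnv (Set.univ : Set (Fin q × (Colour L × Option (Colour L)))) n₁ (by
    rw [Set.ncard_univ, Nat.card_prod, hκ, Nat.card_fin]
    exact le_trans (Nat.mul_le_mul_right _ hqL) hn₁)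
  -- Each combination of a set and a good pair receives the number of picks with this pair.
  have h9 := h8.join hE (Set.mem_insert_of_mem _ (Set.mem_insert _ _)) (Set.mem_insert _ _)
    (by omega) (by
      rintro x π c c' ⟨p, hp, h1, h2⟩ ⟨p', hp', h1', h2'⟩
      exact Fin.ext (h2.trans h2'.symm)) Prod.snd
    (fun z o => if Good F z.1 z.2 then o.map (fun c => (z.1, z.2, c)) else none)
  have h10 := h9.congr (S' := fun x => {z | Good F z.1 z.2.1 ∧ (∃ p ∈ K x, ends L (K x) p = z.2.1) ∧
      (z.2.2 : ℕ) = {p | p ∈ K x ∧ ends L (K x) p = z.2.1}.ncard}) (Set.mem_insert _ _) le_rfl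
    fun x => by
      have hlook : ∀ (π : Colour L × Option (Colour L)) (c : Fin (V + 1)),
          lookup {z : (Colour L × Option (Colour L)) × Fin (V + 1) |
          ∃ p ∈ K x, ends L (K x) p = z.1 ∧
          (z.2 : ℕ) = {p | p ∈ K x ∧ ends L (K x) p = z.1}.ncard} π = some c ↔
          (∃ p ∈ K x, ends L (K x) p = π) ∧
            (c : ℕ) = {p | p ∈ K x ∧ ends L (K x) p = π}.ncard := by
        intro π c
        rw [lookup_eq_some]
        · constructor
          · rintro ⟨p, hp, h1, h2⟩
            exact ⟨⟨p, hp, h1⟩, h2⟩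
          · rintro ⟨⟨p, hp, h1⟩, h2⟩
            exact ⟨p, hp, h1, h2⟩
        · rintro π c c' ⟨p, hp, h1, h2⟩ ⟨p', hp', h1', h2'⟩
          exact Fin.ext (h2.trans h2'.symm)
      ext ⟨s, π, c⟩
      constructor
      · rintro ⟨⟨s', π'⟩, -, hz⟩
        split_ifs at hz with hg
        obtain ⟨c', hc', hz⟩ := Option.map_eq_some_iff.1 hz
        rw [Prod.mk.injEq, Prod.mk.injEq] at hz
        obtain ⟨rfl, rfl, rfl⟩ := hz
        exact ⟨hg, (hlook _ _).1 hc'⟩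
      · rintro ⟨hg, hc⟩
        exact ⟨(s, π), Set.mem_univ _, by rw [if_pos hg, (hlook _ _).2 hc]; rfl⟩
  have hsum : ∀ x (s : Fin q), ∑ᶠ y' ∈ {y' : Fin q × (Colour L × Option (Colour L)) × Fin (V + 1) |
      y' ∈ {z : Fin q × (Colour L × Option (Colour L)) × Fin (V + 1) |
        Good F z.1 z.2.1 ∧ (∃ p ∈ K x, ends L (K x) p = z.2.1) ∧
        (z.2.2 : ℕ) = {p | p ∈ K x ∧ ends L (K x) p = z.2.1}.ncard} ∧ y'.1 = s}, (y'.2.2 : ℕ) =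
      (survivors F (K x) s).ncard := by
    intro x s
    have himg : {y' : Fin q × (Colour L × Option (Colour L)) × Fin (V + 1) |
        y' ∈ {z : Fin q × (Colour L × Option (Colour L)) × Fin (V + 1) |
          Good F z.1 z.2.1 ∧ (∃ p ∈ K x, ends L (K x) p = z.2.1) ∧
          (z.2.2 : ℕ) = {p | p ∈ K x ∧ ends L (K x) p = z.2.1}.ncard} ∧ y'.1 = s} =
        (fun π => (s, π, (⟨_, Nat.lt_succ_of_le (hle x π)⟩ : Fin (V + 1)))) ''
          {π | Good F s π ∧ ∃ p ∈ K x, ends L (K x) p = π} := by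
      ext ⟨s', π, c⟩
      constructor
      · rintro ⟨⟨hg, hp, hc⟩, rfl⟩
        exact ⟨π, ⟨hg, hp⟩, by rw [Prod.mk.injEq, Prod.mk.injEq]; exact ⟨rfl, rfl, Fin.ext hc.symm⟩⟩
      · rintro ⟨π', ⟨hg, hp⟩, hz⟩
        rw [Prod.mk.injEq, Prod.mk.injEq] at hz
        obtain ⟨rfl, rfl, rfl⟩ := hz
        exact ⟨⟨hg, hp, rfl⟩, rfl⟩
    rw [himg, finsum_mem_image (fun π _ π' _ h => congrArg (fun z => z.2.1) h)]
    dsimp only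
    rw [finsum_card_fiber (K x) (ends L (K x)) _ fun π hπ => hπ.2]
    congr 1
    ext p
    exact ⟨fun h => ⟨h.1, h.2.1⟩, fun h => ⟨h.1, h.2, p, h.1, rfl⟩⟩
  have hsV : ∀ x s, (survivors F (K x) s).ncard ≤ V := fun x s =>
    (Set.ncard_le_ncard (fun p hp => hp.1) (Set.toFinite _)).trans (hKV x)
  -- Adding up over the good pairs of a set gives the number of its survivors.
  have h11 := h10.groupSum hE (Set.mem_insert _ _) (by omega) Prod.fst (fun y => (y.2.2 : ℕ)) V
    (f := 2) (fun x y _ => by rw [hsum]; exact hsV x _)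
    (hE.add_one_le (d := 1) (by simpa using hV.out))
    (fun s c => if hc : c < V + 1 then some (s, (⟨c, hc⟩ : Fin (V + 1))) else none)
  have h12 := h11.congr (S' := fun x => {z | (survivors F (K x) z.1).Nonempty ∧
      (z.2 : ℕ) = (survivors F (K x) z.1).ncard}) (Set.mem_insert _ _) le_rfl fun x => by
    ext z
    constructor
    · rintro ⟨⟨s, π, c⟩, hy, hz⟩
      rw [hsum, dif_pos (Nat.lt_succ_of_le (hsV x _)), Option.some_inj] at hz
      subst hz
      obtain ⟨hg, ⟨p, hp, hpe⟩, -⟩ := hy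
      refine ⟨⟨p, hp, ?_⟩, rfl⟩
      rw [hpe]
      exact hg
    · rintro ⟨⟨p, hp⟩, hz⟩
      refine ⟨(z.1, ends L (K x) p, ⟨_, Nat.lt_succ_of_le (hle x _)⟩),
        ⟨hp.2, ⟨p, hp.1, rfl⟩, rfl⟩, ?_⟩
      rw [hsum, dif_pos (Nat.lt_succ_of_le (hsV x _)), Option.some_inj]
      exact Prod.ext rfl (Fin.ext hz.symm)
  have h13 := h12.groupMin hE (Set.mem_insert _ _) (by omega) (fun _ => ())
    (fun z => toLex (OrderDual.toDual z.2, z.1))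
    (fun z z' _ h => Prod.ext (Prod.mk.inj (toLex.injective h)).2
      (OrderDual.toDual.injective (Prod.mk.inj (toLex.injective h)).1)) (fun z => some ((), z.1))
  have h14 := h13.congr (S' := fun x => {z : Unit × Fin q | IsBest F (K x) z.2})
    (Set.mem_insert _ _) le_rfl fun x => by
      have hcmp : ∀ z z' : Fin q × Fin (V + 1), (z.2 : ℕ) = (survivors F (K x) z.1).ncard →
          (z'.2 : ℕ) = (survivors F (K x) z'.1).ncard →
          (toLex (OrderDual.toDual z.2, z.1) ≤ toLex (OrderDual.toDual z'.2, z'.1) ↔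
          toLex (OrderDual.toDual (survivors F (K x) z.1).ncard, z.1) ≤
            toLex (OrderDual.toDual (survivors F (K x) z'.1).ncard, z'.1)) := by
        intro z z' h h'
        rw [Prod.Lex.le_iff, Prod.Lex.le_iff, ← h, ← h']
        exact or_congr (OrderDual.toDual_lt_toDual.trans
          (Fin.lt_def.trans OrderDual.toDual_lt_toDual.symm)) (and_congr_left'
          ((OrderDual.toDual.injective.eq_iff.trans Fin.ext_iff).trans
            OrderDual.toDual.injective.eq_iff.symm))
      ext ⟨_, s⟩
      constructor
      · rintro ⟨z, ⟨hz1, hz2⟩, hmin, hz⟩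
        rw [Option.some_inj, Prod.mk.injEq] at hz
        obtain ⟨-, rfl⟩ := hz
        refine ⟨hz1, fun s' hs' => ?_⟩
        have := hmin (s', ⟨_, Nat.lt_succ_of_le (hsV x s')⟩) ⟨hs', rfl⟩ rfl
        exact (hcmp _ _ hz2 rfl).1 this
      · rintro ⟨hs, hmin⟩
        refine ⟨(s, ⟨_, Nat.lt_succ_of_le (hsV x s)⟩), ⟨hs, rfl⟩, fun z' hz' _ => ?_, rfl⟩
        exact (hcmp _ _ rfl hz'.2).2 (hmin z'.1 hz'.1)
  -- A join with a trivial key announces the best set to every pick.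
  have h15 := h14.join hE (G := fun x => {z | ∃ p ∈ K x, z = (p, ends L (K x) p)})
    (n' := n + n) (Set.mem_insert _ _) (by
      iterate 11 apply Set.mem_insert_of_mem
      exact Set.mem_insert _ _) (by omega)
    (fun x _ s s' hs hs' => IsBest.unique F (K x) hs hs') (fun _ => ())
    (fun z o => o.bind fun s => if Good F s z.2 then some z.1 else none)
  refine (h15.congr (S' := fun x => hooks F (K x)) (Set.mem_insert _ _) le_rfl fun x => ?_).mono
    (Set.insert_subset_insert fun t ht => ?_) ?_
  · have hlook : ∀ s, lookup {z : Unit × Fin q | IsBest F (K x) z.2} () = some s ↔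
        IsBest F (K x) s := fun s =>
      lookup_eq_some (fun _ s s' hs hs' => IsBest.unique F (K x) hs hs')
    ext p
    constructor
    · rintro ⟨_, ⟨p', hp', rfl⟩, hz⟩
      obtain ⟨s, hs, hz⟩ := Option.bind_eq_some_iff.1 hz
      split_ifs at hz with hg
      rw [Option.some_inj] at hz
      dsimp only at hz
      subst hz
      exact ⟨s, (hlook s).1 hs, hp', hg⟩
    · rintro ⟨s, hs, hp, hg⟩
      refine ⟨_, ⟨p, hp, rfl⟩, ?_⟩
      rw [(hlook s).2 hs]
      exact if_pos hg
  · iterate 15 apply Set.mem_insert_of_mem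
    exact ht
  · have := hE.one_le
    push_cast
    nlinarith [(Nat.cast_nonneg n : (0 : ℝ) ≤ n), (Nat.cast_nonneg n₁ : (0 : ℝ) ≤ n₁)]

end Rounds

/-! ### Contraction rounds -/

section Rounds

variable {V U L q : ℕ}

/-- The order in which a component considers its edges. -/
def recKey (r : Rec V U) : Ed V U ×ₗ ℕ := toLex (r.2.1, r.2.2.elim 0 fun t => (t : ℕ) + 1)

/-- The record of a pick. -/
def Pick.toRec (p : Pick V U) : Rec V U := (p.1, p.2.2, some p.2.1)

/-- The records of edges that leave their component. -/
def external (H : Set (Rec V U)) : Set (Rec V U) := {r | r ∈ H ∧ r.2.2 ≠ some r.1}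

/-- The lightest edges of the components. -/
def picks (H : Set (Rec V U)) : Set (Pick V U) :=
  {p | p.toRec ∈ external H ∧ ∀ r ∈ external H, r.1 = p.1 → recKey p.toRec ≤ recKey r}

/-- A mark has the value `0`, below that of any component. So it precedes the other records with the
same edge and is not confused with them. -/
theorem recKey_injective {r r' : Rec V U} (h : r.1 = r'.1) (hk : recKey r = recKey r') : r = r' := by
  obtain ⟨a, e, t⟩ := r
  obtain ⟨a', e', t'⟩ := r'
  obtain ⟨h1, h2⟩ := Prod.mk.inj (toLex.injective hk)
  dsimp only at h h1 h2
  subst h h1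
  cases t <;> cases t' <;> simp_all [Fin.ext_iff]

theorem picks_functional (H : Set (Rec V U)) (p : Pick V U) (hp : p ∈ picks H) (p' : Pick V U)
    (hp' : p' ∈ picks H) (h : p.1 = p'.1) : p = p' := by
  have h1 := recKey_injective (r := p.toRec) (r' := p'.toRec) h
    (le_antisymm (hp.2 _ hp'.1 h.symm) (hp'.2 _ hp.1 h))
  obtain ⟨a, t, e⟩ := p
  obtain ⟨a', t', e'⟩ := p'
  simp only [Pick.toRec, Prod.mk.injEq, Option.some_inj] at h1
  obtain ⟨rfl, rfl, rfl⟩ := h1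
  rfl

/-- Where a set of picks moves the component `a`. -/
noncomputable def moveTo (K : Set (Pick V U)) (a : Fin V) : Fin V :=
  (lookup {z | ∃ p ∈ K, some (p.1, p.2.1) = some z} a).getD a

/-- New names for the components. -/
def Rec.map (f : Fin V → Fin V) (r : Rec V U) : Rec V U := (f r.1, r.2.1, r.2.2.map f)

/-- The state of the contraction: the records, the names of the components compared to the names at
the start, and the edges that have been contracted. -/
structure CState (V U : ℕ) where
  H : Set (Rec V U)
  M : Set (Fin V × Fin V)
  O : Set (Ed V U)

namespace CState

variable [NeZero L] (F : Fin q → Colour L → Prop)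

/-- The hooks of a contraction round. -/
def hk (s : CState V U) : Set (Pick V U) := hooks F (picks s.H)

/-- One contraction round. -/
noncomputable def step (s : CState V U) : CState V U where
  H := Rec.map (moveTo (s.hk F)) '' s.H
  M := Prod.map id (moveTo (s.hk F)) '' s.M
  O := s.O ∪ (fun p : Pick V U => p.2.2) '' s.hk F

theorem ncard_step_H (s : CState V U) : (s.step F).H.ncard ≤ s.H.ncard :=
  Set.ncard_image_le (Set.toFinite _)

theorem ncard_step_M (s : CState V U) : (s.step F).M.ncard ≤ s.M.ncard :=
  Set.ncard_image_le (Set.toFinite _)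

theorem ncard_hk_le (s : CState V U) : (s.hk F).ncard ≤ s.H.ncard := by
  refine Set.ncard_le_ncard_of_injOn Pick.toRec (fun p hp => (hooks_subset _ _ hp).1.1) ?_
    (Set.toFinite _)
  rintro ⟨a, t, e⟩ - ⟨a', t', e'⟩ - h
  simp only [Pick.toRec, Prod.mk.injEq, Option.some_inj] at h
  obtain ⟨rfl, rfl, rfl⟩ := h
  rfl

end CState

variable {P : OEMParams} {X : Type} {ld : X → P.Server} {R : ℕ} {𝓢 𝓢' : Set (Tbl X)}
  {T T' u : ℝ} {N Q : ℕ}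

theorem Reach.picks (h : Reach ld R 𝓢 T) (hE : AlgEnv P u N Q) [hV : Fact (V ≤ Q)]
    [hU : Fact (U ≤ Q)] {n : ℕ} {H : X → Set (Rec V U)} (hH : ⟨Rec V U, n, H⟩ ∈ 𝓢) (hn : n ≤ N) :
    Reach ld R (insert ⟨Pick V U, n, fun x => _root_.picks (H x)⟩ 𝓢) (T + 7 * u * n) := by
  have hQ : Fact (2 ≤ Q) := ⟨hE.two_le⟩
  have h1 := h.filterMap hH (fun r => if r.2.2 = some r.1 then none else some r)
  have h2 := h1.groupMin hE (Set.mem_insert _ _) hn Prod.fst recKey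
    (fun _ _ h h' => recKey_injective h h') (fun r => r.2.2.map fun t => ((r.1, t, r.2.1) : Pick V U))
  refine (h2.congr (Set.mem_insert _ _) le_rfl (S' := fun x => _root_.picks (H x))
    fun x => ?_).mono
    (Set.insert_subset_insert ((Set.subset_insert _ _).trans (Set.subset_insert _ _))) le_rfl
  have hext : {z | ∃ r ∈ H x, (if r.2.2 = some r.1 then none else some r) = some z} =
      external (H x) := by
    ext r
    constructor
    · rintro ⟨r', hr', hz⟩
      split_ifs at hz with h1
      rw [Option.some_inj] at hz
      exact hz ▸ ⟨hr', h1⟩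
    · rintro ⟨hr, h1⟩
      exact ⟨r, hr, if_neg h1⟩
  ext p
  simp only [hext]
  constructor
  · rintro ⟨⟨a, e, t⟩, hr, hmin, hz⟩
    obtain ⟨t', rfl, rfl⟩ := Option.map_eq_some_iff.1 hz
    exact ⟨hr, hmin⟩
  · rintro ⟨hp, hmin⟩
    exact ⟨Pick.toRec p, hp, hmin, rfl⟩

/-- The new names that a table describes; names that do not occur are kept. -/
noncomputable def newName (D : Set (Fin V × Fin V)) (a : Fin V) : Fin V := (lookup D a).getD a

theorem Reach.relabelMap (h : Reach ld R 𝓢 T) (hE : AlgEnv P u N Q) [hV : Fact (V ≤ Q)]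
    {n n' : ℕ} {D : X → Set (Fin V × Fin V)} {M : X → Set (Fin V × Fin V)}
    (hD : ⟨Fin V × Fin V, n, D⟩ ∈ 𝓢) (hM : ⟨Fin V × Fin V, n', M⟩ ∈ 𝓢) (hn : n + n' ≤ N)
    (hfun : ∀ x k d d', (k, d) ∈ D x → (k, d') ∈ D x → d = d') (m : ℕ)
    (hm : ∀ x, (M x).ncard ≤ m) :
    Reach ld R (insert ⟨Fin V × Fin V, m ⌈/⌉ P.blockSize,
      fun x => Prod.map id (newName (D x)) '' M x⟩ 𝓢) (T + 18 * u * (n + n' : ℕ)) := by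
  have h1 := h.join hE hD hM hn hfun Prod.snd (fun y o => some (y.1, o.getD y.2))
  have h2 := h1.congr (S' := fun x => Prod.map id (newName (D x)) '' M x) (Set.mem_insert _ _)
    le_rfl fun x => by
      ext z
      exact exists_congr fun y => and_congr_right fun _ => Option.some_inj
  refine (h2.shrink hE (Set.mem_insert _ _) hn m fun x =>
    (Set.ncard_image_le (Set.toFinite _)).trans (hm x)).mono
    (Set.insert_subset_insert ((Set.subset_insert _ _).trans (Set.subset_insert _ _)))
    (le_of_eq (by ring))

theorem Reach.relabelRec (h : Reach ld R 𝓢 T) (hE : AlgEnv P u N Q) [hV : Fact (V ≤ Q)]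
    [hU : Fact (U ≤ Q)]
    {n n' : ℕ} {D : X → Set (Fin V × Fin V)} {H : X → Set (Rec V U)}
    (hD : ⟨Fin V × Fin V, n, D⟩ ∈ 𝓢) (hH : ⟨Rec V U, n', H⟩ ∈ 𝓢) (hn : n + (n + n') ≤ N)
    (hfun : ∀ x k d d', (k, d) ∈ D x → (k, d') ∈ D x → d = d') (m : ℕ)
    (hm : ∀ x, (H x).ncard ≤ m) :
    Reach ld R (insert ⟨Rec V U, m ⌈/⌉ P.blockSize,
      fun x => Rec.map (newName (D x)) '' H x⟩ 𝓢) (T + 43 * u * (n + n' : ℕ)) := by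
  have hu := hE.one_le
  have hQ : Fact (2 ≤ Q) := ⟨hE.two_le⟩
  have h1 := h.join hE hD hH (by omega) hfun Prod.fst
    (fun r o => some ((o.getD r.1, r.2) : Rec V U))
  -- A second join renames the component that is entered. A mark has none: it looks up an arbitrary
  -- name and ignores the answer.
  have h2 := h1.join hE (Set.mem_insert_of_mem _ hD) (Set.mem_insert _ _) hn hfun
    (fun r => r.2.2.getD r.1) (fun r o => some ((r.1, r.2.1, r.2.2.map fun t => o.getD t) : Rec V U))
  have h3 := h2.congr (S' := fun x => Rec.map (newName (D x)) '' H x) (Set.mem_insert _ _)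
    le_rfl fun x => by
      ext z
      constructor
      · rintro ⟨_, ⟨r, hr, hz'⟩, hz⟩
        rw [Option.some_inj] at hz' hz
        subst hz' hz
        refine ⟨r, hr, ?_⟩
        obtain ⟨a, e, t⟩ := r
        cases t <;> rfl
      · rintro ⟨r, hr, rfl⟩
        refine ⟨_, ⟨r, hr, rfl⟩, ?_⟩
        obtain ⟨a, e, t⟩ := r
        cases t <;> rfl
  refine (h3.shrink hE (Set.mem_insert _ _) hn m fun x =>
    (Set.ncard_image_le (Set.toFinite _)).trans (hm x)).mono
    (Set.insert_subset_insert ((Set.subset_insert _ _).trans ((Set.subset_insert _ _).trans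
      (Set.subset_insert _ _)))) ?_
  push_cast
  nlinarith [(Nat.cast_nonneg n : (0 : ℝ) ≤ n), (Nat.cast_nonneg n' : (0 : ℝ) ≤ n')]

theorem hooks_functional [NeZero L] (F : Fin q → Colour L → Prop) (H : Set (Rec V U)) (a b b' : Fin V)
    (h : (a, b) ∈ {z | ∃ p ∈ hooks F (picks H), some (p.1, p.2.1) = some z})
    (h' : (a, b') ∈ {z | ∃ p ∈ hooks F (picks H), some (p.1, p.2.1) = some z}) : b = b' := by
  obtain ⟨p, hp, h⟩ := h
  obtain ⟨p', hp', h'⟩ := h'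
  rw [Option.some_inj, Prod.mk.injEq] at h h'
  obtain rfl := picks_functional H p (hooks_subset _ _ hp) p' (hooks_subset _ _ hp')
    (h.1.trans h'.1.symm)
  exact h.2.symm.trans h'.2

/-- The tables of a state with at most `h`, `m` and `o` elements. -/
def CState.tables (P : OEMParams) (s : X → CState V U) (h m o : ℕ) : Set (Tbl X) :=
  {⟨Rec V U, h ⌈/⌉ P.blockSize, fun x => (s x).H⟩,
    ⟨Fin V × Fin V, m ⌈/⌉ P.blockSize, fun x => (s x).M⟩,
    ⟨Ed V U, o ⌈/⌉ P.blockSize, fun x => (s x).O⟩}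

theorem Reach.step (hE : AlgEnv P u N Q) [hV : Fact (V ≤ Q)]
    [hU : Fact (U ≤ Q)] [hL : Fact (L ≤ Q)] [NeZero L] (F : Fin q → Colour L → Prop)
    (hq : q ≤ 4 * Nat.card (Colour L)) {n₁ h m o : ℕ} {s : X → CState V U}
    (hs : Reach ld R (CState.tables P s h m o ∪ 𝓢) T)
    (hN : 6 * (h ⌈/⌉ P.blockSize + m ⌈/⌉ P.blockSize + o ⌈/⌉ P.blockSize + n₁) ≤ N)
    (hn₁ : 8 * L * (2 * L * (2 * L + 1)) ≤ n₁ * P.blockSize)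
    (hh : ∀ x, (s x).H.ncard ≤ h) (hm : ∀ x, (s x).M.ncard ≤ m)
    (ho : ∀ x, ((s x).step F).O.ncard ≤ o) :
    Reach ld R (CState.tables P (fun x => (s x).step F) h m o ∪ 𝓢)
      (T + 300 * u * (h ⌈/⌉ P.blockSize + m ⌈/⌉ P.blockSize + o ⌈/⌉ P.blockSize + n₁ : ℕ)) := by
  have hu := hE.one_le
  set nh := h ⌈/⌉ P.blockSize
  set nm := m ⌈/⌉ P.blockSize
  set no := o ⌈/⌉ P.blockSize
  have h1 := hs.picks hE (H := fun x => (s x).H) (n := nh) (Or.inl (Or.inl rfl)) (by omega)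
  have h2 := h1.hookTable hE F hq (Set.mem_insert _ _) (fun x => picks_functional (s x).H)
    (by omega) hn₁
  -- The table of hooks has come with the overhead of several joins. There are at most as many hooks
  -- as records, so it can be squeezed to `h`.
  have h3 := h2.shrink hE (Set.mem_insert _ _) (by omega) h
    fun x => ((s x).ncard_hk_le F).trans (hh x)
  have h4 := h3.filterMap (Set.mem_insert _ _) (fun p => some (p.1, p.2.1))
  have h5 := h4.relabelRec hE (n' := nh) (H := fun x => (s x).H) (Set.mem_insert _ _) (by
    iterate 4 apply Set.mem_insert_of_mem
    exact Or.inl (Or.inl rfl)) (by omega) (fun x => hooks_functional F (s x).H) h hh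
  have h6 := h5.relabelMap hE (n' := nm) (M := fun x => (s x).M)
    (Set.mem_insert_of_mem _ (Set.mem_insert _ _)) (by
    iterate 5 apply Set.mem_insert_of_mem
    exact Or.inl (Or.inr (Or.inl rfl))) (by omega) (fun x => hooks_functional F (s x).H) m hm
  have h7 := h6.filterMap (S := fun x => hooks F (_root_.picks (s x).H)) (n := nh) (by
    iterate 3 apply Set.mem_insert_of_mem
    exact Set.mem_insert _ _) (fun p => some p.2.2)
  have h8 := h7.union (n := no) (S := fun x => (s x).O) (by
    iterate 7 apply Set.mem_insert_of_mem
    exact Or.inl (Or.inr (Or.inr rfl))) (Set.mem_insert _ _)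
  have h9 := h8.congr (S' := fun x => ((s x).step F).O) (Set.mem_insert _ _) le_rfl fun x => by
    refine congrArg ((s x).O ∪ ·) ?_
    ext e
    exact exists_congr fun y => and_congr_right fun _ => Option.some_inj
  have h10 := h9.shrink hE (Set.mem_insert _ _) (by omega) o ho
  refine h10.mono ?_ ?_
  · rintro t ((rfl | rfl | rfl) | ht)
    · iterate 5 apply Set.mem_insert_of_mem
      exact Set.mem_insert _ _
    · iterate 4 apply Set.mem_insert_of_mem
      exact Set.mem_insert _ _
    · exact Set.mem_insert _ _
    · iterate 10 apply Set.mem_insert_of_mem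
      exact Or.inr ht
  · push_cast
    nlinarith [(Nat.cast_nonneg nh : (0 : ℝ) ≤ nh), (Nat.cast_nonneg nm : (0 : ℝ) ≤ nm),
      (Nat.cast_nonneg no : (0 : ℝ) ≤ no), (Nat.cast_nonneg n₁ : (0 : ℝ) ≤ n₁)]

theorem Reach.iterate_step (hE : AlgEnv P u N Q) [hV : Fact (V ≤ Q)]
    [hU : Fact (U ≤ Q)] [hL : Fact (L ≤ Q)] [NeZero L] (F : Fin q → Colour L → Prop)
    (hq : q ≤ 4 * Nat.card (Colour L)) {n₁ h m o : ℕ} {s : X → CState V U}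
    (hs : Reach ld R (CState.tables P s h m o ∪ 𝓢) T)
    (hN : 6 * (h ⌈/⌉ P.blockSize + m ⌈/⌉ P.blockSize + o ⌈/⌉ P.blockSize + n₁) ≤ N)
    (hn₁ : 8 * L * (2 * L * (2 * L + 1)) ≤ n₁ * P.blockSize)
    (hh : ∀ x, (s x).H.ncard ≤ h) (hm : ∀ x, (s x).M.ncard ≤ m) (k : ℕ)
    (ho : ∀ x, ∀ i ≤ k, ((CState.step F)^[i] (s x)).O.ncard ≤ o) :
    Reach ld R (CState.tables P (fun x => (CState.step F)^[k] (s x)) h m o ∪ 𝓢)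
      (T + k * (300 * u *
        (h ⌈/⌉ P.blockSize + m ⌈/⌉ P.blockSize + o ⌈/⌉ P.blockSize + n₁ : ℕ))) := by
  induction k with
  | zero => simpa using hs
  | succ k ih =>
    have hH : ∀ x, ∀ i, ((CState.step F)^[i] (s x)).H.ncard ≤ h ∧
        ((CState.step F)^[i] (s x)).M.ncard ≤ m := by
      intro x i
      induction i with
      | zero => exact ⟨hh x, hm x⟩
      | succ i ih =>
        rw [Function.iterate_succ_apply']
        exact ⟨(CState.ncard_step_H F _).trans ih.1, (CState.ncard_step_M F _).trans ih.2⟩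
    have h1 := (ih fun x i hi => ho x i (by omega)).step hE F hq hN hn₁ (fun x => (hH x k).1)
      (fun x => (hH x k).2) (fun x => by
        rw [← Function.iterate_succ_apply' (CState.step F)]
        exact ho x (k + 1) le_rfl)
    simp only [← Function.iterate_succ_apply' (CState.step F)] at h1
    refine h1.mono subset_rfl (le_of_eq ?_)
    push_cast
    ring

end Rounds

/-! ### The invariant of the contraction -/

section Invariant

variable {V U L q : ℕ}

/-- The edge `e` leads from the component `a` to the component `b`. -/
def Joins (l : Fin V → Fin V) (e : Ed V U) (a b : Fin V) : Prop :=
  (l e.src = a ∧ l e.dst = b) ∨ (l e.dst = a ∧ l e.src = b)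

theorem Joins.unique {l : Fin V → Fin V} {e : Ed V U} {a b b' : Fin V} (h : Joins l e a b)
    (h' : Joins l e a b') (hab : a ≠ b) : b = b' := by
  rcases h with ⟨h1, h2⟩ | ⟨h1, h2⟩ <;> rcases h' with ⟨h3, h4⟩ | ⟨h3, h4⟩
  · rw [← h2, h4]
  · exact absurd (h3.symm.trans h2) hab
  · exact absurd (h3.symm.trans h2) hab
  · rw [← h2, h4]

theorem Joins.comp {l : Fin V → Fin V} {e : Ed V U} {a b : Fin V} (h : Joins l e a b)
    (f : Fin V → Fin V) : Joins (f ∘ l) e (f a) (f b) := by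
  rcases h with ⟨h1, h2⟩ | ⟨h1, h2⟩
  · exact Or.inl ⟨congrArg f h1, congrArg f h2⟩
  · exact Or.inr ⟨congrArg f h1, congrArg f h2⟩

/-- The set `O` of edges of the minimum spanning tree connects all vertices with the same name, and
the records `H` list, up to the marks, the lightest edges from each component to any other. -/
structure Contraction (𝓔 : Set (Ed V U)) (l : Fin V → Fin V) (H : Set (Rec V U)) (O : Set (Ed V U)) :
    Prop where
  sound : ∀ r ∈ H, ∀ t, r.2.2 = some t → r.2.1 ∈ 𝓔 ∧ Joins l r.2.1 r.1 t
  complete : ∀ e ∈ 𝓔, ∀ a b, Joins l e a b → a ≠ b →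
    ∃ r ∈ H, r.1 = a ∧ r.2.1 ≤ e ∧ (r.2.2 = some b ∨ r.2.2 = none)
  sub : O ⊆ Ed.msf 𝓔
  conn : ∀ a b, l a = l b → Ed.Conn O a b

theorem moveTo_of_mem {K : Set (Pick V U)} (hK : ∀ p ∈ K, ∀ p' ∈ K, p.1 = p'.1 → p = p')
    {p : Pick V U} (hp : p ∈ K) : moveTo K p.1 = p.2.1 := by
  have : lookup {z | ∃ p ∈ K, some (p.1, p.2.1) = some z} p.1 = some p.2.1 := by
    refine (lookup_eq_some ?_).2 ⟨p, hp, rfl⟩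
    rintro k d d' ⟨p, hp, h⟩ ⟨p', hp', h'⟩
    rw [Option.some_inj, Prod.mk.injEq] at h h'
    rw [← h.2, ← h'.2, hK p hp p' hp' (h.1.trans h'.1.symm)]
  rw [moveTo, this]
  rfl

theorem moveTo_of_notMem {K : Set (Pick V U)} {a : Fin V} (ha : ∀ p ∈ K, p.1 ≠ a) :
    moveTo K a = a := by
  have : lookup {z | ∃ p ∈ K, some (p.1, p.2.1) = some z} a = none := by
    rw [lookup_eq_none]
    rintro d ⟨p, hp, h⟩
    rw [Option.some_inj, Prod.mk.injEq] at h
    exact ha p hp h.1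
  rw [moveTo, this]
  rfl

variable {𝓔 : Set (Ed V U)} {l : Fin V → Fin V} {H : Set (Rec V U)} {O : Set (Ed V U)}

/-- The cut property is applied to the component that picks: each edge of the graph leaving it is
accounted for by a record that is no heavier. -/
theorem Contraction.pick (h : Contraction 𝓔 l H O) {p : Pick V U} (hp : p ∈ picks H) :
    p.2.2 ∈ Ed.msf 𝓔 ∧ Joins l p.2.2 p.1 p.2.1 ∧ p.1 ≠ p.2.1 := by
  obtain ⟨⟨hpH, hne⟩, hmin⟩ := hp
  have hne' : p.1 ≠ p.2.1 := fun h => hne (congrArg some h.symm)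
  obtain ⟨he, hj⟩ := h.sound _ hpH p.2.1 rfl
  refine ⟨Ed.mem_msf_of_cut (fun v => l v = p.1) he ?_ fun f hf hcross => ?_, hj, hne'⟩
  · rcases hj with ⟨h1, h2⟩ | ⟨h1, h2⟩
    · change l p.2.2.src = p.1 at h1
      change l p.2.2.dst = _ at h2
      rw [h1, h2]
      exact fun h => hne' (h.1 rfl).symm
    · change l p.2.2.dst = p.1 at h1
      change l p.2.2.src = _ at h2
      rw [h1, h2]
      exact fun h => hne' (h.2 rfl).symm
  · obtain ⟨b, hb, hjf⟩ : ∃ b, p.1 ≠ b ∧ Joins l f p.1 b := by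
      by_cases h1 : l f.src = p.1
      · exact ⟨l f.dst, fun h2 => hcross ⟨fun _ => h2.symm, fun _ => h1⟩, Or.inl ⟨h1, rfl⟩⟩
      · have h2 : l f.dst = p.1 := by
          by_contra h2
          exact hcross ⟨fun h => absurd h h1, fun h => absurd h h2⟩
        exact ⟨l f.src, fun h => h1 h.symm, Or.inr ⟨h2, rfl⟩⟩
    -- The record found here may be a mark instead of the edge itself. A pick is minimal among the
    -- marks as well, so the comparison works in both cases.
    obtain ⟨r, hr, hr1, hre, hrt⟩ := h.complete f hf _ _ hjf hb
    have hext : r ∈ external H := by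
      refine ⟨hr, fun h => ?_⟩
      rcases hrt with hrt | hrt
      · rw [hrt, hr1, Option.some_inj] at h
        exact hb h.symm
      · rw [hrt] at h
        simp at h
    have h3 := hmin r hext hr1
    rw [recKey, recKey, Prod.Lex.le_iff] at h3
    rcases h3 with h3 | h3
    · exact (le_of_lt h3).trans hre
    · exact (le_of_eq h3.1).trans hre

theorem Contraction.map (h : Contraction 𝓔 l H O) (f : Fin V → Fin V) {O' : Set (Ed V U)} (hsub : O' ⊆ Ed.msf 𝓔)
    (hconn : ∀ a b, f (l a) = f (l b) → Ed.Conn O' a b) : Contraction 𝓔 (f ∘ l) (Rec.map f '' H) O' where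
  sound := by
    rintro _ ⟨r, hr, rfl⟩ t ht
    obtain ⟨t', ht', rfl⟩ := Option.map_eq_some_iff.1 ht
    obtain ⟨h1, h2⟩ := h.sound r hr t' ht'
    exact ⟨h1, h2.comp f⟩
  complete := by
    intro e he a b hj hab
    have key : ∀ a' b', Joins l e a' b' → f a' = a → f b' = b →
        ∃ r ∈ Rec.map f '' H, r.1 = a ∧ r.2.1 ≤ e ∧ (r.2.2 = some b ∨ r.2.2 = none) := by
      intro a' b' hj' ha hb
      obtain ⟨r, hr, h1, h2, h3⟩ := h.complete e he a' b' hj' fun h => hab (by rw [← ha, ← hb, h])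
      refine ⟨_, ⟨r, hr, rfl⟩, (congrArg f h1).trans ha, h2, ?_⟩
      rcases h3 with h3 | h3
      · exact Or.inl (by simp [Rec.map, h3, hb])
      · exact Or.inr (by simp [Rec.map, h3])
    rcases hj with ⟨h1, h2⟩ | ⟨h1, h2⟩
    · exact key _ _ (Or.inl ⟨rfl, rfl⟩) h1 h2
    · exact key _ _ (Or.inr ⟨rfl, rfl⟩) h1 h2
  sub := hsub
  conn := hconn

variable [NeZero L] (F : Fin q → Colour L → Prop)

/-- Every hook is an edge of the minimum spanning tree between two components. Since hooks form
stars, each of them makes one name disappear, namely that of the component at which it starts. -/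
theorem Contraction.step {s : CState V U} {O₀ : Set (Ed V U)} (h : Contraction 𝓔 l s.H (O₀ ∪ s.O)) :
    Contraction 𝓔 (moveTo (s.hk F) ∘ l) (s.step F).H (O₀ ∪ (s.step F).O) ∧
      (Set.range (moveTo (s.hk F) ∘ l)).ncard + (s.hk F).ncard ≤ (Set.range l).ncard := by
  set K := s.hk F with hK
  have hKp : ∀ p ∈ K, p ∈ picks s.H := fun p hp => hooks_subset _ _ hp
  have hKf : ∀ p ∈ K, ∀ p' ∈ K, p.1 = p'.1 → p = p' := fun p hp p' hp' =>
    picks_functional s.H p (hKp p hp) p' (hKp p' hp')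
  have hstar : ∀ p ∈ K, ∀ p' ∈ K, p.2.1 ≠ p'.1 := fun p hp p' hp' =>
    hooks_star F (picks_functional s.H) hp hp'
  have hO : O₀ ∪ (s.step F).O = (O₀ ∪ s.O) ∪ (fun p : Pick V U => p.2.2) '' K :=
    (Set.union_assoc _ _ _).symm
  refine ⟨h.map _ ?_ ?_, ?_⟩
  · rw [hO]
    refine Set.union_subset h.sub ?_
    rintro _ ⟨p, hp, rfl⟩
    exact (h.pick (hKp p hp)).1
  · rw [hO]
    have hmono : ∀ {a b}, Ed.Conn (O₀ ∪ s.O) a b →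
        Ed.Conn ((O₀ ∪ s.O) ∪ (fun p : Pick V U => p.2.2) '' K) a b :=
      fun h => h.mono Set.subset_union_left
    -- Each vertex is connected, by at most one hook and edges contracted before, to a vertex of the
    -- component whose name it takes over.
    have key : ∀ a, ∃ v, l v = moveTo K (l a) ∧
        Ed.Conn ((O₀ ∪ s.O) ∪ (fun p : Pick V U => p.2.2) '' K) a v := by
      intro a
      by_cases ha : ∃ p ∈ K, p.1 = l a
      · obtain ⟨p, hp, hpa⟩ := ha
        have he : Ed.Conn ((O₀ ∪ s.O) ∪ (fun p : Pick V U => p.2.2) '' K) p.2.2.src p.2.2.dst :=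
          Ed.conn_of_mem (Or.inr ⟨p, hp, rfl⟩)
        rw [← hpa, moveTo_of_mem hKf hp]
        rcases (h.pick (hKp p hp)).2.1 with ⟨h1, h2⟩ | ⟨h1, h2⟩
        · exact ⟨_, h2, (hmono (h.conn _ _ (hpa.symm.trans h1.symm))).trans he⟩
        · exact ⟨_, h2, (hmono (h.conn _ _ (hpa.symm.trans h1.symm))).trans he.symm⟩
      · push Not at ha
        exact ⟨a, (moveTo_of_notMem ha).symm, Ed.Conn.refl _ _⟩
    intro a b hab
    obtain ⟨v, hv, hav⟩ := key a
    obtain ⟨w, hw, hbw⟩ := key b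
    exact (hav.trans (hmono (h.conn _ _ (by rw [hv, hw, hab])))).trans hbw.symm
  · have hsrc : (Prod.fst '' K) ⊆ Set.range l := by
      rintro _ ⟨p, hp, rfl⟩
      rcases (h.pick (hKp p hp)).2.1 with ⟨h1, -⟩ | ⟨h1, -⟩ <;> exact ⟨_, h1⟩
    have hnew : Set.range (moveTo K ∘ l) ⊆ Set.range l \ (Prod.fst '' K) := by
      rintro _ ⟨a, rfl⟩
      by_cases ha : ∃ p ∈ K, p.1 = l a
      · obtain ⟨p, hp, hpa⟩ := ha
        rw [Function.comp_apply, ← hpa, moveTo_of_mem hKf hp]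
        refine ⟨?_, ?_⟩
        · rcases (h.pick (hKp p hp)).2.1 with ⟨-, h1⟩ | ⟨-, h1⟩ <;> exact ⟨_, h1⟩
        · rintro ⟨p', hp', h1⟩
          exact hstar p hp p' hp' h1.symm
      · push Not at ha
        rw [Function.comp_apply, moveTo_of_notMem ha]
        refine ⟨⟨a, rfl⟩, ?_⟩
        rintro ⟨p', hp', h1⟩
        exact ha p' hp' h1
    have h1 := Set.ncard_le_ncard hnew (Set.toFinite _)
    have h2 := Set.ncard_sdiff_add_ncard_of_subset hsrc (Set.toFinite _)
    have h3 : (Prod.fst '' K).ncard = K.ncard :=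
      Set.InjOn.ncard_image fun p hp p' hp' h => hKf p hp p' hp' h
    omega

/-- A component without a pick is everything, or has a mark that precedes its edges. -/
theorem Contraction.exists_mark (h : Contraction 𝓔 l H O) (hc : (Ed.gr 𝓔).Connected)
    (h2 : 2 ≤ (Set.range l).ncard) {a : Fin V} (ha : a ∈ Set.range l)
    (hp : ∀ p ∈ picks H, p.1 ≠ a) :
    ∃ r ∈ H, r.1 = a ∧ r.2.2 = none ∧ ∀ r' ∈ external H, r'.1 = a → recKey r ≤ recKey r' := by
  obtain ⟨v, rfl⟩ := ha
  have hother : ∃ w, l w ≠ l v := by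
    by_contra hno
    push Not at hno
    have : Set.range l ⊆ {l v} := by
      rintro _ ⟨w, rfl⟩
      exact hno w
    have := Set.ncard_le_ncard this (Set.toFinite _)
    rw [Set.ncard_singleton] at this
    omega
  obtain ⟨w, hw⟩ := hother
  have hcross : ∃ e ∈ 𝓔, ¬ (l e.src = l v ↔ l e.dst = l v) := by
    by_contra hno
    push Not at hno
    exact hw (((show Ed.Conn 𝓔 v w from hc.preconnected v w).invariant
      (W := fun x => l x = l v) hno).1 rfl)
  obtain ⟨e, he, hce⟩ := hcross
  have hj : ∃ b, l v ≠ b ∧ Joins l e (l v) b := by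
    by_cases h1 : l e.src = l v
    · exact ⟨l e.dst, fun h2 => hce ⟨fun _ => h2.symm, fun _ => h1⟩, Or.inl ⟨h1, rfl⟩⟩
    · have h2 : l e.dst = l v := by
        by_contra h2
        exact hce ⟨fun h => absurd h h1, fun h => absurd h h2⟩
      exact ⟨l e.src, fun h => h1 h.symm, Or.inr ⟨h2, rfl⟩⟩
  obtain ⟨b, hb, hj⟩ := hj
  obtain ⟨r, hr, hr1, -, hrt⟩ := h.complete e he _ _ hj hb
  have hext : r ∈ external H := by
    refine ⟨hr, fun h => ?_⟩
    rcases hrt with hrt | hrt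
    · rw [hrt, hr1, Option.some_inj] at h
      exact hb h.symm
    · rw [hrt] at h
      simp at h
  -- The first external record of the component. If it were not a mark, then it would be a pick.
  obtain ⟨m, ⟨hm, hm1⟩, hmin⟩ := Set.exists_min_image {r | r ∈ external H ∧ r.1 = l v} recKey
    (Set.toFinite _) ⟨r, hext, hr1⟩
  refine ⟨m, hm.1, hm1, ?_, fun r' hr' h' => hmin r' ⟨hr', h'⟩⟩
  obtain ⟨a, f, t⟩ := m
  cases t with
  | none => rfl
  | some t =>
    exact absurd hm1 (hp (a, t, f) ⟨hm, fun r' hr' h' => hmin r' ⟨hr', h'.trans hm1⟩⟩)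

/-- Among `n` components at least `n - z` have a pick, and a quarter of the picks are hooks, each of
which removes a component. -/
theorem Contraction.ncard_step_le {s : CState V U} {O₀ : Set (Ed V U)} (h : Contraction 𝓔 l s.H (O₀ ∪ s.O))
    (hL : V ≤ 2 ^ L) (hq : 0 < q)
    (hF : ∀ c c', c ≠ c' → q ≤ 4 * {s | F s c ∧ ¬ F s c'}.ncard) (z : ℕ)
    (hz : {a | a ∈ Set.range l ∧ ∀ p ∈ picks s.H, p.1 ≠ a}.ncard ≤ z) :
    4 * (Set.range (moveTo (s.hk F) ∘ l)).ncard ≤ 3 * (Set.range l).ncard + z := by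
  have h1 := (h.step F).2
  have h2 := card_le_hooks F hL hq hF (picks_functional s.H) fun p hp => (h.pick hp).2.2
  have h3 : (Set.range l).ncard ≤ (picks s.H).ncard + z := by
    have hsub : Set.range l ⊆ (Prod.fst '' picks s.H) ∪
        {a | a ∈ Set.range l ∧ ∀ p ∈ picks s.H, p.1 ≠ a} := by
      intro a ha
      by_cases hp : ∃ p ∈ picks s.H, p.1 = a
      · exact Or.inl hp
      · push Not at hp
        exact Or.inr ⟨ha, hp⟩
    have h4 := (Set.ncard_le_ncard hsub (Set.toFinite _)).trans (Set.ncard_union_le _ _)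
    have h5 := Set.ncard_image_le (f := Prod.fst) (Set.toFinite (picks s.H))
    omega
  rw [← CState.hk] at h2
  omega

end Invariant

/-! ### The main loop -/

section MainLoop

theorem mul_ceilDiv_le (k a : ℕ) {b : ℕ} (hb : 0 < b) : (k * a) ⌈/⌉ b ≤ k * (a ⌈/⌉ b) := by
  rw [ceilDiv_le_iff_le_mul hb, Nat.mul_left_comm]
  exact Nat.mul_le_mul_left k ((ceilDiv_le_iff_le_mul hb).1 le_rfl)

theorem ceilDiv_mono {a a' : ℕ} (b : ℕ) (hb : 0 < b) (h : a ≤ a') : a ⌈/⌉ b ≤ a' ⌈/⌉ b := by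
  rw [ceilDiv_le_iff_le_mul hb]
  exact h.trans ((ceilDiv_le_iff_le_mul hb).1 le_rfl)

/-- The parameters of the algorithms for graphs with `V` vertices, `E` edges and weights below `U`:
colours with `L` digits, a pairwise independent family of `q` sets of colours, and the number `n₁`
of blocks of a table of triples of a set and two colours. -/
structure Setting (P : OEMParams) (V E U : ℕ) (u : ℝ) (N R Q L q n₁ A : ℕ)
    (F : Fin q → Colour L → Prop) : Prop where
  env : AlgEnv P u N Q
  V_le : V ≤ Q
  U_le : U ≤ Q
  L_le : L ≤ Q
  V_le_pow : V ≤ 2 ^ L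
  q_le : q ≤ 4 * Nat.card (Colour L)
  q_pos : 0 < q
  indep : ∀ c c', c ≠ c' → q ≤ 4 * {s | F s c ∧ ¬ F s c'}.ncard
  le_n₁ : 8 * L * (2 * L * (2 * L + 1)) ≤ n₁ * P.blockSize
  n₁_le : n₁ ≤ A * (E ⌈/⌉ P.blockSize)
  n₁_block : n₁ * P.blockSize ≤ 8 * L * (2 * L * (2 * L + 1)) + P.blockSize
  L_small : 8 * L * (2 * L * (2 * L + 1)) * (8 * L) ≤ A * E
  le_N : (100 + 10 * A) * (E ⌈/⌉ P.blockSize) ≤ N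
  le_R : 100 * (E ⌈/⌉ P.blockSize) ≤ R
  V_le_E : V ≤ 2 * E
  two_le : 2 ≤ E
  word : V + E + U ≤ 2 ^ P.wordBits

variable {P : OEMParams} {V E U : ℕ} {u : ℝ} {N R Q L q n₁ A : ℕ} {F : Fin q → Colour L → Prop}
  {𝓕 : Set (SimpleGraph (Fin V))} {T T' ν : ℝ}

theorem Setting.n₀_pos (hS : Setting P V E U u N R Q L q n₁ A F) : 1 ≤ E ⌈/⌉ P.blockSize := by
  by_contra h
  have h1 : E ≤ P.blockSize * 0 := (ceilDiv_le_iff_le_mul P.blockSize_pos).1 (by omega)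
  have := hS.two_le
  omega

theorem Setting.V_blocks (hS : Setting P V E U u N R Q L q n₁ A F) :
    V ⌈/⌉ P.blockSize ≤ 2 * (E ⌈/⌉ P.blockSize) :=
  (ceilDiv_mono _ P.blockSize_pos hS.V_le_E).trans (mul_ceilDiv_le 2 E P.blockSize_pos)

/-- In the absence of marks, `Contraction.exists_mark` shows that each component has a pick unless
only one is left. The maximum with 1 covers that case. -/
theorem Contraction.ncard_round_le [NeZero L] {𝓔 : Set (Ed V U)} {l : Fin V → Fin V}
    {s : CState V U} {O₀ : Set (Ed V U)} (F : Fin q → Colour L → Prop)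
    (h : Contraction 𝓔 l s.H (O₀ ∪ s.O)) (hH : ∀ r ∈ s.H, r.2.2 ≠ none)
    (hc : (Ed.gr 𝓔).Connected) (hL : V ≤ 2 ^ L) (hq : 0 < q)
    (hF : ∀ c c', c ≠ c' → q ≤ 4 * {s | F s c ∧ ¬ F s c'}.ncard)
    (hl : ((Set.range l).ncard : ℝ) ≤ max 1 ν) :
    ((Set.range (moveTo (s.hk F) ∘ l)).ncard : ℝ) ≤ max 1 (3 / 4 * ν) := by
  have hle := (h.step F).2
  rcases Nat.lt_or_ge (Set.range l).ncard 2 with h6 | h6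
  · refine le_trans ?_ (le_max_left _ _)
    exact_mod_cast (by omega : (Set.range (moveTo (s.hk F) ∘ l)).ncard ≤ 1)
  · have h7 := h.ncard_step_le F hL hq hF 0 (by
      rw [Nat.le_zero, Set.ncard_eq_zero (Set.toFinite _), Set.eq_empty_iff_forall_notMem]
      rintro a ⟨ha, hp⟩
      obtain ⟨r, hr, -, hn, -⟩ := h.exists_mark hc h6 ha hp
      exact hH r hr hn)
    refine le_trans ?_ (le_max_right _ _)
    have h8 : (2 : ℝ) ≤ (Set.range l).ncard := by exact_mod_cast h6
    have h9 : ((Set.range l).ncard : ℝ) ≤ ν := by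
      rcases le_max_iff.1 hl with h | h
      · linarith
      · exact h
    have h10 : (4 : ℝ) * (Set.range (moveTo (s.hk F) ∘ l)).ncard ≤ 3 * (Set.range l).ncard := by
      exact_mod_cast h7
    linarith

/-- With `T` I/Os, the graph can be contracted to at most `max 1 ν` vertices: there are at most so
many names, and tables of the records and of the contracted edges. -/
def Contracted (P : OEMParams) (V E U : ℕ) (𝓕 : Set (SimpleGraph (Fin V))) (R : ℕ) (ν T : ℝ) :
    Prop :=
  ∃ (l : GraphInput V E U 𝓕 → Fin V → Fin V) (G : GraphInput V E U 𝓕 → Set (Rec V U))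
    (O : GraphInput V E U 𝓕 → Set (Ed V U)),
    Reach (P := P) (fun x => x.1.load) R {⟨Rec V U, (2 * E) ⌈/⌉ P.blockSize, G⟩,
      ⟨Ed V U, V ⌈/⌉ P.blockSize, O⟩} T ∧
    ∀ x, Contraction x.1.edges (l x) (G x) (O x) ∧ (∀ r ∈ G x, r.2.2 ≠ none) ∧
      (G x).ncard ≤ 2 * E ∧ ((Set.range (l x)).ncard : ℝ) ≤ max 1 ν

theorem GraphInput.connected (x : GraphInput V E U 𝓕) : (Ed.gr x.1.edges).Connected := by
  rw [← EdgeArray.graph_eq]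
  exact x.2.1

theorem GraphInput.ncard_msf_le (x : GraphInput V E U 𝓕) : (Ed.msf x.1.edges).ncard ≤ V := by
  have := Ed.ncard_msf x.1.simple_edges x.connected
  omega

/-- The records of the given graph. -/
theorem exists_records (hS : Setting P V E U u N R Q L q n₁ A F) :
    ∃ G : GraphInput V E U 𝓕 → Set (Rec V U), Reach (P := P) (fun x => x.1.load) R
      {⟨Rec V U, (2 * E) ⌈/⌉ P.blockSize, G⟩, ⟨Ed V U, V ⌈/⌉ P.blockSize, fun _ => ∅⟩}
      (80 * u * (E ⌈/⌉ P.blockSize : ℕ)) ∧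
      ∀ x, Contraction x.1.edges id (G x) ∅ ∧ (∀ r ∈ G x, r.2.2 ≠ none) ∧ (G x).ncard ≤ 2 * E := by
  have : Fact (V ≤ Q) := ⟨hS.V_le⟩
  have : Fact (U ≤ Q) := ⟨hS.U_le⟩
  have hQ : Fact (2 ≤ Q) := ⟨hS.env.two_le⟩
  have hu := hS.env.one_le
  have hN := hS.le_N
  have hR := hS.le_R
  have hn₀ := hS.n₀_pos
  set n₀ := E ⌈/⌉ P.blockSize with hn₀'
  have hN' : 100 * n₀ ≤ N := le_trans (Nat.mul_le_mul_right _ (Nat.le_add_right _ _)) hN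
  have h0 := reach_edges (P := P) (𝓕 := 𝓕) (E := E) (R := R) hS.env hS.V_le hS.U_le (by omega)
  have h1 := h0.unionMap (Set.mem_singleton _) (Set.mem_singleton _)
    (fun e => some ((e.src, e, some e.dst) : Rec V U)) (fun e => some ((e.dst, e, some e.src) : Rec V U))
  have hcard : ∀ x : GraphInput V E U 𝓕, ({z | ∃ e ∈ x.1.edges,
      some ((e.src, e, some e.dst) : Rec V U) = some z} ∪ {z | ∃ e ∈ x.1.edges,
      some ((e.dst, e, some e.src) : Rec V U) = some z}).ncard ≤ 2 * E := by
    intro x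
    have h1 : ∀ f : Ed V U → Rec V U, {z | ∃ e ∈ x.1.edges, some (f e) = some z}.ncard ≤ E := by
      intro f
      have : {z | ∃ e ∈ x.1.edges, some (f e) = some z} = f '' x.1.edges := by
        ext z
        exact exists_congr fun y => and_congr_right fun _ => Option.some_inj
      rw [this]
      exact (Set.ncard_image_le (Set.toFinite _)).trans x.1.ncard_edges.le
    refine (Set.ncard_union_le _ _).trans ?_
    rw [Nat.two_mul]
    exact Nat.add_le_add (h1 _) (h1 _)
  have h2 := h1.shrink hS.env (Set.mem_insert _ _) (by omega) (2 * E) hcard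
  have h3 := h2.const hS.env.toSortEnv (∅ : Set (Ed V U)) 0 (by simp)
  have h4 := h3.congr (n' := V ⌈/⌉ P.blockSize) (Set.mem_insert _ _) (Nat.zero_le _) fun x => rfl
  refine ⟨_, h4.mono (T' := 80 * u * (n₀ : ℕ)) ?_ ?_,
    fun x => ⟨⟨?_, ?_, ?_, ?_⟩, ?_, hcard x⟩⟩
  · rintro t (rfl | rfl)
    · exact Set.mem_insert_of_mem _ (Set.mem_insert_of_mem _ (Set.mem_insert _ _))
    · exact Set.mem_insert _ _
  · have : (1 : ℝ) ≤ n₀ := by exact_mod_cast hn₀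
    push_cast
    nlinarith
  · rintro r (⟨e, he, hr⟩ | ⟨e, he, hr⟩) t ht
    · rw [Option.some_inj] at hr
      subst hr
      exact ⟨he, Or.inl ⟨rfl, Option.some.inj ht⟩⟩
    · rw [Option.some_inj] at hr
      subst hr
      exact ⟨he, Or.inr ⟨rfl, Option.some.inj ht⟩⟩
  · rintro e he a b (⟨h1, h2⟩ | ⟨h1, h2⟩) -
    · exact ⟨_, Or.inl ⟨e, he, rfl⟩, h1, le_rfl, Or.inl (congrArg some h2)⟩
    · exact ⟨_, Or.inr ⟨e, he, rfl⟩, h1, le_rfl, Or.inl (congrArg some h2)⟩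
  · exact Set.empty_subset _
  · rintro a b rfl
    exact Ed.Conn.refl _ _
  · rintro r (⟨e, he, hr⟩ | ⟨e, he, hr⟩)
    · rw [Option.some_inj] at hr
      subst hr
      simp
    · rw [Option.some_inj] at hr
      subst hr
      simp

theorem contracted_start (hS : Setting P V E U u N R Q L q n₁ A F) :
    Contracted P V E U 𝓕 R V (80 * u * (E ⌈/⌉ P.blockSize : ℕ)) := by
  obtain ⟨G, h1, h2⟩ := exists_records (𝓕 := 𝓕) hS
  refine ⟨fun _ => id, G, fun _ => ∅, h1, fun x => ⟨(h2 x).1, (h2 x).2.1, (h2 x).2.2,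
    le_max_of_le_right ?_⟩⟩
  rw [Set.range_id, Set.ncard_univ, Nat.card_fin]

theorem Contracted.mono (h : Contracted P V E U 𝓕 R ν T) {ν' : ℝ} (hν : ν ≤ ν') (hT : T ≤ T') :
    Contracted P V E U 𝓕 R ν' T' := by
  obtain ⟨l, G, O, h1, h2⟩ := h
  exact ⟨l, G, O, h1.mono subset_rfl hT, fun x => ⟨(h2 x).1, (h2 x).2.1, (h2 x).2.2.1,
    (h2 x).2.2.2.trans (max_le_max le_rfl hν)⟩⟩

theorem Contraction.eq_msf {𝓔 : Set (Ed V U)} {l : Fin V → Fin V} {H : Set (Rec V U)}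
    {O : Set (Ed V U)} (h : Contraction 𝓔 l H O) (hs : Ed.Simple 𝓔) (hc : (Ed.gr 𝓔).Connected)
    (hl : ((Set.range l).ncard : ℝ) ≤ 1) : O = Ed.msf 𝓔 := by
  have hl' : (Set.range l).ncard ≤ 1 := by exact_mod_cast hl
  rw [Set.ncard_le_one (Set.toFinite _)] at hl'
  exact Ed.eq_msf hs hc h.sub fun a b => h.conn a b (hl' _ ⟨a, rfl⟩ _ ⟨b, rfl⟩)

theorem Contracted.finish (hS : Setting P V E U u N R Q L q n₁ A F)
    (h : Contracted P V E U 𝓕 R ν T) (hν : ν ≤ 1) :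
    MSTConstructible P V E U 𝓕 (ENNReal.ofReal (T + 120 * u * (E ⌈/⌉ P.blockSize : ℕ))) := by
  obtain ⟨l, G, O, h1, h2⟩ := h
  have hO : ∀ x, O x = Ed.msf x.1.edges := fun x =>
    (h2 x).1.eq_msf x.1.simple_edges x.connected ((h2 x).2.2.2.trans_eq (max_eq_left hν))
  obtain rfl : O = fun x => Ed.msf x.1.edges := funext hO
  have hN := hS.le_N
  have hR := hS.le_R
  have hVb := hS.V_blocks
  have hu := hS.env.one_le
  have hN' : 100 * (E ⌈/⌉ P.blockSize) ≤ N :=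
    le_trans (Nat.mul_le_mul_right _ (Nat.le_add_right _ _)) hN
  obtain ⟨p, hp, hpT⟩ := mstConstructible_of_reach hS.env hS.V_le hS.U_le hS.word
    (V ⌈/⌉ P.blockSize) (by omega) (by omega) h1 (Or.inr rfl)
  refine ⟨p, hp, hpT.trans (ENNReal.ofReal_le_ofReal ?_)⟩
  have : ((V ⌈/⌉ P.blockSize : ℕ) : ℝ) ≤ 2 * (E ⌈/⌉ P.blockSize : ℕ) := by exact_mod_cast hVb
  nlinarith

/-- The records of the whole graph carry the current names. No table that compares them to older
names is needed, so the component `M` of the state stays empty. -/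
theorem Contracted.round [NeZero L] (hS : Setting P V E U u N R Q L q n₁ A F)
    (h : Contracted P V E U 𝓕 R ν T) :
    Contracted P V E U 𝓕 R (3 / 4 * ν) (T + 300 * u * ((4 + A) * (E ⌈/⌉ P.blockSize) : ℕ)) := by
  have : Fact (V ≤ Q) := ⟨hS.V_le⟩
  have : Fact (U ≤ Q) := ⟨hS.U_le⟩
  have : Fact (L ≤ Q) := ⟨hS.L_le⟩
  have hu := hS.env.one_le
  obtain ⟨l, G, O, h1, h2⟩ := h
  set s : GraphInput V E U 𝓕 → CState V U := fun x => ⟨G x, ∅, O x⟩ with hs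
  have hinv : ∀ x, Contraction x.1.edges (l x) (s x).H (∅ ∪ (s x).O) := fun x => by
    rw [Set.empty_union]
    exact (h2 x).1
  have hstep := fun x => (hinv x).step F
  have hN := hS.le_N
  have hVb := hS.V_blocks
  have hEb := mul_ceilDiv_le 2 E P.blockSize_pos
  have hn₁ := hS.n₁_le
  have h0 : (0 : ℕ) ⌈/⌉ P.blockSize = 0 :=
    Nat.le_zero.1 ((ceilDiv_le_iff_le_mul P.blockSize_pos).2 (Nat.zero_le _))
  have hA : (100 + 10 * A) * (E ⌈/⌉ P.blockSize) =
      100 * (E ⌈/⌉ P.blockSize) + 10 * (A * (E ⌈/⌉ P.blockSize)) := by ring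
  have h3 := h1.const hS.env.toSortEnv (∅ : Set (Fin V × Fin V)) 0 (by simp)
  have h4 : Reach (P := P) (fun x : GraphInput V E U 𝓕 => x.1.load) R
      (CState.tables P s (2 * E) 0 V ∪ ∅) T := by
    refine h3.mono ?_ (by simp)
    rintro t ((rfl | rfl | rfl) | ht)
    · exact Or.inr (Or.inl rfl)
    · exact Or.inl (by rw [h0])
    · exact Or.inr (Or.inr rfl)
    · exact ht.elim
  have h5 := h4.step hS.env F hS.q_le (by omega) hS.le_n₁ (fun x => (h2 x).2.2.1)
    (fun x => by simp [hs]) (fun x => by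
      have := (hstep x).1.sub
      rw [Set.empty_union] at this
      exact (Set.ncard_le_ncard this (Set.toFinite _)).trans x.ncard_msf_le)
  refine ⟨fun x => moveTo ((s x).hk F) ∘ l x, fun x => ((s x).step F).H,
    fun x => ((s x).step F).O, h5.mono ?_ ?_, fun x => ⟨?_, ?_, ?_, ?_⟩⟩
  · rintro t (rfl | rfl)
    · exact Or.inl (Or.inl rfl)
    · exact Or.inl (Or.inr (Or.inr rfl))
  · have hle : (2 * E) ⌈/⌉ P.blockSize + 0 ⌈/⌉ P.blockSize + V ⌈/⌉ P.blockSize + n₁ ≤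
        (4 + A) * (E ⌈/⌉ P.blockSize) := by
      rw [h0, Nat.add_mul]; omega
    have : (((2 * E) ⌈/⌉ P.blockSize + 0 ⌈/⌉ P.blockSize + V ⌈/⌉ P.blockSize + n₁ : ℕ) : ℝ) ≤
        ((4 + A) * (E ⌈/⌉ P.blockSize) : ℕ) := by exact_mod_cast hle
    nlinarith
  · have := (hstep x).1
    rwa [Set.empty_union] at this
  · rintro _ ⟨r, hr, rfl⟩ hn
    exact (h2 x).2.1 r hr (Option.map_eq_none_iff.1 hn)
  · exact ((s x).ncard_step_H F).trans (h2 x).2.2.1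
  · exact (hinv x).ncard_round_le F (h2 x).2.1 x.connected hS.V_le_pow hS.q_pos hS.indep
      (h2 x).2.2.2

end MainLoop

/-! ### Truncated lists of neighbours -/

section Truncation

variable {V U L q : ℕ}

/-- The lightest edge from each component to each other. -/
def lightest (G : Set (Rec V U)) : Set (Rec V U) :=
  {r | r ∈ external G ∧ ∀ r' ∈ external G, r'.1 = r.1 ∧ r'.2.2 = r.2.2 → r.2.1 ≤ r'.2.1}

/-- The records that precede `r` in the list of its component. -/
def before (D : Set (Rec V U)) (r : Rec V U) : Set (Rec V U) :=
  {r' | r' ∈ D ∧ r'.1 = r.1 ∧ recKey r' < recKey r}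

/-- The record in position `c` is kept if `c < j`, and turned into a mark if `c = j`. -/
def cut (j : ℕ) (r : Rec V U) (c : ℕ) : Option (Rec V U) :=
  if c < j then some r else if c = j then some (r.1, r.2.1, none) else none

/-- The lists of the `j` lightest neighbours. -/
def trunc (j : ℕ) (D : Set (Rec V U)) : Set (Rec V U) :=
  {z | ∃ r ∈ D, cut j r (before D r).ncard = some z}

/-- The components that occur in the records, with their own names. -/
def initialNames (H : Set (Rec V U)) : Set (Fin V × Fin V) :=
  {z | ∃ r ∈ H, some (r.1, r.1) = some z} ∪ {z | ∃ r ∈ H, (r.2.2.map fun t => (t, t)) = some z}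

theorem ncard_before_lt {D : Set (Rec V U)} {r r' : Rec V U} (h : r' ∈ before D r) :
    (before D r').ncard < (before D r).ncard :=
  Set.ncard_lt_ncard ((Set.ssubset_iff_of_subset (show before D r' ⊆ before D r from fun _ hs =>
    ⟨hs.1, hs.2.1.trans h.2.1, hs.2.2.trans h.2.2⟩)).2 ⟨r', h, fun h' => lt_irrefl _ h'.2.2⟩)
    (Set.toFinite _)

/-- A record is determined by its component and its rank in the list, and the ranks `0, …, j` are
retained, the last one as a mark. -/
theorem ncard_trunc_le (j : ℕ) (D : Set (Rec V U)) (W : Set (Fin V)) (hW : ∀ r ∈ D, r.1 ∈ W) :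
    (trunc j D).ncard ≤ W.ncard * (j + 1) := by
  have h1 : trunc j D ⊆ (fun r : Rec V U => if (before D r).ncard < j then r else (r.1, r.2.1, none)) ''
      {r | r ∈ D ∧ (before D r).ncard < j + 1} := by
    rintro z ⟨r, hr, hz⟩
    rw [cut] at hz
    split_ifs at hz with h2 h3
    · exact ⟨r, ⟨hr, by omega⟩, (if_pos h2).trans (Option.some.inj hz)⟩
    · exact ⟨r, ⟨hr, by omega⟩, (if_neg h2).trans (Option.some.inj hz)⟩
  refine (Set.ncard_le_ncard h1 (Set.toFinite _)).trans ((Set.ncard_image_le (Set.toFinite _)).trans ?_)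
  have h2 : (W ×ˢ (Set.Iio (j + 1))).ncard = W.ncard * (j + 1) := by
    rw [Set.ncard_prod]
    congr 1
    rw [← Nat.card_coe_set_eq]
    simp
  rw [← h2]
  refine Set.ncard_le_ncard_of_injOn (fun r => (r.1, (before D r).ncard))
    (fun r hr => ⟨hW r hr.1, hr.2⟩) ?_ ((Set.toFinite W).prod (Set.finite_Iio _))
  rintro r ⟨hr, -⟩ r' ⟨hr', -⟩ h
  obtain ⟨h3, h4⟩ := Prod.mk.inj h
  rcases lt_trichotomy (recKey r) (recKey r') with h5 | h5 | h5
  · exact absurd h4 (ncard_before_lt (D := D) ⟨hr, h3, h5⟩).ne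
  · exact recKey_injective h3 h5
  · exact absurd h4 (ncard_before_lt (D := D) ⟨hr', h3.symm, h5⟩).ne'

variable {𝓔 : Set (Ed V U)} {l : Fin V → Fin V} {G : Set (Rec V U)} {O : Set (Ed V U)}

theorem Contraction.lightest_spec (h : Contraction 𝓔 l G O) (hG : ∀ r ∈ G, r.2.2 ≠ none)
    {r : Rec V U} (hr : r ∈ lightest G) :
    ∃ t, r.2.2 = some t ∧ r.1 ≠ t ∧ r.2.1 ∈ 𝓔 ∧ Joins l r.2.1 r.1 t := by
  obtain ⟨t, ht⟩ := Option.ne_none_iff_exists'.1 (hG r hr.1.1)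
  obtain ⟨h1, h2⟩ := h.sound r hr.1.1 t ht
  exact ⟨t, ht, fun h3 => hr.1.2 (by rw [ht, h3]), h1, h2⟩

theorem Joins.mem_range {e : Ed V U} {a b : Fin V} (h : Joins l e a b) :
    a ∈ Set.range l ∧ b ∈ Set.range l := by
  rcases h with ⟨h1, h2⟩ | ⟨h1, h2⟩ <;> exact ⟨⟨_, h1⟩, ⟨_, h2⟩⟩

theorem lightest_injective {r r' : Rec V U} (hr : r ∈ lightest G) (hr' : r' ∈ lightest G)
    (h1 : r.1 = r'.1) (h2 : r.2.2 = r'.2.2) : r = r' :=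
  Prod.ext h1 (Prod.ext (le_antisymm (hr.2 _ hr'.1 ⟨h1.symm, h2.symm⟩) (hr'.2 _ hr.1 ⟨h1, h2⟩)) h2)

theorem Contraction.lightest_complete (h : Contraction 𝓔 l G O) (hG : ∀ r ∈ G, r.2.2 ≠ none)
    {e : Ed V U} (he : e ∈ 𝓔) {a b : Fin V} (hj : Joins l e a b) (hab : a ≠ b) :
    ∃ r ∈ lightest G, r.1 = a ∧ r.2.1 ≤ e ∧ r.2.2 = some b := by
  obtain ⟨r, hr, h1, h2, h3⟩ := h.complete e he a b hj hab
  have h3 := h3.resolve_right (hG r hr)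
  obtain ⟨m, hm, hmin⟩ := Set.exists_min_image {r | r ∈ external G ∧ r.1 = a ∧ r.2.2 = some b}
    (fun r => r.2.1) (Set.toFinite _)
    ⟨r, ⟨hr, by rw [h3, h1]; exact fun h => hab (Option.some.inj h).symm⟩, h1, h3⟩
  refine ⟨m, ⟨hm.1, fun r' hr' h' => hmin r' ⟨hr', h'.1.trans hm.2.1, h'.2.trans hm.2.2⟩⟩, hm.2.1,
    (hmin r ⟨⟨hr, by rw [h3, h1]; exact fun h => hab (Option.some.inj h).symm⟩, h1, h3⟩).trans h2,
    hm.2.2⟩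

theorem Contraction.lightest (h : Contraction 𝓔 l G O) (hG : ∀ r ∈ G, r.2.2 ≠ none) :
    Contraction 𝓔 l (lightest G) O where
  sound := fun r hr => h.sound r hr.1.1
  complete := fun e he a b hj hab => by
    obtain ⟨r, hr, h1, h2, h3⟩ := h.lightest_complete hG he hj hab
    exact ⟨r, hr, h1, h2, Or.inl h3⟩
  sub := h.sub
  conn := h.conn

theorem trunc_owner {j : ℕ} {r : Rec V U} (hr : r ∈ trunc j (_root_.lightest G)) :
    ∃ d ∈ _root_.lightest G, d.1 = r.1 ∧ d.2.1 = r.2.1 ∧ (r.2.2 = none ∨ r = d) := by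
  obtain ⟨d, hd, hz⟩ := hr
  rw [cut] at hz
  split_ifs at hz with h2 h3
  · rw [Option.some_inj] at hz
    exact ⟨d, hd, by rw [hz], by rw [hz], Or.inr hz.symm⟩
  · rw [Option.some_inj] at hz
    subst hz
    exact ⟨d, hd, rfl, rfl, Or.inl rfl⟩

/-- An edge that has been cut off the list of a component is no lighter than the record of rank `j`
in this list, which has become the mark. -/
theorem Contraction.trunc (h : Contraction 𝓔 l G O) (hG : ∀ r ∈ G, r.2.2 ≠ none) (j : ℕ) :
    Contraction 𝓔 l (trunc j (_root_.lightest G)) O where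
  sound := by
    intro r hr t ht
    obtain ⟨d, hd, -, -, h1 | h1⟩ := trunc_owner hr
    · rw [h1] at ht
      simp at ht
    · rw [h1] at ht ⊢
      exact h.sound d hd.1.1 t ht
  complete := by
    intro e he a b hj hab
    obtain ⟨r, hr, h1, h2, h3⟩ := h.lightest_complete hG he hj hab
    by_cases hrank : (before (_root_.lightest G) r).ncard < j
    · exact ⟨r, ⟨r, hr, if_pos hrank⟩, h1, h2, Or.inl h3⟩
    · obtain ⟨m, ⟨hm, hm1, hmj⟩, hmin⟩ := Set.exists_min_image {r | r ∈ _root_.lightest G ∧ r.1 = a ∧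
        j ≤ (before (_root_.lightest G) r).ncard} recKey (Set.toFinite _)
        ⟨r, hr, h1, not_lt.1 hrank⟩
      have hmr : m.2.1 ≤ e := by
        have := hmin r ⟨hr, h1, not_lt.1 hrank⟩
        rw [recKey, recKey, Prod.Lex.le_iff] at this
        rcases this with h4 | h4
        · exact (le_of_lt h4).trans h2
        · exact (le_of_eq h4.1).trans h2
      -- If the first record of rank at least `j` had a larger rank, then its immediate predecessor
      -- `y` would have rank at least `j`, too.
      have hmj' : (before (_root_.lightest G) m).ncard = j := by
        refine le_antisymm ?_ hmj
        by_contra hlt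
        obtain ⟨y, hy, hmax⟩ := Set.exists_max_image (before (_root_.lightest G) m) recKey
          (Set.toFinite _) ((Set.ncard_pos (Set.toFinite _)).1 (by omega))
        have hsub : before (_root_.lightest G) m ⊆ insert y (before (_root_.lightest G) y) := by
          intro w hw
          rcases (hmax w hw).lt_or_eq with h4 | h4
          · exact Or.inr ⟨hw.1, hw.2.1.trans hy.2.1.symm, h4⟩
          · exact Or.inl (recKey_injective (hw.2.1.trans hy.2.1.symm) h4)
        have h5 := (Set.ncard_le_ncard hsub (Set.toFinite _)).trans (Set.ncard_insert_le _ _)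
        exact not_le.2 hy.2.2 (hmin y ⟨hy.1, hy.2.1.trans hm1, by omega⟩)
      refine ⟨(m.1, m.2.1, none), ⟨m, hm, ?_⟩, hm1, hmr, Or.inr rfl⟩
      rw [cut, if_neg (by omega), if_pos hmj']
  sub := h.sub
  conn := h.conn

/-- A component that is stuck at a mark consists of many components of the beginning. -/
theorem Contraction.le_fiber (h : Contraction 𝓔 l G O) (hG : ∀ r ∈ G, r.2.2 ≠ none) {j : ℕ}
    (m : Fin V → Fin V) {a : Fin V} {r : Rec V U}
    (hr : r ∈ Rec.map m '' _root_.trunc j (_root_.lightest G)) (hra : r.1 = a) (hrn : r.2.2 = none)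
    (hmin : ∀ r' ∈ external (Rec.map m '' _root_.trunc j (_root_.lightest G)), r'.1 = a →
      recKey r ≤ recKey r') : j ≤ {b | b ∈ Set.range l ∧ m b = a}.ncard := by
  obtain ⟨r₀, hr₀, rfl⟩ := hr
  obtain ⟨d, hd, hz⟩ := hr₀
  obtain ⟨t, ht, hdt, hde, hdj⟩ := h.lightest_spec hG hd
  have hrn' : r₀.2.2 = none := Option.map_eq_none_iff.1 hrn
  rw [cut] at hz
  split_ifs at hz with h1 h2
  · rw [Option.some_inj] at hz
    rw [← hz, ht] at hrn'
    simp at hrn'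
  · rw [Option.some_inj] at hz
    subst hz
    change m d.1 = a at hra
    rw [← h2]
    -- The list originally had `j` records before the mark. Each of them now leads back into the
    -- component, since otherwise an external record would precede the mark.
    have key : ∀ d' ∈ before (_root_.lightest G) d, ∃ t', d'.2.2 = some t' ∧ t' ∈ Set.range l ∧
        m t' = a := by
      intro d' hd'
      obtain ⟨t', ht', hdt', hde', hdj'⟩ := h.lightest_spec hG hd'.1
      refine ⟨t', ht', hdj'.mem_range.2, ?_⟩
      by_contra hne
      have hd'H : d' ∈ _root_.trunc j (_root_.lightest G) :=
        ⟨d', hd'.1, if_pos (by have := ncard_before_lt hd'; omega)⟩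
      have h3 := hmin (Rec.map m d') ⟨⟨d', hd'H, rfl⟩, fun h4 => hne (by
        have h5 : (d'.2.2.map m) = some (m d'.1) := h4
        rw [ht', hd'.2.1, hra] at h5
        exact Option.some.inj h5)⟩ ((congrArg m hd'.2.1).trans hra)
      have h4 : d.2.1 ≤ d'.2.1 := by
        rw [recKey, recKey, Prod.Lex.le_iff] at h3
        rcases h3 with h3 | h3
        · exact le_of_lt h3
        · exact le_of_eq h3.1
      have h5 := hd'.2.2
      rw [recKey, recKey, Prod.Lex.lt_iff] at h5
      rcases h5 with h5 | ⟨h5, h6⟩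
      · exact not_le.2 h5 h4
      -- Two records of a component with the same edge enter the same component, so they cannot have
      -- different keys.
      · change d'.2.1 = d.2.1 at h5
        rw [h5, hd'.2.1] at hdj'
        have h7 := hdj.unique hdj' hdt
        have h8 : d'.2.2.elim 0 (fun t => (t : ℕ) + 1) < d.2.2.elim 0 (fun t => (t : ℕ) + 1) := h6
        rw [ht, ht', h7] at h8
        exact lt_irrefl _ h8
    -- These records lead to different components of the beginning, since `lightest` keeps only one
    -- record for each pair of components.
    refine Set.ncard_le_ncard_of_injOn (fun d' => d'.2.2.getD a) (fun d' hd' => ?_) ?_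
      (Set.toFinite _)
    · obtain ⟨t', ht', h3, h4⟩ := key d' hd'
      simp only [ht', Option.getD_some]
      exact ⟨h3, h4⟩
    · intro d' hd' d'' hd'' heq
      obtain ⟨t', ht', -⟩ := key d' hd'
      obtain ⟨t'', ht'', -⟩ := key d'' hd''
      simp only [ht', ht'', Option.getD_some] at heq
      exact lightest_injective hd'.1 hd''.1 (hd'.2.1.trans hd''.2.1.symm) (by rw [ht', ht'', heq])

end Truncation

/-! ### A phase: contraction rounds on truncated lists -/

section Phase

variable {V U L q : ℕ}

/-- The components that occur in the records. -/
def recNames (H : Set (Rec V U)) : Set (Fin V) := {a | ∃ r ∈ H, r.1 = a ∨ r.2.2 = some a}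

theorem initialNames_eq (H : Set (Rec V U)) : initialNames H = (fun a => (a, a)) '' recNames H := by
  ext ⟨a, b⟩
  constructor
  · rintro (⟨r, hr, hz⟩ | ⟨r, hr, hz⟩)
    · exact ⟨r.1, ⟨r, hr, Or.inl rfl⟩, Option.some.inj hz⟩
    · obtain ⟨t, ht, hz⟩ := Option.map_eq_some_iff.1 hz
      exact ⟨t, ⟨r, hr, Or.inr ht⟩, hz⟩
  · rintro ⟨c, ⟨r, hr, rfl | hc⟩, hz⟩
    · exact Or.inl ⟨r, hr, congrArg some hz⟩
    · exact Or.inr ⟨r, hr, by rw [hc, ← hz]; rfl⟩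

theorem Rec.map_map (f g : Fin V → Fin V) (r : Rec V U) : Rec.map f (Rec.map g r) = Rec.map (f ∘ g) r := by
  simp [Rec.map]

/-- A table of the renaming on the names in use determines it completely, because all other names
are fixed. -/
theorem newName_image (D : Set (Fin V)) (m : Fin V → Fin V) (hm : ∀ a ∉ D, m a = a) :
    newName ((fun a => (a, m a)) '' D) = m := by
  have hfun : ∀ k d d', (k, d) ∈ (fun a => (a, m a)) '' D → (k, d') ∈ (fun a => (a, m a)) '' D → d = d' := by
    rintro k d d' ⟨a, -, h⟩ ⟨a', -, h'⟩
    obtain ⟨rfl, rfl⟩ := Prod.mk.inj h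
    obtain ⟨rfl, rfl⟩ := Prod.mk.inj h'
    rfl
  funext a
  by_cases ha : a ∈ D
  · rw [newName, (lookup_eq_some hfun).2 ⟨a, ha, rfl⟩]
    rfl
  · rw [newName, lookup_eq_none.2, hm a ha]
    · rfl
    · rintro d ⟨b, hb, h⟩
      exact ha ((Prod.mk.inj h).1 ▸ hb)

variable {𝓔 : Set (Ed V U)} {l : Fin V → Fin V} {G : Set (Rec V U)} {O : Set (Ed V U)}

/-- The start of a phase. -/
def phaseStart (j : ℕ) (G : Set (Rec V U)) : CState V U :=
  ⟨trunc j (lightest G), initialNames (trunc j (lightest G)), ∅⟩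

variable [NeZero L] (F : Fin q → Colour L → Prop)

/-- The state `s` is reached from `phaseStart j G` by renaming the components with `m`. -/
structure Renamed (𝓔 : Set (Ed V U)) (l : Fin V → Fin V) (G : Set (Rec V U)) (O : Set (Ed V U)) (j : ℕ)
    (s : CState V U) (m : Fin V → Fin V) : Prop where
  H_eq : s.H = Rec.map m '' trunc j (lightest G)
  M_eq : s.M = (fun a => (a, m a)) '' recNames (trunc j (lightest G))
  fix : ∀ a ∉ recNames (trunc j (lightest G)), m a = a
  mem : ∀ a ∈ recNames (trunc j (lightest G)), m a ∈ recNames (trunc j (lightest G))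
  contraction : Contraction 𝓔 (m ∘ l) s.H (O ∪ s.O)
  card : s.O.ncard + (Set.range (m ∘ l)).ncard ≤ (Set.range l).ncard

theorem Contraction.renamed_start (h : Contraction 𝓔 l G O) (hG : ∀ r ∈ G, r.2.2 ≠ none) (j : ℕ) :
    Renamed 𝓔 l G O j (phaseStart j G) id where
  H_eq := by
    have : (Rec.map id : Rec V U → Rec V U) = id := by funext r; simp [Rec.map]
    rw [this, Set.image_id]
    rfl
  M_eq := initialNames_eq _
  fix := fun _ _ => rfl
  mem := fun _ h => h
  contraction := by
    rw [phaseStart, Set.union_empty]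
    exact h.trunc hG j
  card := by simp [phaseStart]

theorem Renamed.step {j : ℕ} {s : CState V U} {m : Fin V → Fin V} (h : Renamed 𝓔 l G O j s m) :
    Renamed 𝓔 l G O j (s.step F) (moveTo (s.hk F) ∘ m) := by
  have hpick : ∀ p ∈ s.hk F, p.1 ∈ recNames (trunc j (lightest G)) ∧
      p.2.1 ∈ recNames (trunc j (lightest G)) := by
    intro p hp
    have h1 : p.toRec ∈ s.H := (hooks_subset _ _ hp).1.1
    rw [h.H_eq] at h1
    obtain ⟨r, hr, hrp⟩ := h1
    constructor
    · have : m r.1 = p.1 := congrArg (fun r : Rec V U => r.1) hrp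
      exact this ▸ h.mem _ ⟨r, hr, Or.inl rfl⟩
    · have : r.2.2.map m = some p.2.1 := congrArg (fun r : Rec V U => r.2.2) hrp
      obtain ⟨t, ht, h2⟩ := Option.map_eq_some_iff.1 this
      exact h2 ▸ h.mem _ ⟨r, hr, Or.inr ht⟩
  have hstep := h.contraction.step F
  refine ⟨?_, ?_, fun a ha => ?_, fun a ha => ?_, hstep.1, ?_⟩
  · rw [CState.step, h.H_eq, Set.image_image]
    simp only [Rec.map_map]
  · rw [CState.step, h.M_eq, Set.image_image]
    rfl
  · rw [Function.comp_apply, h.fix a ha]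
    exact moveTo_of_notMem fun p hp hpa => ha (hpa ▸ (hpick p hp).1)
  · rw [Function.comp_apply]
    by_cases hp : ∃ p ∈ s.hk F, p.1 = m a
    · obtain ⟨p, hp, hpa⟩ := hp
      rw [← hpa, moveTo_of_mem (K := s.hk F) (fun p hp p' hp' => picks_functional s.H p
        (hooks_subset _ _ hp) p' (hooks_subset _ _ hp')) hp]
      exact (hpick p hp).2
    · push Not at hp
      rw [moveTo_of_notMem hp]
      exact h.mem a ha
  · have h1 := h.card
    have h2 := hstep.2
    have h3 : (s.step F).O.ncard ≤ s.O.ncard + (s.hk F).ncard :=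
      (Set.ncard_union_le _ _).trans (Nat.add_le_add_left (Set.ncard_image_le (Set.toFinite _)) _)
    rw [Function.comp_assoc]
    omega

/-- At most `n / j` components are stuck at a mark at any time. So one round leads from `x`
components to at most `3 x / 4 + (n / j) / 4`, and the bound `n / j + (3 / 4) ^ i * n` is preserved.
-/
theorem Contraction.phase (h : Contraction 𝓔 l G O) (hG : ∀ r ∈ G, r.2.2 ≠ none)
    (hc : (Ed.gr 𝓔).Connected) (hL : V ≤ 2 ^ L) (hq : 0 < q)
    (hF : ∀ c c', c ≠ c' → q ≤ 4 * {s | F s c ∧ ¬ F s c'}.ncard) {j : ℕ} (hj : 1 ≤ j) (i : ℕ) :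
    ∃ m, Renamed 𝓔 l G O j ((CState.step F)^[i] (phaseStart j G)) m ∧
      ((Set.range (m ∘ l)).ncard : ℝ) ≤
        max (1 : ℝ) ((Set.range l).ncard / j + (3 / 4 : ℝ) ^ i * (Set.range l).ncard) := by
  have hj' : (0 : ℝ) < j := by exact_mod_cast hj
  set n := (Set.range l).ncard with hn
  induction i with
  | zero =>
    refine ⟨id, h.renamed_start hG j, le_max_of_le_right ?_⟩
    rw [Function.id_comp, pow_zero, one_mul]
    have : (0 : ℝ) ≤ (n : ℝ) / j := by positivity
    linarith
  | succ i ih =>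
    obtain ⟨m, hm, hcard⟩ := ih
    rw [Function.iterate_succ_apply']
    set s := (CState.step F)^[i] (phaseStart j G)
    refine ⟨_, hm.step F, ?_⟩
    have hle := (hm.contraction.step F).2
    rw [Function.comp_assoc]
    rcases Nat.lt_or_ge (Set.range (m ∘ l)).ncard 2 with h2 | h2
    · exact le_max_of_le_left (by
        exact_mod_cast (by omega : (Set.range (moveTo (s.hk F) ∘ m ∘ l)).ncard ≤ 1))
    · set W := {a | a ∈ Set.range (m ∘ l) ∧ ∀ p ∈ picks s.H, p.1 ≠ a}
      have h3 := hm.contraction.ncard_step_le F hL hq hF W.ncard le_rfl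
      -- Each stuck component comprises at least `j` components of the beginning, and different ones
      -- comprise disjoint sets.
      have h4 : W.ncard * j ≤ n := by
        have h5 := finsum_card_fiber (Set.range l) m W fun b hb => by
          obtain ⟨v, hv⟩ := hb.1
          exact ⟨l v, ⟨v, rfl⟩, hv⟩
        have h6 : W.ncard * j ≤ ∑ᶠ b ∈ W, {a | a ∈ Set.range l ∧ m a = b}.ncard := by
          rw [finsum_mem_eq_finite_toFinset_sum _ (Set.toFinite W), Set.ncard_eq_toFinset_card _,
            ← smul_eq_mul]
          refine Finset.card_nsmul_le_sum _ _ _ fun a ha => ?_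
          obtain ⟨ha, hp⟩ := (Set.Finite.mem_toFinset _).1 ha
          obtain ⟨r, hr, hra, hrn, hmin⟩ := hm.contraction.exists_mark hc h2 ha hp
          rw [hm.H_eq] at hr hmin
          exact h.le_fiber hG m hr hra hrn hmin
        exact h6.trans (h5.trans_le (Set.ncard_le_ncard (fun a ha => ha.1) (Set.toFinite _)))
      refine le_max_of_le_right ?_
      have h5 : ((Set.range (m ∘ l)).ncard : ℝ) ≤ n / j + (3 / 4) ^ i * n := by
        rcases le_max_iff.1 hcard with h6 | h6
        · have : (Set.range (m ∘ l)).ncard ≤ 1 := by exact_mod_cast h6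
          omega
        · exact h6
      have h6 : (W.ncard : ℝ) ≤ n / j := by
        rw [le_div_iff₀ hj']
        exact_mod_cast h4
      have h7 : (4 : ℝ) * (Set.range (moveTo (s.hk F) ∘ m ∘ l)).ncard ≤
          3 * (Set.range (m ∘ l)).ncard + W.ncard := by exact_mod_cast h3
      rw [pow_succ]
      linarith

variable {P : OEMParams} {X : Type} {ld : X → P.Server} {R : ℕ} {𝓢 : Set (Tbl X)}
  {T u : ℝ} {N Q : ℕ}

theorem Reach.lightest (h : Reach ld R 𝓢 T) (hE : AlgEnv P u N Q) [hV : Fact (V ≤ Q)]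
    [hU : Fact (U ≤ Q)] {n : ℕ} {H : X → Set (Rec V U)} (hH : ⟨Rec V U, n, H⟩ ∈ 𝓢) (hn : n ≤ N) :
    Reach ld R (insert ⟨Rec V U, n, fun x => _root_.lightest (H x)⟩ 𝓢) (T + 7 * u * n) := by
  have hQ : Fact (2 ≤ Q) := ⟨hE.two_le⟩
  have h1 := h.filterMap hH (fun r => if r.2.2 = some r.1 then none else some r)
  have h2 := h1.groupMin hE (Set.mem_insert _ _) hn (fun r => (r.1, r.2.2)) (fun r => r.2.1)
    (fun y y' h h' => Prod.ext (Prod.mk.inj h).1 (Prod.ext h' (Prod.mk.inj h).2)) some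
  refine (h2.congr (Set.mem_insert _ _) le_rfl (S' := fun x => _root_.lightest (H x))
    fun x => ?_).mono
    (Set.insert_subset_insert ((Set.subset_insert _ _).trans (Set.subset_insert _ _))) le_rfl
  have hext : {z | ∃ r ∈ H x, (if r.2.2 = some r.1 then none else some r) = some z} =
      external (H x) := by
    ext r
    constructor
    · rintro ⟨r', hr', hz⟩
      split_ifs at hz with h1
      rw [Option.some_inj] at hz
      exact hz ▸ ⟨hr', h1⟩
    · rintro ⟨hr, h1⟩
      exact ⟨r, hr, if_neg h1⟩
  ext r
  simp only [hext, Option.some_inj]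
  constructor
  · rintro ⟨r', hr', hmin, rfl⟩
    exact ⟨hr', fun r hr h => hmin r hr (Prod.ext h.1 h.2)⟩
  · rintro ⟨hr, hmin⟩
    exact ⟨r, hr, fun r hr h => hmin r hr (Prod.mk.inj h), rfl⟩

/-- A counter that stops at `j + 1` suffices, as `cut` does not distinguish ranks beyond `j`. -/
theorem Reach.trunc (h : Reach ld R 𝓢 T) (hE : AlgEnv P u N Q) [hV : Fact (V ≤ Q)]
    [hU : Fact (U ≤ Q)] {n : ℕ} {D : X → Set (Rec V U)} (hD : ⟨Rec V U, n, D⟩ ∈ 𝓢) (hn : n ≤ N)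
    (j : ℕ) (hj : j + 2 ≤ Q) :
    Reach ld R (insert ⟨Rec V U, n, fun x => _root_.trunc j (D x)⟩ 𝓢) (T + 7 * u * n) := by
  have hQ : Fact (2 ≤ Q) := ⟨hE.two_le⟩
  have hj' : Fact (j + 2 ≤ Q) := ⟨hj⟩
  have h2 := h.groupScan hE hD hn Prod.fst recKey (fun _ _ h h' => recKey_injective h h')
    (σ := Fin (j + 2)) (fun A => ⟨min (j + 1) A.ncard, by omega⟩)
    (fun c _ => ⟨min (j + 1) (c + 1), by omega⟩) (fun A y hA => by
      rw [Fin.mk.injEq, Set.ncard_insert_of_notMem (fun hy => lt_irrefl _ (hA y hy)) (Set.toFinite _)]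
      dsimp only
      omega) (fun r c => cut j r c)
  refine (h2.congr (Set.mem_insert _ _) le_rfl (S' := fun x => _root_.trunc j (D x))
    fun x => ?_).mono (Set.insert_subset_insert (Set.subset_insert _ _)) le_rfl
  have hcut : ∀ (r : Rec V U) (c : ℕ), cut j r (min (j + 1) c) = cut j r c := by
    intro r c
    rcases le_total (j + 1) c with h | h
    · rw [min_eq_left h, cut, cut, if_neg (by omega), if_neg (by omega), if_neg (by omega),
        if_neg (by omega)]
    · rw [min_eq_right h]
  simp only [hcut]
  rfl

end Phase

/-! ### The cost of a phase -/

section PhaseCost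

variable {P : OEMParams} {V E U : ℕ} {u : ℝ} {N R Q L q n₁ A : ℕ} {F : Fin q → Colour L → Prop}
  {𝓕 : Set (SimpleGraph (Fin V))} {T ν : ℝ}

theorem Contraction.ncard_names_le {𝓔 : Set (Ed V U)} {l : Fin V → Fin V} {G : Set (Rec V U)}
    {O : Set (Ed V U)} (h : Contraction 𝓔 l G O) (hG : ∀ r ∈ G, r.2.2 ≠ none) (j : ℕ) :
    (recNames (_root_.trunc j (_root_.lightest G))).ncard ≤ (Set.range l).ncard ∧
      (_root_.trunc j (_root_.lightest G)).ncard ≤ (Set.range l).ncard * (j + 1) := by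
  refine ⟨Set.ncard_le_ncard ?_ (Set.toFinite _), ncard_trunc_le j _ _ fun r hr => ?_⟩
  · rintro a ⟨r, hr, ha⟩
    obtain ⟨d, hd, h1, -, h3⟩ := trunc_owner hr
    obtain ⟨t, ht, -, -, hj⟩ := h.lightest_spec hG hd
    rcases ha with rfl | ha
    · exact h1 ▸ hj.mem_range.1
    · rcases h3 with h3 | rfl
      · simp [h3] at ha
      · rw [ht, Option.some_inj] at ha
        exact ha ▸ hj.mem_range.2
  · obtain ⟨t, ht, -, -, hj⟩ := h.lightest_spec hG hr
    exact hj.mem_range.1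

/-- The rounds of a phase work on `max 1 ν * (j + 1)` records at most, so by `hν` all `k` rounds
together cost as much as a few operations on the `E` edges. Only at the end are the records of the
whole graph renamed, in one go. -/
theorem Contracted.phase [NeZero L] (hS : Setting P V E U u N R Q L q n₁ A F)
    (h : Contracted P V E U 𝓕 R ν T) {j k : ℕ} (hj : 1 ≤ j) (hjQ : j + 2 ≤ Q) (hk : 1 ≤ k)
    (hkL : k ≤ 8 * L) (hjk : (j : ℝ) ≤ (4 / 3) ^ k) (hν : max 1 ν * (j + 1) * k ≤ E) :
    Contracted P V E U 𝓕 R (2 * ν / j) (T + (3000 + 300 * A) * u * (E ⌈/⌉ P.blockSize : ℕ)) := by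
  have : Fact (V ≤ Q) := ⟨hS.V_le⟩
  have : Fact (U ≤ Q) := ⟨hS.U_le⟩
  have : Fact (L ≤ Q) := ⟨hS.L_le⟩
  have : Fact (2 ≤ Q) := ⟨hS.env.two_le⟩
  have hu := hS.env.one_le
  have hB := P.blockSize_pos
  have hn₀ := hS.n₀_pos
  have hN := hS.le_N
  have hVb := hS.V_blocks
  have hEb := mul_ceilDiv_le 2 E P.blockSize_pos
  have hn₁ := hS.n₁_le
  have hEB : E ≤ P.blockSize * (E ⌈/⌉ P.blockSize) := (ceilDiv_le_iff_le_mul hB).1 le_rfl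
  set n₀ := E ⌈/⌉ P.blockSize with hn₀'
  have hA : (100 + 10 * A) * n₀ = 100 * n₀ + 10 * (A * n₀) := by ring
  have hn₀r : (1 : ℝ) ≤ n₀ := by exact_mod_cast hn₀
  obtain ⟨l, G, O, h1, h2⟩ := h
  set νN := ⌊max 1 ν⌋₊ with hνN
  have hlN : ∀ x, (Set.range (l x)).ncard ≤ νN := fun x => Nat.le_floor (h2 x).2.2.2
  set w := νN * (j + 1) with hw
  have hwk : w * k ≤ E := by
    have h3 : ((w * k : ℕ) : ℝ) ≤ max 1 ν * (j + 1) * k := by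
      rw [hw]
      push_cast
      have := Nat.floor_le (le_max_of_le_left zero_le_one : (0 : ℝ) ≤ max 1 ν)
      gcongr
    exact_mod_cast h3.trans hν
  have hwE : w ≤ E := (Nat.le_mul_of_pos_right w hk).trans hwk
  have hνw : νN ≤ w := Nat.le_mul_of_pos_right _ (Nat.succ_pos _)
  set nh := w ⌈/⌉ P.blockSize with hnh
  have hnhE : nh ≤ n₀ := ceilDiv_mono _ hB hwE
  have hnm : νN ⌈/⌉ P.blockSize ≤ nh := ceilDiv_mono _ hB hνw
  have hspec := fun x i => (h2 x).1.phase F (h2 x).2.1 x.connected hS.V_le_pow hS.q_pos hS.indep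
    (j := j) hj i
  have hnames := fun x => (h2 x).1.ncard_names_le (h2 x).2.1 j
  set s : GraphInput V E U 𝓕 → CState V U := fun x => (CState.step F)^[k] (phaseStart j (G x))
    with hs
  have hO : ∀ x i, ((CState.step F)^[i] (phaseStart j (G x))).O.ncard ≤ νN := by
    intro x i
    obtain ⟨m, hm, -⟩ := hspec x i
    have := hm.card
    have := hlN x
    omega
  have hM : ∀ x, (s x).M.ncard ≤ νN := by
    intro x
    obtain ⟨m, hm, -⟩ := hspec x k
    rw [hm.M_eq]
    exact (Set.ncard_image_le (Set.toFinite _)).trans ((hnames x).1.trans (hlN x))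
  have h3 := h1.lightest hS.env (Set.mem_insert _ _) (by omega)
  have h4 := h3.trunc hS.env (Set.mem_insert _ _) (by omega) j hjQ
  have h5 := h4.shrink hS.env (Set.mem_insert _ _) (by omega) w fun x =>
    (hnames x).2.trans (Nat.mul_le_mul_right _ (hlN x))
  rw [← hnh] at h5
  have key : Reach (P := P) (fun x : GraphInput V E U 𝓕 => x.1.load) R
      ({⟨Fin V × Fin V, n₀, fun x => (s x).M⟩, ⟨Ed V U, n₀, fun x => (s x).O⟩} ∪
        {⟨Rec V U, (2 * E) ⌈/⌉ P.blockSize, G⟩, ⟨Ed V U, V ⌈/⌉ P.blockSize, O⟩})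
      (T + (2300 + 300 * A) * u * n₀) := by
    have hg : (((2 * E) ⌈/⌉ P.blockSize : ℕ) : ℝ) ≤ 2 * n₀ := by exact_mod_cast hEb
    -- If the truncated lists do not fill a block, then charging each round for a full block could
    -- exceed the budget. In that case the client carries out the whole phase in its private memory.
    rcases Nat.lt_or_ge P.blockSize w with hwB | hwB
    · have h6 := h5.unionMap (Set.mem_insert _ _) (Set.mem_insert _ _)
        (fun r : Rec V U => some (r.1, r.1)) (fun r : Rec V U => r.2.2.map fun t => (t, t))
      have h7 := h6.shrink hS.env (Set.mem_insert _ _) (by omega) νN fun x => by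
        change (initialNames (_root_.trunc j (_root_.lightest (G x)))).ncard ≤ νN
        rw [initialNames_eq]
        exact (Set.ncard_image_le (Set.toFinite _)).trans ((hnames x).1.trans (hlN x))
      have h8 := h7.const hS.env.toSortEnv (∅ : Set (Ed V U)) 0 (by simp)
      have h9 := h8.congr (n' := νN ⌈/⌉ P.blockSize) (Set.mem_insert _ _) (Nat.zero_le _)
        (S' := fun x => (phaseStart j (G x)).O) fun x => rfl
      have h10 := Reach.iterate_step hS.env F hS.q_le (n₁ := n₁) (h := w) (m := νN) (o := νN)
        (s := fun x => phaseStart j (G x))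
        (𝓢 := {⟨Rec V U, (2 * E) ⌈/⌉ P.blockSize, G⟩, ⟨Ed V U, V ⌈/⌉ P.blockSize, O⟩})
        (h9.mono (T' := _) (by
          rintro t ((rfl | rfl | rfl) | ht)
          · iterate 4 apply Set.mem_insert_of_mem
            exact Set.mem_insert _ _
          · iterate 2 apply Set.mem_insert_of_mem
            exact Set.mem_insert _ _
          · exact Set.mem_insert _ _
          · iterate 7 apply Set.mem_insert_of_mem
            exact ht) le_rfl) (by omega) hS.le_n₁
        (fun x => (hnames x).2.trans (Nat.mul_le_mul_right _ (hlN x)))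
        (fun x => by
          change (initialNames (_root_.trunc j (_root_.lightest (G x)))).ncard ≤ νN
          rw [initialNames_eq]
          exact (Set.ncard_image_le (Set.toFinite _)).trans ((hnames x).1.trans (hlN x)))
        k (fun x i _ => hO x i)
      have h11 := h10.congr (n' := n₀) (S' := fun x => (s x).M)
        (Or.inl (Or.inr (Or.inl rfl))) (hnm.trans hnhE) fun x => rfl
      have h12 := h11.congr (n' := n₀) (S' := fun x => (s x).O)
        (Or.inr (Or.inl (Or.inr (Or.inr rfl)))) (hnm.trans hnhE) fun x => rfl
      refine h12.mono ?_ ?_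
      · rintro t ((rfl | rfl) | ht)
        · exact Or.inr (Or.inl rfl)
        · exact Or.inl rfl
        · exact Or.inr (Or.inr (Or.inr ht))
      -- Since the lists fill more than one block, rounding up to full blocks costs at most a factor
      -- 2.
      · have hk1 : k * nh ≤ 2 * n₀ := by
          have h13 : P.blockSize * nh ≤ 2 * w := by
            have : P.blockSize * nh ≤ w + P.blockSize := by
              rw [hnh, Nat.ceilDiv_eq_add_pred_div]
              exact (Nat.mul_div_le _ _).trans (by omega)
            omega
          refine Nat.le_of_mul_le_mul_left ?_ hB
          calc P.blockSize * (k * nh) = k * (P.blockSize * nh) := by ring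
            _ ≤ k * (2 * w) := Nat.mul_le_mul_left _ h13
            _ = 2 * (w * k) := by ring
            _ ≤ P.blockSize * (2 * n₀) := by linarith
        -- The tables for the choice of the set, summed over all rounds: their contents are bounded
        -- by `L_small` and `k ≤ 8 * L`, and the rounding up to blocks by `k * P.blockSize ≤ E`.
        have hk2 : k * n₁ ≤ (A + 1) * n₀ := by
          refine Nat.le_of_mul_le_mul_right ?_ hB
          have h13 := hS.n₁_block
          have h14 := hS.L_small
          have h15 : k * P.blockSize ≤ E :=
            (Nat.mul_le_mul_left _ hwB.le).trans (by rwa [Nat.mul_comm])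
          calc k * n₁ * P.blockSize = k * (n₁ * P.blockSize) := by ring
            _ ≤ k * (8 * L * (2 * L * (2 * L + 1)) + P.blockSize) := Nat.mul_le_mul_left _ h13
            _ = 8 * L * (2 * L * (2 * L + 1)) * k + k * P.blockSize := by ring
            _ ≤ 8 * L * (2 * L * (2 * L + 1)) * (8 * L) + E :=
              Nat.add_le_add (Nat.mul_le_mul_left _ hkL) h15
            _ ≤ (A + 1) * E := by linarith
            _ ≤ (A + 1) * (P.blockSize * n₀) := Nat.mul_le_mul_left _ hEB
            _ = (A + 1) * n₀ * P.blockSize := by ring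
        have hk3 : k * (nh + νN ⌈/⌉ P.blockSize + νN ⌈/⌉ P.blockSize + n₁) ≤ (7 + A) * n₀ := by
          have := Nat.mul_le_mul_left k hnm
          linarith
        have hk4 : (k : ℝ) * (nh + νN ⌈/⌉ P.blockSize + νN ⌈/⌉ P.blockSize + n₁ : ℕ) ≤
            (7 + A) * n₀ := by exact_mod_cast hk3
        have h13 : (k : ℝ) * (300 * u * (nh + νN ⌈/⌉ P.blockSize + νN ⌈/⌉ P.blockSize + n₁ : ℕ)) ≤
            300 * u * ((7 + A) * n₀) := by
          rw [mul_left_comm]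
          gcongr
        have h14 : (nh : ℝ) ≤ n₀ := by exact_mod_cast hnhE
        rw [← hnh]
        push_cast at h13 ⊢
        have h15 : u * (((2 * E) ⌈/⌉ P.blockSize : ℕ) : ℝ) ≤ u * (2 * n₀) := by gcongr
        have h16 : u * (nh : ℝ) ≤ u * n₀ := by gcongr
        nlinarith
    · have hnh1 : nh ≤ 1 := (ceilDiv_le_iff_le_mul hB).2 (by omega)
      have h6 := h5.congr (n' := 1) (Set.mem_insert _ _) hnh1 fun x => rfl
      have h7 := h6.onBlock hS.env (Set.mem_insert _ _)
        (fun D => ((CState.step F)^[k] ⟨D, initialNames D, ∅⟩).M)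
        (fun x => (hM x).trans (hνw.trans hwB))
      have h8 := h7.onBlock hS.env (Set.mem_insert_of_mem _ (Set.mem_insert _ _))
        (fun D => ((CState.step F)^[k] ⟨D, initialNames D, ∅⟩).O)
        (fun x => (hO x k).trans (hνw.trans hwB))
      have h9 := h8.congr (n' := n₀) (S' := fun x => (s x).M)
        (Set.mem_insert_of_mem _ (Set.mem_insert _ _)) hn₀ fun x => rfl
      have h10 := h9.congr (n' := n₀) (S' := fun x => (s x).O)
        (Set.mem_insert_of_mem _ (Set.mem_insert _ _)) hn₀ fun x => rfl
      refine h10.mono ?_ ?_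
      · rintro t ((rfl | rfl) | ht)
        · exact Or.inr (Or.inl rfl)
        · exact Or.inl rfl
        · iterate 8 apply Set.mem_insert_of_mem
          exact ht
      · have h15 : u * (((2 * E) ⌈/⌉ P.blockSize : ℕ) : ℝ) ≤ u * (2 * n₀) := by gcongr
        have h16 : u * 1 ≤ u * n₀ := by gcongr
        have h17 : 0 ≤ (A : ℝ) * (u * n₀) := by positivity
        nlinarith
  choose m hm hcard using fun x => hspec x k
  -- The table `M` of the final state contains the renaming of the phase.
  have hname : ∀ x, newName (s x).M = m x := fun x => by
    rw [(hm x).M_eq]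
    exact newName_image _ _ (hm x).fix
  have h6 := key.relabelRec hS.env (Or.inl (Or.inl rfl)) (Or.inr (Or.inl rfl)) (by omega)
    (fun x a d d' hd hd' => by
      rw [(hm x).M_eq] at hd hd'
      obtain ⟨b, -, hb⟩ := hd
      obtain ⟨b', -, hb'⟩ := hd'
      obtain ⟨rfl, rfl⟩ := Prod.mk.inj hb
      obtain ⟨rfl, rfl⟩ := Prod.mk.inj hb'
      rfl) (2 * E) fun x => (h2 x).2.2.1
  simp only [hname] at h6
  have h7 := h6.union (n := V ⌈/⌉ P.blockSize) (S := O) (n' := n₀) (S' := fun x => (s x).O)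
    (Or.inr (Or.inr (Or.inr rfl))) (Or.inr (Or.inl (Or.inr rfl)))
  have h8 := h7.shrink hS.env (Set.mem_insert _ _) (by omega) V fun x =>
    (Set.ncard_le_ncard (hm x).contraction.sub (Set.toFinite _)).trans x.ncard_msf_le
  refine ⟨fun x => m x ∘ l x, fun x => Rec.map (m x) '' G x, fun x => O x ∪ (s x).O,
    h8.mono ?_ ?_, fun x => ⟨(h2 x).1.map _ (hm x).contraction.sub (hm x).contraction.conn, ?_,
      (Set.ncard_image_le (Set.toFinite _)).trans (h2 x).2.2.1, ?_⟩⟩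
  · rintro t (rfl | rfl)
    · exact Or.inr (Or.inr (Or.inl rfl))
    · exact Or.inl rfl
  · have hg : (((2 * E) ⌈/⌉ P.blockSize : ℕ) : ℝ) ≤ 2 * n₀ := by exact_mod_cast hEb
    have hV : ((V ⌈/⌉ P.blockSize : ℕ) : ℝ) ≤ 2 * n₀ := by exact_mod_cast hVb
    have h15 : u * (((2 * E) ⌈/⌉ P.blockSize : ℕ) : ℝ) ≤ u * (2 * n₀) := by gcongr
    have h16 : u * ((V ⌈/⌉ P.blockSize : ℕ) : ℝ) ≤ u * (2 * n₀) := by gcongr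
    push_cast
    nlinarith
  · rintro _ ⟨r, hr, rfl⟩ hn
    exact (h2 x).2.1 r hr (Option.map_eq_none_iff.1 hn)
  · have h9 := (h2 x).2.2.2
    have hj' : (0 : ℝ) < j := by exact_mod_cast hj
    have h10 : (Set.range (m x ∘ l x)).ncard ≤ (Set.range (l x)).ncard := by
      have := (hm x).card
      omega
    have h10' : ((Set.range (m x ∘ l x)).ncard : ℝ) ≤ (Set.range (l x)).ncard := by
      exact_mod_cast h10
    rcases le_max_iff.1 h9 with h11 | h11
    · exact le_max_of_le_left (h10'.trans h11)
    · refine (hcard x).trans (max_le_max le_rfl ?_)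
      -- The number of rounds is chosen such that the decaying term is at most that of the stuck
      -- components.
      have h12 : ((3 : ℝ) / 4) ^ k ≤ 1 / j := by
        rw [le_div_iff₀ hj', ← le_div_iff₀' (by positivity), one_div, ← inv_pow]
        norm_num
        exact hjk
      have h13 : ((3 : ℝ) / 4) ^ k * (Set.range (l x)).ncard ≤ 1 / j * ν := by gcongr
      have h14 : ((Set.range (l x)).ncard : ℝ) / j ≤ ν / j := by gcongr
      calc _ ≤ ν / j + 1 / j * ν := add_le_add h14 h13
        _ = 2 * ν / j := by ring

end PhaseCost

/-! ### The parameters of the algorithms -/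

section Parameters

/-- A power of `log V` is bounded by a multiple of `V`. This keeps the tables for the choice of the
set small in comparison to the graph, even when they are used in `O(log V)` rounds. -/
theorem pow_four_le (n : ℕ) : (n + 1) ^ 4 ≤ 64 * 2 ^ n := by
  rcases Nat.lt_or_ge n 6 with h | h
  · interval_cases n <;> norm_num
  · induction n, h using Nat.le_induction with
    | base => norm_num
    | succ n hn ih =>
      have h1 : (n + 1 + 1) ^ 4 ≤ 2 * (n + 1) ^ 4 := by
        obtain ⟨t, rfl⟩ := Nat.exists_eq_add_of_le hn
        ring_nf
        nlinarith [Nat.zero_le t, Nat.zero_le (t ^ 2), Nat.zero_le (t ^ 3), Nat.zero_le (t ^ 4)]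
      rw [pow_succ 2]
      omega

theorem exists_setting (K : ℕ) : ∃ C : ℝ, 0 < C ∧ ∀ (P : OEMParams) (V E U : ℕ), P.Fits 100 V E U →
    2 ≤ E → 1 ≤ V → V ≤ 2 * E → ∃ (u : ℝ) (N R q n₁ : ℕ)
      (F : Fin q → Colour (Nat.log 2 V + 1) → Prop),
      Setting P V E U u N R (V + E + U) (Nat.log 2 V + 1) q n₁ 50000 F ∧
      K * (E ⌈/⌉ P.blockSize) ≤ N ∧
      ENNReal.ofReal (u * (E ⌈/⌉ P.blockSize : ℕ)) ≤ ENNReal.ofReal C * DOSort P E := by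
  obtain ⟨C, hC, h⟩ := exists_sort_unit (100 + 10 * 50000 + K)
  refine ⟨C, hC, fun P V E U hP hE hV hVE => ?_⟩
  obtain ⟨hM, hw⟩ := hP
  have hB := P.blockSize_pos
  have hpow : ∀ i ≤ 100, (V + E + U) ^ i ≤ 2 ^ P.wordBits := fun i hi =>
    (Nat.pow_le_pow_right (by omega) hi).trans hw
  have hword : V + E + U ≤ 2 ^ P.wordBits := by simpa using hpow 1 (by norm_num)
  have hM2 : 2 * P.blockSize ≤ P.memSize := le_trans (by omega) hM
  obtain ⟨u, hu, hsort, hcost⟩ := h P E hM2 (by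
    by_contra h0
    rw [Nat.eq_zero_of_not_pos h0, pow_zero] at hword
    omega) hE
  set L := Nat.log 2 V + 1 with hL
  have hL2 : 2 ^ (L - 1) ≤ V := Nat.pow_log_le_self 2 (by omega)
  have hL4 : L ^ 4 ≤ 64 * V := (pow_four_le (Nat.log 2 V)).trans (Nat.mul_le_mul_left _ hL2)
  have hLV : L ≤ V := (Nat.lt_two_pow_self (n := L - 1)).trans_le hL2 |> fun h => by omega
  obtain ⟨q, F, hq, hq4, hF⟩ := exists_seeds (Colour L)
  have hL1 : 1 ≤ L := by omega
  -- From `L ^ 4 ≤ 64 * V` and `V ≤ 2 * E` follows the bound `384 * 64 * 2 * E`, and this product is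
  -- 49152.
  have hsmall : 8 * L * (2 * L * (2 * L + 1)) * (8 * L) ≤ 50000 * E := by
    calc 8 * L * (2 * L * (2 * L + 1)) * (8 * L) ≤ 8 * L * (2 * L * (3 * L)) * (8 * L) := by
          gcongr; omega
      _ = 384 * L ^ 4 := by ring
      _ ≤ 50000 * E := by omega
  refine ⟨u, (100 + 10 * 50000 + K) * (E ⌈/⌉ P.blockSize), 100 * (E ⌈/⌉ P.blockSize), q,
    (8 * L * (2 * L * (2 * L + 1))) ⌈/⌉ P.blockSize, F, ⟨⟨⟨hu, hsort, hM2⟩, by omega,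
    hpow 80 (by norm_num)⟩, by omega, by omega, by omega, ?_, hq4, hq, hF, ?_, ?_, ?_, hsmall,
    Nat.mul_le_mul_right _ (Nat.le_add_right _ _), le_rfl, hVE, hE, hword⟩,
    Nat.mul_le_mul_right _ (Nat.le_add_left _ _), hcost⟩
  · exact (Nat.lt_pow_succ_log_self (by norm_num) V).le
  · rw [Nat.mul_comm (_ ⌈/⌉ _)]
    exact (ceilDiv_le_iff_le_mul hB).1 le_rfl
  · refine (ceilDiv_mono _ hB ?_).trans (mul_ceilDiv_le 50000 E hB)
    exact le_trans (Nat.le_mul_of_pos_right _ (by omega)) hsmall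
  · rw [Nat.mul_comm, Nat.ceilDiv_eq_add_pred_div]
    exact (Nat.mul_div_le _ _).trans (by omega)

variable {P : OEMParams} {V E U : ℕ} {𝓕 : Set (SimpleGraph (Fin V))}

theorem MSTConstructible.mono {T T' : ℝ≥0∞} (h : MSTConstructible P V E U 𝓕 T) (hT : T ≤ T') :
    MSTConstructible P V E U 𝓕 T' := by
  obtain ⟨p, hp, hl⟩ := h
  exact ⟨p, hp, hl.trans hT⟩

/-- If there are no connected graphs, or these are trees, nothing needs to be done. -/
theorem mstConstructible_of_small (hw : V + E + U ≤ 2 ^ P.wordBits) (h : E ≤ 1 ∨ E + 1 < V)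
    (T : ℝ≥0∞) : MSTConstructible P V E U 𝓕 T := by
  refine ⟨[], ⟨fun X hX o ho => ?_, fun X _ Y _ => ?_⟩, by simp⟩
  · have hc := hX.1
    rw [EdgeArray.graph_eq] at hc
    have h1 := Ed.card_le_of_connected X.simple_edges hc
    have h2 := Ed.ncard_msf X.simple_edges hc
    rw [X.ncard_edges] at h1
    -- Connected graphs within these bounds have `V = E + 1`. The input is a tree then, and already
    -- in the format of the output.
    have hVE : V = E + 1 := by
      have hV : 1 ≤ V := by omega
      by_contra hne
      have hV1 : V = 1 := by omega
      have hE1 : E = 1 := by omega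
      subst hV1 hE1
      exact X.src_ne_dst 0 (Subsingleton.elim _ _)
    subst hVE
    rw [OEMProgram.run, PMF.support_pure, Set.mem_singleton_iff] at ho
    subst ho
    refine X.holdsMinSpanningTree_of hX.1 _ hw (fun k : Fin E => X.ed k) X.ed_injective ?_
      fun k => ?_
    · refine (Set.eq_of_subset_of_ncard_le Ed.msf_subset ?_ (Set.toFinite _)).symm
      have h3 := X.ncard_edges
      change X.edges.ncard ≤ (Ed.msf X.edges).ncard
      omega
    · have hk : (k : ℕ) < E := k.2
      have h3 : (3 * (k : ℕ)) / 3 = k := by omega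
      have h4 : (3 * (k : ℕ) + 1) / 3 = k := by omega
      have h5 : (3 * (k : ℕ) + 2) / 3 = k := by omega
      refine ⟨?_, ?_, ?_⟩
      · simp only [EdgeArray.load, h3, hk, dif_pos]
        rw [if_pos (by omega)]
        rfl
      · simp only [EdgeArray.load, h4, hk, dif_pos]
        rw [if_neg (by omega), if_pos (by omega)]
        rfl
      · simp only [EdgeArray.load, h5, hk, dif_pos]
        rw [if_neg (by omega), if_neg (by omega)]
        rfl
  · rw [OEMProgram.run, OEMProgram.run, PMF.pure_map, PMF.pure_map]

theorem MSTConstructible.of_large (hP : P.Fits 100 V E U) {T : ℝ≥0∞}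
    (h : 2 ≤ E → V ≤ E + 1 → 2 ≤ V → MSTConstructible P V E U 𝓕 T) :
    MSTConstructible P V E U 𝓕 T := by
  by_cases h1 : E ≤ 1 ∨ E + 1 < V
  · refine mstConstructible_of_small ?_ h1 T
    rcases Nat.eq_zero_or_pos (V + E + U) with h0 | h0
    · rw [h0]
      exact Nat.zero_le _
    · exact (Nat.le_self_pow (by norm_num) _).trans hP.2
  · push Not at h1
    rcases Nat.lt_or_ge V 2 with hV | hV
    · have hno : ∀ X : EdgeArray V E U, False := fun X => X.src_ne_dst ⟨0, by omega⟩ (Fin.ext (by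
        have := (X.src ⟨0, by omega⟩).2
        have := (X.dst ⟨0, by omega⟩).2
        omega))
      exact ⟨[], ⟨fun X => (hno X).elim, fun X => (hno X).elim⟩, by simp⟩
    · exact h (by omega) h1.2 hV

end Parameters

/-! ### The number of rounds and phases -/

section Cost

variable {P : OEMParams} {V E U : ℕ} {u : ℝ} {N R Q L q n₁ A : ℕ} {F : Fin q → Colour L → Prop}
  {𝓕 : Set (SimpleGraph (Fin V))} {T ν : ℝ}

theorem contracted_rounds [NeZero L] (hS : Setting P V E U u N R Q L q n₁ A F) (r : ℕ) :
    Contracted P V E U 𝓕 R ((3 / 4 : ℝ) ^ r * V)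
      ((80 + 300 * (4 + A) * r) * (u * (E ⌈/⌉ P.blockSize : ℕ))) := by
  induction r with
  | zero =>
    refine (contracted_start hS).mono (by simp) (le_of_eq ?_)
    push_cast
    ring
  | succ r ih =>
    refine (ih.round hS).mono (le_of_eq (by ring)) (le_of_eq ?_)
    push_cast
    ring

theorem Contracted.phases [NeZero L] (hS : Setting P V E U u N R Q L q n₁ A F)
    (h : Contracted P V E U 𝓕 R ν T) (hν0 : 0 ≤ ν) {j k : ℕ} (hj : 2 ≤ j) (hjQ : j + 2 ≤ Q)
    (hk : 1 ≤ k) (hkL : k ≤ 8 * L) (hjk : (j : ℝ) ≤ (4 / 3) ^ k) (hν : max 1 ν * (j + 1) * k ≤ E)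
    (p : ℕ) : Contracted P V E U 𝓕 R ((2 / j : ℝ) ^ p * ν)
      (T + p * (3000 + 300 * A) * (u * (E ⌈/⌉ P.blockSize : ℕ))) := by
  induction p with
  | zero => exact h.mono (by simp) (by simp)
  | succ p ih =>
    have hj' : (2 : ℝ) ≤ j := by exact_mod_cast hj
    refine (ih.phase hS (by omega) hjQ hk hkL hjk (le_trans ?_ hν)).mono (le_of_eq ?_)
      (le_of_eq ?_)
    · have : (2 / j : ℝ) ^ p ≤ 1 := pow_le_one₀ (by positivity) (by
        rw [div_le_one (by linarith)]
        exact hj')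
      gcongr
      nlinarith
    · ring
    · push_cast
      ring

theorem Contracted.mst (hS : Setting P V E U u N R Q L q n₁ A F)
    (h : Contracted P V E U 𝓕 R ν T) (hν : ν ≤ 1) {C K : ℝ}
    (hcost : ENNReal.ofReal (u * (E ⌈/⌉ P.blockSize : ℕ)) ≤ ENNReal.ofReal C * DOSort P E)
    (hT : T + 120 * (u * (E ⌈/⌉ P.blockSize : ℕ)) ≤ K * (u * (E ⌈/⌉ P.blockSize : ℕ)))
    (hK : 0 ≤ K) : MSTConstructible P V E U 𝓕 (ENNReal.ofReal (C * K) * DOSort P E) := by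
  refine (h.finish hS hν).mono ?_
  calc ENNReal.ofReal (T + 120 * u * (E ⌈/⌉ P.blockSize : ℕ))
      ≤ ENNReal.ofReal (K * (u * (E ⌈/⌉ P.blockSize : ℕ))) :=
        ENNReal.ofReal_le_ofReal (by rwa [mul_assoc])
    _ = ENNReal.ofReal K * ENNReal.ofReal (u * (E ⌈/⌉ P.blockSize : ℕ)) := ENNReal.ofReal_mul hK
    _ ≤ ENNReal.ofReal K * (ENNReal.ofReal C * DOSort P E) := mul_le_mul' le_rfl hcost
    _ = ENNReal.ofReal (C * K) * DOSort P E := by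
      rw [mul_comm C, ENNReal.ofReal_mul hK, mul_assoc]

/-- Three rounds more than halve the excess components, because `(4 / 3) ^ 3 = 64 / 27 > 2`; so `3
log V` rounds always suffice. Otherwise `r` rounds are followed by phases with `j ≈ 2 ^ y` and `k ≈
3 y`, for which `j ≤ (4 / 3) ^ k`. Each phase divides the bound by `j / 2 ≥ 2 ^ (y / 2)`, so `2 (log
V) / y` phases are enough. -/
theorem exists_mst_cost : ∃ C : ℝ, 0 < C ∧ ∀ (P : OEMParams) (V E U : ℕ)
    (𝓕 : Set (SimpleGraph (Fin V))), P.Fits 100 V E U → 2 ≤ E → 1 ≤ V → V ≤ 2 * E →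
    MSTConstructible P V E U 𝓕 (ENNReal.ofReal (C * (Real.logb 2 V + 1)) * DOSort P E) ∧
    ∀ (r : ℕ) (y : ℝ), 4 ≤ y → (2 : ℝ) ^ y ≤ V →
      max 1 ((3 / 4 : ℝ) ^ r * V) * 2 ^ (3 * y) ≤ E →
      MSTConstructible P V E U 𝓕
        (ENNReal.ofReal (C * (r + Real.logb 2 V / y + 1)) * DOSort P E) := by
  obtain ⟨C, hC, h⟩ := exists_setting 0
  refine ⟨C * 10 ^ 8, by positivity, fun P V E U 𝓕 hP hE hV hVE => ?_⟩
  obtain ⟨u, N, R, q, n₁, F, hS, -, hcost⟩ := h P V E U hP hE hV hVE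
  have hV1 : (1 : ℝ) ≤ V := by exact_mod_cast hV
  have hlog : 0 ≤ Real.logb 2 V := Real.logb_nonneg (by norm_num) hV1
  have hVlog : (2 : ℝ) ^ Real.logb 2 V = V :=
    Real.rpow_logb (by norm_num) (by norm_num) (by linarith)
  have hu := hS.env.one_le
  have hun : 0 ≤ u * ((E ⌈/⌉ P.blockSize : ℕ) : ℝ) := by positivity
  constructor
  · set r := ⌈3 * Real.logb 2 V⌉₊
    have hr : (r : ℝ) ≤ 3 * Real.logb 2 V + 1 := (Nat.ceil_lt_add_one (by positivity)).le
    rw [mul_assoc]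
    refine (contracted_rounds hS r).mst hS ?_ hcost ?_ (by positivity)
    · have h1 : (V : ℝ) ≤ (4 / 3 : ℝ) ^ r := by
        calc (V : ℝ) = 2 ^ Real.logb 2 V := hVlog.symm
          _ ≤ (64 / 27 : ℝ) ^ Real.logb 2 V :=
            Real.rpow_le_rpow (by norm_num) (by norm_num) hlog
          _ = (4 / 3 : ℝ) ^ (3 * Real.logb 2 V) := by
            rw [Real.rpow_mul (by norm_num)]
            norm_num
          _ ≤ (4 / 3 : ℝ) ^ (r : ℝ) :=
            Real.rpow_le_rpow_of_exponent_le (by norm_num) (Nat.le_ceil _)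
          _ = (4 / 3 : ℝ) ^ r := Real.rpow_natCast _ _
      calc (3 / 4 : ℝ) ^ r * V ≤ (3 / 4 : ℝ) ^ r * (4 / 3 : ℝ) ^ r := by gcongr
        _ = 1 := by rw [← mul_pow]; norm_num
    · rw [← add_mul]
      gcongr
      push_cast
      linarith
  · intro r y hy hyV hE'
    set p := ⌈2 * Real.logb 2 V / y⌉₊
    have hp : (p : ℝ) ≤ 2 * Real.logb 2 V / y + 1 := (Nat.ceil_lt_add_one (by positivity)).le
    have hlt : Real.logb 2 V < (Nat.log 2 V + 1 : ℕ) := by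
      rw [Real.logb_lt_iff_lt_rpow (by norm_num) (by linarith), Real.rpow_natCast]
      exact_mod_cast Nat.lt_pow_succ_log_self (by norm_num) V
    have hylog : y ≤ Real.logb 2 V := by
      rwa [Real.le_logb_iff_rpow_le (by norm_num) (by linarith)]
    have hy16 : (16 : ℝ) ≤ 2 ^ y := by
      calc (16 : ℝ) = 2 ^ (4 : ℝ) := by norm_num
        _ ≤ 2 ^ y := Real.rpow_le_rpow_of_exponent_le (by norm_num) hy
    have hy1 : 1 + y ≤ (2 : ℝ) ^ y := by
      have := one_add_mul_self_le_rpow_one_add (s := 1) (by norm_num) (p := y) (by linarith)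
      rw [mul_one] at this
      norm_num at this
      exact this
    set j := ⌊(2 : ℝ) ^ y⌋₊
    have hj1 : (j : ℝ) ≤ 2 ^ y := Nat.floor_le (by positivity)
    have hj2 : (2 : ℝ) ^ y < j + 1 := Nat.lt_floor_add_one _
    set k := ⌈3 * y⌉₊
    have hk1 : (k : ℝ) ≤ 3 * y + 1 := (Nat.ceil_lt_add_one (by positivity)).le
    have hk2 : 3 * y ≤ k := Nat.le_ceil _
    have hjV : j ≤ V := by exact_mod_cast hj1.trans hyV
    have hj16 : 2 ≤ j := by exact_mod_cast (by linarith : (2 : ℝ) ≤ j)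
    rw [mul_assoc]
    refine ((contracted_rounds hS r).phases hS (k := k) (by positivity) hj16 (by omega) ?_ ?_ ?_ ?_ p).mst hS ?_
      hcost ?_ (by positivity)
    · exact Nat.ceil_pos.2 (by linarith)
    · have : (k : ℝ) ≤ (8 * (Nat.log 2 V + 1) : ℕ) := by
        push_cast at hlt ⊢
        linarith
      exact_mod_cast this
    · calc (j : ℝ) ≤ 2 ^ y := hj1
        _ ≤ (64 / 27 : ℝ) ^ y := Real.rpow_le_rpow (by norm_num) (by norm_num) (by linarith)
        _ = (4 / 3 : ℝ) ^ (3 * y) := by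
          rw [Real.rpow_mul (by norm_num)]
          norm_num
        _ ≤ (4 / 3 : ℝ) ^ (k : ℝ) := Real.rpow_le_rpow_of_exponent_le (by norm_num) hk2
        _ = (4 / 3 : ℝ) ^ k := Real.rpow_natCast _ _
    · refine le_trans ?_ hE'
      have h3 : (2 : ℝ) ^ (3 * y) = 2 ^ y * 2 ^ y * 2 ^ y := by
        rw [← Real.rpow_add (by norm_num), ← Real.rpow_add (by norm_num)]
        ring_nf
      have hm : (0 : ℝ) ≤ max 1 ((3 / 4 : ℝ) ^ r * V) := le_max_of_le_left zero_le_one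
      rw [h3, mul_assoc]
      refine mul_le_mul_of_nonneg_left ?_ hm
      -- The product is at most `8 * 2 ^ (2 * y)`, and `8` is less than the remaining factor `2 ^
      -- y`, as `4 ≤ y`.
      have h4 : ((j : ℝ) + 1) * k ≤ (2 * 2 ^ y) * (4 * 2 ^ y) := by
        gcongr <;> linarith
      nlinarith
    · set t := (2 : ℝ) ^ (y / 2)
      have ht2 : t * t = 2 ^ y := by
        rw [← Real.rpow_add (by norm_num)]
        ring_nf
      have ht4 : 4 ≤ t := by nlinarith [Real.rpow_pos_of_pos (show (0 : ℝ) < 2 by norm_num) (y / 2)]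
      -- With `t ^ 2 = 2 ^ y` and `4 ≤ t`, one has `j > t ^ 2 - 1 ≥ 2 * t`.
      have h2j : (2 / j : ℝ) ≤ 1 / t := by
        rw [div_le_div_iff₀ (by linarith) (by linarith)]
        nlinarith
      have htp : (V : ℝ) ≤ t ^ p := by
        calc (V : ℝ) = 2 ^ Real.logb 2 V := hVlog.symm
          _ ≤ 2 ^ (y / 2 * p) := by
            refine Real.rpow_le_rpow_of_exponent_le (by norm_num) ?_
            have := Nat.le_ceil (2 * Real.logb 2 V / y)
            rw [div_le_iff₀ (by linarith)] at this
            linarith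
          _ = t ^ p := by rw [Real.rpow_mul (by norm_num), Real.rpow_natCast]
      calc (2 / j : ℝ) ^ p * ((3 / 4 : ℝ) ^ r * V) ≤ (1 / t) ^ p * (1 * t ^ p) := by
            gcongr
            exact pow_le_one₀ (by norm_num) (by norm_num)
        _ = 1 := by
          rw [one_mul, ← mul_pow, one_div_mul_cancel (by linarith), one_pow]
    · rw [← add_mul, ← add_mul]
      gcongr
      push_cast
      rw [mul_div_assoc] at hp
      have : (0 : ℝ) ≤ r := by positivity
      have : 0 ≤ Real.logb 2 V / y := by positivity
      linarith

end Cost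

/-! ### Sparse, dense and very dense graphs -/

section Densities

theorem add_one_le_two_rpow {x : ℝ} (hx : 1 ≤ x) : x + 1 ≤ (2 : ℝ) ^ x := by
  have := one_add_mul_self_le_rpow_one_add (s := 1) (by norm_num) hx
  norm_num at this
  linarith

theorem logb_two_le {x : ℝ} (hx : 1 ≤ x) : Real.logb 2 x ≤ x := by
  rw [Real.logb_le_iff_le_rpow (by norm_num) (by linarith)]
  linarith [add_one_le_two_rpow hx]

/-- The time bound `T(V)` can be reached for all graphs with `V` vertices and `E` edges that satisfy
`p V E`, up to a constant factor. -/
def MSTBound (p : ℕ → ℕ → Prop) (T : ℕ → ℝ) : Prop :=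
  ∃ C : ℝ, ∀ (P : OEMParams) (V E U : ℕ), P.Fits 100 V E U → p V E →
    MSTConstructible P V E U Set.univ (ENNReal.ofReal (C * T V) * DOSort P E)

/-- To prove a bound, it suffices to bound the number of rounds and phases. -/
theorem mstBound_of {p : ℕ → ℕ → Prop} {T : ℕ → ℝ} (K : ℝ) (h : ∀ V E : ℕ, p V E → 2 ≤ E → 2 ≤ V →
    V ≤ E + 1 → Real.logb 2 V + 1 ≤ K * T V ∨ ∃ (r : ℕ) (y : ℝ), 4 ≤ y ∧ (2 : ℝ) ^ y ≤ V ∧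
      max 1 ((3 / 4 : ℝ) ^ r * V) * 2 ^ (3 * y) ≤ E ∧ r + Real.logb 2 V / y + 1 ≤ K * T V) :
    MSTBound p T := by
  obtain ⟨C, hC, hmst⟩ := exists_mst_cost
  refine ⟨C * K, fun P V E U hP hp => MSTConstructible.of_large hP fun hE hVE hV => ?_⟩
  obtain ⟨h1, h2⟩ := hmst P V E U Set.univ hP hE (by omega) (by omega)
  have key : ∀ t : ℝ, t ≤ K * T V → ENNReal.ofReal (C * t) * DOSort P E ≤
      ENNReal.ofReal (C * K * T V) * DOSort P E := fun t ht => by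
    refine mul_le_mul' (ENNReal.ofReal_le_ofReal ?_) le_rfl
    rw [mul_assoc]
    exact mul_le_mul_of_nonneg_left ht hC.le
  rcases h V E hp hE hV hVE with h3 | ⟨r, y, hy, hyV, hyE, h3⟩
  · exact h1.mono (key _ h3)
  · exact (h2 r y hy hyV hyE).mono (key _ h3)

theorem one_le_logb {V : ℕ} (hV : 2 ≤ V) : 1 ≤ Real.logb 2 V := by
  rw [Real.le_logb_iff_rpow_le (by norm_num) (by positivity)]
  simpa using hV

theorem rpow_logb_two {V : ℕ} (hV : 2 ≤ V) : (2 : ℝ) ^ Real.logb 2 V = V :=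
  Real.rpow_logb (by norm_num) (by norm_num) (by positivity)

/-- About `3 (log log V + 1)` rounds leave at most `V / (2 log V) ≤ E / log V` components, or one.
For `y = (log log V) / 3` the number `2 ^ (3 y)` is exactly `log V`, so phases are affordable, and
there are `O(log V / log log V)` of them. -/
theorem mstBound_sparse : MSTBound (fun V _ => 3 ≤ V)
    (fun V => Real.logb 2 V / Real.logb 2 (Real.logb 2 V)) := by
  refine mstBound_of 24 fun V E hV3 hE hV hVE => ?_
  set ℓ := Real.logb 2 V with hℓ
  have hℓ1 : 1 < ℓ := by
    rw [hℓ, Real.lt_logb_iff_rpow_lt (by norm_num) (by positivity), Real.rpow_one]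
    exact_mod_cast hV3
  set m := Real.logb 2 ℓ with hm
  have hm0 : 0 < m := Real.logb_pos (by norm_num) hℓ1
  have h2m : (2 : ℝ) ^ m = ℓ := Real.rpow_logb (by norm_num) (by norm_num) (by linarith)
  have hmℓ : m ≤ ℓ := logb_two_le hℓ1.le
  have hℓE : ℓ ≤ E := by
    have h1 := add_one_le_two_rpow hℓ1.le
    rw [rpow_logb_two hV] at h1
    have h2 : (V : ℝ) ≤ E + 1 := by exact_mod_cast hVE
    linarith
  -- While `log log V` is bounded, plain rounds suffice; from 12 on, `m / 3` is a valid choice of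
  -- `y`.
  rcases lt_or_ge m 12 with h12 | h12
  · refine Or.inl ?_
    rw [mul_div_assoc', le_div_iff₀ hm0]
    nlinarith
  · refine Or.inr ⟨⌈3 * (m + 1)⌉₊, m / 3, by linarith, ?_, ?_, ?_⟩
    · rw [← rpow_logb_two hV, ← hℓ]
      exact Real.rpow_le_rpow_of_exponent_le (by norm_num) (by linarith)
    · rw [mul_div_cancel₀ _ (by norm_num : (3 : ℝ) ≠ 0), h2m]
      have h1 : 2 * ℓ ≤ (4 / 3 : ℝ) ^ ⌈3 * (m + 1)⌉₊ := by
        calc 2 * ℓ = (2 : ℝ) ^ (m + 1) := by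
              rw [Real.rpow_add (by norm_num), h2m, Real.rpow_one, mul_comm]
          _ ≤ (64 / 27 : ℝ) ^ (m + 1) :=
            Real.rpow_le_rpow (by norm_num) (by norm_num) (by linarith)
          _ = (4 / 3 : ℝ) ^ (3 * (m + 1)) := by
            rw [Real.rpow_mul (by norm_num)]
            norm_num
          _ ≤ (4 / 3 : ℝ) ^ (⌈3 * (m + 1)⌉₊ : ℝ) :=
            Real.rpow_le_rpow_of_exponent_le (by norm_num) (Nat.le_ceil _)
          _ = _ := Real.rpow_natCast _ _
      have h2 : (3 / 4 : ℝ) ^ ⌈3 * (m + 1)⌉₊ * (2 * ℓ) ≤ 1 := by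
        calc _ ≤ (3 / 4 : ℝ) ^ ⌈3 * (m + 1)⌉₊ * (4 / 3 : ℝ) ^ ⌈3 * (m + 1)⌉₊ := by gcongr
          _ = 1 := by rw [← mul_pow]; norm_num
      have h3 : (V : ℝ) ≤ 2 * E := by exact_mod_cast (by omega : V ≤ 2 * E)
      rw [max_mul_of_nonneg _ _ (by linarith), one_mul]
      refine max_le hℓE ?_
      have h4 : (0 : ℝ) ≤ V := by positivity
      nlinarith [mul_le_mul_of_nonneg_right h2 h4]
    · have h1 : ((⌈3 * (m + 1)⌉₊ : ℕ) : ℝ) ≤ 3 * (m + 1) + 1 :=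
        (Nat.ceil_lt_add_one (by positivity)).le
      -- The `O(log log V)` preliminary rounds are within the bound, as `(log log V) ^ 2 ≤ 4 log V`.
      have h2 : m * m ≤ 4 * ℓ := by
        have h3 : (1 : ℝ) ≤ (2 : ℝ) ^ (m / 2) := Real.one_le_rpow (by norm_num) (by linarith)
        have h4 : (2 : ℝ) ^ (m / 2) * (2 : ℝ) ^ (m / 2) = ℓ := by
          rw [← Real.rpow_add (by norm_num), add_halves, h2m]
        have h5 := add_one_le_two_rpow (x := m / 2) (by linarith)
        nlinarith
      rw [mul_div_assoc', le_div_iff₀ hm0, add_mul, add_mul]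
      have h3 : ℓ / (m / 3) * m = 3 * ℓ := by field_simp
      rw [h3]
      nlinarith

/-- The parameters of the phases for graphs with at least `a V 2 ^ x` edges. -/
theorem exists_phases {a x : ℝ} {V E : ℕ} (ha : 0 < a) (hV : 2 ≤ V)
    (hx : 24 - 2 * Real.logb 2 (min a 1) ≤ x) (hxV : x ≤ Real.logb 2 V)
    (hE : a * (V * 2 ^ x) ≤ E) : 4 ≤ x / 6 ∧ (2 : ℝ) ^ (x / 6) ≤ V ∧
      max 1 ((3 / 4 : ℝ) ^ 0 * V) * 2 ^ (3 * (x / 6)) ≤ E := by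
  have hmin : 0 < min a 1 := lt_min ha one_pos
  have hlog : Real.logb 2 (min a 1) ≤ 0 :=
    Real.logb_nonpos (by norm_num) hmin.le (min_le_right _ _)
  refine ⟨by linarith, ?_, ?_⟩
  · rw [← rpow_logb_two hV]
    exact Real.rpow_le_rpow_of_exponent_le (by norm_num) (by linarith)
  · have hV1 : (1 : ℝ) ≤ V := by exact_mod_cast (by omega : 1 ≤ V)
    rw [pow_zero, one_mul, max_eq_right hV1]
    refine le_trans ?_ hE
    have h1 : (2 : ℝ) ^ x = 2 ^ (3 * (x / 6)) * 2 ^ (x / 2) := by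
      rw [← Real.rpow_add (by norm_num)]
      ring_nf
    -- Only half of the exponent `x` is spent on phases with `y = x / 6`. The other half compensates
    -- for a small constant `a`, by the choice of the threshold for `x`.
    have h2 : 1 ≤ a * (2 : ℝ) ^ (x / 2) := by
      calc (1 : ℝ) = min a 1 * 2 ^ (-Real.logb 2 (min a 1)) := by
            rw [Real.rpow_neg (by norm_num), Real.rpow_logb (by norm_num) (by norm_num) hmin,
              mul_inv_cancel₀ hmin.ne']
        _ ≤ a * (2 : ℝ) ^ (x / 2) := by
          gcongr
          · exact min_le_left _ _
          · norm_num
          · linarith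
    have h3 : (0 : ℝ) ≤ V * 2 ^ (3 * (x / 6)) := by positivity
    rw [h1]
    nlinarith

/-- The excess of edges allows `y = (log V) ^ δ / 6` from the start, and then `(log V) / y = 6 (log
V) ^ (1 - δ)`. Below the threshold `x₀`, plain rounds are good enough. -/
theorem mstBound_dense (δ a : ℝ) (hδ : 0 < δ) (hδ1 : δ < 1) (ha : 0 < a) :
    MSTBound (fun V E => a * (V * 2 ^ (Real.logb 2 V ^ δ)) ≤ (E : ℝ))
      (fun V => Real.logb 2 V ^ (1 - δ)) := by
  set x₀ := 24 - 2 * Real.logb 2 (min a 1)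
  refine mstBound_of (max 7 (2 * x₀)) fun V E hVE hE hV _ => ?_
  have hℓ := one_le_logb hV
  set ℓ := Real.logb 2 V
  have hsplit : ℓ ^ (1 - δ) * ℓ ^ δ = ℓ := by
    rw [← Real.rpow_add (by linarith), sub_add_cancel, Real.rpow_one]
  have h1 : 1 ≤ ℓ ^ (1 - δ) := Real.one_le_rpow hℓ (by linarith)
  have h2 : 1 ≤ ℓ ^ δ := Real.one_le_rpow hℓ hδ.le
  rcases lt_or_ge (ℓ ^ δ) x₀ with h | h
  · refine Or.inl ((?_ : ℓ + 1 ≤ 2 * x₀ * ℓ ^ (1 - δ)).trans ?_)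
    · nlinarith
    · gcongr
      exact le_max_right _ _
  · obtain ⟨h3, h4, h5⟩ := exists_phases ha hV h (by nlinarith) hVE
    refine Or.inr ⟨0, _, h3, h4, h5, (?_ : _ ≤ 7 * ℓ ^ (1 - δ)).trans ?_⟩
    · have : ℓ / (ℓ ^ δ / 6) = 6 * ℓ ^ (1 - δ) := by
        rw [div_div_eq_mul_div, div_eq_iff (by positivity), mul_assoc, hsplit, mul_comm]
      rw [this]
      push_cast
      linarith
    · gcongr
      exact le_max_left _ _

/-- With `y = ε (log V) / 6` the number of phases is bounded. If `ε log V` is below the threshold,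
then `log V` itself is bounded. -/
theorem mstBound_very_dense (ε a : ℝ) (hε : 0 < ε) (hε1 : ε ≤ 1) (ha : 0 < a) :
    MSTBound (fun V E => a * (V : ℝ) ^ (1 + ε) ≤ (E : ℝ)) (fun _ => 1) := by
  set x₀ := 24 - 2 * Real.logb 2 (min a 1)
  refine mstBound_of (max (6 / ε + 1) (x₀ / ε + 1)) fun V E hVE hE hV _ => ?_
  have hℓ := one_le_logb hV
  have hVr := rpow_logb_two hV
  set ℓ := Real.logb 2 V
  rw [mul_one]
  rcases lt_or_ge (ε * ℓ) x₀ with h | h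
  · refine Or.inl (le_max_of_le_right ?_)
    have : ℓ ≤ x₀ / ε := by
      rw [le_div_iff₀ hε]
      linarith
    linarith
  · obtain ⟨h3, h4, h5⟩ := exists_phases ha hV h (by nlinarith) (by
      rw [mul_comm ε ℓ, Real.rpow_mul (by norm_num), hVr]
      rwa [Real.rpow_add (by positivity), Real.rpow_one] at hVE)
    refine Or.inr ⟨0, _, h3, h4, h5, le_max_of_le_left (le_of_eq ?_)⟩
    push_cast
    field_simp
    ring

end Densities

/-! ### Graphs without a complete minor -/

section Minors

variable {V W κ : Type}

/-- The pairs of adjacent vertices. -/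
def adjPairs (G : SimpleGraph V) : Set (V × V) := {p | G.Adj p.1 p.2}

/-- The preimages of the branch sets are branch sets: fibres are connected, and adjacent points of
the quotient come from adjacent points of their fibres. -/
theorem SimpleGraph.IsMinorOf.of_quotient {K : SimpleGraph κ} {H : SimpleGraph W}
    {G : SimpleGraph V} (h : K.IsMinorOf H) (π : V → W)
    (hfib : ∀ w, (G.induce (π ⁻¹' {w})).Connected)
    (hadj : ∀ a b, H.Adj a b → ∃ x y, π x = a ∧ π y = b ∧ G.Adj x y) : K.IsMinorOf G := by
  obtain ⟨β, h1, h2, h3⟩ := h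
  refine ⟨fun x => π ⁻¹' β x, fun x => ?_, fun x y hxy => (h2 x y hxy).preimage π,
    fun x y hxy => ?_⟩
  · have hin : ∀ w ∈ β x, ∀ (a b : V) (ha : π a = w) (hb : π b = w) (ha' : π a ∈ β x)
        (hb' : π b ∈ β x), (G.induce (π ⁻¹' β x)).Reachable ⟨a, ha'⟩ ⟨b, hb'⟩ := by
      intro w hw a b ha hb ha' hb'
      have := ((hfib w).preconnected ⟨a, ha⟩ ⟨b, hb⟩).map
        (G.induceHomOfLE (s' := π ⁻¹' β x) (fun v hv => by
          rw [Set.mem_preimage, (show π v = w from hv)]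
          exact hw)).toHom
      exact this
    have hall : ∀ w w' : β x, (H.induce (β x)).Reachable w w' → ∀ (a b : V) (_ : π a = w)
        (_ : π b = w') (ha' : π a ∈ β x) (hb' : π b ∈ β x),
        (G.induce (π ⁻¹' β x)).Reachable ⟨a, ha'⟩ ⟨b, hb'⟩ := by
      rintro w w' ⟨p⟩
      induction p with
      | nil => exact fun a b ha hb ha' hb' => hin _ (Subtype.prop _) a b ha hb ha' hb'
      | @cons w v w' hwv p ih =>
        intro a b ha hb ha' hb'
        obtain ⟨x', y', hx, hy, hxy⟩ := hadj _ _ hwv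
        have hx' : π x' ∈ β x := hx ▸ w.2
        have hy' : π y' ∈ β x := hy ▸ v.2
        have h4 : (G.induce (π ⁻¹' β x)).Adj ⟨x', hx'⟩ ⟨y', hy'⟩ := hxy
        exact (hin _ w.2 a x' ha hx ha' hx').trans (h4.reachable.trans (ih y' b hy hb hy' hb'))
    obtain ⟨w⟩ := (h1 x).nonempty
    obtain ⟨v⟩ := (hfib w.1).nonempty
    have : Nonempty (π ⁻¹' β x) := ⟨⟨v.1, by
      rw [Set.mem_preimage, (show π v.1 = w.1 from v.2)]
      exact w.2⟩⟩
    exact ⟨fun a b => hall ⟨π a, a.2⟩ ⟨π b, b.2⟩ ((h1 x).preconnected _ _) a b rfl rfl a.2 b.2⟩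
  · obtain ⟨a, ha, b, hb, hab⟩ := h3 x y hxy
    obtain ⟨v, w, rfl, rfl, hvw⟩ := hadj a b hab
    exact ⟨v, ha, w, hb, hvw⟩

/-- The vertex `v` is adjacent to all branch sets among its neighbours and is itself a further
branch set. -/
theorem isMinorOf_cone {t : ℕ} {G : SimpleGraph V} (v : V)
    (h : (⊤ : SimpleGraph (Fin t)).IsMinorOf (G.induce (G.neighborSet v))) :
    (⊤ : SimpleGraph (Fin (t + 1))).IsMinorOf G := by
  obtain ⟨β, h1, h2, h3⟩ := h
  have hv : ∀ i, ∀ a ∈ Subtype.val '' β i, G.Adj v a := by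
    rintro i _ ⟨a, -, rfl⟩
    exact a.2
  have hne : ∀ i, ∃ a, a ∈ Subtype.val '' β i := fun i => by
    obtain ⟨a⟩ := (h1 i).nonempty
    exact ⟨_, a.1, a.2, rfl⟩
  refine ⟨Fin.cons {v} fun i => Subtype.val '' β i, fun x => ?_, fun x y hxy => ?_,
    fun x y hxy => ?_⟩
  · refine Fin.cases ?_ (fun i => ?_) x
    · rw [Fin.cons_zero]
      have : Subsingleton ({v} : Set V) := ⟨fun a b => Subtype.ext (a.2.trans b.2.symm)⟩
      exact ⟨fun a b => by rw [Subsingleton.elim a b]⟩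
    · rw [Fin.cons_succ]
      refine (h1 i).map (⟨fun a => ⟨a.1.1, a.1, a.2, rfl⟩, fun h => h⟩ :
        (G.induce (G.neighborSet v)).induce (β i) →g G.induce (Subtype.val '' β i)) ?_
      rintro ⟨_, a, ha, rfl⟩
      exact ⟨⟨a, ha⟩, rfl⟩
  · induction x using Fin.cases with
    | zero =>
      induction y using Fin.cases with
      | zero => exact absurd rfl hxy
      | succ j =>
        rw [Fin.cons_zero, Fin.cons_succ, Set.disjoint_singleton_left]
        exact fun h => G.loopless.irrefl _ (hv j v h)
    | succ i =>
      induction y using Fin.cases with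
      | zero =>
        rw [Fin.cons_zero, Fin.cons_succ, Set.disjoint_singleton_right]
        exact fun h => G.loopless.irrefl _ (hv i v h)
      | succ j =>
        rw [Fin.cons_succ, Fin.cons_succ, Set.disjoint_image_iff Subtype.val_injective]
        exact h2 i j fun h => hxy (by rw [h])
  · induction x using Fin.cases with
    | zero =>
      induction y using Fin.cases with
      | zero => exact absurd rfl hxy
      | succ j =>
        obtain ⟨a, ha⟩ := hne j
        exact ⟨v, rfl, a, ha, hv j a ha⟩
    | succ i =>
      induction y using Fin.cases with
      | zero =>
        obtain ⟨a, ha⟩ := hne i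
        exact ⟨a, ha, v, rfl, (hv i a ha).symm⟩
      | succ j =>
        obtain ⟨a, ha, b, hb, hab⟩ := h3 i j fun h => hxy (by rw [h])
        exact ⟨a, ⟨a, ha, rfl⟩, b, ⟨b, hb, rfl⟩, hab⟩

theorem mul_card_le_adjPairs [Finite V] (G : SimpleGraph V) (d : ℕ)
    (h : ∀ v, d ≤ (G.neighborSet v).ncard) : d * Nat.card V ≤ (adjPairs G).ncard := by
  have := Fintype.ofFinite V
  have h1 : (adjPairs G).ncard = ∑ v : V, (G.neighborSet v).ncard := by
    rw [← Nat.card_coe_set_eq]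
    simp only [← Nat.card_coe_set_eq]
    rw [← Nat.card_sigma]
    exact Nat.card_congr ⟨fun p => ⟨p.1.1, p.1.2, p.2⟩, fun p => ⟨(p.1, p.2.1), p.2.2⟩,
      fun _ => rfl, fun _ => rfl⟩
  rw [h1, Nat.card_eq_fintype_card, Nat.mul_comm, ← smul_eq_mul, ← Finset.card_univ]
  exact Finset.card_nsmul_le_sum _ _ _ fun v _ => h v

/-- The graph after contraction of `v` into `u`. -/
def contractEdge (G : SimpleGraph V) (u v : V) : SimpleGraph {x // x ≠ v} :=
  SimpleGraph.fromRel fun x y => G.Adj x y ∨ (x.1 = u ∧ G.Adj v y)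

open Classical in
/-- The map to the contracted graph. -/
noncomputable def toContracted {u v : V} (huv : u ≠ v) (x : V) : {x // x ≠ v} :=
  if h : x = v then ⟨u, huv⟩ else ⟨x, h⟩

theorem toContracted_eq {u v : V} (huv : u ≠ v) {x y : V}
    (h : toContracted huv x = toContracted huv y) : x = y ∨ (x = u ∧ y = v) ∨ (x = v ∧ y = u) := by
  rw [toContracted, toContracted] at h
  split_ifs at h with h1 h2 h2
  · exact Or.inl (h1.trans h2.symm)
  · exact Or.inr (Or.inr ⟨h1, (congrArg Subtype.val h).symm⟩)
  · exact Or.inr (Or.inl ⟨congrArg Subtype.val h, h2⟩)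
  · exact Or.inl (congrArg Subtype.val h)

theorem toContracted_of_ne {u v : V} (huv : u ≠ v) {x : V} (h : x ≠ v) :
    toContracted huv x = ⟨x, h⟩ := dif_neg h

theorem toContracted_self {u v : V} (huv : u ≠ v) : toContracted huv v = ⟨u, huv⟩ := dif_pos rfl

/-- The fibres of the contraction are single vertices, and the pair of `u` and `v`, which is
connected by an edge. -/
theorem isMinorOf_contractEdge {K : SimpleGraph κ} {G : SimpleGraph V} {u v : V} (huv : G.Adj u v)
    (h : K.IsMinorOf (contractEdge G u v)) : K.IsMinorOf G := by
  refine h.of_quotient (toContracted huv.ne) (fun w => ?_) fun a b hab => ?_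
  · have hw : toContracted huv.ne w.1 = w := toContracted_of_ne _ w.2
    have : Nonempty (toContracted huv.ne ⁻¹' {w}) := ⟨w.1, hw⟩
    refine ⟨?_⟩
    rintro ⟨x, hx⟩ ⟨y, hy⟩
    have hx' : toContracted huv.ne x = w := hx
    have hy' : toContracted huv.ne y = w := hy
    rcases toContracted_eq huv.ne (hx'.trans hy'.symm) with rfl | ⟨rfl, rfl⟩ | ⟨rfl, rfl⟩
    · rfl
    · exact SimpleGraph.Adj.reachable (show (G.induce _).Adj _ _ from huv)
    · exact SimpleGraph.Adj.reachable (show (G.induce _).Adj _ _ from huv.symm)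
  · rw [contractEdge, SimpleGraph.fromRel_adj] at hab
    obtain ⟨-, (h1 | ⟨h1, h2⟩) | (h1 | ⟨h1, h2⟩)⟩ := hab
    · exact ⟨a, b, toContracted_of_ne _ a.2, toContracted_of_ne _ b.2, h1⟩
    · exact ⟨v, b, (toContracted_self _).trans (Subtype.ext h1.symm), toContracted_of_ne _ b.2, h2⟩
    · exact ⟨a, b, toContracted_of_ne _ a.2, toContracted_of_ne _ b.2, h1.symm⟩
    · exact ⟨a, v, toContracted_of_ne _ a.2, (toContracted_self _).trans (Subtype.ext h1.symm),
        h2.symm⟩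

/-- Contraction destroys the edge itself and identifies the two edges to each common neighbour.
Every edge counts twice, as pairs are ordered. -/
theorem adjPairs_le_contractEdge [Finite V] {G : SimpleGraph V} {u v : V} (huv : G.Adj u v) :
    (adjPairs G).ncard ≤ (adjPairs (contractEdge G u v)).ncard +
      (2 + 2 * {w | G.Adj u w ∧ G.Adj v w}.ncard) := by
  set C := {w | G.Adj u w ∧ G.Adj v w}
  set D : Set (V × V) := ({(u, v), (v, u)} : Set (V × V)) ∪ (Prod.mk v '' C ∪ (fun w => (w, v)) '' C)
  have hD : D.ncard ≤ 2 + 2 * C.ncard := by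
    refine (Set.ncard_union_le _ _).trans (Nat.add_le_add ?_ ((Set.ncard_union_le _ _).trans ?_))
    · exact (Set.ncard_insert_le _ _).trans (by rw [Set.ncard_singleton])
    · rw [Nat.two_mul]
      exact Nat.add_le_add (Set.ncard_image_le (Set.toFinite _)) (Set.ncard_image_le (Set.toFinite _))
  have h1 := Set.ncard_le_ncard_sdiff_add_ncard (adjPairs G) D (Set.toFinite _)
  have h2 : (adjPairs G \ D).ncard ≤ (adjPairs (contractEdge G u v)).ncard := by
    refine Set.ncard_le_ncard_of_injOn (Prod.map (toContracted huv.ne) (toContracted huv.ne)) ?_ ?_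
      (Set.toFinite _)
    · rintro ⟨x, y⟩ ⟨hxy, hD⟩
      have hxy : G.Adj x y := hxy
      rw [adjPairs, Set.mem_ofPred_eq, contractEdge, SimpleGraph.fromRel_adj]
      refine ⟨fun h => ?_, ?_⟩
      · rcases toContracted_eq huv.ne h with rfl | ⟨rfl, rfl⟩ | ⟨rfl, rfl⟩
        · exact G.loopless.irrefl _ hxy
        · exact hD (Or.inl (Or.inl rfl))
        · exact hD (Or.inl (Or.inr rfl))
      · rw [Prod.map_apply]
        dsimp only
        by_cases hx : x = v
        · subst hx
          rw [toContracted_self, toContracted_of_ne _ hxy.ne']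
          exact Or.inl (Or.inr ⟨rfl, hxy⟩)
        · by_cases hy : y = v
          · subst hy
            rw [toContracted_self, toContracted_of_ne _ hx]
            exact Or.inr (Or.inr ⟨rfl, hxy.symm⟩)
          · rw [toContracted_of_ne _ hx, toContracted_of_ne _ hy]
            exact Or.inl (Or.inl hxy)
    · rintro ⟨x, y⟩ ⟨hxy, hD⟩ ⟨x', y'⟩ ⟨hxy', hD'⟩ heq
      obtain ⟨h3, h4⟩ := Prod.mk.inj heq
      have hxy : G.Adj x y := hxy
      have hxy' : G.Adj x' y' := hxy'
      rcases toContracted_eq huv.ne h3 with rfl | ⟨rfl, rfl⟩ | ⟨rfl, rfl⟩ <;>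
        rcases toContracted_eq huv.ne h4 with rfl | ⟨rfl, rfl⟩ | ⟨rfl, rfl⟩
      · rfl
      · exact absurd (Or.inr (Or.inr ⟨_, ⟨hxy.symm, hxy'.symm⟩, rfl⟩)) hD'
      · exact absurd (Or.inr (Or.inr ⟨_, ⟨hxy'.symm, hxy.symm⟩, rfl⟩)) hD
      · exact absurd (Or.inr (Or.inl ⟨_, ⟨hxy, hxy'⟩, rfl⟩)) hD'
      · exact (G.loopless.irrefl _ hxy).elim
      · exact absurd (Or.inl (Or.inl rfl)) hD
      · exact absurd (Or.inr (Or.inl ⟨_, ⟨hxy', hxy⟩, rfl⟩)) hD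
      · exact absurd (Or.inl (Or.inr rfl)) hD
      · exact (G.loopless.irrefl _ hxy).elim
  omega

/-- A graph of average degree at least `2 ^ t` has a complete minor with `t` vertices. -/
theorem complete_isMinorOf (t : ℕ) : ∀ (n : ℕ) (V : Type) [Finite V] [Nonempty V]
    (G : SimpleGraph V), Nat.card V = n → 2 ^ t * Nat.card V ≤ (adjPairs G).ncard →
    (⊤ : SimpleGraph (Fin t)).IsMinorOf G := by
  induction t with
  | zero =>
    intro n V _ _ G _ _
    exact ⟨fun i => i.elim0, fun i => i.elim0, fun i => i.elim0, fun i => i.elim0⟩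
  | succ t iht =>
    intro n
    induction n with
    | zero =>
      intro V _ _ G hn
      exact absurd hn Nat.card_pos.ne'
    | succ n ihn =>
      intro V _ _ G hn hG
      -- An edge with few common neighbours is contracted: one vertex and at most `2 ^ (t + 1)`
      -- pairs are lost, so the assumption on the average degree persists.
      by_cases hex : ∃ u v, G.Adj u v ∧ 2 + 2 * {w | G.Adj u w ∧ G.Adj v w}.ncard ≤ 2 ^ (t + 1)
      · obtain ⟨u, v, huv, hC⟩ := hex
        have : Nonempty {x // x ≠ v} := ⟨⟨u, huv.ne⟩⟩
        have h1 : Nat.card {x // x ≠ v} = n := by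
          have := Fintype.ofFinite V
          classical
          rw [Nat.card_eq_fintype_card] at hn ⊢
          rw [Fintype.card_subtype_compl, hn, Fintype.card_subtype_eq, Nat.add_sub_cancel]
        refine isMinorOf_contractEdge huv (ihn _ _ h1 ?_)
        have h2 := adjPairs_le_contractEdge huv
        rw [hn, Nat.mul_add] at hG
        rw [h1]
        omega
      -- Now the two ends of any edge have at least `2 ^ t` common neighbours. Hence the
      -- neighbourhood of a vertex has minimal degree at least `2 ^ t`, and the vertex is a cone
      -- over a complete minor in it.
      · push Not at hex
        have hpos : 0 < (adjPairs G).ncard :=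
          lt_of_lt_of_le (Nat.mul_pos (by positivity) Nat.card_pos) hG
        obtain ⟨⟨v, w⟩, hvw⟩ := (Set.ncard_pos (Set.toFinite _)).1 hpos
        have : Nonempty (G.neighborSet v) := ⟨w, hvw⟩
        refine isMinorOf_cone v (iht _ _ _ rfl (mul_card_le_adjPairs _ _ fun x => ?_))
        have h3 := hex v x.1 x.2
        have h4 : {w | G.Adj v w ∧ G.Adj x.1 w}.ncard =
            ((G.induce (G.neighborSet v)).neighborSet x).ncard := by
          rw [← Set.ncard_image_of_injective _ Subtype.val_injective]
          congr 1
          ext w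
          constructor
          · rintro ⟨h5, h6⟩
            exact ⟨⟨w, h5⟩, h6, rfl⟩
          · rintro ⟨w, h5, rfl⟩
            exact ⟨w.2, h5⟩
        rw [pow_succ] at h3
        omega

/-- If `H` with `t` vertices is missing from the family, then so is every graph with a complete
minor on `t` vertices, since `H` is a subgraph of the latter. -/
theorem IsProperMinorClosed.exists_complete {F : (n : ℕ) → Set (SimpleGraph (Fin n))}
    (hF : IsProperMinorClosed F) : ∃ t : ℕ, ∀ (n : ℕ) (G : SimpleGraph (Fin n)), G ∈ F n →
      ¬ (⊤ : SimpleGraph (Fin t)).IsMinorOf G := by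
  obtain ⟨t, H, hH⟩ := hF.proper
  refine ⟨t, fun n G hG hm => hH (hF.minor_mem ⊤ H (hF.minor_mem G ⊤ hG hm) ?_)⟩
  refine ⟨fun x => {x}, fun x => ?_, fun x y hxy => Set.disjoint_singleton.2 hxy,
    fun x y hxy => ⟨x, rfl, y, rfl, hxy.ne⟩⟩
  have : Subsingleton ({x} : Set (Fin t)) := ⟨fun a b => Subtype.ext (a.2.trans b.2.symm)⟩
  exact ⟨fun a b => by rw [Subsingleton.elim a b]⟩

end Minors

/-! ### Minor-closed families -/

section MinorClosed

variable {V U L q : ℕ} {𝓔 : Set (Ed V U)} {l : Fin V → Fin V} {H : Set (Rec V U)}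
  {O : Set (Ed V U)}

/-- Contracted edges stay within the components, so a path of such edges does not leave a union of
components. Therefore the components are connected subgraphs, and the contracted graph is a minor of
the given one. -/
theorem Contraction.reachable_fiber (h : Contraction 𝓔 l H O)
    (hsat : ∀ e ∈ O, l e.src = l e.dst) {a b : Fin V} (hab : Ed.Conn O a b) (s : Set (Fin V))
    (hs : ∀ x y, l x = l y → x ∈ s → y ∈ s) (ha : a ∈ s) :
    ∃ hb : b ∈ s, ((Ed.gr 𝓔).induce s).Reachable ⟨a, ha⟩ ⟨b, hb⟩ := by
  obtain ⟨p⟩ := hab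
  induction p with
  | nil => exact ⟨ha, SimpleGraph.Reachable.refl _⟩
  | @cons a c b hac p ih =>
    rw [Ed.gr, SimpleGraph.fromEdgeSet_adj] at hac
    obtain ⟨⟨e, he, hends⟩, hne⟩ := hac
    have hl : l a = l c := by
      rcases Sym2.eq_iff.1 hends with ⟨rfl, rfl⟩ | ⟨rfl, rfl⟩
      · exact hsat e he
      · exact (hsat e he).symm
    have hadj : (Ed.gr 𝓔).Adj a c := by
      rw [Ed.gr, SimpleGraph.fromEdgeSet_adj]
      exact ⟨⟨e, Ed.msf_subset (h.sub he), hends⟩, hne⟩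
    have hc := hs a c hl ha
    obtain ⟨hb, hcb⟩ := ih hc
    exact ⟨hb, (SimpleGraph.Adj.reachable (show ((Ed.gr 𝓔).induce s).Adj ⟨a, ha⟩ ⟨c, hc⟩ from
      hadj)).trans hcb⟩

/-- In a graph without a complete minor, few pairs of components are adjacent. -/
theorem Contraction.ncard_lightest_le {t : ℕ} (h : Contraction 𝓔 l H O)
    (hH : ∀ r ∈ H, r.2.2 ≠ none) (hsat : ∀ e ∈ O, l e.src = l e.dst)
    (hK : ¬ (⊤ : SimpleGraph (Fin t)).IsMinorOf (Ed.gr 𝓔)) {ν : ℝ}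
    (hl : ((Set.range l).ncard : ℝ) ≤ max 1 ν) :
    (_root_.lightest H).ncard ≤ ⌊((2 ^ t : ℕ) : ℝ) * ν⌋₊ := by
  -- The graph of the components. Its ordered adjacent pairs bound the records that remain when only
  -- the lightest edge of each pair is kept.
  set Q : SimpleGraph (Set.range l) := SimpleGraph.fromRel fun a b => ∃ e ∈ 𝓔, Joins l e a b with hQ
  have hQadj : ∀ a b, Q.Adj a b → ∃ x y, (⟨l x, x, rfl⟩ : Set.range l) = a ∧
      (⟨l y, y, rfl⟩ : Set.range l) = b ∧ (Ed.gr 𝓔).Adj x y := by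
    have key : ∀ a b : Set.range l, a ≠ b → (∃ e ∈ 𝓔, Joins l e a b) →
        ∃ x y, (⟨l x, x, rfl⟩ : Set.range l) = a ∧
          (⟨l y, y, rfl⟩ : Set.range l) = b ∧ (Ed.gr 𝓔).Adj x y := by
      rintro a b hab ⟨e, he, ⟨h1, h2⟩ | ⟨h1, h2⟩⟩
      · refine ⟨e.src, e.dst, Subtype.ext h1, Subtype.ext h2, ?_⟩
        rw [Ed.gr, SimpleGraph.fromEdgeSet_adj]
        exact ⟨⟨e, he, rfl⟩, fun h => hab (Subtype.ext (by rw [← h1, ← h2, h]))⟩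
      · refine ⟨e.dst, e.src, Subtype.ext h1, Subtype.ext h2, ?_⟩
        rw [Ed.gr, SimpleGraph.fromEdgeSet_adj]
        exact ⟨⟨e, he, Sym2.eq_swap⟩, fun h => hab (Subtype.ext (by rw [← h1, ← h2, h]))⟩
    intro a b hab
    rw [hQ, SimpleGraph.fromRel_adj] at hab
    rcases hab with ⟨hne, h1 | h1⟩
    · exact key a b hne h1
    · obtain ⟨x, y, hx, hy, hxy⟩ := key b a hne.symm h1
      exact ⟨y, x, hy, hx, hxy.symm⟩
  have h1 : (_root_.lightest H).ncard ≤ (adjPairs Q).ncard := by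
    rw [← Set.ncard_image_of_injective _
      (Function.Injective.prodMap Subtype.val_injective Subtype.val_injective)]
    refine Set.ncard_le_ncard_of_injOn (fun r => (r.1, r.2.2.getD r.1)) (fun r hr => ?_) ?_
      (Set.toFinite _)
    · obtain ⟨b, hb, hne, he, hj⟩ := h.lightest_spec hH hr
      refine ⟨(⟨r.1, hj.mem_range.1⟩, ⟨b, hj.mem_range.2⟩), ?_, by simp [hb]⟩
      rw [adjPairs, Set.mem_ofPred_eq, hQ, SimpleGraph.fromRel_adj]
      exact ⟨fun h => hne (congrArg Subtype.val h), Or.inl ⟨_, he, hj⟩⟩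
    · intro r hr r' hr' heq
      obtain ⟨b, hb, -⟩ := h.lightest_spec hH hr
      obtain ⟨b', hb', -⟩ := h.lightest_spec hH hr'
      obtain ⟨h2, h3⟩ := Prod.mk.inj heq
      rw [hb, hb', Option.getD_some, Option.getD_some] at h3
      exact lightest_injective hr hr' h2 (by rw [hb, hb', h3])
  -- A single component has no records. This case is separate as `ν` may be smaller than 1.
  rcases Nat.lt_or_ge (Set.range l).ncard 2 with h2 | h2
  · have h3 : _root_.lightest H = ∅ := by
      rw [Set.eq_empty_iff_forall_notMem]
      intro r hr
      obtain ⟨b, -, hne, -, hj⟩ := h.lightest_spec hH hr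
      exact hne ((Set.ncard_le_one (Set.toFinite _)).1 (by omega) _ hj.mem_range.1 _ hj.mem_range.2)
    rw [h3, Set.ncard_empty]
    exact Nat.zero_le _
  · have h3 : ((Set.range l).ncard : ℝ) ≤ ν := by
      rcases le_max_iff.1 hl with h3 | h3
      · have : (Set.range l).ncard ≤ 1 := by exact_mod_cast h3
        omega
      · exact h3
    have hne : Nonempty (Set.range l) := by
      obtain ⟨x, hx⟩ := (Set.ncard_pos (Set.toFinite _)).1 (by omega : 0 < (Set.range l).ncard)
      exact ⟨⟨x, hx⟩⟩
    have h4 : (adjPairs Q).ncard ≤ 2 ^ t * (Set.range l).ncard := by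
      rw [← Nat.card_coe_set_eq (Set.range l)]
      by_contra hlt
      refine hK ((complete_isMinorOf t _ _ Q rfl (not_le.1 hlt).le).of_quotient
        (fun x => ⟨l x, x, rfl⟩) (fun w => ?_) hQadj)
      obtain ⟨_, v, rfl⟩ := w
      have : Nonempty ((fun x => (⟨l x, x, rfl⟩ : Set.range l)) ⁻¹' {⟨l v, v, rfl⟩}) := ⟨⟨v, rfl⟩⟩
      refine ⟨fun a b => ?_⟩
      have hab : l a = l b := (congrArg Subtype.val a.2).trans (congrArg Subtype.val b.2).symm
      obtain ⟨hb, hr⟩ := h.reachable_fiber hsat (h.conn _ _ hab)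
        ((fun x => (⟨l x, x, rfl⟩ : Set.range l)) ⁻¹' {⟨l v, v, rfl⟩})
        (fun x y hxy hx => (Subtype.ext hxy.symm : (⟨l y, y, rfl⟩ : Set.range l) = ⟨l x, x, rfl⟩).trans hx)
        a.2
      exact hr
    refine Nat.le_floor ?_
    calc ((_root_.lightest H).ncard : ℝ) ≤ ((2 ^ t * (Set.range l).ncard : ℕ) : ℝ) := by
          exact_mod_cast h1.trans h4
      _ ≤ ((2 ^ t : ℕ) : ℝ) * ν := by
        rw [Nat.cast_mul]
        gcongr

/-- The target of a hook keeps its name, by `hooks_star`, and the start of the hook takes this name.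
So both ends of the edge have the same name afterwards. -/
theorem Contraction.step_saturated [NeZero L] (F : Fin q → Colour L → Prop) {s : CState V U}
    {O₀ : Set (Ed V U)} (h : Contraction 𝓔 l s.H (O₀ ∪ s.O))
    (hsat : ∀ e ∈ O₀ ∪ s.O, l e.src = l e.dst) :
    ∀ e ∈ O₀ ∪ (s.step F).O, (moveTo (s.hk F) ∘ l) e.src = (moveTo (s.hk F) ∘ l) e.dst := by
  have hKp : ∀ p ∈ s.hk F, p ∈ picks s.H := fun p hp => hooks_subset _ _ hp
  rintro e (he | he | ⟨p, hp, rfl⟩)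
  · exact congrArg (moveTo (s.hk F)) (hsat e (Or.inl he))
  · exact congrArg (moveTo (s.hk F)) (hsat e (Or.inr he))
  · have h1 : moveTo (s.hk F) p.1 = p.2.1 := moveTo_of_mem
      (fun p hp p' hp' => picks_functional s.H p (hKp p hp) p' (hKp p' hp')) hp
    have h2 : moveTo (s.hk F) p.2.1 = p.2.1 := moveTo_of_notMem fun p' hp' h =>
      hooks_star F (picks_functional s.H) hp hp' h.symm
    rw [Function.comp_apply, Function.comp_apply]
    rcases (h.pick (hKp p hp)).2.1 with ⟨h3, h4⟩ | ⟨h3, h4⟩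
    · rw [h3, h4, h1, h2]
    · rw [h3, h4, h1, h2]

/-- Repeated rounds. -/
theorem Contraction.iterate [NeZero L] (F : Fin q → Colour L → Prop) (h : Contraction 𝓔 l H O)
    (hH : ∀ r ∈ H, r.2.2 ≠ none) (hc : (Ed.gr 𝓔).Connected) (hL : V ≤ 2 ^ L) (hq : 0 < q)
    (hF : ∀ c c', c ≠ c' → q ≤ 4 * {s | F s c ∧ ¬ F s c'}.ncard) (i : ℕ) :
    ∃ l' : Fin V → Fin V,
      Contraction 𝓔 l' ((CState.step F)^[i] ⟨H, ∅, ∅⟩).H (O ∪ ((CState.step F)^[i] ⟨H, ∅, ∅⟩).O) ∧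
      (∀ r ∈ ((CState.step F)^[i] ⟨H, ∅, ∅⟩).H, r.2.2 ≠ none) ∧
      ((CState.step F)^[i] ⟨H, ∅, ∅⟩).O.ncard + (Set.range l').ncard ≤ (Set.range l).ncard ∧
      ((Set.range l').ncard : ℝ) ≤ max 1 ((3 / 4 : ℝ) ^ i * (Set.range l).ncard) := by
  induction i with
  | zero =>
    refine ⟨l, ?_, hH, by simp, by simp⟩
    rw [Function.iterate_zero_apply, Set.union_empty]
    exact h
  | succ i ih =>
    obtain ⟨l', h1, h2, h3, h4⟩ := ih
    rw [Function.iterate_succ_apply']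
    set s := (CState.step F)^[i] ⟨H, ∅, ∅⟩
    have h5 := h1.step F
    refine ⟨_, h5.1, ?_, ?_, (h1.ncard_round_le F h2 hc hL hq hF h4).trans (le_of_eq ?_)⟩
    · rintro _ ⟨r, hr, rfl⟩ hn
      exact h2 r hr (Option.map_eq_none_iff.1 hn)
    · have h6 : (s.step F).O.ncard ≤ s.O.ncard + (s.hk F).ncard :=
        (Set.ncard_union_le _ _).trans (Nat.add_le_add_left (Set.ncard_image_le (Set.toFinite _)) _)
      omega
    · rw [pow_succ]
      ring_nf

variable {P : OEMParams} {E : ℕ} {u : ℝ} {N R Q n₁ A D t : ℕ} {F : Fin q → Colour L → Prop}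
  {𝓕 : Set (SimpleGraph (Fin V))} {T ν : ℝ} {S : ℕ}

/-- With `T` I/Os, the graph can be contracted to at most `max 1 ν` vertices, with a table of at most
`D ν` records, and a table of `S` blocks for the contracted edges. -/
def Compressed (P : OEMParams) (V E U : ℕ) (𝓕 : Set (SimpleGraph (Fin V))) (R D : ℕ) (ν T : ℝ)
    (S : ℕ) : Prop :=
  ∃ (l : GraphInput V E U 𝓕 → Fin V → Fin V) (H : GraphInput V E U 𝓕 → Set (Rec V U))
    (O : GraphInput V E U 𝓕 → Set (Ed V U)),
    Reach (P := P) (fun x => x.1.load) R {⟨Rec V U, ⌊D * ν⌋₊ ⌈/⌉ P.blockSize, H⟩,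
      ⟨Ed V U, S, O⟩} T ∧
    ∀ x, Contraction x.1.edges (l x) (H x) (O x) ∧ (∀ r ∈ H x, r.2.2 ≠ none) ∧
      (∀ e ∈ O x, l x e.src = l x e.dst) ∧ (H x).ncard ≤ ⌊D * ν⌋₊ ∧
      ((Set.range (l x)).ncard : ℝ) ≤ max 1 ν

theorem compressed_start (hS : Setting P V E U u N R Q L q n₁ A F)
    (hK : ∀ x : GraphInput V E U 𝓕, ¬ (⊤ : SimpleGraph (Fin t)).IsMinorOf (Ed.gr x.1.edges)) :
    Compressed P V E U 𝓕 R (2 ^ t) V (120 * u * (E ⌈/⌉ P.blockSize : ℕ)) (V ⌈/⌉ P.blockSize) := by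
  have : Fact (V ≤ Q) := ⟨hS.V_le⟩
  have : Fact (U ≤ Q) := ⟨hS.U_le⟩
  have : Fact (2 ≤ Q) := ⟨hS.env.two_le⟩
  have hu := hS.env.one_le
  have hEb := mul_ceilDiv_le 2 E P.blockSize_pos
  have hN : 100 * (E ⌈/⌉ P.blockSize) ≤ N :=
    le_trans (Nat.mul_le_mul_right _ (Nat.le_add_right _ _)) hS.le_N
  obtain ⟨G, h1, h2⟩ := exists_records (𝓕 := 𝓕) hS
  have hl : ∀ x : GraphInput V E U 𝓕, ((Set.range (id : Fin V → Fin V)).ncard : ℝ) ≤ max (1 : ℝ) V :=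
    fun x => by
      rw [Set.range_id, Set.ncard_univ, Nat.card_fin]
      exact le_max_right _ _
  have hcard := fun x => (h2 x).1.ncard_lightest_le (h2 x).2.1 (by simp) (hK x) (hl x)
  have h3 := h1.lightest hS.env (Set.mem_insert _ _) (by omega)
  have h4 := h3.shrink hS.env (Set.mem_insert _ _) (by omega) _ hcard
  refine ⟨fun _ => id, _, fun _ => ∅, h4.mono ?_ ?_, fun x => ⟨(h2 x).1.lightest (h2 x).2.1,
    fun r hr => (h2 x).2.1 r hr.1.1, by simp, hcard x, hl x⟩⟩
  · rintro t (rfl | rfl)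
    · exact Or.inl rfl
    · exact Or.inr (Or.inr (Or.inr rfl))
  · have hg : (((2 * E) ⌈/⌉ P.blockSize : ℕ) : ℝ) ≤ 2 * (E ⌈/⌉ P.blockSize : ℕ) := by
      exact_mod_cast hEb
    have h15 : u * (((2 * E) ⌈/⌉ P.blockSize : ℕ) : ℝ) ≤ u * (2 * (E ⌈/⌉ P.blockSize : ℕ)) := by
      gcongr
    have h16 : 0 ≤ u * (E ⌈/⌉ P.blockSize : ℕ) := by positivity
    linarith

/-- After each round loops and parallel edges are removed, which restores the bound on the number of
records in terms of the components. -/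
theorem Compressed.round [NeZero L] (hS : Setting P V E U u N R Q L q n₁ A F)
    (hK : ∀ x : GraphInput V E U 𝓕, ¬ (⊤ : SimpleGraph (Fin t)).IsMinorOf (Ed.gr x.1.edges))
    (h : Compressed P V E U 𝓕 R (2 ^ t) ν T S)
    (hN : 6 * (2 * (⌊((2 ^ t : ℕ) : ℝ) * ν⌋₊ ⌈/⌉ P.blockSize) + n₁) ≤ N) :
    Compressed P V E U 𝓕 R (2 ^ t) (3 / 4 * ν)
      (T + 1000 * u * (⌊((2 ^ t : ℕ) : ℝ) * ν⌋₊ ⌈/⌉ P.blockSize + n₁ : ℕ))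
      (S + ⌊((2 ^ t : ℕ) : ℝ) * ν⌋₊ ⌈/⌉ P.blockSize) := by
  have : Fact (V ≤ Q) := ⟨hS.V_le⟩
  have : Fact (U ≤ Q) := ⟨hS.U_le⟩
  have : Fact (L ≤ Q) := ⟨hS.L_le⟩
  have : Fact (2 ≤ Q) := ⟨hS.env.two_le⟩
  have hu := hS.env.one_le
  obtain ⟨l, H, O, h1, h2⟩ := h
  set w := ⌊((2 ^ t : ℕ) : ℝ) * ν⌋₊
  set nh := w ⌈/⌉ P.blockSize with hnh
  set s : GraphInput V E U 𝓕 → CState V U := fun x => ⟨H x, ∅, ∅⟩ with hs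
  have h0 : (0 : ℕ) ⌈/⌉ P.blockSize = 0 :=
    Nat.le_zero.1 ((ceilDiv_le_iff_le_mul P.blockSize_pos).2 (Nat.zero_le _))
  have hinv : ∀ x, Contraction x.1.edges (l x) (s x).H (O x ∪ (s x).O) := fun x => by
    rw [Set.union_empty]
    exact (h2 x).1
  have hstep := fun x => (hinv x).step F
  have hsat := fun x => (hinv x).step_saturated F (by
    rw [Set.union_empty]
    exact (h2 x).2.2.1)
  have hmark : ∀ x, ∀ r ∈ ((s x).step F).H, r.2.2 ≠ none := by
    rintro x _ ⟨r, hr, rfl⟩ hn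
    exact (h2 x).2.1 r hr (Option.map_eq_none_iff.1 hn)
  have hl := fun x => (hinv x).ncard_round_le F (h2 x).2.1 x.connected hS.V_le_pow hS.q_pos
    hS.indep (h2 x).2.2.2.2
  have hcard := fun x => (hstep x).1.ncard_lightest_le (hmark x) (hsat x) (hK x) (hl x)
  have h3 := h1.const hS.env.toSortEnv (∅ : Set (Fin V × Fin V)) 0 (by simp)
  have h4 := h3.const hS.env.toSortEnv (∅ : Set (Ed V U)) 0 (by simp)
  have h5 := h4.congr (n' := nh) (Set.mem_insert _ _) (Nat.zero_le _)
    (S' := fun x => (s x).O) fun x => rfl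
  have h6 := Reach.step hS.env F hS.q_le (n₁ := n₁) (h := w) (m := 0) (o := w) (s := s)
    (𝓢 := {⟨Ed V U, S, O⟩})
    (h5.mono (T' := T) (by
      rintro t ((rfl | rfl | rfl) | rfl)
      · exact Or.inr (Or.inr (Or.inr (Or.inl rfl)))
      · exact Or.inr (Or.inr (Or.inl (by rw [h0])))
      · exact Or.inl rfl
      · exact Or.inr (Or.inr (Or.inr (Or.inr rfl)))) (by simp)) (by omega) hS.le_n₁
    (fun x => (h2 x).2.2.2.1) (fun x => by simp [hs]) (fun x => by
      change (∅ ∪ _ : Set (Ed V U)).ncard ≤ w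
      rw [Set.empty_union]
      exact (Set.ncard_image_le (Set.toFinite _)).trans
        (((s x).ncard_hk_le F).trans (h2 x).2.2.2.1))
  have h7 := h6.lightest hS.env (Or.inl (Or.inl rfl)) (by omega)
  have h8 := h7.shrink hS.env (Set.mem_insert _ _) (by omega) _ hcard
  -- The contracted edges are appended without being compacted. Appending takes no I/Os, whereas
  -- compacting the growing table in each round would not fit into a geometric series.
  have h9 := h8.union (n := S) (S := O) (n' := nh) (S' := fun x => ((s x).step F).O)
    (Or.inr (Or.inr (Or.inr rfl))) (Or.inr (Or.inr (Or.inl (Or.inr (Or.inr rfl)))))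
  refine ⟨_, _, _, h9.mono ?_ ?_, fun x => ⟨(hstep x).1.lightest (hmark x),
    fun r hr => hmark x r hr.1.1, hsat x, hcard x, hl x⟩⟩
  · rintro t (rfl | rfl)
    · exact Or.inr (Or.inl rfl)
    · exact Or.inl rfl
  · rw [h0, ← hnh]
    push_cast
    nlinarith [(Nat.cast_nonneg nh : (0 : ℝ) ≤ nh), (Nat.cast_nonneg n₁ : (0 : ℝ) ≤ n₁)]

theorem Compressed.finish [NeZero L] (hS : Setting P V E U u N R Q L q n₁ A F)
    (h : Compressed P V E U 𝓕 R (2 ^ t) ν T S) (hν : ((2 ^ t : ℕ) : ℝ) * ν ≤ P.blockSize)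
    (hSN : S + 1 ≤ N) : MSTConstructible P V E U 𝓕
      (ENNReal.ofReal (T + 11 * u * (S + 1 : ℕ) + 130 * u * (E ⌈/⌉ P.blockSize : ℕ))) := by
  have : Fact (V ≤ Q) := ⟨hS.V_le⟩
  have : Fact (U ≤ Q) := ⟨hS.U_le⟩
  have hu := hS.env.one_le
  have hB := P.blockSize_pos
  have hVb := hS.V_blocks
  have hR := hS.le_R
  have hn₀ := hS.n₀_pos
  have hN : 100 * (E ⌈/⌉ P.blockSize) ≤ N :=
    le_trans (Nat.mul_le_mul_right _ (Nat.le_add_right _ _)) hS.le_N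
  obtain ⟨l, H, O, h1, h2⟩ := h
  -- The client alone performs `3 * L` further rounds. They leave one component, since `(3 / 4) ^ 3
  -- < 1 / 2` and `V ≤ 2 ^ L`.
  set f : Set (Rec V U) → Set (Ed V U) := fun H => ((CState.step F)^[3 * L] ⟨H, ∅, ∅⟩).O with hf
  have hiter := fun x => (h2 x).1.iterate F (h2 x).2.1 x.connected hS.V_le_pow hS.q_pos hS.indep
    (3 * L)
  have hfcard : ∀ x, (f (H x)).ncard ≤ P.blockSize := by
    intro x
    obtain ⟨l', -, -, h3, -⟩ := hiter x
    rcases le_max_iff.1 (h2 x).2.2.2.2 with h4 | h4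
    · have : (Set.range (l x)).ncard ≤ 1 := by exact_mod_cast h4
      simp only [hf]
      omega
    · have h5 : ((Set.range (l x)).ncard : ℝ) ≤ P.blockSize := by
        refine h4.trans (le_trans ?_ hν)
        have h6 : (1 : ℝ) ≤ (2 ^ t : ℕ) := by exact_mod_cast Nat.one_le_two_pow
        have h7 : 0 ≤ ν := (Nat.cast_nonneg _).trans h4
        nlinarith
      have : (Set.range (l x)).ncard ≤ P.blockSize := by exact_mod_cast h5
      simp only [hf]
      omega
  have hmsf : ∀ x, O x ∪ f (H x) = Ed.msf x.1.edges := by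
    intro x
    obtain ⟨l', h3, -, -, h4⟩ := hiter x
    refine h3.eq_msf x.1.simple_edges x.connected (h4.trans (le_of_eq (max_eq_left ?_)))
    have h5 : ((Set.range (l x)).ncard : ℝ) ≤ V := by
      have := Set.ncard_le_ncard (Set.subset_univ (Set.range (l x))) (Set.toFinite _)
      rw [Set.ncard_univ, Nat.card_fin] at this
      exact_mod_cast this
    have h6 : (V : ℝ) ≤ 2 ^ L := by exact_mod_cast hS.V_le_pow
    calc (3 / 4 : ℝ) ^ (3 * L) * (Set.range (l x)).ncard ≤ (1 / 2) ^ L * 2 ^ L := by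
          rw [pow_mul]
          gcongr
          · norm_num
          · exact h5.trans h6
      _ = 1 := by rw [← mul_pow]; norm_num
  have h3 := h1.congr (n' := 1) (Set.mem_insert _ _)
    ((ceilDiv_le_iff_le_mul hB).2 (by rw [mul_one]; exact Nat.floor_le_of_le hν)) fun x => rfl
  have h4 := h3.onBlock hS.env (Set.mem_insert _ _) f hfcard
  have h5 := h4.union (n := S) (S := O) (Or.inr (Or.inr (Or.inr rfl))) (Set.mem_insert _ _)
  simp only [hmsf] at h5
  have h6 := h5.shrink hS.env (Set.mem_insert _ _) hSN V fun x => x.ncard_msf_le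
  obtain ⟨p, hp, hpT⟩ := mstConstructible_of_reach hS.env hS.V_le hS.U_le hS.word
    (V ⌈/⌉ P.blockSize) (by omega) (by omega) h6 (Or.inl rfl)
  refine ⟨p, hp, hpT.trans (ENNReal.ofReal_le_ofReal ?_)⟩
  have h7 : ((V ⌈/⌉ P.blockSize : ℕ) : ℝ) ≤ 2 * (E ⌈/⌉ P.blockSize : ℕ) := by exact_mod_cast hVb
  have h8 : (1 : ℝ) ≤ (E ⌈/⌉ P.blockSize : ℕ) := by exact_mod_cast hn₀
  nlinarith

end MinorClosed

/-! ### The cost for minor-closed families -/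

section MinorClosedCost

variable {P : OEMParams} {V E U : ℕ} {u : ℝ} {N R Q L q n₁ A t : ℕ} {F : Fin q → Colour L → Prop}
  {𝓕 : Set (SimpleGraph (Fin V))}

/-- The geometric series is expressed by its partial sums: a round with bound `ν` is charged to the
decrease of `ν` by a quarter, and the decreases add up to `V - (3 / 4) ^ k * V`. As each of the
rounds has more than a block of records, the same decrease also bounds the number of rounds times
the block size. -/
theorem compressed_rounds [NeZero L] (hS : Setting P V E U u N R Q L q n₁ A F)
    (hK : ∀ x : GraphInput V E U 𝓕, ¬ (⊤ : SimpleGraph (Fin t)).IsMinorOf (Ed.gr x.1.edges))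
    (hN : 200 * 2 ^ t * (E ⌈/⌉ P.blockSize) ≤ N) (k : ℕ)
    (hk : ∀ i < k, (P.blockSize : ℝ) < ((2 ^ t : ℕ) : ℝ) * ((3 / 4 : ℝ) ^ i * V)) :
    ∃ (S : ℕ) (T : ℝ), Compressed P V E U 𝓕 R (2 ^ t) ((3 / 4 : ℝ) ^ k * V) T S ∧
      T ≤ u * (120 * (E ⌈/⌉ P.blockSize : ℕ) + 1000 *
        (8 * ((2 ^ t : ℕ) * (V - (3 / 4 : ℝ) ^ k * V)) / P.blockSize + k * n₁)) ∧
      (S : ℝ) ≤ 2 * (E ⌈/⌉ P.blockSize : ℕ) +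
        8 * ((2 ^ t : ℕ) * (V - (3 / 4 : ℝ) ^ k * V)) / P.blockSize ∧
      (k : ℝ) * P.blockSize ≤ 4 * ((2 ^ t : ℕ) * (V - (3 / 4 : ℝ) ^ k * V)) := by
  have hB := P.blockSize_pos
  have hBr : (0 : ℝ) < P.blockSize := by exact_mod_cast hB
  have hu := hS.env.one_le
  induction k with
  | zero =>
    refine ⟨_, _, by simpa using compressed_start hS hK, le_of_eq (by push_cast; ring), ?_, by simp⟩
    have : ((V ⌈/⌉ P.blockSize : ℕ) : ℝ) ≤ 2 * (E ⌈/⌉ P.blockSize : ℕ) := by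
      exact_mod_cast hS.V_blocks
    simpa using this
  | succ k ih =>
    obtain ⟨S, T, h1, h2, h3, h4⟩ := ih fun i hi => hk i (by omega)
    have hkk := hk k (by omega)
    set D := 2 ^ t
    set ν := (3 / 4 : ℝ) ^ k * V with hν
    have hνs : (3 / 4 : ℝ) ^ (k + 1) * V = 3 / 4 * ν := by rw [pow_succ, hν]; ring
    set nh := ⌊(D : ℝ) * ν⌋₊ ⌈/⌉ P.blockSize with hnh
    have hν0 : 0 ≤ ν := by positivity
    -- Rounding up to full blocks at most doubles the size, because the bound on the records exceeds
    -- one block.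
    have hnhB : (nh : ℝ) * P.blockSize ≤ 2 * (D * ν) := by
      have h5 : nh * P.blockSize ≤ ⌊(D : ℝ) * ν⌋₊ + P.blockSize := by
        rw [hnh, Nat.ceilDiv_eq_add_pred_div, Nat.mul_comm]
        exact (Nat.mul_div_le _ _).trans (by omega)
      have h6 : (nh : ℝ) * P.blockSize ≤ ⌊(D : ℝ) * ν⌋₊ + P.blockSize := by exact_mod_cast h5
      have h7 := Nat.floor_le (by positivity : (0 : ℝ) ≤ D * ν)
      linarith
    have hnh1 : (nh : ℝ) ≤ 2 * (D * ν) / P.blockSize := (le_div_iff₀ hBr).2 hnhB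
    have hEB : (E : ℝ) ≤ P.blockSize * (E ⌈/⌉ P.blockSize : ℕ) := by
      exact_mod_cast (ceilDiv_le_iff_le_mul hB).1 le_rfl
    have hVE : (V : ℝ) ≤ 2 * E := by exact_mod_cast hS.V_le_E
    have hnhn : nh ≤ 4 * D * (E ⌈/⌉ P.blockSize) := by
      have h5 : (nh : ℝ) * P.blockSize ≤ (4 * D * (E ⌈/⌉ P.blockSize : ℕ)) * P.blockSize := by
        have h6 : ν ≤ V := by
          have : (3 / 4 : ℝ) ^ k ≤ 1 := pow_le_one₀ (by norm_num) (by norm_num)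
          nlinarith [(Nat.cast_nonneg V : (0 : ℝ) ≤ V)]
        calc (nh : ℝ) * P.blockSize ≤ 2 * (D * ν) := hnhB
          _ ≤ 2 * (D * (2 * (P.blockSize * (E ⌈/⌉ P.blockSize : ℕ)))) := by gcongr; linarith
          _ = _ := by ring
      exact_mod_cast le_of_mul_le_mul_right h5 hBr
    have hround : Compressed P V E U 𝓕 R D (3 / 4 * ν) (T + 1000 * u * (nh + n₁ : ℕ)) (S + nh) :=
        h1.round hS hK (by
      change 6 * (2 * nh + n₁) ≤ N
      have h5 := hS.n₁_le
      have h6 := hS.le_N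
      have h7 : (100 + 10 * A) * (E ⌈/⌉ P.blockSize) =
        100 * (E ⌈/⌉ P.blockSize) + 10 * (A * (E ⌈/⌉ P.blockSize)) := by ring
      have h8 : 200 * D * (E ⌈/⌉ P.blockSize) = 50 * (4 * D * (E ⌈/⌉ P.blockSize)) := by ring
      omega)
    have hdiff : 8 * ((D : ℝ) * (V - 3 / 4 * ν)) / P.blockSize =
        8 * (D * (V - ν)) / P.blockSize + 2 * (D * ν) / P.blockSize := by
      rw [← add_div]
      ring_nf
    rw [hνs]
    refine ⟨_, _, hround, ?_, ?_, ?_⟩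
    · have h5 : u * (nh : ℝ) ≤ u * (2 * (D * ν) / P.blockSize) := by gcongr
      rw [hdiff]
      push_cast
      linarith
    · rw [hdiff]
      push_cast
      linarith
    · push_cast
      nlinarith

theorem exists_mst_cost_of_minor (t : ℕ) : ∃ C : ℝ, ∀ (P : OEMParams) (V E U : ℕ)
    (𝓕 : Set (SimpleGraph (Fin V))), P.Fits 100 V E U → 2 ≤ E → 1 ≤ V → V ≤ 2 * E →
    (∀ G ∈ 𝓕, ¬ (⊤ : SimpleGraph (Fin t)).IsMinorOf G) →
    MSTConstructible P V E U 𝓕 (ENNReal.ofReal C * DOSort P E) := by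
  obtain ⟨C, hC, h⟩ := exists_setting (200 * 2 ^ t)
  refine ⟨C * (300 + 25000 * (2 ^ t : ℕ) + 150000000 * (1 + t)),
    fun P V E U 𝓕 hP hE hV hVE h𝓕 => ?_⟩
  obtain ⟨u, N, R, q, n₁, F, hS, hN, hcost⟩ := h P V E U hP hE hV hVE
  have hK : ∀ x : GraphInput V E U 𝓕,
      ¬ (⊤ : SimpleGraph (Fin t)).IsMinorOf (Ed.gr x.1.edges) := fun x => by
    rw [← EdgeArray.graph_eq]
    exact h𝓕 _ x.2.2
  have hB := P.blockSize_pos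
  have hBr : (0 : ℝ) < P.blockSize := by exact_mod_cast hB
  have hB1 : (1 : ℝ) ≤ P.blockSize := by exact_mod_cast hB
  have hu := hS.env.one_le
  set L := Nat.log 2 V + 1
  have hlast : ((2 ^ t : ℕ) : ℝ) * ((3 / 4 : ℝ) ^ (3 * (L + t)) * V) ≤ P.blockSize := by
    refine le_trans ?_ hB1
    have h6 : (V : ℝ) ≤ 2 ^ L := by exact_mod_cast hS.V_le_pow
    calc ((2 ^ t : ℕ) : ℝ) * ((3 / 4 : ℝ) ^ (3 * (L + t)) * V)
        ≤ 2 ^ t * ((1 / 2) ^ (L + t) * 2 ^ L) := by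
          rw [pow_mul]
          push_cast
          gcongr
          norm_num
      _ = ((1 / 2) ^ L * 2 ^ L) * ((1 / 2) ^ t * 2 ^ t) := by rw [pow_add]; ring
      _ = 1 := by rw [← mul_pow, ← mul_pow]; norm_num
  classical
  have hex : ∃ i, ((2 ^ t : ℕ) : ℝ) * ((3 / 4 : ℝ) ^ i * V) ≤ P.blockSize := ⟨_, hlast⟩
  -- The first moment at which the bound on the records is at most one block; before that, every
  -- round satisfies the condition of `compressed_rounds`.
  set k := Nat.find hex with hk
  have hkL : k ≤ 3 * (L + t) := Nat.find_min' hex hlast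
  obtain ⟨S, T, h1, h2, h3, h4⟩ := compressed_rounds hS hK hN k
    fun i hi => not_le.1 (Nat.find_min hex hi)
  set D := 2 ^ t
  set n₀ := E ⌈/⌉ P.blockSize with hn₀'
  have hn₀ : (1 : ℝ) ≤ n₀ := by exact_mod_cast hS.n₀_pos
  have hEB : (E : ℝ) ≤ P.blockSize * n₀ := by
    exact_mod_cast (ceilDiv_le_iff_le_mul hB).1 le_rfl
  have hVE' : (V : ℝ) ≤ 2 * E := by exact_mod_cast hVE
  have hsub : (V : ℝ) - (3 / 4 : ℝ) ^ k * V ≤ 2 * (P.blockSize * n₀) := by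
    have : (0 : ℝ) ≤ (3 / 4 : ℝ) ^ k * V := by positivity
    linarith
  have h5 : 8 * ((D : ℝ) * (V - (3 / 4 : ℝ) ^ k * V)) / P.blockSize ≤ 16 * D * n₀ := by
    rw [div_le_iff₀ hBr]
    calc 8 * ((D : ℝ) * (V - (3 / 4 : ℝ) ^ k * V)) ≤ 8 * (D * (2 * (P.blockSize * n₀))) := by gcongr
      _ = _ := by ring
  -- The tables for the choice of the set do not shrink with the graph. Their contents amount to
  -- `O(L ^ 4)` records over all rounds, which `L_small` bounds by `O(E)`; their rounding up to
  -- blocks is covered by `h4`.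
  have h6 : (k : ℝ) * n₁ ≤ (150000 * (1 + t) + 8 * D) * n₀ := by
    refine le_of_mul_le_mul_right ?_ hBr
    have h7 : (n₁ : ℝ) * P.blockSize ≤ (8 * L * (2 * L * (2 * L + 1)) : ℕ) + P.blockSize := by
      exact_mod_cast hS.n₁_block
    have h8 : k * (8 * L * (2 * L * (2 * L + 1))) ≤ 150000 * (1 + t) * E := by
      have h9 : k ≤ 3 * (1 + t) * (8 * L) := by
        have : 1 ≤ L := Nat.le_add_left _ _
        nlinarith
      calc k * (8 * L * (2 * L * (2 * L + 1)))
          ≤ 3 * (1 + t) * (8 * L) * (8 * L * (2 * L * (2 * L + 1))) := Nat.mul_le_mul_right _ h9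
        _ = 3 * (1 + t) * (8 * L * (2 * L * (2 * L + 1)) * (8 * L)) := by ring
        _ ≤ 3 * (1 + t) * (50000 * E) := Nat.mul_le_mul_left _ hS.L_small
        _ = 150000 * (1 + t) * E := by ring
    have h9 : (k : ℝ) * (8 * L * (2 * L * (2 * L + 1)) : ℕ) ≤ 150000 * (1 + t) * E := by
      exact_mod_cast h8
    calc (k : ℝ) * n₁ * P.blockSize = k * (n₁ * P.blockSize) := by ring
      _ ≤ k * ((8 * L * (2 * L * (2 * L + 1)) : ℕ) + P.blockSize) := by gcongr
      _ = k * (8 * L * (2 * L * (2 * L + 1)) : ℕ) + k * P.blockSize := by ring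
      _ ≤ 150000 * (1 + t) * E + 4 * (D * (2 * (P.blockSize * n₀))) := by
        refine add_le_add h9 (h4.trans ?_)
        gcongr
      _ ≤ 150000 * (1 + t) * (P.blockSize * n₀) + 4 * (D * (2 * (P.blockSize * n₀))) := by gcongr
      _ = (150000 * (1 + t) + 8 * D) * n₀ * P.blockSize := by ring
  have hD : (1 : ℝ) ≤ D := by exact_mod_cast Nat.one_le_two_pow
  have h7 : (S : ℝ) + 1 ≤ (3 + 16 * D) * n₀ := by nlinarith
  have hSN : S + 1 ≤ N := by
    have h8 : S + 1 ≤ 200 * D * n₀ := by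
      have : ((S + 1 : ℕ) : ℝ) ≤ (200 * D * n₀ : ℕ) := by
        push_cast
        nlinarith
      exact_mod_cast this
    exact h8.trans hN
  refine (h1.finish hS (Nat.find_spec hex) hSN).mono ?_
  have hKpos : (0 : ℝ) ≤ 300 + 25000 * D + 150000000 * (1 + t) := by positivity
  have hfin : T + 11 * u * (S + 1 : ℕ) + 130 * u * n₀ ≤
      (300 + 25000 * D + 150000000 * (1 + t)) * (u * n₀) := by
    have h8 : u * (120 * n₀ + 1000 *
        (8 * ((D : ℝ) * (V - (3 / 4 : ℝ) ^ k * V)) / P.blockSize + k * n₁)) ≤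
        u * (120 * n₀ + 1000 * (16 * D * n₀ + (150000 * (1 + t) + 8 * D) * n₀)) := by gcongr
    have h9 : u * ((S : ℝ) + 1) ≤ u * ((3 + 16 * D) * n₀) := by gcongr
    have h10 : (0 : ℝ) ≤ D * (u * n₀) := by positivity
    have h11 : (0 : ℝ) ≤ t * (u * n₀) := by positivity
    have h12 : (0 : ℝ) ≤ u * n₀ := by positivity
    push_cast
    linarith
  calc ENNReal.ofReal (T + 11 * u * (S + 1 : ℕ) + 130 * u * n₀)
      ≤ ENNReal.ofReal ((300 + 25000 * D + 150000000 * (1 + t)) * (u * n₀)) :=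
        ENNReal.ofReal_le_ofReal hfin
    _ = ENNReal.ofReal (300 + 25000 * D + 150000000 * (1 + t)) * ENNReal.ofReal (u * n₀) :=
        ENNReal.ofReal_mul hKpos
    _ ≤ ENNReal.ofReal (300 + 25000 * D + 150000000 * (1 + t)) * (ENNReal.ofReal C * DOSort P E) :=
        mul_le_mul' le_rfl hcost
    _ = _ := by rw [mul_comm C, ENNReal.ofReal_mul hKpos, mul_assoc]

end MinorClosedCost

/-! ### The four cases -/

theorem theorem4p1 :
    ∃ c : ℕ,
      (∀ γ a : ℝ, 0 ≤ γ → 0 < a → ∃ C : ℝ, ∀ (P : OEMParams) (V E U : ℕ),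
        P.Fits c V E U → 3 ≤ V →
        (E : ℝ) ≤ a * (V * Real.logb 2 V ^ γ) →
        MSTConstructible P V E U Set.univ
          (ENNReal.ofReal (C * (Real.logb 2 V / Real.logb 2 (Real.logb 2 V))) * DOSort P E)) ∧
      (∀ δ a b : ℝ, 0 < δ → δ < 1 → 0 < a → 0 < b → ∃ C : ℝ, ∀ (P : OEMParams) (V E U : ℕ),
        P.Fits c V E U →
        a * (V * 2 ^ (Real.logb 2 V ^ δ)) ≤ (E : ℝ) →
        (E : ℝ) ≤ b * (V * 2 ^ (Real.logb 2 V ^ δ)) →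
        MSTConstructible P V E U Set.univ
          (ENNReal.ofReal (C * Real.logb 2 V ^ (1 - δ)) * DOSort P E)) ∧
      (∀ ε a : ℝ, 0 < ε → ε ≤ 1 → 0 < a → ∃ C : ℝ, ∀ (P : OEMParams) (V E U : ℕ),
        P.Fits c V E U →
        a * (V : ℝ) ^ (1 + ε) ≤ (E : ℝ) →
        MSTConstructible P V E U Set.univ (ENNReal.ofReal C * DOSort P E)) ∧
      (∀ F : (n : ℕ) → Set (SimpleGraph (Fin n)), IsProperMinorClosed F →
        ∃ C : ℝ, ∀ (P : OEMParams) (V E U : ℕ), P.Fits c V E U →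
          MSTConstructible P V E U (F V) (ENNReal.ofReal C * DOSort P E)) := by
  -- The exponent 100 provides words for 80 numbers below `V + E + U`, as records and scan states
  -- require, and private memory for two blocks.
  refine ⟨100, fun γ a _ _ => ?_, fun δ a b hδ hδ1 ha _ => ?_, fun ε a hε hε1 ha => ?_,
    fun F hF => ?_⟩
  · obtain ⟨C, hC⟩ := mstBound_sparse
    exact ⟨C, fun P V E U hP hV _ => hC P V E U hP hV⟩
  · obtain ⟨C, hC⟩ := mstBound_dense δ a hδ hδ1 ha
    exact ⟨C, fun P V E U hP h _ => hC P V E U hP h⟩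
  · obtain ⟨C, hC⟩ := mstBound_very_dense ε a hε hε1 ha
    exact ⟨C, fun P V E U hP h => by simpa using hC P V E U hP h⟩
  · obtain ⟨t, ht⟩ := hF.exists_complete
    obtain ⟨C, hC⟩ := exists_mst_cost_of_minor t
    exact ⟨C, fun P V E U hP => MSTConstructible.of_large hP fun hE hVE hV =>
      hC P V E U (F V) hP hE (by omega) (by omega) (ht V)⟩
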